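/- **Associated Pestov identity.** Let $(M,g)$ be a smooth closed connected oriented Riemannian manifold of dimension $n\ge 2$ with Levi-Civita connection $\nabla$ and curvature $\mathcal R(X,Y)=\nabla_X\nabla_Y-\nabla_Y\nabla_X-\nabla_{[X,Y]}$, and let $FM\to M$ be the principal $\mathrm{SO}(n)$-bundle of oriented orthonormal frames $w:\mathbb R^n\to T_xM$. Identify $\Lambda^2\mathbb R^n$ with $\mathfrak{so}(n)$ via $e_i\wedge e_j:\theta\mapsto\langle e_i,\theta\rangle e_j-\langle e_j,\theta\rangle e_i$, with the inner product for which $(e_i\wedge e_j)_{i<j}$ is orthonormal, and identify $\mathcal R(X\wedge Y)$ with the skew endomorphism $\mathcal R(X,Y)$. For $\xi\in\mathfrak{so}(n)$ let $Y_\xi(w)=\frac{d}{dt}|_{t=0}\,w\circ e^{t\xi}$, and let $\mathbf X$ be the generator of the frame flow, i.e. $\mathbf X(w)$ is the horizontal lift of $w(e_1)$. For $\xi,\xi'\in\mathfrak{so}(n)$ set $$\langle R_{FM}(w)\xi,\xi'\rangle=\langle \xi, w^{-1}\mathcal R_x(w(\xi'e_1)\wedge w(e_1))\rangle .$$ Let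 $G\le \mathrm{SO}(n-1)\subset\mathrm{SO}(n)$ (the subgroup fixing $e_1$) be a closed subgroup with Lie algebra $\mathfrak g$, let $\pi:FM\to PM:=FM/G$ be the quotient, and let $\mathbb V_{PM}$ be the bundle of vectors tangent to the fibres of $PM\to M$. Each $T\in\mathbb V_{PM}(z)$ has for each $w\in\pi^{-1}(z)$ a unique lift $Y_{\xi(w)}(w)$ with $\xi(w)\in\mathfrak g^\perp\subset\mathfrak{so}(n)$ (so that $\xi(wa)=a^{-1}\xi(w)a$ for $a\in G$), and $\langle T,T'\rangle:=\langle\xi(w),\xi'(w)\rangle$. Let $\nabla^{PM}_{\mathbb V}u$ be the vertical gradient ($\langle\nabla^{PM}_{\mathbb V}u,T\rangle=du(T)$ for $T\in\mathbb V_{PM}$), $\mathbf X_{PM}$ the vector field on $PM$ to which $\mathbf X$ descends, also acting on sections of $\mathbb V_{PM}$ by covariant differentiation (i.e. $\mathbf X$ is applied to the function $w\mapsto\xi(w)$ on $FM$), and $R_{PM}$ the endomorphism of $\mathbb V_{PM}$ with $\langle R_{PM}(z)T,T'\rangle=\langle R_{FM}(w)\xi(w),\xi'(w)\rangle$, $\pi(w)=z$.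 Let $L^2$ refer to the Riemannian measure on $PM$, or more generally to any measure which in local trivializations is the product of the Riemannian measure of $M$ and a fixed finite $\mathrm{SO}(n)$-invariant Borel measure on $\mathrm{SO}(n)/G$. Then for every $u\in C^\infty(PM,\mathbb R)$ all the integrals below converge and $$\|\nabla_{\mathbb V}^{PM}\mathbf X_{PM}u\|_{L^2}^2-\|\mathbf X_{PM}\nabla_{\mathbb V}^{PM}u\|_{L^2}^2=(n-1)\|\mathbf X_{PM}u\|_{L^2}^2-\langle R_{PM}\nabla_{\mathbb V}^{PM}u,\nabla_{\mathbb V}^{PM}u\rangle_{L^2}.$$ Moreover, if $G=\mathrm{SO}(n-1)$, then $\pi(w)\mapsto v:=w(e_1)$ is a well-defined bijection of $PM$ onto the unit tangent bundle $SM$; it carries $\mathbf X_{PM}$ to the geodesic vector field, that is, the horizontal lift of $v$ at $v\in SM$; $T\mapsto KT:=w(\xi(w)e_1)$ is a linear isometry of $\mathbb V_{PM}(\pi(w))$ onto $v^\perp\subset T_xM$; and $$\langle R_{PM}T,T'\rangle=\langle\mathcal R_x(KT,v)v,KT'\rangle ,$$ so that $\langle R_{PM}T,T\rangle$ is the sectional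 curvature of the plane spanned by $v$ and $KT$ times $|KT|^2$ for $T\neq 0$, and the identity is the classical Pestov identity on $SM$. -/

import Mathlib

open Bundle Manifold MeasureTheory Matrix Topology
open scoped ContDiff

noncomputable section

namespace FramePestov

/-! ### The groups `SO(n)`, `SO(n-1)` and the Lie algebra `so(n) = Λ²ℝⁿ` -/

/-- The special orthogonal group. -/
abbrev SO (n : ℕ) : Type := Matrix.specialOrthogonalGroup (Fin n) ℝ

/-- The Lie algebra of skew-symmetric matrices. It is identified with `Λ²ℝⁿ` by letting
`e_i ∧ e_j` act as `θ ↦ ⟨e_i, θ⟩ e_j - ⟨e_j, θ⟩ e_i`. -/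
abbrev so (n : ℕ) : Type := LieAlgebra.Orthogonal.so (Fin n) ℝ

/-- The inner product on matrices that restricts to the one on `so(n) = Λ²ℝⁿ` for which the
`e_i ∧ e_j` (`i < j`) are orthonormal. -/
def ip {n : ℕ} (A B : Matrix (Fin n) (Fin n) ℝ) : ℝ := (1 / 2 : ℝ) * (Aᵀ * B).trace

theorem so_transpose {n : ℕ} (ξ : so n) : (ξ : Matrix (Fin n) (Fin n) ℝ)ᵀ = -ξ :=
  (LieAlgebra.Orthogonal.mem_so (Fin n) ℝ _).1 ξ.2

theorem SO_transpose_mul {n : ℕ} (a : SO n) : a.1ᵀ * a.1 = 1 :=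
  Matrix.mem_orthogonalGroup_iff' _ _ |>.1 a.2.1

theorem SO_mul_transpose {n : ℕ} (a : SO n) : a.1 * a.1ᵀ = 1 :=
  Matrix.mem_orthogonalGroup_iff _ _ |>.1 a.2.1

theorem exp_mem_SO {n : ℕ} (ξ : so n) :
    NormedSpace.exp (ξ : Matrix (Fin n) (Fin n) ℝ) ∈ Matrix.specialOrthogonalGroup (Fin n) ℝ := by
  have key : ∀ η : so n, (NormedSpace.exp (η : Matrix (Fin n) (Fin n) ℝ))ᵀ *
      NormedSpace.exp (η : Matrix (Fin n) (Fin n) ℝ) = 1 := by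
    intro η
    rw [← Matrix.exp_transpose, so_transpose, ← Matrix.exp_add_of_commute]
    · simp
    · exact (Commute.refl _).neg_left
  refine Matrix.mem_specialOrthogonalGroup_iff.2 ⟨Matrix.mem_orthogonalGroup_iff' _ _ |>.2 (key ξ), ?_⟩
  have h2 : NormedSpace.exp (ξ : Matrix (Fin n) (Fin n) ℝ) =
      NormedSpace.exp (((1 / 2 : ℝ) • ξ : so n) : Matrix (Fin n) (Fin n) ℝ) *
      NormedSpace.exp (((1 / 2 : ℝ) • ξ : so n) : Matrix (Fin n) (Fin n) ℝ) := by
    rw [← Matrix.exp_add_of_commute _ _ (Commute.refl _)]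
    congr 1
    change (ξ : Matrix (Fin n) (Fin n) ℝ) = (1 / 2 : ℝ) • (ξ : Matrix (Fin n) (Fin n) ℝ) +
      (1 / 2 : ℝ) • (ξ : Matrix (Fin n) (Fin n) ℝ)
    rw [← add_smul]
    norm_num
  have h3 := congrArg Matrix.det (key ((1 / 2 : ℝ) • ξ))
  rw [Matrix.det_mul, Matrix.det_transpose, Matrix.det_one] at h3
  rw [h2, Matrix.det_mul, h3]

/-- The exponential map `so(n) → SO(n)`. -/
def expSO {n : ℕ} (ξ : so n) : SO n :=
  ⟨NormedSpace.exp (ξ : Matrix (Fin n) (Fin n) ℝ), exp_mem_SO ξ⟩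

theorem toEuclideanLin_mul_apply {n : ℕ} (A B : Matrix (Fin n) (Fin n) ℝ)
    (v : EuclideanSpace ℝ (Fin n)) :
    Matrix.toEuclideanLin A (Matrix.toEuclideanLin B v) = Matrix.toEuclideanLin (A * B) v := by
  ext i
  simp [Matrix.toLpLin_apply, Matrix.mulVec_mulVec]

theorem toEuclideanLin_one_apply {n : ℕ} (v : EuclideanSpace ℝ (Fin n)) :
    Matrix.toEuclideanLin (1 : Matrix (Fin n) (Fin n) ℝ) v = v := by
  ext i
  simp

theorem inner_toEuclideanLin_SO {n : ℕ} (a : SO n) (v w : EuclideanSpace ℝ (Fin n)) :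
    inner ℝ (Matrix.toEuclideanLin a.1 v) (Matrix.toEuclideanLin a.1 w) = inner ℝ v w := by
  rw [EuclideanSpace.inner_eq_star_dotProduct, EuclideanSpace.inner_eq_star_dotProduct]
  simp only [star_trivial, Matrix.toLpLin_apply]
  rw [Matrix.dotProduct_mulVec, ← Matrix.mulVec_transpose, Matrix.mulVec_mulVec,
    SO_transpose_mul, Matrix.one_mulVec]

/-- The isometry of Euclidean space given by an element of `SO(n)`. -/
def rotation {n : ℕ} (a : SO n) : EuclideanSpace ℝ (Fin n) ≃ₗᵢ[ℝ] EuclideanSpace ℝ (Fin n) where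
  toLinearEquiv := LinearEquiv.ofLinearMap (Matrix.toEuclideanLin a.1) (Matrix.toEuclideanLin a.1ᵀ)
    (by ext1 v
        simp only [LinearMap.comp_apply, toEuclideanLin_mul_apply, SO_mul_transpose,
          toEuclideanLin_one_apply, LinearMap.id_apply])
    (by ext1 v
        simp only [LinearMap.comp_apply, toEuclideanLin_mul_apply, SO_transpose_mul,
          toEuclideanLin_one_apply, LinearMap.id_apply])
  norm_map' v := by
    change ‖Matrix.toEuclideanLin a.1 v‖ = ‖v‖
    rw [@norm_eq_sqrt_real_inner _ _ _ (Matrix.toEuclideanLin a.1 v), inner_toEuclideanLin_SO,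
      ← norm_eq_sqrt_real_inner]

theorem rotation_apply {n : ℕ} (a : SO n) (v : EuclideanSpace ℝ (Fin n)) :
    rotation a v = Matrix.toEuclideanLin a.1 v := rfl

theorem rotation_mul {n : ℕ} (a b : SO n) : rotation (a * b) = (rotation b).trans (rotation a) := by
  ext1 v
  simp only [LinearIsometryEquiv.trans_apply, rotation_apply, toEuclideanLin_mul_apply]
  rfl

theorem rotation_one {n : ℕ} : rotation (1 : SO n) = LinearIsometryEquiv.refl ℝ _ := by
  ext1 v
  exact toEuclideanLin_one_apply v

/-- The orientation of Euclidean space given by the standard basis. -/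
def stdOrientation (n : ℕ) : Orientation ℝ (EuclideanSpace ℝ (Fin n)) (Fin n) :=
  (EuclideanSpace.basisFun (Fin n) ℝ).toBasis.orientation

theorem map_rotation_stdOrientation {n : ℕ} (a : SO n) :
    Orientation.map (Fin n) (rotation a).toLinearEquiv (stdOrientation n) = stdOrientation n := by
  rw [Orientation.map_eq_iff_det_pos _ _ (by simp)]
  have h : ((rotation a).toLinearEquiv : EuclideanSpace ℝ (Fin n) →ₗ[ℝ] EuclideanSpace ℝ (Fin n)) =
      Matrix.toEuclideanLin a.1 := by
    ext1 v
    rfl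
  have h1 : a.1.det = 1 := a.2.2
  rw [h, Matrix.toEuclideanLin, Matrix.toLpLin_eq_toLin, LinearMap.det_toLin, h1]
  norm_num

/-- The standard first basis vector of Euclidean space. -/
def e₁ (n : ℕ) [NeZero n] : EuclideanSpace ℝ (Fin n) := EuclideanSpace.single 0 1

/-- `SO(n-1)` as a subgroup of `SO(n)`: the elements `a` fixing the first basis vector, that is,
the block diagonal matrices `diag(1, a')` with `a'` in `SO(n-1)`. -/
def subSO (n : ℕ) [NeZero n] : Subgroup (SO n) where
  carrier := {a | rotation a (e₁ n) = e₁ n}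
  mul_mem' := by
    intro a b ha hb
    change rotation (a * b) (e₁ n) = e₁ n
    rw [rotation_mul, LinearIsometryEquiv.trans_apply, hb, ha]
  one_mem' := by
    change rotation 1 (e₁ n) = e₁ n
    rw [rotation_one]
    rfl
  inv_mem' := by
    intro a ha
    change rotation a⁻¹ (e₁ n) = e₁ n
    conv_lhs => rw [← (show rotation a (e₁ n) = e₁ n from ha)]
    rw [← LinearIsometryEquiv.trans_apply, ← rotation_mul, inv_mul_cancel, rotation_one]
    rfl

/-! ### Oriented Riemannian manifolds and their frame bundle -/

section Geometry

variable {n : ℕ} {M : Type*} [TopologicalSpace M] [ChartedSpace (EuclideanSpace ℝ (Fin n)) M]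
  [IsManifold (𝓡 n) ∞ M]

variable (n M) in
/-- An orientation of the manifold `M`: an orientation of each tangent space such that near each
point there is a smooth local frame of the tangent bundle which is everywhere positive. -/
structure ManifoldOrientation where
  /-- The orientation of each tangent space. -/
  orient : ∀ x : M, Orientation ℝ (TangentSpace (𝓡 n) x) (Fin n)
  exists_positive_frame : ∀ x₀ : M, ∃ U : Set M, IsOpen U ∧ x₀ ∈ U ∧
    ∃ (s : Fin n → ∀ x : M, TangentSpace (𝓡 n) x)
      (hs : IsLocalFrameOn (𝓡 n) (EuclideanSpace ℝ (Fin n)) ∞ s U),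
      ∀ (x : M) (hx : x ∈ U), (hs.toBasisAt hx).orientation = orient x

variable [RiemannianBundle (fun x : M ↦ TangentSpace (𝓡 n) x)]

/-- The fibre of the frame bundle at `x`: the oriented orthonormal frames of `T_x M`, that is, the
orientation preserving linear isometries from Euclidean space onto `T_x M`. -/
structure FrameAt (o : ManifoldOrientation n M) (x : M) where
  /-- The isometry underlying a frame. -/
  iso : EuclideanSpace ℝ (Fin n) ≃ₗᵢ[ℝ] TangentSpace (𝓡 n) x
  map_orientation : Orientation.map (Fin n) iso.toLinearEquiv (stdOrientation n) = o.orient x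

variable {o : ManifoldOrientation n M}

/-- The right action of `SO(n)` on frames, `w ↦ w ∘ a`. -/
def FrameAt.rot {x : M} (w : FrameAt o x) (a : SO n) : FrameAt o x where
  iso := (rotation a).trans w.iso
  map_orientation := by
    rw [← w.map_orientation]
    conv_rhs => rw [← map_rotation_stdOrientation a]
    induction stdOrientation n using Module.Ray.ind
    rfl

variable (o) in
/-- The bundle `FM` of oriented orthonormal frames. -/
def FM : Type _ := Σ x : M, FrameAt o x

/-- The right action of `SO(n)` on `FM`. -/
def FM.rot (w : FM o) (a : SO n) : FM o := ⟨w.1, w.2.rot a⟩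

theorem FM.rot_mul (w : FM o) (a b : SO n) : w.rot (a * b) = (w.rot a).rot b := by
  simp only [FM.rot, FrameAt.rot, rotation_mul]
  rfl

theorem FM.rot_one (w : FM o) : w.rot 1 = w := by
  simp only [FM.rot, FrameAt.rot, rotation_one]
  rfl

/-- The topology of `FM` as a subspace of the `n`-fold power of the tangent bundle. -/
instance : TopologicalSpace (FM o) :=
  TopologicalSpace.induced
    (fun w (i : Fin n) ↦
      (⟨w.1, w.2.iso (EuclideanSpace.single i 1)⟩ : TangentBundle (𝓡 n) M)) inferInstance

/-- A family of frames, one at each point, is smooth on `U` if each of its vector fields is. -/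
def SmoothFrameOn (s : ∀ x : M, FrameAt o x) (U : Set M) : Prop :=
  ∀ i : Fin n, ContMDiffOn (𝓡 n) ((𝓡 n).prod 𝓘(ℝ, EuclideanSpace ℝ (Fin n))) ∞
    (fun x ↦ (⟨x, (s x).iso (EuclideanSpace.single i 1)⟩ : TangentBundle (𝓡 n) M)) U

/-- `u ∈ C^∞(FM)`: in the local trivialization `(x, a) ↦ s x ∘ a` of `FM` over an open set `U`
given by any smooth frame field `s` on `U`, the function `u` is a smooth function on `U × SO(n)`,
i.e. the restriction of a smooth function on `U` times the vector space of matrices, in which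
`SO(n)` is a closed submanifold. -/
def SmoothFM (u : FM o → ℝ) : Prop :=
  ∀ (U : Set M) (s : ∀ x : M, FrameAt o x), IsOpen U → SmoothFrameOn s U →
    ∃ F : M × (Fin n → Fin n → ℝ) → ℝ,
      ContMDiffOn ((𝓡 n).prod 𝓘(ℝ, Fin n → Fin n → ℝ)) 𝓘(ℝ, ℝ) ∞ F (U ×ˢ Set.univ) ∧
      ∀ x ∈ U, ∀ a : SO n, u ⟨x, (s x).rot a⟩ = F (x, fun i j ↦ a.1 i j)

theorem nonempty_frameAt [NeZero n] (o : ManifoldOrientation n M) (x : M) :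
    Nonempty (FrameAt o x) := by
  have hd : Module.finrank ℝ (TangentSpace (𝓡 n) x) = n := by
    change Module.finrank ℝ (EuclideanSpace ℝ (Fin n)) = n
    simp
  let b := (o.orient x).finOrthonormalBasis (Nat.pos_of_ne_zero (NeZero.ne n)) hd
  have hb : b.toBasis.orientation = o.orient x :=
    Orientation.finOrthonormalBasis_orientation _ hd _
  refine ⟨⟨b.repr.symm, ?_⟩⟩
  rw [← hb, stdOrientation, ← Module.Basis.orientation_map]
  congr 1

/-! ### Levi-Civita connection, curvature and the frame flow -/

/-- The Levi-Civita connection: the torsion-free metric connection on the tangent bundle. -/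
def IsLeviCivita [IsContMDiffRiemannianBundle (𝓡 n) ∞ (EuclideanSpace ℝ (Fin n))
      (fun x : M ↦ TangentSpace (𝓡 n) x)]
    (cov : CovariantDerivative (𝓡 n) (EuclideanSpace ℝ (Fin n))
      (fun x : M ↦ TangentSpace (𝓡 n) x)) : Prop :=
  haveI : IsContMDiffRiemannianBundle (𝓡 n) 1 (EuclideanSpace ℝ (Fin n))
      (fun x : M ↦ TangentSpace (𝓡 n) x) :=
    IsContMDiffRiemannianBundle.of_le (n := ∞) (by exact_mod_cast le_top)
  cov.torsion = 0 ∧ cov.IsMetricCompatible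

variable (cov : CovariantDerivative (𝓡 n) (EuclideanSpace ℝ (Fin n))
  (fun x : M ↦ TangentSpace (𝓡 n) x))

/-- The curvature tensor `R(X, Y) Z = ∇_X ∇_Y Z - ∇_Y ∇_X Z - ∇_[X, Y] Z` at a point, computed by
extending the three tangent vectors to local smooth vector fields. -/
def curvature (x : M) (a b c : TangentSpace (𝓡 n) x) : TangentSpace (𝓡 n) x :=
  let ext (v : TangentSpace (𝓡 n) x) : ∀ y : M, TangentSpace (𝓡 n) y :=
    FiberBundle.extend (EuclideanSpace ℝ (Fin n)) v
  cov (fun y ↦ cov (ext c) y (ext b y)) x a - cov (fun y ↦ cov (ext c) y (ext a y)) x b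
    - cov (ext c) x (VectorField.mlieBracket (𝓡 n) (ext a) (ext b) x)

/-- For `w ∈ FM` over `x` and `X, Y ∈ T_x M`, the element `w⁻¹ R_x(X ∧ Y)` of `Λ²ℝⁿ = so(n)`: the
matrix of the endomorphism `w⁻¹ ∘ R_x(X, Y) ∘ w`. -/
def frameCurvature (w : FM o) (X Y : TangentSpace (𝓡 n) w.1) : Matrix (Fin n) (Fin n) ℝ :=
  Matrix.of fun i j ↦ inner ℝ (w.2.iso (EuclideanSpace.single i 1))
    (curvature cov w.1 X Y (w.2.iso (EuclideanSpace.single j 1)))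

/-- The bilinear form `⟨R_FM(w) ξ, ξ'⟩ = ⟨ξ, w⁻¹ R_x(w(ξ' e₁) ∧ w(e₁))⟩` on `Λ²ℝⁿ = so(n)`. -/
def RFM [NeZero n] (w : FM o) (ξ ξ' : so n) : ℝ :=
  ip ξ.1 (frameCurvature cov w (w.2.iso (Matrix.toEuclideanLin ξ'.1 (e₁ n))) (w.2.iso (e₁ n)))

/-- The frame field `s` is smooth near `x` and parallel at `x` (all its vector fields have
vanishing covariant derivative at `x`). Equivalently, it is smooth near `x` and the image of
the differential at `x` of the section `s` of `FM` is the horizontal space at `s x`. -/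
def ParallelFrameAt (s : ∀ y : M, FrameAt o y) (x : M) : Prop :=
  (∃ U : Set M, IsOpen U ∧ x ∈ U ∧ SmoothFrameOn s U) ∧
    ∀ i : Fin n, cov (fun y ↦ (s y).iso (EuclideanSpace.single i 1)) x = 0

open Classical in
/-- The generator `𝐗 = B_{e₁}` of the frame flow acting on functions on `FM`: `(𝐗 f)(w)` is the
derivative of `f` along the horizontal lift at `w` of the vector `w(e₁)`, that is, along the image
of `w(e₁)` under the differential of a section of `FM` which takes the value `w` at the base point
and is parallel there. Such a section exists and its differential does not depend on the choice. -/
def X [NeZero n] (f : FM o → ℝ) (w : FM o) : ℝ :=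
  if h : ∃ s : ∀ y : M, FrameAt o y, ParallelFrameAt cov s w.1 ∧ s w.1 = w.2 then
    mvfderiv (𝓡 n) (fun y : M ↦ f ⟨y, h.choose y⟩) w.1 (w.2.iso (e₁ n))
  else 0

/-! ### The associated bundle `PM = FM/G` and its vertical bundle -/

variable (o) in
/-- The orbit relation of `G` on `FM`. -/
def orbitSetoid (G : Subgroup (SO n)) : Setoid (FM o) where
  r w w' := ∃ a ∈ G, w.rot a = w'
  iseqv :=
    { refl := fun w ↦ ⟨1, G.one_mem, w.rot_one⟩
      symm := by
        rintro w _ ⟨a, ha, rfl⟩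
        exact ⟨a⁻¹, G.inv_mem ha, by rw [← FM.rot_mul, mul_inv_cancel, FM.rot_one]⟩
      trans := by
        rintro w _ _ ⟨a, ha, rfl⟩ ⟨b, hb, rfl⟩
        exact ⟨a * b, G.mul_mem ha hb, FM.rot_mul _ _ _⟩ }

variable (o) in
/-- The associated bundle `PM = FM/G`. -/
def PM (G : Subgroup (SO n)) : Type _ := Quotient (orbitSetoid o G)

variable {G : Subgroup (SO n)}

instance : TopologicalSpace (PM o G) :=
  inferInstanceAs (TopologicalSpace (Quotient (orbitSetoid o G)))

instance : MeasurableSpace (PM o G) := borel _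

instance : BorelSpace (PM o G) := ⟨rfl⟩

variable (G) in
/-- The projection `π : FM → PM`. -/
def toPM (w : FM o) : PM o G := Quotient.mk (orbitSetoid o G) w

/-- `u ∈ C^∞(PM)`: since `π` is a surjective submersion, this means that `π^* u` is smooth. -/
def SmoothPM (u : PM o G → ℝ) : Prop := SmoothFM fun w ↦ u (toPM G w)

/-- The points of `FM` over a point of `PM`. -/
abbrev FibreOver (z : PM o G) : Type _ := {w : FM o // toPM G w = z}

/-- A choice of a point of `FM` over a point of `PM`; nothing below depends on the choice. -/
def lift (z : PM o G) : FibreOver z := ⟨Quotient.out z, Quotient.out_eq z⟩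

theorem exists_rot_eq {z : PM o G} (w w' : FibreOver z) : ∃ a ∈ G, w.1.rot a = w'.1 :=
  Quotient.exact (w.2.trans w'.2.symm)

variable (G) in
/-- The Lie algebra of the closed subgroup `G` of `SO(n)`. -/
def lieAlg : Set (so n) := {η | ∀ t : ℝ, expSO (t • η) ∈ G}

/-- The vertical space of `PM` at `z`. As `FM → PM` is a principal bundle with fibres the orbits of
`G`, a vertical vector `T` at `z` is the same as the family of its vertical lifts
`T_w = Y_{ξ(w)}` at the points `w` over `z`, where `ξ(w)` is in the orthogonal complement of the Lie
algebra of `G` in `so(n)` and `ξ(w a) = a⁻¹ ξ(w) a` for `a ∈ G`. Here `T` is recorded as `ξ`. -/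
def verticalSubmodule (z : PM o G) : Submodule ℝ (FibreOver z → so n) where
  carrier := {ξ | (∀ w, ∀ η ∈ lieAlg G, ip (ξ w).1 η.1 = 0) ∧
    ∀ w w' : FibreOver z, ∀ a ∈ G, w.1.rot a = w'.1 → (ξ w').1 = a.1ᵀ * (ξ w).1 * a.1}
  add_mem' := by
    rintro ξ ξ' ⟨h1, h2⟩ ⟨h1', h2'⟩
    refine ⟨fun w η hη ↦ ?_, fun w w' a ha hw ↦ ?_⟩
    · have e1 := h1 w η hη
      have e2 := h1' w η hη
      change ip ((ξ w).1 + (ξ' w).1) η.1 = 0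
      simp only [ip, Matrix.transpose_add, Matrix.add_mul, Matrix.trace_add] at *
      linarith
    · change (ξ w').1 + (ξ' w').1 = a.1ᵀ * ((ξ w).1 + (ξ' w).1) * a.1
      rw [h2 w w' a ha hw, h2' w w' a ha hw, Matrix.mul_add, Matrix.add_mul]
  zero_mem' := by
    refine ⟨fun w η _ ↦ ?_, fun w w' a _ _ ↦ ?_⟩
    · change ip 0 η.1 = 0
      simp [ip]
    · change (0 : Matrix (Fin n) (Fin n) ℝ) = a.1ᵀ * 0 * a.1
      simp
  smul_mem' := by
    rintro c ξ ⟨h1, h2⟩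
    refine ⟨fun w η hη ↦ ?_, fun w w' a ha hw ↦ ?_⟩
    · have e1 := h1 w η hη
      change ip (c • (ξ w).1) η.1 = 0
      simp only [ip, Matrix.transpose_smul, Matrix.smul_mul, Matrix.trace_smul, smul_eq_mul] at *
      linear_combination c * e1
    · change c • (ξ w').1 = a.1ᵀ * (c • (ξ w).1) * a.1
      rw [h2 w w' a ha hw, Matrix.mul_smul, Matrix.smul_mul]

/-- The vertical space `𝕍_PM(z)`. -/
def Vert (z : PM o G) : Type _ := verticalSubmodule z

instance (z : PM o G) : AddCommGroup (Vert z) := inferInstanceAs (AddCommGroup (verticalSubmodule z))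

instance (z : PM o G) : Module ℝ (Vert z) := inferInstanceAs (Module ℝ (verticalSubmodule z))

/-- The vertical lift `ξ(w)` of a vertical vector, as a linear map. -/
def Vert.at {z : PM o G} (w : FibreOver z) : Vert z →ₗ[ℝ] so n :=
  (LinearMap.proj w).comp (verticalSubmodule z).subtype

theorem ip_conj (a : SO n) (A B : Matrix (Fin n) (Fin n) ℝ) :
    ip (a.1ᵀ * A * a.1) (a.1ᵀ * B * a.1) = ip A B := by
  unfold ip
  congr 1
  have h : (a.1ᵀ * A * a.1)ᵀ * (a.1ᵀ * B * a.1) = a.1ᵀ * (Aᵀ * B * a.1) := by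
    simp only [Matrix.transpose_mul, Matrix.transpose_transpose, Matrix.mul_assoc]
    rw [← Matrix.mul_assoc a.1 a.1ᵀ, SO_mul_transpose, Matrix.one_mul]
  rw [h, Matrix.trace_mul_comm, Matrix.mul_assoc, SO_mul_transpose, Matrix.mul_one]

theorem ip_at {z : PM o G} (w w' : FibreOver z) (T T' : Vert z) :
    ip (Vert.at w T).1 (Vert.at w T').1 = ip (Vert.at w' T).1 (Vert.at w' T').1 := by
  obtain ⟨a, ha, h⟩ := exists_rot_eq w w'
  have e1 : (Vert.at w' T).1 = a.1ᵀ * (Vert.at w T).1 * a.1 := T.2.2 w w' a ha h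
  have e2 : (Vert.at w' T').1 = a.1ᵀ * (Vert.at w T').1 * a.1 := T'.2.2 w w' a ha h
  rw [e1, e2, ip_conj]

theorem ip_self {n : ℕ} (A : Matrix (Fin n) (Fin n) ℝ) :
    ip A A = (1 / 2 : ℝ) * ∑ i, ∑ j, A j i ^ 2 := by
  simp [ip, Matrix.trace, Matrix.mul_apply, sq]

theorem ip_self_nonneg {n : ℕ} (A : Matrix (Fin n) (Fin n) ℝ) : 0 ≤ ip A A := by
  rw [ip_self]
  positivity

theorem eq_zero_of_ip_self {n : ℕ} {A : Matrix (Fin n) (Fin n) ℝ} (h : ip A A = 0) : A = 0 := by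
  rw [ip_self] at h
  have h1 : ∑ i, ∑ j, A j i ^ 2 = 0 := by linarith
  ext i j
  have h2 := (Finset.sum_eq_zero_iff_of_nonneg
    (fun i _ ↦ Finset.sum_nonneg fun j _ ↦ sq_nonneg (A j i))).1 h1 j (Finset.mem_univ _)
  have h3 := (Finset.sum_eq_zero_iff_of_nonneg (fun j _ ↦ sq_nonneg (A j _))).1 h2 i
    (Finset.mem_univ _)
  simpa using h3

theorem Vert.at_injective {z : PM o G} (w : FibreOver z) :
    Function.Injective (Vert.at w) := by
  rw [injective_iff_map_eq_zero]
  intro T hT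
  apply Subtype.ext
  funext w'
  apply Subtype.ext
  apply eq_zero_of_ip_self
  change ip (Vert.at w' T).1 (Vert.at w' T).1 = 0
  rw [ip_at w' w, hT]
  simp [ip]

/-- The inner product of `𝕍_PM(z)`, for which `dπ : (𝕍_FM)_w ⊇ (ker dπ)^⊥ → 𝕍_PM(z)` is isometric. -/
@[reducible]
def vertCore (z : PM o G) : InnerProductSpace.Core ℝ (Vert z) where
  inner T T' := ip (Vert.at (lift z) T).1 (Vert.at (lift z) T').1
  conj_inner_symm T T' := by
    simp only [ip, conj_trivial]
    rw [← Matrix.trace_transpose, Matrix.transpose_mul, Matrix.transpose_transpose]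
  re_inner_nonneg T := ip_self_nonneg _
  add_left T T' T'' := by
    rw [map_add]
    change ip ((Vert.at (lift z) T).1 + (Vert.at (lift z) T').1) _ = _
    simp only [ip, Matrix.transpose_add, Matrix.add_mul, Matrix.trace_add]
    ring
  smul_left T T' c := by
    rw [map_smul]
    change ip (c • (Vert.at (lift z) T).1) _ = _
    simp only [ip, Matrix.transpose_smul, Matrix.smul_mul, Matrix.trace_smul, smul_eq_mul,
      conj_trivial]
    ring
  definite T h := by
    apply Vert.at_injective (lift z)
    rw [map_zero]
    exact Subtype.ext (eq_zero_of_ip_self h)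

instance (z : PM o G) : NormedAddCommGroup (Vert z) :=
  @InnerProductSpace.Core.toNormedAddCommGroup ℝ _ _ _ _ (vertCore z)

instance (z : PM o G) : InnerProductSpace ℝ (Vert z) :=
  InnerProductSpace.ofCore (vertCore z).toCore

instance (z : PM o G) : FiniteDimensional ℝ (Vert z) :=
  FiniteDimensional.of_injective (Vert.at (lift z)) (Vert.at_injective _)

theorem Vert.inner_eq {z : PM o G} (w : FibreOver z) (T T' : Vert z) :
    inner ℝ T T' = ip (Vert.at w T).1 (Vert.at w T').1 :=
  ip_at _ _ _ _

/-- The vector of `𝕍_PM(z)` representing a linear form via the inner product. -/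
def riesz {z : PM o G} (ℓ : Vert z → ℝ) : Vert z :=
  ∑ i, ℓ (stdOrthonormalBasis ℝ (Vert z) i) • stdOrthonormalBasis ℝ (Vert z) i

/-! ### The operators on `PM` -/

/-- The derivative `du(T)` of a function `u` on `PM` in the direction of `T ∈ 𝕍_PM(z)`: the
derivative at `t = 0` of `u` along the curve `t ↦ π(w e^{t ξ(w)})`. -/
def vertDeriv (u : PM o G → ℝ) {z : PM o G} (T : Vert z) : ℝ :=
  deriv (fun t : ℝ ↦ u (toPM G ((lift z).1.rot (expSO (t • Vert.at (lift z) T))))) 0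

/-- The vertical gradient `∇_𝕍 u`, i.e. the section of `𝕍_PM` with `⟨∇_𝕍 u, T⟩ = du(T)`. -/
def vertGrad (u : PM o G → ℝ) (z : PM o G) : Vert z := riesz fun T ↦ vertDeriv u T

/-- The vector field `𝐗_PM` to which `𝐗` descends, acting on functions on `PM`. -/
def XPM [NeZero n] (u : PM o G → ℝ) (z : PM o G) : ℝ :=
  X cov (fun w ↦ u (toPM G w)) (lift z).1

/-- The covariant derivative `∇_{𝐗_PM} S` of a section `S` of `𝕍_PM`: its vertical lift is obtained
by applying `𝐗` to the components of the vertical lift of `S`, a function from `FM` to `so(n)`. -/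
def covX [NeZero n] (S : ∀ z : PM o G, Vert z) (z : PM o G) : Vert z :=
  riesz fun T ↦ ip
    (Matrix.of fun i j ↦ X cov
      (fun w : FM o ↦ (Vert.at ⟨w, rfl⟩ (S (toPM G w))).1 i j) (lift z).1)
    (Vert.at (lift z) T).1

/-- The curvature endomorphism of `𝕍_PM(z)`, `⟨R_PM(z) T, T'⟩ = ⟨R_FM(w) ξ(w), ξ'(w)⟩`. -/
def RPM [NeZero n] (z : PM o G) : Vert z →ₗ[ℝ] Vert z where
  toFun T := riesz fun T' ↦ RFM cov (lift z).1 (Vert.at (lift z) T) (Vert.at (lift z) T')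
  map_add' T T' := by
    simp only [riesz, RFM, map_add]
    rw [← Finset.sum_add_distrib]
    refine Finset.sum_congr rfl fun i _ ↦ ?_
    rw [← add_smul]
    congr 1
    change ip ((Vert.at (lift z) T).1 + (Vert.at (lift z) T').1) _ = _
    simp only [ip, Matrix.transpose_add, Matrix.add_mul, Matrix.trace_add]
    ring
  map_smul' c T := by
    simp only [riesz, RFM, map_smul]
    rw [RingHom.id_apply, Finset.smul_sum]
    refine Finset.sum_congr rfl fun i _ ↦ ?_
    rw [smul_smul]
    congr 1
    change ip (c • (Vert.at (lift z) T).1) _ = _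
    simp only [ip, Matrix.transpose_smul, Matrix.smul_mul, Matrix.trace_smul, smul_eq_mul]
    ring

/-! ### Measures -/

/-- The Riemannian measure in the chart at `x`: the image of `√(det g_ij) dy`. -/
def chartVolume [MeasurableSpace M] (x : M) : Measure M :=
  ((volume.restrict (extChartAt (𝓡 n) x).target).withDensity fun y ↦
    ENNReal.ofReal √(Matrix.det (Matrix.of fun i j : Fin n ↦
      (inner ℝ
        (mfderiv 𝓘(ℝ, EuclideanSpace ℝ (Fin n)) (𝓡 n) (extChartAt (𝓡 n) x).symm y
          (EuclideanSpace.single i 1))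
        (mfderiv 𝓘(ℝ, EuclideanSpace ℝ (Fin n)) (𝓡 n) (extChartAt (𝓡 n) x).symm y
          (EuclideanSpace.single j 1)) : ℝ)))).map (extChartAt (𝓡 n) x).symm

variable (n M) in
/-- The Riemannian measure of `M`. The measures in the charts agree on overlaps, so that their
supremum is the measure on `M` that restricts to each of them. -/
def riemannianVolume [MeasurableSpace M] : Measure M := ⨆ x : M, chartVolume (n := n) x

instance : MeasurableSpace (SO n ⧸ G) := borel _

instance : BorelSpace (SO n ⧸ G) := ⟨rfl⟩

/-- The identification `a G ↦ π(w a)` of the model fibre `SO(n)/G` with the fibre of `PM → M` over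
`x` given by a frame `w` at `x`. -/
def fibreMap {x : M} (w : FrameAt o x) : SO n ⧸ G → PM o G :=
  Quotient.lift (fun a : SO n ↦ toPM G ⟨x, w.rot a⟩) (by
    intro a b hab
    refine Quotient.sound ⟨a⁻¹ * b, QuotientGroup.leftRel_apply.1 hab, ?_⟩
    have h := FM.rot_mul (⟨x, w⟩ : FM o) a (a⁻¹ * b)
    rw [mul_inv_cancel_left] at h
    exact h.symm)

/-- The measure on `PM` which is, in local trivializations of `PM → M` with fibre `SO(n)/G`, the
product of the Riemannian measure of `M` and of the `SO(n)`-invariant measure `σ` on `SO(n)/G`. By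
invariance the frame used to identify a fibre with `SO(n)/G` does not matter. If `σ` is the
Riemannian measure of the homogeneous metric on `SO(n)/G`, this is the Riemannian measure of `PM`. -/
def liouville [MeasurableSpace M] [NeZero n] (o : ManifoldOrientation n M)
    (σ : Measure (SO n ⧸ G)) : Measure (PM o G) :=
  (riemannianVolume n M).bind fun x ↦
    σ.map (fibreMap (Classical.choice (nonempty_frameAt o x)))

/-! ### The unit tangent bundle -/

variable (M) in
/-- The unit tangent bundle. -/
def SM : Type _ := Σ x : M, {v : TangentSpace (𝓡 n) x // ‖v‖ = 1}

theorem norm_iso_e₁ [NeZero n] {x : M} (w : FrameAt o x) : ‖w.iso (e₁ n)‖ = 1 := by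
  rw [LinearIsometryEquiv.norm_map, e₁]
  simp

/-- The projection `FM → SM`, `w ↦ w(e₁)`. -/
def FM.toSM [NeZero n] (w : FM o) : SM (n := n) M := ⟨w.1, w.2.iso (e₁ n), norm_iso_e₁ w.2⟩

/-- The projection `PM → SM` induced by `w ↦ w(e₁)`, for `G` contained in `SO(n-1)`. -/
def PM.toSM [NeZero n] (z : PM o G) : SM (n := n) M := (lift z).1.toSM

end Geometry

end FramePestov
end

open FramePestov

open Bundle Manifold MeasureTheory Matrix Topology
open scoped ContDiff

noncomputable section

namespace FramePestov

/-! ### Frame bundle calculus in a local trivialization -/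

section Model

section Shortcuts

variable (E : Type*) [NormedAddCommGroup E] [NormedSpace ℝ E]

/-! The identity is proved on the frame bundle and then pushed down to PM.

Let B_v be the horizontal field on FM whose value at w is the lift of w(v), so that 𝐗 = B_{e₁}. The
structure equations are [Y_ξ, B_v] = B_{ξv} and, since the torsion vanishes, [B_v, B_w] = minus the
vertical field given by the curvature form on the two frame vectors. Put H_ξ = [Y_ξ, 𝐗] = B_{ξe₁}.
Over an orthonormal basis ξ_k of so(n) one has ∑ ξ_k² = -(n-1), hence ∑ [Y_k, H_k] = -(n-1) 𝐗
(`sum_Y_H`). Moreover [𝐗, H_ξ] is the vertical field of -R(e₁, ξe₁) (`X_H`), whose pairing with the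
vertical gradient is the quadratic form R_FM (`sum_X_H`).

For a single Y = Y_ξ, (Y𝐗f)² - (𝐗Yf)² = Hf · (Y𝐗f + 𝐗Yf). Both Y and 𝐗 preserve the measure of FM,
so their derivatives integrate to zero, and integration by parts gives ∫ (Y𝐗f)² - (𝐗Yf)² + [Y,H]f ·
𝐗f + [𝐗,H]f · Yf = 0 (`integral_commutator`). Summation over the basis is the identity on FM
(`pestov_frame`).

The calculus is done in local trivializations. A smooth orthonormal frame σ over a chart identifies
FM locally with an open set of E times SO(n) inside E × End E. Functions are extended to this normed
space (`LocalRep`), Y_ξ becomes (p, a) ↦ (0, aξ), and B_v becomes (σ(av), -θ(σ(av))a) with θ the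
connection form. Smoothness of θ comes from the Koszul formula.

That right rotations preserve the measure is right invariance of Haar measure. For 𝐗 (`integral_X`)
a partition of unity localizes to one frame. There the divergence of the base component of B_{e₁}
with respect to the density |det σ|⁻¹ equals the divergence of its fibre component along SO(n), both
being traces of θ, so the two contributions cancel.

An invariant finite measure on SO(n)/G is a multiple of the image of Haar measure, so the measure of
PM is a multiple of the image of that of FM (`liouville_eq`). For a G-invariant function the full
so(n)-gradient is already orthogonal to the Lie algebra of G, and 𝐗 commutes with G because G fixes
e₁. Each integrand on FM is therefore the pullback of its counterpart on PM, with no projection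
involved.

For G = SO(n-1), ξ ↦ ξe₁ is an isometry of the orthogonal complement of the Lie algebra onto the
orthogonal complement of e₁, and the pair symmetry of the curvature turns R_FM into ⟨R(KT, v)v,
KT'⟩. A unit field that is parallel at a point lifts locally to a frame field. That lift need not be
parallel, but its deviation is a vertical direction fixing e₁, which functions on SM do not see
(`X_toSM`). -/

instance instNormedAddCommGroupEnd : NormedAddCommGroup (E →L[ℝ] E) := inferInstance
instance instNormedSpaceEnd : NormedSpace ℝ (E →L[ℝ] E) := inferInstance
instance instAddCommGroupEnd : AddCommGroup (E →L[ℝ] E) := inferInstance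
instance instAddCommMonoidEnd : AddCommMonoid (E →L[ℝ] E) := inferInstance
instance instModuleEnd : Module ℝ (E →L[ℝ] E) := inferInstance
instance instTopologicalSpaceEnd : TopologicalSpace (E →L[ℝ] E) := inferInstance
instance instNormedAddCommGroupHomEnd : NormedAddCommGroup (E →L[ℝ] E →L[ℝ] E) := inferInstance
instance instNormedSpaceHomEnd : NormedSpace ℝ (E →L[ℝ] E →L[ℝ] E) := inferInstance
instance instAddCommGroupHomEnd : AddCommGroup (E →L[ℝ] E →L[ℝ] E) := inferInstance
instance instAddCommMonoidHomEnd : AddCommMonoid (E →L[ℝ] E →L[ℝ] E) := inferInstance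
instance instModuleHomEnd : Module ℝ (E →L[ℝ] E →L[ℝ] E) := inferInstance
instance instTopologicalSpaceHomEnd : TopologicalSpace (E →L[ℝ] E →L[ℝ] E) := inferInstance

end Shortcuts


/-- The derivative of a function along a vector field of a normed space. -/
def dAlong {W : Type*} [NormedAddCommGroup W] [NormedSpace ℝ W] (V : W → W) (F : W → ℝ) : W → ℝ :=
  fun q ↦ fderiv ℝ F q (V q)

section

variable {W : Type*} [NormedAddCommGroup W] [NormedSpace ℝ W] {U V : W → W} {F F' : W → ℝ} {q : W}

/-- The second derivative of F enters the two orders with its arguments exchanged. Its symmetry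
leaves only the derivatives of the fields, that is, F differentiated along the Lie bracket. -/
theorem dAlong_comm (hF : ContDiffAt ℝ 2 F q) (hU : DifferentiableAt ℝ U q)
    (hV : DifferentiableAt ℝ V q) :
    dAlong U (dAlong V F) q - dAlong V (dAlong U F) q =
      fderiv ℝ F q (fderiv ℝ V q (U q) - fderiv ℝ U q (V q)) := by
  have hF' : DifferentiableAt ℝ (fderiv ℝ F) q :=
    (hF.fderiv_right (m := 1) (by norm_num)).differentiableAt (by norm_num)
  have key : ∀ {V : W → W}, DifferentiableAt ℝ V q → ∀ u, fderiv ℝ (dAlong V F) q u =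
      fderiv ℝ F q (fderiv ℝ V q u) + fderiv ℝ (fderiv ℝ F) q u (V q) := by
    intro V hV u
    unfold dAlong
    rw [fderiv_clm_apply hF' hV]
    simp
  have hs : IsSymmSndFDerivAt ℝ F q := hF.isSymmSndFDerivAt (by simp)
  have e1 := key hV (U q)
  have e2 := key hU (V q)
  have e3 := hs (U q) (V q)
  change fderiv ℝ (dAlong V F) q (U q) - fderiv ℝ (dAlong U F) q (V q) = _
  rw [e1, e2, map_sub, e3]
  ring

theorem ContDiffOn.dAlong {s : Set W} (hs : IsOpen s) (hF : ContDiffOn ℝ ∞ F s)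
    (hV : ContDiffOn ℝ ∞ V s) : ContDiffOn ℝ ∞ (dAlong V F) s :=
  (hF.fderiv_of_isOpen hs (by simp)).clm_apply hV

end

variable {E : Type*} [NormedAddCommGroup E] [NormedSpace ℝ E]

/-- The vector field on `E × End E` generated by right multiplication with `exp (t ξ)`. -/
def vertField (ξ : E →L[ℝ] E) (q : E × (E →L[ℝ] E)) : E × (E →L[ℝ] E) := (0, q.2.comp ξ)

/-- The standard horizontal vector field on `E × End E` of a connection form `θ` with respect to
a frame `σ`. -/
def horField (σ : E → E →L[ℝ] E) (θ : E → E →L[ℝ] E →L[ℝ] E) (v : E)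
    (q : E × (E →L[ℝ] E)) : E × (E →L[ℝ] E) :=
  (σ q.1 (q.2 v), -((θ q.1 (σ q.1 (q.2 v))).comp q.2))

theorem contDiff_vertField (ξ : E →L[ℝ] E) : ContDiff ℝ ∞ (vertField ξ) := by
  unfold vertField
  exact contDiff_const.prodMk (contDiff_snd.clm_comp contDiff_const)

variable {σ : E → E →L[ℝ] E} {θ : E → E →L[ℝ] E →L[ℝ] E} {s : Set E}

theorem contDiffOn_horField (hσ : ContDiffOn ℝ ∞ σ s) (hθ : ContDiffOn ℝ ∞ θ s) (v : E) :
    ContDiffOn ℝ ∞ (horField σ θ v) (s ×ˢ Set.univ) := by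
  have h1 : ContDiffOn ℝ ∞ (fun q : E × (E →L[ℝ] E) ↦ q.1) (s ×ˢ Set.univ) :=
    contDiff_fst.contDiffOn
  have h2 : ContDiffOn ℝ ∞ (fun q : E × (E →L[ℝ] E) ↦ q.2) (s ×ˢ Set.univ) :=
    contDiff_snd.contDiffOn
  have hm : Set.MapsTo (fun q : E × (E →L[ℝ] E) ↦ q.1) (s ×ˢ Set.univ) s := fun q hq ↦ hq.1
  have h3 := (hσ.comp h1 hm).clm_apply (h2.clm_apply (contDiffOn_const (c := v)))
  exact h3.prodMk (((hθ.comp h1 hm).clm_apply h3).clm_comp h2).neg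

theorem fderiv_vertField (ξ : E →L[ℝ] E) (q r : E × (E →L[ℝ] E)) :
    fderiv ℝ (vertField ξ) q r = (0, r.2.comp ξ) := by
  have h : HasFDerivAt (vertField ξ) (((0 : (E × (E →L[ℝ] E)) →L[ℝ] E)).prod
      (((ContinuousLinearMap.compL ℝ E E E).flip ξ).comp
        (ContinuousLinearMap.snd ℝ E (E →L[ℝ] E)))) q := by
    refine HasFDerivAt.prodMk (hasFDerivAt_const _ _) ?_
    exact (((ContinuousLinearMap.compL ℝ E E E).flip ξ).comp
        (ContinuousLinearMap.snd ℝ E (E →L[ℝ] E))).hasFDerivAt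
  rw [h.fderiv]
  rfl

theorem differentiableAt_horField {q : E × (E →L[ℝ] E)} (hσ : DifferentiableAt ℝ σ q.1)
    (hθ : DifferentiableAt ℝ θ q.1) (v : E) : DifferentiableAt ℝ (horField σ θ v) q := by
  have h1 := hσ.comp q differentiableAt_fst
  have h3 := (differentiableAt_snd (𝕜 := ℝ) (p := q)).clm_apply (differentiableAt_const v)
  have h4 := h1.clm_apply h3
  exact h4.prodMk ((((hθ.comp q differentiableAt_fst).clm_apply h4).clm_comp
    differentiableAt_snd).neg)

theorem fderiv_horField {q : E × (E →L[ℝ] E)} (hσ : DifferentiableAt ℝ σ q.1)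
    (hθ : DifferentiableAt ℝ θ q.1) (v : E) (r : E × (E →L[ℝ] E)) :
    fderiv ℝ (horField σ θ v) q r =
      (fderiv ℝ σ q.1 r.1 (q.2 v) + σ q.1 (r.2 v),
        -((fderiv ℝ θ q.1 r.1 (σ q.1 (q.2 v)) +
            θ q.1 (fderiv ℝ σ q.1 r.1 (q.2 v) + σ q.1 (r.2 v))).comp q.2
          + (θ q.1 (σ q.1 (q.2 v))).comp r.2)) := by
  have h1 : HasFDerivAt (fun q : E × (E →L[ℝ] E) ↦ σ q.1)
      ((fderiv ℝ σ q.1).comp (ContinuousLinearMap.fst ℝ _ _)) q :=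
    hσ.hasFDerivAt.comp q hasFDerivAt_fst
  have h2 : HasFDerivAt (fun q : E × (E →L[ℝ] E) ↦ θ q.1)
      ((fderiv ℝ θ q.1).comp (ContinuousLinearMap.fst ℝ _ _)) q :=
    HasFDerivAt.comp (g := θ) (f := fun q : E × (E →L[ℝ] E) ↦ q.1) q hθ.hasFDerivAt
      hasFDerivAt_fst
  have h3 := (hasFDerivAt_snd (𝕜 := ℝ) (p := q)).clm_apply (hasFDerivAt_const v q)
  have h4 := h1.clm_apply h3
  have h5 := ((h2.clm_apply h4).clm_comp hasFDerivAt_snd).neg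
  have h6 : HasFDerivAt (horField σ θ v) _ q := h4.prodMk h5
  rw [h6.fderiv]
  ext x
  · simp [add_comm]
  · simp only [ContinuousLinearMap.prod_apply]
    simp
    abel

/-- The structure equation [Y_ξ, B_v] = B_{ξv}. It is pure equivariance: v enters the horizontal
field only through av, and replacing a by a exp(tξ) acts on it linearly. Neither torsion nor metric
plays a role. -/
theorem dAlong_vertField_horField {q : E × (E →L[ℝ] E)} (hσ : DifferentiableAt ℝ σ q.1)
    (hθ : DifferentiableAt ℝ θ q.1) {F : E × (E →L[ℝ] E) → ℝ} (hF : ContDiffAt ℝ 2 F q)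
    (ξ : E →L[ℝ] E) (v : E) :
    dAlong (vertField ξ) (dAlong (horField σ θ v) F) q
      - dAlong (horField σ θ v) (dAlong (vertField ξ) F) q =
      dAlong (horField σ θ (ξ v)) F q := by
  rw [dAlong_comm hF ((contDiff_vertField ξ).differentiable (by simp)).differentiableAt
    (differentiableAt_horField hσ hθ v), fderiv_horField hσ hθ, fderiv_vertField]
  unfold dAlong
  congr 1
  simp only [vertField, horField, map_zero, _root_.zero_apply, zero_add,
    ContinuousLinearMap.comp_apply, Prod.mk_sub_mk, sub_zero]
  congr 1
  rw [ContinuousLinearMap.neg_comp, ContinuousLinearMap.comp_assoc, neg_add, add_sub_cancel_right]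

/-- The curvature of the connection form `θ`. -/
def formCurv (θ : E → E →L[ℝ] E →L[ℝ] E) (p a b : E) : E →L[ℝ] E :=
  fderiv ℝ θ p a b - fderiv ℝ θ p b a + (θ p a).comp (θ p b) - (θ p b).comp (θ p a)

/-- The bracket of two standard horizontal fields has the torsion as base component and minus the
curvature as fibre component. `htor` states in the frame σ that the torsion is zero. -/
theorem dAlong_horField_horField {q : E × (E →L[ℝ] E)} (hσ : DifferentiableAt ℝ σ q.1)
    (hθ : DifferentiableAt ℝ θ q.1) {F : E × (E →L[ℝ] E) → ℝ} (hF : ContDiffAt ℝ 2 F q)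
    (htor : ∀ u v, fderiv ℝ σ q.1 (σ q.1 u) v - fderiv ℝ σ q.1 (σ q.1 v) u =
      σ q.1 (θ q.1 (σ q.1 u) v) - σ q.1 (θ q.1 (σ q.1 v) u)) (v w : E) :
    dAlong (horField σ θ v) (dAlong (horField σ θ w) F) q
      - dAlong (horField σ θ w) (dAlong (horField σ θ v) F) q =
      - fderiv ℝ F q (0, (formCurv θ q.1 (σ q.1 (q.2 v)) (σ q.1 (q.2 w))).comp q.2) := by
  rw [dAlong_comm hF (differentiableAt_horField hσ hθ v)
    (differentiableAt_horField hσ hθ w), fderiv_horField hσ hθ,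
    fderiv_horField hσ hθ, ← map_neg]
  congr 1
  have h := htor (q.2 v) (q.2 w)
  -- The two sides are the base components of the derivative of one horizontal field along the
  -- other, in the two orders. Their equality kills the base component of the bracket and removes
  -- the derivatives of σ inside θ from the fibre component.
  have h1 : fderiv ℝ σ q.1 (σ q.1 (q.2 v)) (q.2 w) - σ q.1 (θ q.1 (σ q.1 (q.2 v)) (q.2 w)) =
    fderiv ℝ σ q.1 (σ q.1 (q.2 w)) (q.2 v) - σ q.1 (θ q.1 (σ q.1 (q.2 w)) (q.2 v)) := by
    rw [sub_eq_sub_iff_add_eq_add] at h ⊢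
    rw [h]
    abel
  refine Prod.ext ?_ ?_
  · simp only [horField, Prod.fst_sub, Prod.fst_neg, _root_.neg_apply,
      ContinuousLinearMap.comp_apply, map_neg, ← sub_eq_add_neg, h1, sub_self, neg_zero]
  · simp only [horField, Prod.snd_sub, Prod.snd_neg, _root_.neg_apply,
      ContinuousLinearMap.comp_apply, map_neg, ← sub_eq_add_neg, h1]
    ext x : 1
    simp [formCurv]
    abel

/-- Gauge transformation of the curvature of a connection: from the frame `σ` to coordinates. -/
theorem formCurv_gauge {Γ : E → E →L[ℝ] E →L[ℝ] E} {p : E} (hσ : ContDiffAt ℝ 2 σ p)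
    (hθ : DifferentiableAt ℝ θ p) (hΓ : DifferentiableAt ℝ Γ p)
    (h : ∀ᶠ y in 𝓝 p, ∀ a, (σ y).comp (θ y a) = fderiv ℝ σ y a + (Γ y a).comp (σ y)) (a b : E) :
    (σ p).comp (formCurv θ p a b) = (formCurv Γ p a b).comp (σ p) := by
  have hσ' : DifferentiableAt ℝ (fderiv ℝ σ) p :=
    (hσ.fderiv_right (m := 1) (by norm_num)).differentiableAt (by norm_num)
  have hσ1 : DifferentiableAt ℝ σ p := hσ.differentiableAt (by norm_num)
  have hp := h.self_of_nhds
  -- The gauge relation differentiated in direction a. On exchanging a and b and subtracting, the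
  -- second derivative of σ disappears by symmetry.
  have key : ∀ a b, (fderiv ℝ σ p a).comp (θ p b) + (σ p).comp (fderiv ℝ θ p a b) =
      fderiv ℝ (fderiv ℝ σ) p a b + (fderiv ℝ Γ p a b).comp (σ p)
        + (Γ p b).comp (fderiv ℝ σ p a) := by
    intro a b
    have h1 := hσ1.hasFDerivAt.clm_comp (hθ.hasFDerivAt.clm_apply (hasFDerivAt_const b p))
    have h2 := (hσ'.hasFDerivAt.clm_apply (hasFDerivAt_const b p)).add
      ((hΓ.hasFDerivAt.clm_apply (hasFDerivAt_const b p)).clm_comp hσ1.hasFDerivAt)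
    have h3 := h1.unique (h2.congr_of_eventuallyEq (h.mono fun y hy ↦ hy b))
    have h4 := congrArg (fun L : E →L[ℝ] E →L[ℝ] E ↦ L a) h3
    simp at h4
    rw [add_comm, h4]
    abel
  have hs := hσ.isSymmSndFDerivAt (by simp) a b
  have k1 := key a b
  have k2 := key b a
  rw [hs] at k1
  -- The undifferentiated relation eliminates the remaining first derivatives of σ, leaving an
  -- algebraic identity in θ, Γ and their derivatives.
  have d : ∀ a, fderiv ℝ σ p a = (σ p).comp (θ p a) - (Γ p a).comp (σ p) := by
    intro a
    rw [hp a]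
    abel
  rw [d a] at k1
  rw [d b] at k2
  ext x
  have k1' := congrArg (fun L : E →L[ℝ] E ↦ L x) k1
  have k2' := congrArg (fun L : E →L[ℝ] E ↦ L x) k2
  simp [formCurv] at k1' k2' ⊢
  have k3 := sub_eq_zero.2 k1'
  have k4 := sub_eq_zero.2 k2'
  rw [← sub_eq_zero]
  rw [← sub_eq_zero.2 (k3.trans k4.symm)]
  abel

/-- The first Bianchi identity. -/
theorem formCurv_bianchi {Γ : E → E →L[ℝ] E →L[ℝ] E} {p : E} (hΓ : DifferentiableAt ℝ Γ p)
    (h : ∀ᶠ y in 𝓝 p, ∀ a b, Γ y a b = Γ y b a) (a b c : E) :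
    formCurv Γ p a b c + formCurv Γ p b c a + formCurv Γ p c a b = 0 := by
  -- Symmetry of Γ near p passes to its derivative. Using both symmetries, the terms of the cyclic
  -- sum cancel in pairs.
  have key : ∀ a b c, fderiv ℝ Γ p a b c = fderiv ℝ Γ p a c b := by
    intro a b c
    have h1 : ∀ b c, HasFDerivAt (fun y ↦ Γ y b c) _ p := fun b c ↦
      (hΓ.hasFDerivAt.clm_apply (hasFDerivAt_const b p)).clm_apply (hasFDerivAt_const c p)
    have h3 := (h1 b c).unique ((h1 c b).congr_of_eventuallyEq (h.mono fun y hy ↦ hy b c))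
    simpa using congrArg (fun L : E →L[ℝ] E ↦ L a) h3
  have hp := h.self_of_nhds
  simp only [formCurv, _root_.add_apply, _root_.sub_apply,
    ContinuousLinearMap.comp_apply]
  rw [key a b c, key b c a, key c a b, hp b c, hp c a, hp a b]
  abel

end Model

/-! ### Tangent vectors and the covariant derivative in a chart -/

section Chart

set_option linter.unusedSectionVars false

/-- Euclidean space. -/
abbrev Eu (n : ℕ) : Type := EuclideanSpace ℝ (Fin n)

variable {n : ℕ} {M : Type*} [TopologicalSpace M] [ChartedSpace (EuclideanSpace ℝ (Fin n)) M]
  [IsManifold (𝓡 n) ∞ M]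

/-- The trivialization of the tangent bundle over the chart at `x₀`. -/
abbrev tanTriv (x₀ : M) : Trivialization (Eu n) (π (Eu n) (TangentSpace (M := M) (𝓡 n))) :=
  trivializationAt (Eu n) (TangentSpace (𝓡 n)) x₀

/-- The coordinate vector field with constant coefficients `v` in the chart at `x₀`. -/
def coordField (x₀ : M) (v : Eu n) (y : M) : TangentSpace (𝓡 n) y := (tanTriv x₀).symmL ℝ y v

/-- The coordinates of a tangent vector in the chart at `x₀`. -/
def coordOf (x₀ : M) {y : M} (v : TangentSpace (𝓡 n) y) : Eu n :=
  (tanTriv x₀).continuousLinearMapAt ℝ y v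

variable {x₀ : M} {p : Eu n}

theorem coordOf_coordField {y : M} (hy : y ∈ (chartAt (Eu n) x₀).source) (v : Eu n) :
    coordOf x₀ (coordField x₀ v y) = v :=
  (tanTriv x₀).continuousLinearMapAt_symmL hy v

theorem coordField_coordOf {y : M} (hy : y ∈ (chartAt (Eu n) x₀).source)
    (v : TangentSpace (𝓡 n) y) : coordField x₀ (coordOf x₀ v) y = v :=
  (tanTriv x₀).symmL_continuousLinearMapAt hy v

theorem symm_mem_source (hp : p ∈ (extChartAt (𝓡 n) x₀).target) :
    (extChartAt (𝓡 n) x₀).symm p ∈ (chartAt (Eu n) x₀).source := by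
  have := (extChartAt (𝓡 n) x₀).map_target hp
  rwa [extChartAt_source] at this

theorem contMDiffAt_symm (hp : p ∈ (extChartAt (𝓡 n) x₀).target) :
    ContMDiffAt 𝓘(ℝ, Eu n) (𝓡 n) ∞ (extChartAt (𝓡 n) x₀).symm p :=
  (contMDiffOn_extChartAt_symm x₀).contMDiffAt ((isOpen_extChartAt_target x₀).mem_nhds hp)

theorem contMDiffAt_chart {y : M} (hy : y ∈ (chartAt (Eu n) x₀).source) :
    ContMDiffAt (𝓡 n) 𝓘(ℝ, Eu n) ∞ (extChartAt (𝓡 n) x₀) y :=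
  contMDiffAt_extChartAt' hy

/-- Tangent vectors act on functions through the chart. -/
theorem hasMFDerivAt_of_chart {F : Type*} [NormedAddCommGroup F] [NormedSpace ℝ F] {g : M → F}
    {L : Eu n →L[ℝ] F} (hp : p ∈ (extChartAt (𝓡 n) x₀).target)
    (h : HasFDerivAt (fun q ↦ g ((extChartAt (𝓡 n) x₀).symm q)) L p) :
    HasMFDerivAt (𝓡 n) 𝓘(ℝ, F) g ((extChartAt (𝓡 n) x₀).symm p)
      (L.comp ((tanTriv x₀).continuousLinearMapAt ℝ ((extChartAt (𝓡 n) x₀).symm p))) := by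
  have hs := symm_mem_source hp
  have h1 : HasMFDerivAt (𝓡 n) 𝓘(ℝ, Eu n) (extChartAt (𝓡 n) x₀) ((extChartAt (𝓡 n) x₀).symm p)
      ((tanTriv x₀).continuousLinearMapAt ℝ ((extChartAt (𝓡 n) x₀).symm p)) := by
    rw [TangentBundle.continuousLinearMapAt_trivializationAt hs]
    exact ((contMDiffAt_chart hs).mdifferentiableAt (by simp)).hasMFDerivAt
  have h2 : HasMFDerivAt 𝓘(ℝ, Eu n) 𝓘(ℝ, F) (fun q ↦ g ((extChartAt (𝓡 n) x₀).symm q))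
      (extChartAt (𝓡 n) x₀ ((extChartAt (𝓡 n) x₀).symm p)) L := by
    rw [(extChartAt (𝓡 n) x₀).right_inv hp]
    exact h.hasMFDerivAt
  refine (h2.comp _ h1).congr_of_eventuallyEq ?_
  filter_upwards [(isOpen_extChartAt_source x₀).mem_nhds
    ((extChartAt (𝓡 n) x₀).map_target hp)] with y hy
  simp only [Function.comp_apply]
  rw [(extChartAt (𝓡 n) x₀).left_inv hy]

theorem mvfderiv_coordField {F : Type*} [NormedAddCommGroup F] [NormedSpace ℝ F] {g : M → F}
    {L : Eu n →L[ℝ] F} (hp : p ∈ (extChartAt (𝓡 n) x₀).target)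
    (h : HasFDerivAt (fun q ↦ g ((extChartAt (𝓡 n) x₀).symm q)) L p) (u : Eu n) :
    mvfderiv (𝓡 n) g ((extChartAt (𝓡 n) x₀).symm p)
      (coordField x₀ u ((extChartAt (𝓡 n) x₀).symm p)) = L u := by
  have h1 := (hasMFDerivAt_of_chart hp h).mfderiv
  unfold mvfderiv
  rw [h1]
  change L (coordOf x₀ (coordField x₀ u _)) = L u
  rw [coordOf_coordField (symm_mem_source hp)]

theorem mvfderiv_eq_coordOf {F : Type*} [NormedAddCommGroup F] [NormedSpace ℝ F] {g : M → F}
    {L : Eu n →L[ℝ] F} (hp : p ∈ (extChartAt (𝓡 n) x₀).target)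
    (h : HasFDerivAt (fun q ↦ g ((extChartAt (𝓡 n) x₀).symm q)) L p)
    (v : TangentSpace (𝓡 n) ((extChartAt (𝓡 n) x₀).symm p)) :
    mvfderiv (𝓡 n) g ((extChartAt (𝓡 n) x₀).symm p) v = L (coordOf x₀ v) := by
  conv_lhs => rw [← coordField_coordOf (symm_mem_source hp) v]
  exact mvfderiv_coordField hp h _

theorem contMDiffAt_iff_of_chart {F : Type*} [NormedAddCommGroup F] [NormedSpace ℝ F] {g : M → F}
    {k : ℕ∞ω} (hk : k ≤ ∞) (hp : p ∈ (extChartAt (𝓡 n) x₀).target) :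
    ContMDiffAt (𝓡 n) 𝓘(ℝ, F) k g ((extChartAt (𝓡 n) x₀).symm p) ↔
      ContDiffAt ℝ k (fun q ↦ g ((extChartAt (𝓡 n) x₀).symm q)) p := by
  constructor
  · intro h
    exact (h.comp p ((contMDiffAt_symm hp).of_le hk)).contDiffAt
  · intro h
    have hs := symm_mem_source hp
    have h2 : ContMDiffAt 𝓘(ℝ, Eu n) 𝓘(ℝ, F) k (fun q ↦ g ((extChartAt (𝓡 n) x₀).symm q))
        (extChartAt (𝓡 n) x₀ ((extChartAt (𝓡 n) x₀).symm p)) := by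
      rw [(extChartAt (𝓡 n) x₀).right_inv hp]
      exact h.contMDiffAt
    refine (h2.comp _ ((contMDiffAt_chart hs).of_le hk)).congr_of_eventuallyEq ?_
    filter_upwards [(isOpen_extChartAt_source x₀).mem_nhds
      ((extChartAt (𝓡 n) x₀).map_target hp)] with y hy
    simp only [Function.comp_apply]
    rw [(extChartAt (𝓡 n) x₀).left_inv hy]

/-- A vector field is smooth at `φ⁻¹(p)` iff its coordinates are smooth at `p`. -/
theorem contMDiffAt_iff_coordOf {Z : ∀ y : M, TangentSpace (𝓡 n) y} {k : ℕ∞ω} (hk : k ≤ ∞)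
    (hp : p ∈ (extChartAt (𝓡 n) x₀).target) :
    ContMDiffAt (𝓡 n) ((𝓡 n).prod 𝓘(ℝ, Eu n)) k (fun y ↦ (⟨y, Z y⟩ : TangentBundle (𝓡 n) M))
      ((extChartAt (𝓡 n) x₀).symm p) ↔
    ContDiffAt ℝ k (fun q ↦ coordOf x₀ (Z ((extChartAt (𝓡 n) x₀).symm q))) p := by
  have hs := symm_mem_source hp
  have : IsManifold (𝓡 n) k M := IsManifold.of_le (n := ∞) hk
  have : ContMDiffVectorBundle k (Eu n) (TangentSpace (M := M) (𝓡 n)) (𝓡 n) :=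
    ContMDiffVectorBundle.of_le hk
  rw [(tanTriv x₀).contMDiffAt_section_iff hs]
  have e2 : ContMDiffAt (𝓡 n) 𝓘(ℝ, Eu n) k (fun y ↦ (tanTriv x₀ ⟨y, Z y⟩).2)
      ((extChartAt (𝓡 n) x₀).symm p) ↔
      ContMDiffAt (𝓡 n) 𝓘(ℝ, Eu n) k (fun y ↦ coordOf x₀ (Z y))
        ((extChartAt (𝓡 n) x₀).symm p) := by
    refine Filter.EventuallyEq.contMDiffAt_iff ?_
    filter_upwards [(tanTriv x₀).open_baseSet.mem_nhds hs] with y hy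
    rw [coordOf, Trivialization.continuousLinearMapAt_apply_of_mem ℝ _ hy]
  rw [e2]
  exact contMDiffAt_iff_of_chart hk hp

theorem contMDiffAt_coordField {k : ℕ∞ω} (hk : k ≤ ∞) {y : M}
    (hy : y ∈ (chartAt (Eu n) x₀).source) (v : Eu n) :
    ContMDiffAt (𝓡 n) ((𝓡 n).prod 𝓘(ℝ, Eu n)) k
      (fun y ↦ (⟨y, coordField x₀ v y⟩ : TangentBundle (𝓡 n) M)) y := by
  have hy' : y ∈ (extChartAt (𝓡 n) x₀).source := by rwa [extChartAt_source]
  have hp := (extChartAt (𝓡 n) x₀).map_source hy'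
  have h := (contMDiffAt_iff_coordOf (Z := coordField x₀ v) hk hp).2 <| by
    refine contDiffAt_const (c := v) |>.congr_of_eventuallyEq ?_
    filter_upwards [(isOpen_extChartAt_target x₀).mem_nhds hp] with q hq
    exact coordOf_coordField (symm_mem_source hq) v
  rwa [(extChartAt (𝓡 n) x₀).left_inv hy'] at h

theorem two_le_infty : (2 : ℕ∞ω) ≤ ∞ := by exact ENat.LEInfty.out

/-- The extensions entering `curvature` have constant coefficients in the chart at the base point.
Their brackets vanish there and their covariant derivatives are Christoffel symbols. -/
theorem extend_eq_coordField (v : TangentSpace (𝓡 n) x₀) {y : M}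
    (hy : y ∈ (chartAt (Eu n) x₀).source) :
    FiberBundle.extend (Eu n) v y = coordField x₀ (coordOf x₀ v) y := by
  have h0 := FiberBundle.mem_baseSet_trivializationAt' (F := Eu n)
    (E := fun y : M ↦ TangentSpace (𝓡 n) y) x₀
  have h1 : coordOf x₀ v = (tanTriv (n := n) (M := M) x₀ ⟨x₀, v⟩).2 :=
    Trivialization.continuousLinearMapAt_apply_of_mem ℝ _ h0 _
  rw [coordField, h1, Trivialization.symmL_apply _ hy]
  rfl

/-- A constant vector field of Euclidean space. -/
def constField (u : Eu n) (p : Eu n) : TangentSpace 𝓘(ℝ, Eu n) p := u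

theorem contMDiff_constField (u : Eu n) : ContMDiff 𝓘(ℝ, Eu n) 𝓘(ℝ, Eu n).tangent ∞
    (fun p ↦ (⟨p, constField u p⟩ : TangentBundle 𝓘(ℝ, Eu n) (Eu n))) := by
  intro p
  rw [contMDiffAt_section]
  simp only [constField, trivializationAt_model_space_apply]
  exact contMDiffAt_const

/-- Coordinate fields are pullbacks of constant fields by the chart, and brackets are natural under
pullback. -/
theorem mlieBracket_coordField {y : M} (hy : y ∈ (chartAt (Eu n) x₀).source) (u v : Eu n) :
    VectorField.mlieBracket (𝓡 n) (coordField x₀ u) (coordField x₀ v) y = 0 := by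
  have key : ∀ z ∈ (chartAt (Eu n) x₀).source, ∀ u : Eu n, coordField x₀ u z =
      VectorField.mpullback (𝓡 n) 𝓘(ℝ, Eu n) (extChartAt (𝓡 n) x₀) (constField u) z := by
    intro z hz u
    rw [VectorField.mpullback_apply, ← TangentBundle.continuousLinearMapAt_trivializationAt hz,
      ← Trivialization.coe_continuousLinearEquivAt_eq' (tanTriv x₀) hz]
    have h1 := ContinuousLinearMap.inverse_equiv ((tanTriv x₀).continuousLinearEquivAt ℝ z hz)
    exact (congrFun ((tanTriv x₀).symm_continuousLinearEquivAt_eq hz) u).symm.trans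
      (congrArg (fun L : Eu n →L[ℝ] TangentSpace (𝓡 n) z ↦ L u) h1).symm
  have hs := (chartAt (Eu n) x₀).open_source.mem_nhds hy
  rw [Filter.EventuallyEq.mlieBracket_vectorField_eq
      (Filter.eventually_of_mem hs fun z hz ↦ key z hz u)
      (Filter.eventually_of_mem hs fun z hz ↦ key z hz v)]
  have : IsManifold (𝓡 n) (minSmoothness ℝ 2) M :=
    IsManifold.of_le (n := ∞) (by simpa only [minSmoothness_of_isRCLikeNormedField] using two_le_infty)
  rw [← VectorField.mpullback_mlieBracket (n := ∞)
    ((contMDiff_constField u _).mdifferentiableAt (by simp))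
    ((contMDiff_constField v _).mdifferentiableAt (by simp)) (contMDiffAt_chart hy)
    (by simpa only [minSmoothness_of_isRCLikeNormedField] using two_le_infty)]
  have h0 : VectorField.mlieBracket 𝓘(ℝ, Eu n) (constField u) (constField v)
      (extChartAt (𝓡 n) x₀ y) = 0 := by
    have : ∀ (u : Eu n) p, fderivWithin ℝ (fun _ : Eu n ↦ u) Set.univ p = 0 :=
      fun u p ↦ fderivWithin_const_apply u
    rw [← VectorField.mlieBracketWithin_univ, VectorField.mlieBracketWithin_eq_lieBracketWithin]
    change fderivWithin ℝ (fun _ : Eu n ↦ v) Set.univ _ u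
      - fderivWithin ℝ (fun _ : Eu n ↦ u) Set.univ _ v = 0
    rw [this, this]
    simp
  rw [VectorField.mpullback_apply, h0, map_zero]

end Chart

/-! ### Christoffel symbols and the Koszul formula in a chart. -/

section Connection

set_option linter.unusedSectionVars false

variable {n : ℕ} {M : Type*} [TopologicalSpace M] [ChartedSpace (EuclideanSpace ℝ (Fin n)) M]
  [IsManifold (𝓡 n) ∞ M] {x₀ : M} {p : Eu n}
  [RiemannianBundle (fun x : M ↦ TangentSpace (𝓡 n) x)]

variable (cov : CovariantDerivative (𝓡 n) (EuclideanSpace ℝ (Fin n))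
  (fun x : M ↦ TangentSpace (𝓡 n) x))

variable (x₀) in
/-- The Christoffel symbols of `cov` in the chart at `x₀`: `∇_u v = Γ u v` for constant coordinate
fields. -/
def christoffel (p : Eu n) : Eu n →L[ℝ] Eu n →L[ℝ] Eu n :=
  (∑ i, (EuclideanSpace.proj i : Eu n →L[ℝ] ℝ).smulRight
    (((tanTriv x₀).continuousLinearMapAt ℝ ((extChartAt (𝓡 n) x₀).symm p)).comp
      ((cov (coordField x₀ (EuclideanSpace.single i 1)) ((extChartAt (𝓡 n) x₀).symm p)).comp
        ((tanTriv x₀).symmL ℝ ((extChartAt (𝓡 n) x₀).symm p))) : Eu n →L[ℝ] Eu n)).flip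

theorem christoffel_apply (u v : Eu n) :
    christoffel x₀ cov p u v = ∑ i, v i • coordOf x₀ (cov (coordField x₀ (EuclideanSpace.single i 1))
      ((extChartAt (𝓡 n) x₀).symm p) (coordField x₀ u ((extChartAt (𝓡 n) x₀).symm p))) := by
  rw [christoffel, ContinuousLinearMap.flip_apply, _root_.sum_apply,
    _root_.sum_apply]
  rfl

theorem sum_single (v : Eu n) : ∑ i, v i • (EuclideanSpace.single i 1 : Eu n) = v := by
  ext j
  simp [Finset.sum_apply, Pi.single_apply]

theorem cov_sum_smul {ι : Type*} (s : Finset ι) {g : ι → M → ℝ}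
    {K : ι → ∀ y : M, TangentSpace (𝓡 n) y} {x : M}
    (hg : ∀ i, MDifferentiableAt (𝓡 n) 𝓘(ℝ, ℝ) (g i) x)
    (hK : ∀ i, MDifferentiableAt (𝓡 n) ((𝓡 n).prod 𝓘(ℝ, Eu n))
      (fun y ↦ (⟨y, K i y⟩ : TangentBundle (𝓡 n) M)) x) (u : TangentSpace (𝓡 n) x) :
    cov (fun y ↦ ∑ i ∈ s, g i y • K i y) x u =
      ∑ i ∈ s, (g i x • cov (K i) x u + mvfderiv (𝓡 n) (g i) x u • K i x) := by
  classical
  induction s using Finset.induction_on with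
  | empty =>
    have := cov.isCovariantDerivativeOn.zero (s := Set.univ) (x := x) (Set.mem_univ x)
    simp only [Finset.sum_empty]
    exact congrArg (fun L : TangentSpace (𝓡 n) x →L[ℝ] TangentSpace (𝓡 n) x ↦ L u) this
  | insert i s hi ih =>
    have h1 := cov.isCovariantDerivativeOn.leibniz (s := Set.univ) (hK i) (hg i) (Set.mem_univ x)
    have h2 := cov.isCovariantDerivativeOn.add (s := Set.univ) (σ := g i • K i)
      (σ' := fun y ↦ ∑ i ∈ s, g i y • K i y) ((hg i).smul_section (hK i))
      (MDifferentiableAt.sum_section fun j _ ↦ (hg j).smul_section (hK j)) (Set.mem_univ x)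
    have h3 : (fun y ↦ ∑ i ∈ insert i s, g i y • K i y) =
        g i • K i + fun y ↦ ∑ i ∈ s, g i y • K i y := by
      funext y
      simp [Finset.sum_insert hi]
    rw [h3, h2, h1, Finset.sum_insert hi, ← ih]
    rfl

/-- Near the point Z is the combination of coordinate fields with its own coordinates as
coefficients. A covariant derivative sees only the germ, so the Leibniz rule yields ∂_u Z + Γ(u, Z).
-/
theorem coordOf_cov {Z : ∀ y : M, TangentSpace (𝓡 n) y}
    (hp : p ∈ (extChartAt (𝓡 n) x₀).target)
    (hZ : ContDiffAt ℝ 1 (fun q ↦ coordOf x₀ (Z ((extChartAt (𝓡 n) x₀).symm q))) p) (u : Eu n) :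
    coordOf x₀ (cov Z ((extChartAt (𝓡 n) x₀).symm p)
      (coordField x₀ u ((extChartAt (𝓡 n) x₀).symm p))) =
      fderiv ℝ (fun q ↦ coordOf x₀ (Z ((extChartAt (𝓡 n) x₀).symm q))) p u +
        christoffel x₀ cov p u (coordOf x₀ (Z ((extChartAt (𝓡 n) x₀).symm p))) := by
  set x := (extChartAt (𝓡 n) x₀).symm p with hx
  have hs : x ∈ (chartAt (Eu n) x₀).source := symm_mem_source hp
  have h1 : (1 : ℕ∞ω) ≤ ∞ := ENat.LEInfty.out
  have hZd := ((contMDiffAt_iff_coordOf h1 hp).2 hZ).mdifferentiableAt one_ne_zero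
  have hKd : ∀ i, MDifferentiableAt (𝓡 n) ((𝓡 n).prod 𝓘(ℝ, Eu n))
      (fun y ↦ (⟨y, coordField x₀ (EuclideanSpace.single i 1 : Eu n) y⟩ : TangentBundle (𝓡 n) M))
      x := fun i ↦ (contMDiffAt_coordField h1 hs _).mdifferentiableAt one_ne_zero
  have hcd : ∀ i, DifferentiableAt ℝ
      (fun q ↦ coordOf x₀ (Z ((extChartAt (𝓡 n) x₀).symm q)) i) p := fun i ↦
    (EuclideanSpace.proj i : Eu n →L[ℝ] ℝ).differentiableAt.comp p (hZ.differentiableAt one_ne_zero)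
  have hcm : ∀ i, MDifferentiableAt (𝓡 n) 𝓘(ℝ, ℝ) (fun y ↦ coordOf x₀ (Z y) i) x := fun i ↦
    (hasMFDerivAt_of_chart hp (hcd i).hasFDerivAt).mdifferentiableAt
  have hloc : ∀ᶠ y in 𝓝 x, Z y = ∑ i, coordOf x₀ (Z y) i •
      coordField x₀ (EuclideanSpace.single i 1 : Eu n) y := by
    filter_upwards [(chartAt (Eu n) x₀).open_source.mem_nhds hs] with y hy
    conv_lhs => rw [← coordField_coordOf hy (Z y), ← sum_single (coordOf x₀ (Z y))]
    simp only [coordField, map_sum, map_smul]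
  have hcong : cov Z x = cov (fun y ↦ ∑ i, coordOf x₀ (Z y) i •
      coordField x₀ (EuclideanSpace.single i 1 : Eu n) y) x :=
    cov.isCovariantDerivativeOn.congr_of_eventuallyEq (s := Set.univ) hZd
      (MDifferentiableAt.sum_section fun j _ ↦ (hcm j).smul_section (hKd j)) Filter.univ_mem hloc
  rw [hcong, cov_sum_smul cov _ hcm hKd, christoffel_apply]
  have e1 : ∀ i, mvfderiv (𝓡 n) (fun y ↦ coordOf x₀ (Z y) i) x (coordField x₀ u x) =
      fderiv ℝ (fun q ↦ coordOf x₀ (Z ((extChartAt (𝓡 n) x₀).symm q))) p u i := by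
    intro i
    rw [mvfderiv_coordField hp ((EuclideanSpace.proj i : Eu n →L[ℝ] ℝ).hasFDerivAt.comp p
      (hZ.differentiableAt one_ne_zero).hasFDerivAt)]
    rfl
  simp only [e1]
  rw [Finset.sum_add_distrib, add_comm]
  have e2 : ∀ v : Eu n, coordOf x₀ (∑ i, v i • coordField x₀ (EuclideanSpace.single i 1 : Eu n) x)
      = v := by
    intro v
    have : ∑ i, v i • coordField x₀ (EuclideanSpace.single i 1 : Eu n) x = coordField x₀ v x := by
      conv_rhs => rw [← sum_single v]
      simp only [coordField, map_sum, map_smul]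
    rw [this, coordOf_coordField hs]
  have e3 : ∀ a b : TangentSpace (𝓡 n) x, coordOf x₀ (a + b) = coordOf x₀ a + coordOf x₀ b :=
    fun a b ↦ map_add ((tanTriv x₀).continuousLinearMapAt ℝ x) a b
  rw [e3, e2]
  congr 1
  simp only [coordOf, map_sum, map_smul]
  rfl

theorem coordOf_cov_coordField (hp : p ∈ (extChartAt (𝓡 n) x₀).target) (u v : Eu n) :
    coordOf x₀ (cov (coordField x₀ v) ((extChartAt (𝓡 n) x₀).symm p)
      (coordField x₀ u ((extChartAt (𝓡 n) x₀).symm p))) = christoffel x₀ cov p u v := by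
  have hloc : (fun q ↦ coordOf x₀ (coordField x₀ v ((extChartAt (𝓡 n) x₀).symm q))) =ᶠ[𝓝 p]
      fun _ ↦ v := by
    filter_upwards [(isOpen_extChartAt_target x₀).mem_nhds hp] with q hq
    exact coordOf_coordField (symm_mem_source hq) v
  rw [coordOf_cov cov hp (contDiffAt_const.congr_of_eventuallyEq hloc), hloc.fderiv_eq,
    coordOf_coordField (symm_mem_source hp)]
  simp

variable {cov}

/-- Vanishing torsion together with vanishing brackets of coordinate fields. -/
theorem christoffel_symm (hp : p ∈ (extChartAt (𝓡 n) x₀).target) (htor : cov.torsion = 0)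
    (u v : Eu n) : christoffel x₀ cov p u v = christoffel x₀ cov p v u := by
  have hs := symm_mem_source hp
  have hd : ∀ v, MDifferentiableAt (𝓡 n) ((𝓡 n).prod 𝓘(ℝ, Eu n))
      (fun y ↦ (⟨y, coordField x₀ v y⟩ : TangentBundle (𝓡 n) M))
      ((extChartAt (𝓡 n) x₀).symm p) := fun v ↦
    (contMDiffAt_coordField (k := 1) ENat.LEInfty.out hs _).mdifferentiableAt one_ne_zero
  have h := (CovariantDerivative.torsion_eq_zero_iff cov).1 htor (hd u) (hd v)
  rw [mlieBracket_coordField hs, sub_eq_zero] at h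
  rw [← coordOf_cov_coordField cov hp, h, coordOf_cov_coordField cov hp]

variable (x₀) in
/-- The metric coefficients in the chart at `x₀`. -/
def metricCoeff (p v w : Eu n) : ℝ :=
  inner ℝ (coordField x₀ v ((extChartAt (𝓡 n) x₀).symm p))
    (coordField x₀ w ((extChartAt (𝓡 n) x₀).symm p))

theorem inner_eq_metricCoeff (hp : p ∈ (extChartAt (𝓡 n) x₀).target)
    (v w : TangentSpace (𝓡 n) ((extChartAt (𝓡 n) x₀).symm p)) :
    inner ℝ v w = metricCoeff x₀ p (coordOf x₀ v) (coordOf x₀ w) := by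
  rw [metricCoeff, coordField_coordOf (symm_mem_source hp), coordField_coordOf (symm_mem_source hp)]

theorem metricCoeff_comm (v w : Eu n) : metricCoeff x₀ p v w = metricCoeff x₀ p w v :=
  real_inner_comm _ _

variable [IsContMDiffRiemannianBundle (𝓡 n) ∞ (EuclideanSpace ℝ (Fin n))
  (fun x : M ↦ TangentSpace (𝓡 n) x)]

instance isContMDiffRiemannianBundle_one : IsContMDiffRiemannianBundle (𝓡 n) 1
    (EuclideanSpace ℝ (Fin n)) (fun x : M ↦ TangentSpace (𝓡 n) x) :=
  IsContMDiffRiemannianBundle.of_le (n := ∞) (by exact_mod_cast le_top)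

theorem contDiffOn_metricCoeff (v w : Eu n) :
    ContDiffOn ℝ ∞ (fun p ↦ metricCoeff x₀ p v w) (extChartAt (𝓡 n) x₀).target := by
  intro p hp
  have hs := symm_mem_source hp
  have h := (contMDiffAt_coordField (x₀ := x₀) le_rfl hs v).inner_bundle
    (contMDiffAt_coordField le_rfl hs w)
  exact ((contMDiffAt_iff_of_chart le_rfl hp).1 h).contDiffWithinAt

theorem fderiv_metricCoeff (hp : p ∈ (extChartAt (𝓡 n) x₀).target) (hmet : cov.IsMetricCompatible)
    (u v w : Eu n) : fderiv ℝ (fun p ↦ metricCoeff x₀ p v w) p u =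
      metricCoeff x₀ p (christoffel x₀ cov p u v) w +
        metricCoeff x₀ p v (christoffel x₀ cov p u w) := by
  have hs := symm_mem_source hp
  have hd : ∀ v, MDifferentiableAt (𝓡 n) ((𝓡 n).prod 𝓘(ℝ, Eu n))
      (fun y ↦ (⟨y, coordField x₀ v y⟩ : TangentBundle (𝓡 n) M))
      ((extChartAt (𝓡 n) x₀).symm p) := fun v ↦
    (contMDiffAt_coordField (k := 1) ENat.LEInfty.out hs _).mdifferentiableAt one_ne_zero
  have h := hmet.mvfderiv_inner_eq (coordField x₀ u) (hd v) (hd w)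
  have hD : DifferentiableAt ℝ (fun p ↦ metricCoeff x₀ p v w) p :=
    ((contDiffOn_metricCoeff v w).contDiffAt
      ((isOpen_extChartAt_target x₀).mem_nhds hp)).differentiableAt (by simp)
  rw [mvfderiv_coordField hp hD.hasFDerivAt] at h
  rw [h]
  beta_reduce
  rw [inner_eq_metricCoeff hp, inner_eq_metricCoeff hp, coordOf_cov_coordField cov hp,
    coordOf_cov_coordField cov hp, coordOf_coordField hs, coordOf_coordField hs]

/-- The Koszul formula for commuting fields. No regularity of `cov` is assumed. This formula, which
expresses Γ through first derivatives of the smooth metric, is where the smoothness of the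
connection comes from. -/
theorem metricCoeff_christoffel (hp : p ∈ (extChartAt (𝓡 n) x₀).target)
    (htor : cov.torsion = 0) (hmet : cov.IsMetricCompatible) (u v w : Eu n) :
    metricCoeff x₀ p (christoffel x₀ cov p u v) w = (1 / 2 : ℝ) *
      (fderiv ℝ (fun p ↦ metricCoeff x₀ p v w) p u + fderiv ℝ (fun p ↦ metricCoeff x₀ p u w) p v
        - fderiv ℝ (fun p ↦ metricCoeff x₀ p u v) p w) := by
  simp only [fderiv_metricCoeff hp hmet]
  rw [christoffel_symm hp htor v u, christoffel_symm hp htor w u, christoffel_symm hp htor w v,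
    metricCoeff_comm v, metricCoeff_comm u]
  ring

end Connection

/-! ### Local orthonormal frames and their connection forms. -/

section Frames

set_option linter.unusedSectionVars false

variable {n : ℕ} {M : Type*} [TopologicalSpace M] [ChartedSpace (EuclideanSpace ℝ (Fin n)) M]
  [IsManifold (𝓡 n) ∞ M] {x₀ : M} {p : Eu n}
  [RiemannianBundle (fun x : M ↦ TangentSpace (𝓡 n) x)]

/-- A smooth oriented orthonormal frame field on a neighbourhood of `x₀` in the chart domain. -/
structure LocalFrame (o : ManifoldOrientation n M) (x₀ : M) where
  /-- The neighbourhood. -/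
  dom : Set M
  /-- The frame field. -/
  frame : ∀ x : M, FrameAt o x
  isOpen_dom : IsOpen dom
  mem_dom : x₀ ∈ dom
  dom_subset : dom ⊆ (chartAt (Eu n) x₀).source
  smooth : SmoothFrameOn frame dom

namespace LocalFrame

variable {o : ManifoldOrientation n M} (L : LocalFrame o x₀)

/-- The domain of a local frame in coordinates. -/
def cdom : Set (Eu n) := (extChartAt (𝓡 n) x₀).target ∩ (extChartAt (𝓡 n) x₀).symm ⁻¹' L.dom

theorem isOpen_cdom : IsOpen L.cdom :=
  (continuousOn_extChartAt_symm x₀).isOpen_inter_preimage (isOpen_extChartAt_target x₀) L.isOpen_dom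

variable {L}

theorem chart_mem_cdom {x : M} (hx : x ∈ L.dom) : extChartAt (𝓡 n) x₀ x ∈ L.cdom := by
  have h : x ∈ (extChartAt (𝓡 n) x₀).source := by
    rw [extChartAt_source]
    exact L.dom_subset hx
  refine ⟨(extChartAt (𝓡 n) x₀).map_source h, ?_⟩
  rwa [Set.mem_preimage, (extChartAt (𝓡 n) x₀).left_inv h]

theorem symm_chart {x : M} (hx : x ∈ L.dom) :
    (extChartAt (𝓡 n) x₀).symm (extChartAt (𝓡 n) x₀ x) = x :=
  (extChartAt (𝓡 n) x₀).left_inv (by rw [extChartAt_source]; exact L.dom_subset hx)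

variable (L) in
/-- The local frame in coordinates. -/
def coordFrame (p : Eu n) : Eu n →L[ℝ] Eu n :=
  ∑ i, (EuclideanSpace.proj i : Eu n →L[ℝ] ℝ).smulRight
    (coordOf x₀ ((L.frame ((extChartAt (𝓡 n) x₀).symm p)).iso (EuclideanSpace.single i 1)))

theorem coordFrame_apply (v : Eu n) :
    L.coordFrame p v = coordOf x₀ ((L.frame ((extChartAt (𝓡 n) x₀).symm p)).iso v) := by
  conv_rhs => rw [← sum_single v]
  simp only [coordFrame, _root_.sum_apply, ContinuousLinearMap.smulRight_apply, coordOf, map_sum,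
    map_smul]
  rfl

theorem coordField_coordFrame (hp : p ∈ L.cdom) (v : Eu n) :
    coordField x₀ (L.coordFrame p v) ((extChartAt (𝓡 n) x₀).symm p) =
      (L.frame ((extChartAt (𝓡 n) x₀).symm p)).iso v := by
  rw [coordFrame_apply, coordField_coordOf (symm_mem_source hp.1)]

theorem contDiffOn_coordFrame : ContDiffOn ℝ ∞ L.coordFrame L.cdom := by
  refine ContDiffOn.sum fun i _ ↦ ?_
  intro p hp
  have h := (L.smooth i).contMDiffAt (L.isOpen_dom.mem_nhds hp.2)
  exact (contDiffAt_const.smulRight ((contMDiffAt_iff_coordOf le_rfl hp.1).1 h)).contDiffWithinAt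

theorem metricCoeff_coordFrame (hp : p ∈ L.cdom) (v w : Eu n) :
    metricCoeff x₀ p (L.coordFrame p v) (L.coordFrame p w) = inner ℝ v w := by
  rw [metricCoeff, coordField_coordFrame hp, coordField_coordFrame hp, LinearIsometryEquiv.inner_map_map]

theorem coordFrame_injective (hp : p ∈ L.cdom) : Function.Injective (L.coordFrame p) := by
  intro v w h
  apply (L.frame ((extChartAt (𝓡 n) x₀).symm p)).iso.injective
  rw [← coordField_coordFrame hp, h, coordField_coordFrame hp]

variable (L) in
/-- The inverse of the matrix of the local frame in coordinates. -/
def coordCoframe (p : Eu n) : Eu n →L[ℝ] Eu n := (L.coordFrame p).inverse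

theorem exists_equiv_coordFrame (hp : p ∈ L.cdom) : ∃ e : Eu n ≃L[ℝ] Eu n,
    (e : Eu n →L[ℝ] Eu n) = L.coordFrame p := by
  let e := LinearEquiv.ofInjectiveEndo (L.coordFrame p : Eu n →ₗ[ℝ] Eu n) (coordFrame_injective hp)
  exact ⟨e.toContinuousLinearEquiv, by ext1 v; rfl⟩

theorem coordFrame_coordCoframe (hp : p ∈ L.cdom) :
    (L.coordFrame p).comp (L.coordCoframe p) = ContinuousLinearMap.id ℝ (Eu n) := by
  obtain ⟨e, he⟩ := exists_equiv_coordFrame hp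
  rw [coordCoframe, ← he, ContinuousLinearMap.inverse_equiv]
  simp

theorem coordCoframe_coordFrame (hp : p ∈ L.cdom) :
    (L.coordCoframe p).comp (L.coordFrame p) = ContinuousLinearMap.id ℝ (Eu n) := by
  obtain ⟨e, he⟩ := exists_equiv_coordFrame hp
  rw [coordCoframe, ← he, ContinuousLinearMap.inverse_equiv]
  simp

theorem contDiffOn_coordCoframe : ContDiffOn ℝ ∞ L.coordCoframe L.cdom := by
  intro p hp
  obtain ⟨e, he⟩ := exists_equiv_coordFrame hp
  have h := contDiffAt_map_inverse (n := ∞) (𝕜 := ℝ) e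
  rw [he] at h
  exact h.comp_contDiffWithinAt p (contDiffOn_coordFrame p hp)

variable (L) in
/-- The connection form of `cov` with respect to a local frame, in coordinates. -/
def connForm (cov : CovariantDerivative (𝓡 n) (EuclideanSpace ℝ (Fin n))
    (fun x : M ↦ TangentSpace (𝓡 n) x)) (p : Eu n) : Eu n →L[ℝ] Eu n →L[ℝ] Eu n :=
  (ContinuousLinearMap.compL ℝ (Eu n) (Eu n) (Eu n) (L.coordCoframe p)).comp
    (fderiv ℝ L.coordFrame p +
      ((ContinuousLinearMap.compL ℝ (Eu n) (Eu n) (Eu n)).flip (L.coordFrame p)).comp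
        (christoffel x₀ cov p))

variable {cov : CovariantDerivative (𝓡 n) (EuclideanSpace ℝ (Fin n))
  (fun x : M ↦ TangentSpace (𝓡 n) x)}

/-- The gauge relation σθ = dσ + Γσ between the frame and the coordinate description of the
connection. Torsion, curvature and divergence in the frame are all computed from it. -/
theorem coordFrame_connForm (hp : p ∈ L.cdom) (u : Eu n) :
    (L.coordFrame p).comp (L.connForm cov p u) =
      fderiv ℝ L.coordFrame p u + (christoffel x₀ cov p u).comp (L.coordFrame p) := by
  have h := coordFrame_coordCoframe hp
  change (L.coordFrame p).comp ((L.coordCoframe p).comp (fderiv ℝ L.coordFrame p u +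
    (christoffel x₀ cov p u).comp (L.coordFrame p))) = _
  rw [← ContinuousLinearMap.comp_assoc, h, ContinuousLinearMap.id_comp]

/-- The covariant derivative of the vector fields of a local frame. -/
theorem cov_frame (hp : p ∈ L.cdom) (u v : Eu n) :
    cov (fun y ↦ (L.frame y).iso v) ((extChartAt (𝓡 n) x₀).symm p)
      (coordField x₀ u ((extChartAt (𝓡 n) x₀).symm p)) =
      (L.frame ((extChartAt (𝓡 n) x₀).symm p)).iso (L.connForm cov p u v) := by
  have hs := symm_mem_source hp.1
  have hD := (contDiffOn_coordFrame (L := L)).contDiffAt (L.isOpen_cdom.mem_nhds hp)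
  have h1 : ∀ q, coordOf x₀ ((L.frame ((extChartAt (𝓡 n) x₀).symm q)).iso v) = L.coordFrame q v :=
    fun q ↦ (coordFrame_apply v).symm
  rw [← coordField_coordOf hs (cov _ _ _), coordOf_cov cov hp.1]
  · simp only [h1]
    rw [fderiv_clm_apply (hD.differentiableAt (by simp)) (differentiableAt_const _)]
    rw [← coordField_coordFrame hp]
    congr 1
    have := congrArg (fun A : Eu n →L[ℝ] Eu n ↦ A v) (coordFrame_connForm (cov := cov) hp u)
    simpa using this.symm
  · simp only [h1]
    exact (hD.of_le ENat.LEInfty.out).clm_apply contDiffAt_const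

/-- The Christoffel terms of the gauge relation cancel by symmetry. The result is the torsion
hypothesis of `dAlong_horField_horField`. -/
theorem coordFrame_torsion (hp : p ∈ L.cdom) (htor : cov.torsion = 0) (u v : Eu n) :
    fderiv ℝ L.coordFrame p (L.coordFrame p u) v - fderiv ℝ L.coordFrame p (L.coordFrame p v) u =
      L.coordFrame p (L.connForm cov p (L.coordFrame p u) v)
        - L.coordFrame p (L.connForm cov p (L.coordFrame p v) u) := by
  have h1 := congrArg (fun A : Eu n →L[ℝ] Eu n ↦ A v)
    (coordFrame_connForm (cov := cov) hp (L.coordFrame p u))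
  have h2 := congrArg (fun A : Eu n →L[ℝ] Eu n ↦ A u)
    (coordFrame_connForm (cov := cov) hp (L.coordFrame p v))
  simp only [ContinuousLinearMap.comp_apply, _root_.add_apply] at h1 h2
  rw [h1, h2, christoffel_symm hp.1 htor]
  abel

variable [IsContMDiffRiemannianBundle (𝓡 n) ∞ (EuclideanSpace ℝ (Fin n))
  (fun x : M ↦ TangentSpace (𝓡 n) x)]

theorem sum_metricCoeff_smul (hp : p ∈ L.cdom) (v : Eu n) :
    v = ∑ i, metricCoeff x₀ p v (L.coordFrame p (EuclideanSpace.single i 1)) •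
      L.coordFrame p (EuclideanSpace.single i 1) := by
  have h := congrArg (fun A : Eu n →L[ℝ] Eu n ↦ A v) (coordFrame_coordCoframe hp)
  simp only [ContinuousLinearMap.comp_apply, ContinuousLinearMap.id_apply] at h
  obtain ⟨w, rfl⟩ : ∃ w, L.coordFrame p w = v := ⟨_, h⟩
  simp only [metricCoeff_coordFrame hp]
  conv_lhs => rw [← sum_single w]
  simp only [map_sum, map_smul, EuclideanSpace.inner_single_right, one_mul, conj_trivial]

theorem metricCoeff_eq_sum (p v w : Eu n) :
    metricCoeff x₀ p v w = ∑ j, w j * metricCoeff x₀ p v (EuclideanSpace.single j 1) := by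
  conv_lhs => rw [← sum_single w]
  simp only [metricCoeff, coordField, map_sum, map_smul, inner_sum, inner_smul_right]

/-- Γ(u, v) is expanded in the orthonormal frame, so no inverse of the metric matrix is needed. The
coefficients are linear in the right-hand sides of the Koszul formula, which are smooth. -/
theorem contDiffOn_christoffel (htor : cov.torsion = 0) (hmet : cov.IsMetricCompatible) :
    ContDiffOn ℝ ∞ (christoffel x₀ cov) L.cdom := by
  have hT : L.cdom ⊆ (extChartAt (𝓡 n) x₀).target := Set.inter_subset_left
  have hm : ∀ v w u : Eu n, ContDiffOn ℝ ∞
      (fun p ↦ fderiv ℝ (fun p ↦ metricCoeff x₀ p v w) p u) L.cdom := fun v w u ↦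
    (((contDiffOn_metricCoeff (x₀ := x₀) v w).mono hT).fderiv_of_isOpen L.isOpen_cdom
      (m := ∞) (by simp)).clm_apply contDiffOn_const
  have hf : ∀ v : Eu n, ContDiffOn ℝ ∞ (fun p ↦ L.coordFrame p v) L.cdom := fun v ↦
    contDiffOn_coordFrame.clm_apply contDiffOn_const
  rw [contDiffOn_clm_apply]
  intro u
  rw [contDiffOn_clm_apply]
  intro v
  have h : ∀ p ∈ L.cdom, christoffel x₀ cov p u v = ∑ i, (∑ j,
      L.coordFrame p (EuclideanSpace.single i 1) j * ((1 / 2 : ℝ) *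
        (fderiv ℝ (fun p ↦ metricCoeff x₀ p v (EuclideanSpace.single j 1)) p u
          + fderiv ℝ (fun p ↦ metricCoeff x₀ p u (EuclideanSpace.single j 1)) p v
          - fderiv ℝ (fun p ↦ metricCoeff x₀ p u v) p (EuclideanSpace.single j 1)))) •
      L.coordFrame p (EuclideanSpace.single i 1) := by
    intro p hp
    conv_lhs => rw [sum_metricCoeff_smul hp (christoffel x₀ cov p u v)]
    refine Finset.sum_congr rfl fun i _ ↦ ?_
    congr 1
    rw [metricCoeff_eq_sum]
    refine Finset.sum_congr rfl fun j _ ↦ ?_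
    rw [metricCoeff_christoffel hp.1 htor hmet]
  refine ContDiffOn.congr ?_ h
  refine ContDiffOn.sum fun i _ ↦ ContDiffOn.fun_smul (ContDiffOn.sum fun j _ ↦ ?_) (hf _)
  exact ((EuclideanSpace.proj j : Eu n →L[ℝ] ℝ).contDiff.comp_contDiffOn (hf _)).mul
    (contDiffOn_const.mul (((hm _ _ _).add (hm _ _ _)).sub (hm _ _ _)))

theorem contDiffOn_connForm (htor : cov.torsion = 0) (hmet : cov.IsMetricCompatible) :
    ContDiffOn ℝ ∞ (L.connForm cov) L.cdom := by
  have h1 := contDiffOn_coordFrame (L := L)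
  have h2 := contDiffOn_coordCoframe (L := L)
  have h3 := contDiffOn_christoffel (L := L) htor hmet
  have h4 := h1.fderiv_of_isOpen L.isOpen_cdom (m := ∞) (by simp)
  rw [contDiffOn_clm_apply]
  intro u
  exact h2.clm_comp ((h4.clm_apply contDiffOn_const).add
    ((h3.clm_apply contDiffOn_const).clm_comp h1))

theorem mdifferentiableAt_frame (L : LocalFrame o x₀) {x : M} (hx : x ∈ L.dom) (v : Eu n) :
    MDifferentiableAt (𝓡 n) ((𝓡 n).prod 𝓘(ℝ, Eu n))
      (fun y ↦ (⟨y, (L.frame y).iso v⟩ : TangentBundle (𝓡 n) M)) x := by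
  have hp := chart_mem_cdom hx
  have h := (contMDiffAt_iff_coordOf (Z := fun y ↦ (L.frame y).iso v) (k := 1) ENat.LEInfty.out
    hp.1).2 <| by
    simp only [← coordFrame_apply]
    exact ((contDiffOn_coordFrame.contDiffAt (L.isOpen_cdom.mem_nhds hp)).of_le
      ENat.LEInfty.out).clm_apply contDiffAt_const
  rw [symm_chart hx] at h
  exact h.mdifferentiableAt one_ne_zero

/-- Inner products of frame vectors are constant. Differentiating them by metric compatibility shows
that θ takes skew values. -/
theorem inner_connForm (hp : p ∈ L.cdom) (hmet : cov.IsMetricCompatible) (u v w : Eu n) :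
    inner ℝ (L.connForm cov p u v) w = - inner ℝ v (L.connForm cov p u w) := by
  have h := hmet.mvfderiv_inner_eq (coordField x₀ u) (L.mdifferentiableAt_frame hp.2 v)
    (L.mdifferentiableAt_frame hp.2 w)
  beta_reduce at h
  rw [cov_frame hp, cov_frame hp, LinearIsometryEquiv.inner_map_map,
    LinearIsometryEquiv.inner_map_map] at h
  have h0 : (fun y ↦ inner ℝ ((L.frame y).iso v) ((L.frame y).iso w)) =
      fun _ : M ↦ (inner ℝ v w : ℝ) := by
    funext y
    exact LinearIsometryEquiv.inner_map_map _ _ _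
  rw [h0, mvfderiv_coordField hp.1 (hasFDerivAt_const _ _)] at h
  rw [eq_neg_iff_add_eq_zero, ← h]
  rfl

end LocalFrame

/-! ### Existence of local frames -/

section Existence

variable [IsContMDiffRiemannianBundle (𝓡 n) ∞ (EuclideanSpace ℝ (Fin n))
  (fun x : M ↦ TangentSpace (𝓡 n) x)]

-- Induction on the index: each step subtracts projections, whose coefficients are quotients of
-- smooth inner products with nonvanishing denominators by linear independence.
open InnerProductSpace in
theorem contMDiffOn_gramSchmidt {s : Fin n → ∀ x : M, TangentSpace (𝓡 n) x} {U : Set M}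
    (hs : ∀ i, ContMDiffOn (𝓡 n) ((𝓡 n).prod 𝓘(ℝ, Eu n)) ∞
      (fun y ↦ (⟨y, s i y⟩ : TangentBundle (𝓡 n) M)) U)
    (hi : ∀ x ∈ U, LinearIndependent ℝ (s · x)) (i : Fin n) :
    ContMDiffOn (𝓡 n) ((𝓡 n).prod 𝓘(ℝ, Eu n)) ∞
      (fun y ↦ (⟨y, gramSchmidt ℝ (s · y) i⟩ : TangentBundle (𝓡 n) M)) U := by
  induction i using WellFoundedLT.induction with
  | ind i ih =>
    have h : ∀ y, gramSchmidt ℝ (s · y) i = s i y - ∑ j ∈ Finset.Iio i,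
        (inner ℝ (gramSchmidt ℝ (s · y) j) (s i y) /
          inner ℝ (gramSchmidt ℝ (s · y) j) (gramSchmidt ℝ (s · y) j)) •
            gramSchmidt ℝ (s · y) j := by
      intro y
      rw [gramSchmidt_def]
      congr 1
      refine Finset.sum_congr rfl fun j _ ↦ ?_
      rw [Submodule.starProjection_singleton, real_inner_self_eq_norm_sq]
      rfl
    simp only [h]
    refine (hs i).sub_section (ContMDiffOn.sum_section fun j hj ↦ ?_)
    have hj' := ih j (Finset.mem_Iio.1 hj)
    refine ContMDiffOn.smul_section ?_ hj'
    refine (hj'.inner_bundle (hs i)).div₀ (hj'.inner_bundle hj') fun x hx ↦ ?_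
    exact inner_self_ne_zero.2 (gramSchmidt_ne_zero j (hi x hx))

instance (x : M) : FiniteDimensional ℝ (TangentSpace (𝓡 n) x) :=
  inferInstanceAs (FiniteDimensional ℝ (EuclideanSpace ℝ (Fin n)))

/-- The frame given by a positive orthonormal basis. -/
def FrameAt.ofBasis {o : ManifoldOrientation n M} {x : M}
    (b : OrthonormalBasis (Fin n) ℝ (TangentSpace (𝓡 n) x))
    (hb : b.toBasis.orientation = o.orient x) : FrameAt o x where
  iso := b.repr.symm
  map_orientation := by
    rw [← hb, stdOrientation, ← Module.Basis.orientation_map]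
    congr 1

-- Gram–Schmidt applied to a positive smooth frame. The change of basis is triangular with positive
-- diagonal entries ⟨b_i, s_i⟩ = ‖g_i‖, g_i being the unnormalized vectors, so the orientation is
-- kept.
open InnerProductSpace in
theorem exists_localFrame [NeZero n] (o : ManifoldOrientation n M) (x₀ : M) :
    Nonempty (LocalFrame o x₀) := by
  classical
  obtain ⟨U, hU, hx, s, hs, hpos⟩ := o.exists_positive_frame x₀
  have hd : ∀ x : M, Module.finrank ℝ (TangentSpace (𝓡 n) x) = Fintype.card (Fin n) := by
    intro x
    change Module.finrank ℝ (EuclideanSpace ℝ (Fin n)) = _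
    simp
  have hi : ∀ x ∈ U, LinearIndependent ℝ (s · x) := fun x hx ↦ hs.linearIndependent hx
  let b := fun x ↦ gramSchmidtOrthonormalBasis (hd x) (s · x)
  have hbn : ∀ x ∈ U, ∀ i, b x i = ‖gramSchmidt ℝ (s · x) i‖⁻¹ • gramSchmidt ℝ (s · x) i := by
    intro x hx i
    have h0 : gramSchmidtNormed ℝ (s · x) i =
        ‖gramSchmidt ℝ (s · x) i‖⁻¹ • gramSchmidt ℝ (s · x) i := rfl
    rw [← h0]
    refine gramSchmidtOrthonormalBasis_apply (hd x) ?_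
    rw [h0]
    have := norm_ne_zero_iff.2 (gramSchmidt_ne_zero i (hi x hx))
    exact smul_ne_zero (inv_ne_zero this) (gramSchmidt_ne_zero i (hi x hx))
  have hb : ∀ x ∈ U, (b x).toBasis.orientation = o.orient x := by
    intro x hx
    rw [← hpos x hx, Module.Basis.orientation_eq_iff_det_pos]
    have h1 : ⇑(hs.toBasisAt hx) = (s · x) := by
      funext i
      exact hs.toBasisAt_coe hx i
    rw [h1, gramSchmidtOrthonormalBasis_det]
    refine Finset.prod_pos fun i _ ↦ ?_
    change 0 < inner ℝ (b x i) (s i x)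
    rw [hbn x hx i, real_inner_smul_left]
    have h2 : (inner ℝ (gramSchmidt ℝ (s · x) i) (s i x) : ℝ) =
        inner ℝ (gramSchmidt ℝ (s · x) i) (gramSchmidt ℝ (s · x) i) := by
      conv_lhs => rw [gramSchmidt_def' ℝ (s · x) i]
      rw [inner_add_right, inner_sum, Finset.sum_eq_zero, add_zero]
      intro j hj
      rw [Submodule.starProjection_singleton, inner_smul_right,
        gramSchmidt_orthogonal ℝ _ (Finset.mem_Iio.1 hj).ne', mul_zero]
    rw [h2, real_inner_self_eq_norm_sq]
    have := norm_pos_iff.2 (gramSchmidt_ne_zero i (hi x hx))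
    positivity
  -- Outside `U` any frame will do; smoothness is asserted only inside.
  let F : ∀ x : M, FrameAt o x := fun x ↦
    if hx : x ∈ U then FrameAt.ofBasis (b x) (hb x hx) else Classical.choice (nonempty_frameAt o x)
  -- The norm is written as the root of an inner product so that the normalizing factor becomes a
  -- smooth function of a smooth positive quantity.
  have hF : ∀ x ∈ U, ∀ i, (F x).iso (EuclideanSpace.single i 1) =
      (√(inner ℝ (gramSchmidt ℝ (s · x) i) (gramSchmidt ℝ (s · x) i)))⁻¹ •
        gramSchmidt ℝ (s · x) i := by
    intro x hx i
    rw [← norm_eq_sqrt_real_inner, ← hbn x hx i]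
    simp only [F, dif_pos hx, FrameAt.ofBasis]
    exact (b x).repr_symm_single i
  refine ⟨⟨U ∩ (chartAt (Eu n) x₀).source, F, hU.inter (chartAt (Eu n) x₀).open_source,
    ⟨hx, mem_chart_source _ _⟩, Set.inter_subset_right, fun i ↦ ?_⟩⟩
  have hgs := contMDiffOn_gramSchmidt (fun i ↦ hs.contMDiffOn i) hi i
  have hpos : ∀ x ∈ U, (inner ℝ (gramSchmidt ℝ (s · x) i) (gramSchmidt ℝ (s · x) i) : ℝ) ≠ 0 :=
    fun x hx ↦ inner_self_ne_zero.2 (gramSchmidt_ne_zero i (hi x hx))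
  have h : ContMDiffOn (𝓡 n) ((𝓡 n).prod 𝓘(ℝ, Eu n)) ∞
      (fun y ↦ (⟨y, (F y).iso (EuclideanSpace.single i 1)⟩ : TangentBundle (𝓡 n) M)) U := by
    have h1 : ContMDiffOn (𝓡 n) ((𝓡 n).prod 𝓘(ℝ, Eu n)) ∞
      (fun y ↦ (⟨y, (√(inner ℝ (gramSchmidt ℝ (s · y) i) (gramSchmidt ℝ (s · y) i)))⁻¹ •
        gramSchmidt ℝ (s · y) i⟩ : TangentBundle (𝓡 n) M)) U := by
      refine ContMDiffOn.smul_section (fun x hx ↦ ?_) hgs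
      have h2 : ContDiffAt ℝ ∞ (fun t : ℝ ↦ (√t)⁻¹)
          (inner ℝ (gramSchmidt ℝ (s · x) i) (gramSchmidt ℝ (s · x) i)) :=
        ((contDiffAt_id.sqrt (hpos x hx)).inv (Real.sqrt_ne_zero'.2
          ((real_inner_self_nonneg).lt_of_ne' (hpos x hx))))
      have h3 := hgs.inner_bundle hgs x hx
      exact ContMDiffAt.comp_contMDiffWithinAt (g := fun t : ℝ ↦ (√t)⁻¹) x h2.contMDiffAt h3
    refine h1.congr fun x hx ↦ ?_
    rw [hF x hx i]
  exact h.mono Set.inter_subset_left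

end Existence

end Frames

section Group

variable {n : ℕ}

/-! ### `SO(n)` as a compact topological group -/

theorem SO_coe_inv (a : SO n) : (a⁻¹).1 = a.1ᵀ := by
  have h : (a⁻¹).1 * a.1 = 1 := congrArg Subtype.val (inv_mul_cancel a)
  calc (a⁻¹).1 = (a⁻¹).1 * (a.1 * a.1ᵀ) := by rw [SO_mul_transpose, Matrix.mul_one]
    _ = a.1ᵀ := by rw [← Matrix.mul_assoc, h, Matrix.one_mul]

theorem continuous_SO_iff {T : Type*} [TopologicalSpace T] {f : T → SO n} :
    Continuous f ↔ Continuous fun t ↦ (f t).1 := Topology.IsInducing.subtypeVal.continuous_iff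

instance : IsTopologicalGroup (SO n) where
  continuous_mul := continuous_SO_iff.2
    ((continuous_subtype_val.comp continuous_fst).matrix_mul
      (continuous_subtype_val.comp continuous_snd))
  continuous_inv := continuous_SO_iff.2 (by
    simp only [SO_coe_inv]
    exact continuous_subtype_val.matrix_transpose)

instance : CompactSpace (SO n) := by
  refine isCompact_iff_compactSpace.1 ?_
  have hK : IsCompact (Set.univ.pi fun _ : Fin n ↦ Set.univ.pi fun _ : Fin n ↦
      Set.Icc (-1 : ℝ) 1 : Set (Matrix (Fin n) (Fin n) ℝ)) :=
    isCompact_univ_pi fun _ ↦ isCompact_univ_pi fun _ ↦ isCompact_Icc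
  refine hK.of_isClosed_subset ?_ ?_
  · have h : (Matrix.specialOrthogonalGroup (Fin n) ℝ : Set (Matrix (Fin n) (Fin n) ℝ)) =
        {A | A * Aᵀ = 1} ∩ {A | A.det = 1} := by
      ext A
      rw [SetLike.mem_coe, Matrix.mem_specialOrthogonalGroup_iff, Matrix.mem_orthogonalGroup_iff]
      rfl
    rw [h]
    exact (isClosed_eq (continuous_id.matrix_mul continuous_id.matrix_transpose)
      continuous_const).inter (isClosed_eq continuous_id.matrix_det continuous_const)
  · intro A hA i _ j _
    have h : ‖A i j‖ ≤ 1 := entry_norm_bound_of_unitary hA.1 i j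
    rwa [Real.norm_eq_abs, abs_le] at h

instance : SecondCountableTopology (SO n) := by
  have : SecondCountableTopology (Matrix (Fin n) (Fin n) ℝ) :=
    inferInstanceAs (SecondCountableTopology (Fin n → Fin n → ℝ))
  exact TopologicalSpace.Subtype.secondCountableTopology _

instance : MeasurableSpace (SO n) := borel _

instance : BorelSpace (SO n) := ⟨rfl⟩

/-! ### The Haar probability measure -/

variable (n) in
/-- The invariant probability measure on `SO(n)`. -/
def haarSO : Measure (SO n) := Measure.haarMeasure ⊤

instance : IsProbabilityMeasure (haarSO n) :=
  ⟨by
    rw [haarSO, ← TopologicalSpace.PositiveCompacts.coe_top]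
    exact Measure.haarMeasure_self⟩

instance : (haarSO n).IsMulLeftInvariant := by
  unfold haarSO; infer_instance

instance : (haarSO n).IsHaarMeasure := by
  unfold haarSO; infer_instance

/-- The right translate of the Haar probability measure is again a Haar probability measure, hence
the same one by uniqueness. This is unimodularity of a compact group. -/
theorem map_mul_right_haarSO (a : SO n) : (haarSO n).map (fun b ↦ b * a) = haarSO n := by
  have : IsProbabilityMeasure ((haarSO n).map fun b ↦ b * a) :=
    Measure.isProbabilityMeasure_map (measurable_mul_const a).aemeasurable
  exact Measure.isHaarMeasure_eq_of_isProbabilityMeasure _ _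

instance : (haarSO n).IsMulRightInvariant := ⟨map_mul_right_haarSO⟩

/-- The invariant finite measures on `SO(n)/G` are the multiples of the image of the Haar
measure. -/
theorem eq_smul_map_haarSO {G : Subgroup (SO n)} (hGc : IsClosed (G : Set (SO n)))
    (τ : Measure (SO n ⧸ G)) [IsFiniteMeasure τ]
    (hτ : ∀ a : SO n, τ.map (fun p ↦ a • p) = τ) :
    τ = τ Set.univ • (haarSO n).map (QuotientGroup.mk : SO n → SO n ⧸ G) := by
  have : IsClosed (G : Set (SO n)) := hGc
  have : SecondCountableTopology (SO n ⧸ G) :=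
    QuotientGroup.instSecondCountableTopology G
  have hmk : Measurable (QuotientGroup.mk : SO n → SO n ⧸ G) :=
    QuotientGroup.continuous_mk.measurable
  have hsm : Measurable fun q : SO n × (SO n ⧸ G) ↦ q.1 • q.2 :=
    continuous_smul.measurable
  ext S hS
  have h1 : ∀ a : SO n, τ ((fun p ↦ a • p) ⁻¹' S) = τ S := by
    intro a
    conv_rhs => rw [← hτ a]
    rw [Measure.map_apply (continuous_const_smul a).measurable hS]
  have h2 : ∀ p : SO n ⧸ G, haarSO n ((fun a ↦ a • p) ⁻¹' S) =
      (haarSO n).map (QuotientGroup.mk : SO n → SO n ⧸ G) S := by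
    intro p
    obtain ⟨b, rfl⟩ := QuotientGroup.mk_surjective p
    have h : (fun a : SO n ↦ a • (QuotientGroup.mk b : SO n ⧸ G)) ⁻¹' S =
        (fun a ↦ a * b) ⁻¹' (QuotientGroup.mk ⁻¹' S) := rfl
    rw [h, ← Measure.map_apply (measurable_mul_const b) (hmk hS), map_mul_right_haarSO,
      Measure.map_apply hmk hS]
  -- Invariance of τ is averaged over the group and the order of integration exchanged. For fixed p
  -- = bG the group elements carrying p into S have Haar measure independent of b, by right
  -- invariance (`h2`).
  calc τ S = ∫⁻ a, τ ((fun p ↦ a • p) ⁻¹' S) ∂(haarSO n) := by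
        simp [h1]
    _ = ((haarSO n).prod τ) ((fun q : SO n × (SO n ⧸ G) ↦ q.1 • q.2) ⁻¹' S) :=
        (Measure.prod_apply (hsm hS)).symm
    _ = ∫⁻ p, haarSO n ((fun a ↦ a • p) ⁻¹' S) ∂τ := Measure.prod_apply_symm (hsm hS)
    _ = _ := by
        simp only [h2, lintegral_const, Measure.smul_apply, smul_eq_mul]
        rw [mul_comm]

/-! ### Matrices as endomorphisms of Euclidean space -/

/-- The endomorphism of Euclidean space given by a matrix. -/
def toE (A : Matrix (Fin n) (Fin n) ℝ) : Eu n →L[ℝ] Eu n :=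
  LinearMap.toContinuousLinearMap (Matrix.toEuclideanLin A)

theorem toE_apply (A : Matrix (Fin n) (Fin n) ℝ) (v : Eu n) : toE A v = Matrix.toEuclideanLin A v :=
  rfl

theorem toE_mul (A B : Matrix (Fin n) (Fin n) ℝ) : toE (A * B) = (toE A).comp (toE B) := by
  ext1 v
  exact (toEuclideanLin_mul_apply A B v).symm

theorem toE_one : toE (1 : Matrix (Fin n) (Fin n) ℝ) = ContinuousLinearMap.id ℝ (Eu n) := by
  ext1 v
  exact toEuclideanLin_one_apply v

theorem toE_add (A B : Matrix (Fin n) (Fin n) ℝ) : toE (A + B) = toE A + toE B := by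
  simp [toE]

theorem toE_smul (c : ℝ) (A : Matrix (Fin n) (Fin n) ℝ) : toE (c • A) = c • toE A := by
  simp [toE]

theorem toE_single (A : Matrix (Fin n) (Fin n) ℝ) (i j : Fin n) :
    toE A (EuclideanSpace.single j 1) i = A i j := by
  simp [toE_apply, Matrix.toLpLin_apply]

theorem toE_injective : Function.Injective (toE (n := n)) := by
  intro A B h
  refine Matrix.ext fun i j ↦ ?_
  rw [← toE_single A i j, h, toE_single]

/-- The matrix of an endomorphism. -/
def toMat (T : Eu n →L[ℝ] Eu n) : Matrix (Fin n) (Fin n) ℝ :=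
  Matrix.of fun i j ↦ T (EuclideanSpace.single j 1) i

theorem toE_toMat (T : Eu n →L[ℝ] Eu n) : toE (toMat T) = T := by
  refine ContinuousLinearMap.coe_injective ?_
  refine (EuclideanSpace.basisFun (Fin n) ℝ).toBasis.ext fun j ↦ ?_
  ext i
  simp only [OrthonormalBasis.coe_toBasis, EuclideanSpace.basisFun_apply,
    ContinuousLinearMap.coe_coe]
  rw [toE_single]
  rfl

theorem toMat_toE (A : Matrix (Fin n) (Fin n) ℝ) : toMat (toE A) = A := by
  ext i j
  exact toE_single A i j

theorem continuous_toE : Continuous (toE (n := n)) := by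
  have h : Continuous ((LinearMap.toContinuousLinearMap.toLinearMap ∘ₗ
    (Matrix.toEuclideanLin (𝕜 := ℝ) (m := Fin n) (n := Fin n)).toLinearMap) :
      Matrix (Fin n) (Fin n) ℝ →ₗ[ℝ] (Eu n →L[ℝ] Eu n)) := by
    exact LinearMap.continuous_of_finiteDimensional _
  exact h

theorem toE_expSO (ξ : so n) : toE (expSO ξ).1 = NormedSpace.exp (toE ξ.1) := by
  let : NormedRing (Matrix (Fin n) (Fin n) ℝ) := Matrix.linftyOpNormedRing
  let : NormedAlgebra ℝ (Matrix (Fin n) (Fin n) ℝ) := Matrix.linftyOpNormedAlgebra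
  let : NormedAlgebra ℚ (Matrix (Fin n) (Fin n) ℝ) := NormedAlgebra.restrictScalars ℚ ℝ _
  let f : Matrix (Fin n) (Fin n) ℝ →+* (Eu n →L[ℝ] Eu n) :=
    { toFun := toE
      map_one' := toE_one
      map_mul' := toE_mul
      map_zero' := by simp [toE]
      map_add' := toE_add }
  exact NormedSpace.map_exp (f := f) continuous_toE ξ.1

theorem hasDerivAt_exp_smul_zero {𝔸 : Type*} [NormedRing 𝔸] [NormedAlgebra ℝ 𝔸] [CompleteSpace 𝔸]
    (x : 𝔸) : HasDerivAt (fun t : ℝ ↦ NormedSpace.exp (t • x)) x 0 := by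
  have h := hasDerivAt_exp_smul_const (𝕂 := ℝ) x (0 : ℝ)
  rwa [zero_smul, NormedSpace.exp_zero, one_mul] at h

theorem hasDerivAt_toE_expSO (ξ : so n) :
    HasDerivAt (fun t : ℝ ↦ toE (expSO (t • ξ)).1) (toE ξ.1) 0 := by
  have h := hasDerivAt_exp_smul_zero (toE ξ.1)
  refine h.congr_of_eventuallyEq (Filter.Eventually.of_forall fun t ↦ ?_)
  exact (toE_expSO _).trans (congrArg NormedSpace.exp (toE_smul t ξ.1))

theorem expSO_add_smul (ξ : so n) (s t : ℝ) :
    expSO ((s + t) • ξ) = expSO (s • ξ) * expSO (t • ξ) := by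
  apply Subtype.ext
  change NormedSpace.exp ((s + t) • ξ.1) = NormedSpace.exp (s • ξ.1) * NormedSpace.exp (t • ξ.1)
  rw [add_smul, Matrix.exp_add_of_commute]
  exact ((Commute.refl ξ.1).smul_left s).smul_right t

theorem expSO_zero : expSO (0 : so n) = 1 := by
  apply Subtype.ext
  change NormedSpace.exp (0 : Matrix (Fin n) (Fin n) ℝ) = 1
  simp

theorem inner_toE_so (ξ : so n) (v w : Eu n) :
    inner ℝ (toE ξ.1 v) w = - inner ℝ v (toE ξ.1 w) := by
  rw [toE_apply, toE_apply, EuclideanSpace.inner_eq_star_dotProduct,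
    EuclideanSpace.inner_eq_star_dotProduct]
  simp only [star_trivial, Matrix.toLpLin_apply]
  rw [Matrix.dotProduct_mulVec, ← Matrix.mulVec_transpose, so_transpose, Matrix.neg_mulVec,
    neg_dotProduct]

/-- A skew endomorphism as an element of `so(n)`. -/
def soOf (T : Eu n →L[ℝ] Eu n) (hT : ∀ v w, inner ℝ (T v) w = - inner ℝ v (T w)) : so n :=
  ⟨toMat T, (LieAlgebra.Orthogonal.mem_so (Fin n) ℝ _).2 (by
    ext i j
    have h := hT (EuclideanSpace.single i 1) (EuclideanSpace.single j 1)
    simpa [toMat, EuclideanSpace.inner_single_left, EuclideanSpace.inner_single_right] using h)⟩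

theorem toE_soOf {T : Eu n →L[ℝ] Eu n} (hT : ∀ v w, inner ℝ (T v) w = - inner ℝ v (T w)) :
    toE (soOf T hT).1 = T := toE_toMat T

theorem inner_toE_SO (a : SO n) (v w : Eu n) : inner ℝ (toE a.1 v) (toE a.1 w) = inner ℝ v w :=
  inner_toEuclideanLin_SO a v w

end Group

/-! ### The frame bundle, vertical fields and the frame flow in local trivializations. -/

section FrameBundle

set_option linter.unusedSectionVars false

variable {n : ℕ} {M : Type*} [TopologicalSpace M] [ChartedSpace (EuclideanSpace ℝ (Fin n)) M]
  [IsManifold (𝓡 n) ∞ M] {x₀ : M} {p : Eu n}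
  [RiemannianBundle (fun x : M ↦ TangentSpace (𝓡 n) x)]
  {o : ManifoldOrientation n M}

theorem FrameAt.ext {x : M} {w w' : FrameAt o x} (h : ∀ v, w.iso v = w'.iso v) : w = w' := by
  obtain ⟨i, hi⟩ := w
  obtain ⟨i', hi'⟩ := w'
  obtain rfl : i = i' := LinearIsometryEquiv.ext h
  rfl

theorem FrameAt.rot_iso {x : M} (w : FrameAt o x) (a : SO n) (v : Eu n) :
    (w.rot a).iso v = w.iso (toE a.1 v) := rfl

theorem FrameAt.rot_rot {x : M} (w : FrameAt o x) (a b : SO n) :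
    (w.rot a).rot b = w.rot (a * b) := by
  refine FrameAt.ext fun v ↦ ?_
  have h : (a * b).1 = a.1 * b.1 := rfl
  rw [rot_iso, rot_iso, rot_iso, h, toE_mul]
  rfl

theorem map_stdOrientation_trans {x : M} (e : Eu n ≃ₗ[ℝ] Eu n)
    (f : Eu n ≃ₗ[ℝ] TangentSpace (𝓡 n) x) (or : Orientation ℝ (Eu n) (Fin n)) :
    Orientation.map (Fin n) (e.trans f) or = Orientation.map (Fin n) f
      (Orientation.map (Fin n) e or) := by
  induction or using Module.Ray.ind
  rfl

/-- `SO(n)` acts transitively on the frames at a point. -/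
theorem FrameAt.exists_rot {x : M} (w w' : FrameAt o x) : ∃ a : SO n, w.rot a = w' := by
  let e : Eu n ≃ₗᵢ[ℝ] Eu n := w'.iso.trans w.iso.symm
  let T : Eu n →L[ℝ] Eu n := (e : Eu n ≃L[ℝ] Eu n)
  have hT : ∀ v, toE (toMat T) v = e v := fun v ↦ by rw [toE_toMat]; rfl
  have horth : (toMat T)ᵀ * toMat T = 1 := by
    ext i j
    have h : inner ℝ (e (EuclideanSpace.single i 1)) (e (EuclideanSpace.single j 1)) =
        inner ℝ (EuclideanSpace.single i (1 : ℝ)) (EuclideanSpace.single j (1 : ℝ)) :=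
      e.inner_map_map _ _
    rw [EuclideanSpace.inner_eq_star_dotProduct, EuclideanSpace.inner_eq_star_dotProduct,
      dotProduct_comm] at h
    rw [Matrix.mul_apply]
    simp only [star_trivial, dotProduct] at h
    refine Eq.trans ?_ (h.trans ?_)
    · rfl
    · rw [Matrix.one_apply]
      simp [eq_comm]
  -- Both frames carry the standard orientation to that of the tangent space, so the comparison
  -- isometry preserves orientation. An orthogonal matrix of positive determinant has determinant 1.
  have hdet : 0 < (toMat T).det := by
    have hor : Orientation.map (Fin n) e.toLinearEquiv (stdOrientation n) = stdOrientation n := by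
      apply (Orientation.map (Fin n) w.iso.toLinearEquiv).injective
      rw [← map_stdOrientation_trans, w.map_orientation, ← w'.map_orientation]
      congr 2
      ext v
      exact w.iso.apply_symm_apply (w'.iso v)
    rw [Orientation.map_eq_iff_det_pos _ _ (by simp)] at hor
    have h : (e.toLinearEquiv : Eu n →ₗ[ℝ] Eu n) = Matrix.toEuclideanLin (toMat T) := by
      ext1 v
      exact (hT v).symm
    rwa [h, Matrix.toEuclideanLin, Matrix.toLpLin_eq_toLin, LinearMap.det_toLin] at hor
  have hdet1 : (toMat T).det = 1 := by
    have h := congrArg Matrix.det horth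
    rw [Matrix.det_mul, Matrix.det_transpose, Matrix.det_one] at h
    nlinarith
  refine ⟨⟨toMat T, Matrix.mem_specialOrthogonalGroup_iff.2
    ⟨Matrix.mem_orthogonalGroup_iff' _ _ |>.2 horth, hdet1⟩⟩, FrameAt.ext fun v ↦ ?_⟩
  rw [rot_iso, hT]
  exact w.iso.apply_symm_apply _

namespace LocalFrame

variable (L : LocalFrame o x₀)

/-- The local trivialization of the frame bundle given by a local frame. -/
def point (p : Eu n) (a : SO n) : FM o :=
  ⟨(extChartAt (𝓡 n) x₀).symm p, (L.frame ((extChartAt (𝓡 n) x₀).symm p)).rot a⟩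

variable {L}

theorem exists_point_eq {w : FM o} (hw : w.1 ∈ L.dom) : ∃ p ∈ L.cdom, ∃ a, w = L.point p a := by
  obtain ⟨x, w⟩ := w
  obtain ⟨p, hp, rfl⟩ : ∃ p ∈ L.cdom, (extChartAt (𝓡 n) x₀).symm p = x :=
    ⟨_, chart_mem_cdom hw, symm_chart hw⟩
  obtain ⟨a, ha⟩ := (L.frame _).exists_rot w
  exact ⟨p, hp, a, by rw [point, ha]⟩

theorem point_rot (p : Eu n) (a b : SO n) : (L.point p a).rot b = L.point p (a * b) := by
  simp only [point, FM.rot, FrameAt.rot_rot]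
  rfl

end LocalFrame

/-- `F` represents the function `f` on the frame bundle in the trivialization given by a local
frame. -/
def LocalRep (L : LocalFrame o x₀) (f : FM o → ℝ) (F : Eu n × (Eu n →L[ℝ] Eu n) → ℝ) : Prop :=
  ContDiffOn ℝ ∞ F (L.cdom ×ˢ Set.univ) ∧
    ∀ p ∈ L.cdom, ∀ a : SO n, f (L.point p a) = F (p, toE a.1)

/-- A function on the frame bundle is smooth if it is so in each local frame. -/
def SmoothFn (f : FM o → ℝ) : Prop := ∀ (x₀ : M) (L : LocalFrame o x₀), ∃ F, LocalRep L f F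

/-- The inverse chart and the matrix entries transport the given extension to an open set of the
normed space E × End E, where ordinary differential calculus applies. -/
theorem SmoothFM.smoothFn {f : FM o → ℝ} (hf : SmoothFM f) : SmoothFn f := by
  intro x₀ L
  obtain ⟨F, hF, hfF⟩ := hf L.dom L.frame L.isOpen_dom L.smooth
  refine ⟨fun q ↦ F ((extChartAt (𝓡 n) x₀).symm q.1, fun i j ↦ toMat q.2 i j), ?_, ?_⟩
  · rw [← contMDiffOn_iff_contDiffOn]
    have h1 : ContMDiffOn 𝓘(ℝ, Eu n × (Eu n →L[ℝ] Eu n)) (𝓡 n) ∞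
        (fun q : Eu n × (Eu n →L[ℝ] Eu n) ↦ (extChartAt (𝓡 n) x₀).symm q.1)
        (L.cdom ×ˢ Set.univ) := by
      intro q hq
      have h2 : ContMDiffAt 𝓘(ℝ, Eu n × (Eu n →L[ℝ] Eu n)) 𝓘(ℝ, Eu n) ∞
          (fun q : Eu n × (Eu n →L[ℝ] Eu n) ↦ q.1) q := contDiff_fst.contMDiff.contMDiffAt
      exact ((contMDiffAt_symm hq.1.1).comp q h2).contMDiffWithinAt
    have h3 : ContMDiffOn 𝓘(ℝ, Eu n × (Eu n →L[ℝ] Eu n)) 𝓘(ℝ, Fin n → Fin n → ℝ) ∞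
        (fun q : Eu n × (Eu n →L[ℝ] Eu n) ↦ fun i j ↦ toMat q.2 i j)
        (L.cdom ×ˢ Set.univ) := by
      refine ContDiff.contMDiff ?_ |>.contMDiffOn
      refine contDiff_pi.2 fun i ↦ contDiff_pi.2 fun j ↦ ?_
      exact (EuclideanSpace.proj i : Eu n →L[ℝ] ℝ).contDiff.comp
        (contDiff_snd.clm_apply contDiff_const)
    exact hF.comp (h1.prodMk h3) fun q hq ↦ ⟨hq.1.2, Set.mem_univ _⟩
  · intro p hp a
    have h := hfF _ hp.2 a
    simp only [toMat_toE]
    exact h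

namespace LocalRep

variable {L : LocalFrame o x₀} {f g : FM o → ℝ} {F F' : Eu n × (Eu n →L[ℝ] Eu n) → ℝ}

theorem add (h : LocalRep L f F) (h' : LocalRep L g F') :
    LocalRep L (fun w ↦ f w + g w) (fun q ↦ F q + F' q) :=
  ⟨h.1.add h'.1, fun p hp a ↦ by beta_reduce; rw [h.2 p hp, h'.2 p hp]⟩

theorem sub (h : LocalRep L f F) (h' : LocalRep L g F') :
    LocalRep L (fun w ↦ f w - g w) (fun q ↦ F q - F' q) :=
  ⟨h.1.sub h'.1, fun p hp a ↦ by beta_reduce; rw [h.2 p hp, h'.2 p hp]⟩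

theorem mul (h : LocalRep L f F) (h' : LocalRep L g F') :
    LocalRep L (fun w ↦ f w * g w) (fun q ↦ F q * F' q) :=
  ⟨h.1.mul h'.1, fun p hp a ↦ by beta_reduce; rw [h.2 p hp, h'.2 p hp]⟩

theorem isOpen_domain (L : LocalFrame o x₀) :
    IsOpen (L.cdom ×ˢ (Set.univ : Set (Eu n →L[ℝ] Eu n))) := L.isOpen_cdom.prod isOpen_univ

theorem contDiffAt (h : LocalRep L f F) {q : Eu n × (Eu n →L[ℝ] Eu n)} (hp : q.1 ∈ L.cdom) :
    ContDiffAt ℝ ∞ F q := h.1.contDiffAt ((isOpen_domain L).mem_nhds ⟨hp, Set.mem_univ _⟩)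

theorem hasFDerivAt (h : LocalRep L f F) {q : Eu n × (Eu n →L[ℝ] Eu n)} (hp : q.1 ∈ L.cdom) :
    HasFDerivAt F (fderiv ℝ F q) q := ((h.contDiffAt hp).differentiableAt (by simp)).hasFDerivAt

end LocalRep

/-! ### Vertical derivatives -/

/-- The derivative of a function on the frame bundle along the vertical vector field `Y_ξ`. -/
def Y (ξ : so n) (f : FM o → ℝ) (w : FM o) : ℝ :=
  deriv (fun t : ℝ ↦ f (w.rot (expSO (t • ξ)))) 0

namespace LocalRep

variable {L : LocalFrame o x₀} {f g : FM o → ℝ} {F F' : Eu n × (Eu n →L[ℝ] Eu n) → ℝ}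

/-- The curve a exp(tξ) has velocity aξ at t = 0. The derivative is taken along a curve inside
SO(n), so the way f is extended off the group is immaterial. -/
theorem hasDerivAt_rot (h : LocalRep L f F) (hp : p ∈ L.cdom) (a : SO n) (ξ : so n) :
    HasDerivAt (fun t : ℝ ↦ f ((L.point p a).rot (expSO (t • ξ))))
      (dAlong (vertField (toE ξ.1)) F (p, toE a.1)) 0 := by
  have h1 : ∀ t : ℝ, f ((L.point p a).rot (expSO (t • ξ))) =
      F (p, (toE a.1).comp (toE (expSO (t • ξ)).1)) := by
    intro t
    rw [LocalFrame.point_rot, h.2 p hp]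
    have h2 : (a * expSO (t • ξ)).1 = a.1 * (expSO (t • ξ)).1 := rfl
    rw [h2, toE_mul]
  simp only [h1]
  have h3 : (p, (toE a.1).comp (toE (expSO ((0 : ℝ) • ξ)).1)) = (p, toE a.1) := by
    have h4 : (expSO ((0 : ℝ) • ξ)).1 = 1 := by
      rw [zero_smul, expSO_zero]
      rfl
    rw [h4, toE_one, ContinuousLinearMap.comp_id]
  have h5 : HasDerivAt (fun t : ℝ ↦ (toE a.1).comp (toE (expSO (t • ξ)).1))
      ((toE a.1).comp (toE ξ.1)) 0 := by
    have h6 := ((ContinuousLinearMap.compL ℝ (Eu n) (Eu n) (Eu n) (toE a.1)).hasFDerivAt).comp_hasDerivAt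
      (0 : ℝ) (hasDerivAt_toE_expSO ξ)
    exact h6
  have h7 := (hasDerivAt_const (0 : ℝ) p).prodMk h5
  have h8 := h.hasFDerivAt (q := (p, (toE a.1).comp (toE (expSO ((0 : ℝ) • ξ)).1))) hp
  have h9 := h8.comp_hasDerivAt (0 : ℝ) h7
  rw [h3] at h9
  exact h9

theorem Y (h : LocalRep L f F) (ξ : so n) :
    LocalRep L (Y ξ f) (dAlong (vertField (toE ξ.1)) F) :=
  ⟨ContDiffOn.dAlong (isOpen_domain L) h.1 (contDiff_vertField _).contDiffOn,
    fun _ hp a ↦ (h.hasDerivAt_rot hp a ξ).deriv⟩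

end LocalRep

variable [IsContMDiffRiemannianBundle (𝓡 n) ∞ (EuclideanSpace ℝ (Fin n))
  (fun x : M ↦ TangentSpace (𝓡 n) x)] [NeZero n]

theorem exists_point (w : FM o) : ∃ L : LocalFrame o w.1, ∃ p ∈ L.cdom, ∃ a, w = L.point p a := by
  obtain ⟨L⟩ := exists_localFrame o w.1
  obtain ⟨p, hp, a, h⟩ := L.exists_point_eq L.mem_dom
  exact ⟨L, p, hp, a, h⟩

namespace SmoothFn

variable {f g : FM o → ℝ}

theorem add (h : SmoothFn f) (h' : SmoothFn g) : SmoothFn fun w ↦ f w + g w := fun x₀ L ↦ by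
  obtain ⟨F, hF⟩ := h x₀ L
  obtain ⟨F', hF'⟩ := h' x₀ L
  exact ⟨_, hF.add hF'⟩

theorem sub (h : SmoothFn f) (h' : SmoothFn g) : SmoothFn fun w ↦ f w - g w := fun x₀ L ↦ by
  obtain ⟨F, hF⟩ := h x₀ L
  obtain ⟨F', hF'⟩ := h' x₀ L
  exact ⟨_, hF.sub hF'⟩

theorem mul (h : SmoothFn f) (h' : SmoothFn g) : SmoothFn fun w ↦ f w * g w := fun x₀ L ↦ by
  obtain ⟨F, hF⟩ := h x₀ L
  obtain ⟨F', hF'⟩ := h' x₀ L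
  exact ⟨_, hF.mul hF'⟩

theorem Y (h : SmoothFn f) (ξ : so n) : SmoothFn (Y ξ f) := fun x₀ L ↦ by
  obtain ⟨F, hF⟩ := h x₀ L
  exact ⟨_, hF.Y ξ⟩

theorem hasDerivAt_rot (h : SmoothFn f) (ξ : so n) (w : FM o) :
    HasDerivAt (fun t : ℝ ↦ f (w.rot (expSO (t • ξ)))) (FramePestov.Y ξ f w) 0 := by
  obtain ⟨L, p, hp, a, hw⟩ := exists_point w
  obtain ⟨F, hF⟩ := h _ L
  rw [hw, (hF.Y ξ).2 p hp]
  exact hF.hasDerivAt_rot hp a ξ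

/-- The one-parameter group law moves the derivative at time t to the derivative at 0 based at the
rotated frame. -/
theorem hasDerivAt_rot' (h : SmoothFn f) (ξ : so n) (w : FM o) (t : ℝ) :
    HasDerivAt (fun t : ℝ ↦ f (w.rot (expSO (t • ξ))))
      (FramePestov.Y ξ f (w.rot (expSO (t • ξ)))) t := by
  have h1 := h.hasDerivAt_rot ξ (w.rot (expSO (t • ξ)))
  rw [← sub_self t] at h1
  have h2 := h1.comp_sub_const t t
  refine h2.congr_of_eventuallyEq (Filter.Eventually.of_forall fun s ↦ ?_)
  beta_reduce
  rw [← FM.rot_mul, ← expSO_add_smul, add_sub_cancel]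

end SmoothFn

/-! ### Sections of the frame bundle in coordinates -/

variable (x₀) in
/-- A field of frames in coordinates. -/
def sectionCoord (s : ∀ y : M, FrameAt o y) (p : Eu n) : Eu n →L[ℝ] Eu n :=
  ∑ i, (EuclideanSpace.proj i : Eu n →L[ℝ] ℝ).smulRight
    (coordOf x₀ ((s ((extChartAt (𝓡 n) x₀).symm p)).iso (EuclideanSpace.single i 1)))

theorem sectionCoord_apply (s : ∀ y : M, FrameAt o y) (v : Eu n) :
    sectionCoord x₀ s p v = coordOf x₀ ((s ((extChartAt (𝓡 n) x₀).symm p)).iso v) := by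
  conv_rhs => rw [← sum_single v]
  simp only [sectionCoord, _root_.sum_apply, ContinuousLinearMap.smulRight_apply, coordOf, map_sum,
    map_smul]
  rfl

theorem contDiffAt_sectionCoord {s : ∀ y : M, FrameAt o y}
    (hp : p ∈ (extChartAt (𝓡 n) x₀).target) {U : Set M} (hU : IsOpen U) (hs : SmoothFrameOn s U)
    (hx : (extChartAt (𝓡 n) x₀).symm p ∈ U) : ContDiffAt ℝ ∞ (sectionCoord x₀ s) p := by
  refine ContDiffAt.sum fun i _ ↦ ?_
  have h := (hs i).contMDiffAt (hU.mem_nhds hx)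
  exact contDiffAt_const.smulRight ((contMDiffAt_iff_coordOf le_rfl hp).1 h)

namespace LocalFrame

variable (L : LocalFrame o x₀) {s : ∀ y : M, FrameAt o y}

/-- A field of frames relative to a local frame. -/
def relCoord (s : ∀ y : M, FrameAt o y) (p : Eu n) : Eu n →L[ℝ] Eu n :=
  (L.coordCoframe p).comp (sectionCoord x₀ s p)

variable {L}

theorem relCoord_eq (hp : p ∈ L.cdom) {a : SO n}
    (h : (L.frame ((extChartAt (𝓡 n) x₀).symm p)).rot a = s ((extChartAt (𝓡 n) x₀).symm p)) :
    L.relCoord s p = toE a.1 := by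
  have h1 : sectionCoord x₀ s p = (L.coordFrame p).comp (toE a.1) := by
    ext1 v
    rw [sectionCoord_apply, ← h, FrameAt.rot_iso, ContinuousLinearMap.comp_apply, coordFrame_apply]
  rw [relCoord, h1, ← ContinuousLinearMap.comp_assoc, coordCoframe_coordFrame hp,
    ContinuousLinearMap.id_comp]

theorem sectionCoord_eq (hp : p ∈ L.cdom) :
    sectionCoord x₀ s p = (L.coordFrame p).comp (L.relCoord s p) := by
  rw [relCoord, ← ContinuousLinearMap.comp_assoc, coordFrame_coordCoframe hp,
    ContinuousLinearMap.id_comp]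

theorem contDiffAt_relCoord (hp : p ∈ L.cdom) {U : Set M} (hU : IsOpen U) (hs : SmoothFrameOn s U)
    (hx : (extChartAt (𝓡 n) x₀).symm p ∈ U) : ContDiffAt ℝ ∞ (L.relCoord s) p :=
  (contDiffOn_coordCoframe.contDiffAt (L.isOpen_cdom.mem_nhds hp)).clm_comp
    (contDiffAt_sectionCoord hp.1 hU hs hx)

variable {cov : CovariantDerivative (𝓡 n) (EuclideanSpace ℝ (Fin n))
  (fun x : M ↦ TangentSpace (𝓡 n) x)}

/-- The covariant derivative of a field of frames, by means of the connection form. -/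
theorem cov_section (hp : p ∈ L.cdom) (hs : ContDiffAt ℝ ∞ (L.relCoord s) p) (u v : Eu n) :
    cov (fun y ↦ (s y).iso v) ((extChartAt (𝓡 n) x₀).symm p)
      (coordField x₀ u ((extChartAt (𝓡 n) x₀).symm p)) =
    (L.frame ((extChartAt (𝓡 n) x₀).symm p)).iso
      (fderiv ℝ (L.relCoord s) p u v + L.connForm cov p u (L.relCoord s p v)) := by
  have hx := symm_mem_source hp.1
  have hσ := (contDiffOn_coordFrame (L := L)).contDiffAt (L.isOpen_cdom.mem_nhds hp)
  have hloc : (fun q ↦ coordOf x₀ ((s ((extChartAt (𝓡 n) x₀).symm q)).iso v)) =ᶠ[𝓝 p]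
      fun q ↦ L.coordFrame q (L.relCoord s q v) := by
    filter_upwards [L.isOpen_cdom.mem_nhds hp] with q hq
    rw [← sectionCoord_apply, sectionCoord_eq hq]
    rfl
  have hA : DifferentiableAt ℝ (fun q ↦ L.relCoord s q v) p :=
    (hs.clm_apply contDiffAt_const).differentiableAt (by simp)
  rw [← coordField_coordOf hx (cov _ _ _), coordOf_cov cov hp.1, hloc.fderiv_eq, hloc.eq_of_nhds,
    fderiv_clm_apply (hσ.differentiableAt (by simp)) hA,
    fderiv_clm_apply (hs.differentiableAt (by simp)) (differentiableAt_const _)]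
  · rw [← coordField_coordFrame hp]
    congr 1
    have := congrArg (fun A : Eu n →L[ℝ] Eu n ↦ A (L.relCoord s p v))
      (coordFrame_connForm (cov := cov) hp u)
    simp only [ContinuousLinearMap.comp_apply, _root_.add_apply] at this
    simp [this, add_assoc]
  · refine ContDiffAt.congr_of_eventuallyEq ?_ hloc
    exact (hσ.clm_apply (hs.clm_apply contDiffAt_const)).of_le ENat.LEInfty.out

/-- The derivative of a function on the frame bundle along a section. -/
theorem mvfderiv_section (hp : p ∈ L.cdom) (hs : ContDiffAt ℝ ∞ (L.relCoord s) p)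
    {f : FM o → ℝ} {F : Eu n × (Eu n →L[ℝ] Eu n) → ℝ} (hF : LocalRep L f F) (u : Eu n) :
    mvfderiv (𝓡 n) (fun y ↦ f ⟨y, s y⟩) ((extChartAt (𝓡 n) x₀).symm p)
      (coordField x₀ u ((extChartAt (𝓡 n) x₀).symm p)) =
    fderiv ℝ F (p, L.relCoord s p) (u, fderiv ℝ (L.relCoord s) p u) := by
  have hA := (hs.differentiableAt (by simp)).hasFDerivAt
  have h1 : HasFDerivAt (fun q ↦ F (q, L.relCoord s q))
      ((fderiv ℝ F (p, L.relCoord s p)).comp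
        ((ContinuousLinearMap.id ℝ (Eu n)).prod (fderiv ℝ (L.relCoord s) p))) p :=
    (hF.hasFDerivAt (q := (p, L.relCoord s p)) hp).comp p ((hasFDerivAt_id p).prodMk hA)
  have hloc : (fun q ↦ f ⟨(extChartAt (𝓡 n) x₀).symm q, s ((extChartAt (𝓡 n) x₀).symm q)⟩) =ᶠ[𝓝 p]
      fun q ↦ F (q, L.relCoord s q) := by
    filter_upwards [L.isOpen_cdom.mem_nhds hp] with q hq
    obtain ⟨a, ha⟩ := (L.frame ((extChartAt (𝓡 n) x₀).symm q)).exists_rot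
      (s ((extChartAt (𝓡 n) x₀).symm q))
    rw [relCoord_eq hq ha, ← hF.2 q hq a, point, ha]
  exact mvfderiv_coordField hp.1 (h1.congr_of_eventuallyEq hloc) u

/-- A local frame can be rotated to a field of frames that is parallel at a given point and takes
a given value there. -/
theorem exists_parallel (hp : p ∈ L.cdom) (hmet : cov.IsMetricCompatible) (a : SO n) :
    ∃ s : ∀ y : M, FrameAt o y, ParallelFrameAt cov s ((extChartAt (𝓡 n) x₀).symm p) ∧
      s ((extChartAt (𝓡 n) x₀).symm p) = (L.frame ((extChartAt (𝓡 n) x₀).symm p)).rot a := by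
  have hsk : ∀ u : Eu n, ∀ v w : Eu n, inner ℝ ((-L.connForm cov p u) v) w =
      - inner ℝ v ((-L.connForm cov p u) w) := by
    intro u v w
    rw [_root_.neg_apply, _root_.neg_apply, inner_neg_left, inner_neg_right,
      inner_connForm hp hmet]
  -- With A(q) = exp(-θ_p(q - p)) a one has A(p) = a and dA_p = -θ_p a, so that dA + θA, the
  -- covariant derivative of the frame σA, vanishes at p. Skewness of θ keeps A in SO(n).
  let A : Eu n → SO n := fun q ↦ expSO (soOf (-L.connForm cov p (q - p)) (hsk (q - p))) * a
  have hA : ∀ q, toE (A q).1 = (NormedSpace.exp (-L.connForm cov p (q - p))).comp (toE a.1) := by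
    intro q
    have h1 : (A q).1 = (expSO (soOf (-L.connForm cov p (q - p)) (hsk (q - p)))).1 * a.1 := rfl
    rw [h1, toE_mul, toE_expSO, toE_soOf]
  have hexp : ∀ T : Eu n →L[ℝ] Eu n, ContDiffAt ℝ ∞ (NormedSpace.exp : (Eu n →L[ℝ] Eu n) → _) T :=
    fun T ↦ (NormedSpace.exp_analytic (𝕂 := ℝ) T).contDiffAt
  have hlin : ContDiff ℝ ∞ fun q : Eu n ↦ -L.connForm cov p (q - p) :=
    ((L.connForm cov p).contDiff.comp (contDiff_id.sub contDiff_const)).neg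
  have hAs : ContDiff ℝ ∞ fun q ↦ toE (A q).1 := by
    simp only [hA]
    refine ContDiff.clm_comp ?_ contDiff_const
    exact contDiff_iff_contDiffAt.2 fun q ↦ (hexp _).comp q hlin.contDiffAt
  have hA0 : A p = a := by
    have h1 : soOf (-L.connForm cov p (p - p)) (hsk (p - p)) = 0 := by
      apply Subtype.ext
      apply toE_injective
      rw [toE_soOf, sub_self, map_zero, neg_zero]
      simp [toE]
    simp only [A]
    rw [h1, expSO_zero, one_mul]
  -- A is already known to be smooth, so its derivative may be read off along lines through p, where
  -- the exponential is a one-parameter group.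
  have hAd : ∀ u, fderiv ℝ (fun q ↦ toE (A q).1) p u = (-L.connForm cov p u).comp (toE a.1) := by
    intro u
    have h0 : ∀ t : ℝ, toE (A (p + t • u)).1 =
        (NormedSpace.exp (t • -L.connForm cov p u)).comp (toE a.1) := by
      intro t
      rw [hA, add_sub_cancel_left, map_smul, smul_neg]
    have h1 : HasDerivAt (fun t : ℝ ↦ toE (A (p + t • u)).1)
        ((-L.connForm cov p u).comp (toE a.1)) 0 := by
      simp only [h0]
      have h2 := (((ContinuousLinearMap.compL ℝ (Eu n) (Eu n) (Eu n)).flip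
        (toE a.1)).hasFDerivAt).comp_hasDerivAt (0 : ℝ)
          (hasDerivAt_exp_smul_zero (-L.connForm cov p u))
      exact h2
    have h3 : HasDerivAt (fun t : ℝ ↦ p + t • u) u 0 := by
      simpa using ((hasDerivAt_id (0 : ℝ)).smul_const u).const_add p
    have h4 : HasFDerivAt (fun q ↦ toE (A q).1) (fderiv ℝ (fun q ↦ toE (A q).1) p)
        (p + (0 : ℝ) • u) := by
      rw [zero_smul, add_zero]
      exact (hAs.differentiable (by simp) p).hasFDerivAt
    have h5 := h4.comp_hasDerivAt (0 : ℝ) h3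
    exact h5.unique h1
  let s : ∀ y : M, FrameAt o y := fun y ↦ (L.frame y).rot (A (extChartAt (𝓡 n) x₀ y))
  have hrel : ∀ q ∈ L.cdom, L.relCoord s q = toE (A q).1 := by
    intro q hq
    refine relCoord_eq hq ?_
    simp only [s]
    rw [(extChartAt (𝓡 n) x₀).right_inv hq.1]
  have hrel' : L.relCoord s =ᶠ[𝓝 p] fun q ↦ toE (A q).1 := by
    filter_upwards [L.isOpen_cdom.mem_nhds hp] with q hq using hrel q hq
  refine ⟨s, ⟨⟨L.dom, L.isOpen_dom, hp.2, fun i x hx ↦ ?_⟩, fun i ↦ ?_⟩, ?_⟩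
  · have hq := chart_mem_cdom hx
    rw [← symm_chart hx]
    refine ContMDiffAt.contMDiffWithinAt ((contMDiffAt_iff_coordOf le_rfl hq.1).2 ?_)
    simp only [← sectionCoord_apply]
    have hloc : sectionCoord x₀ s =ᶠ[𝓝 (extChartAt (𝓡 n) x₀ x)]
        fun q ↦ (L.coordFrame q).comp (toE (A q).1) := by
      filter_upwards [L.isOpen_cdom.mem_nhds hq] with q hq
      rw [sectionCoord_eq hq, hrel q hq]
    exact (((contDiffOn_coordFrame.contDiffAt (L.isOpen_cdom.mem_nhds hq)).clm_comp
      hAs.contDiffAt).congr_of_eventuallyEq hloc).clm_apply contDiffAt_const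
  · ext1 v
    obtain ⟨u, rfl⟩ : ∃ u, coordField x₀ u ((extChartAt (𝓡 n) x₀).symm p) = v :=
      ⟨_, coordField_coordOf (symm_mem_source hp.1) v⟩
    rw [cov_section hp (hAs.contDiffAt.congr_of_eventuallyEq hrel'), hrel'.fderiv_eq, hAd,
      hrel p hp, hA0, ContinuousLinearMap.comp_apply, _root_.neg_apply, neg_add_cancel, map_zero]
    rfl
  · simp only [s]
    rw [(extChartAt (𝓡 n) x₀).right_inv hp.1, hA0]

end LocalFrame

open LocalFrame

variable {cov : CovariantDerivative (𝓡 n) (EuclideanSpace ℝ (Fin n))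
  (fun x : M ↦ TangentSpace (𝓡 n) x)}

/-- The generator of the frame flow in coordinates. -/
theorem LocalRep.X_point {L : LocalFrame o x₀} {f : FM o → ℝ} {F : Eu n × (Eu n →L[ℝ] Eu n) → ℝ}
    (hF : LocalRep L f F) (hmet : cov.IsMetricCompatible) (hp : p ∈ L.cdom) (a : SO n) :
    X cov f (L.point p a) =
      dAlong (horField L.coordFrame (L.connForm cov) (e₁ n)) F (p, toE a.1) := by
  have h : ∃ s : ∀ y : M, FrameAt o y, ParallelFrameAt cov s (L.point p a).1 ∧
      s (L.point p a).1 = (L.point p a).2 := exists_parallel hp hmet a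
  rw [X, dif_pos h]
  obtain ⟨⟨⟨U, hU, hx, hs⟩, hpar⟩, hval⟩ := h.choose_spec
  generalize h.choose = s at *
  have hA := contDiffAt_relCoord hp hU hs hx
  have hr : L.relCoord s p = toE a.1 := relCoord_eq hp hval.symm
  -- Parallelism at the point reads dA + θA = 0, so the first derivative of the section there is
  -- determined by its value. Hence the choice of section in `X` has no influence.
  have hdA : ∀ u, fderiv ℝ (L.relCoord s) p u = - (L.connForm cov p u).comp (toE a.1) := by
    intro u
    refine ContinuousLinearMap.coe_injective ?_
    refine (EuclideanSpace.basisFun (Fin n) ℝ).toBasis.ext fun j ↦ ?_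
    have h1 := cov_section (cov := cov) hp hA u (EuclideanSpace.single j 1)
    have h2 := congrArg (fun T ↦ T (coordField x₀ u ((extChartAt (𝓡 n) x₀).symm p))) (hpar j)
    have h3 := h1.symm.trans h2
    have h4 := (L.frame ((extChartAt (𝓡 n) x₀).symm p)).iso.injective (h3.trans (map_zero _).symm)
    rw [hr] at h4
    simpa using eq_neg_of_add_eq_zero_left h4
  have hv : (L.point p a).2.iso (e₁ n) = coordField x₀ (L.coordFrame p (toE a.1 (e₁ n)))
      ((extChartAt (𝓡 n) x₀).symm p) := (coordField_coordFrame hp _).symm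
  rw [hv]
  refine (mvfderiv_section hp hA hF _).trans ?_
  rw [hr, hdA]
  rfl

theorem LocalRep.X {L : LocalFrame o x₀} {f : FM o → ℝ} {F : Eu n × (Eu n →L[ℝ] Eu n) → ℝ}
    (hF : LocalRep L f F) (htor : cov.torsion = 0) (hmet : cov.IsMetricCompatible) :
    LocalRep L (X cov f) (dAlong (horField L.coordFrame (L.connForm cov) (e₁ n)) F) :=
  ⟨ContDiffOn.dAlong (isOpen_domain L) hF.1
    (contDiffOn_horField contDiffOn_coordFrame (contDiffOn_connForm htor hmet) _),
    fun _ hp a ↦ hF.X_point hmet hp a⟩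

theorem SmoothFn.X {f : FM o → ℝ} (hf : SmoothFn f) (htor : cov.torsion = 0)
    (hmet : cov.IsMetricCompatible) : SmoothFn (X cov f) := fun x₀ L ↦ by
  obtain ⟨F, hF⟩ := hf x₀ L
  exact ⟨_, hF.X htor hmet⟩

end FrameBundle

/-! ### The curvature tensor seen from the frame bundle. -/

section Structure

set_option linter.unusedSectionVars false

variable {n : ℕ} {M : Type*} [TopologicalSpace M] [ChartedSpace (EuclideanSpace ℝ (Fin n)) M]
  [IsManifold (𝓡 n) ∞ M] {x₀ : M} {p : Eu n}
  [RiemannianBundle (fun x : M ↦ TangentSpace (𝓡 n) x)]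
  {o : ManifoldOrientation n M}
  {cov : CovariantDerivative (𝓡 n) (EuclideanSpace ℝ (Fin n))
    (fun x : M ↦ TangentSpace (𝓡 n) x)}

theorem coordOf_cov_extend (hp : p ∈ (extChartAt (𝓡 n) x₀).target) (c : TangentSpace (𝓡 n) x₀)
    (u : Eu n) :
    coordOf x₀ (cov (FiberBundle.extend (Eu n) c) ((extChartAt (𝓡 n) x₀).symm p)
      (coordField x₀ u ((extChartAt (𝓡 n) x₀).symm p))) =
      christoffel x₀ cov p u (coordOf x₀ c) := by
  have hloc : (fun q ↦ coordOf x₀ (FiberBundle.extend (Eu n) c ((extChartAt (𝓡 n) x₀).symm q)))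
      =ᶠ[𝓝 p] fun _ ↦ coordOf x₀ c := by
    filter_upwards [(isOpen_extChartAt_target x₀).mem_nhds hp] with q hq
    rw [extend_eq_coordField c (symm_mem_source hq), coordOf_coordField (symm_mem_source hq)]
  rw [coordOf_cov cov hp (contDiffAt_const.congr_of_eventuallyEq hloc), hloc.fderiv_eq,
    hloc.eq_of_nhds]
  simp

variable [IsContMDiffRiemannianBundle (𝓡 n) ∞ (EuclideanSpace ℝ (Fin n))
  (fun x : M ↦ TangentSpace (𝓡 n) x)] [NeZero n]

theorem contDiffAt_christoffel (o : ManifoldOrientation n M) (htor : cov.torsion = 0) (hmet : cov.IsMetricCompatible) (x : M) :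
    ContDiffAt ℝ ∞ (christoffel x cov) (extChartAt (𝓡 n) x x) := by
  obtain ⟨L⟩ := exists_localFrame o x
  exact (LocalFrame.contDiffOn_christoffel (L := L) htor hmet).contDiffAt
    (L.isOpen_cdom.mem_nhds (LocalFrame.chart_mem_cdom L.mem_dom))

/-- The curvature tensor in coordinates. -/
theorem coordOf_curvature (o : ManifoldOrientation n M) (htor : cov.torsion = 0) (hmet : cov.IsMetricCompatible) (x : M)
    (a b c : TangentSpace (𝓡 n) x) :
    coordOf x (curvature cov x a b c) = formCurv (christoffel x cov) (extChartAt (𝓡 n) x x)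
      (coordOf x a) (coordOf x b) (coordOf x c) := by
  have hp : extChartAt (𝓡 n) x x ∈ (extChartAt (𝓡 n) x).target := mem_extChartAt_target x
  have hx : (extChartAt (𝓡 n) x).symm (extChartAt (𝓡 n) x x) = x := extChartAt_to_inv x
  have hs : x ∈ (chartAt (Eu n) x).source := mem_chart_source _ x
  have hΓ := contDiffAt_christoffel o htor hmet x
  -- In the chart the inner covariant derivative is the function q ↦ Γ_q(b, c), with constant b and
  -- c. A second application of the coordinate formula gives dΓ(a)(b, c) + Γ(a, Γ(b, c)).
  have key : ∀ a b c : TangentSpace (𝓡 n) x,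
      coordOf x (cov (fun y ↦ cov (FiberBundle.extend (Eu n) c) y
        (FiberBundle.extend (Eu n) b y)) x a) =
      fderiv ℝ (christoffel x cov) (extChartAt (𝓡 n) x x) (coordOf x a) (coordOf x b)
        (coordOf x c) + christoffel x cov (extChartAt (𝓡 n) x x) (coordOf x a)
          (christoffel x cov (extChartAt (𝓡 n) x x) (coordOf x b) (coordOf x c)) := by
    intro a b c
    have hloc : (fun q ↦ coordOf x (cov (FiberBundle.extend (Eu n) c)
        ((extChartAt (𝓡 n) x).symm q) (FiberBundle.extend (Eu n) b
          ((extChartAt (𝓡 n) x).symm q)))) =ᶠ[𝓝 (extChartAt (𝓡 n) x x)]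
        fun q ↦ christoffel x cov q (coordOf x b) (coordOf x c) := by
      filter_upwards [(isOpen_extChartAt_target x).mem_nhds hp] with q hq
      rw [extend_eq_coordField b (symm_mem_source hq), coordOf_cov_extend hq]
    have hd := (hΓ.clm_apply (contDiffAt_const (c := coordOf x b))).clm_apply
      (contDiffAt_const (c := coordOf x c))
    have hd1 : HasFDerivAt (fun q ↦ christoffel x cov q (coordOf x b) (coordOf x c)) _ _ :=
      ((hΓ.differentiableAt (by simp)).hasFDerivAt.clm_apply
        (hasFDerivAt_const (coordOf x b) _)).clm_apply (hasFDerivAt_const (coordOf x c) _)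
    have h := coordOf_cov cov hp (Z := fun y ↦ cov (FiberBundle.extend (Eu n) c) y
        (FiberBundle.extend (Eu n) b y))
        ((hd.of_le ENat.LEInfty.out).congr_of_eventuallyEq hloc) (coordOf x a)
    rw [hloc.fderiv_eq, hloc.eq_of_nhds, hd1.fderiv, hx, coordField_coordOf hs] at h
    rw [h]
    simp
  have hb : VectorField.mlieBracket (𝓡 n) (FiberBundle.extend (Eu n) a)
      (FiberBundle.extend (Eu n) b) x = 0 := by
    rw [← mlieBracket_coordField hs (coordOf x a) (coordOf x b)]
    have hU := (chartAt (Eu n) x).open_source.mem_nhds hs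
    exact Filter.EventuallyEq.mlieBracket_vectorField_eq
      (Filter.mem_of_superset hU fun y hy ↦ extend_eq_coordField a hy)
      (Filter.mem_of_superset hU fun y hy ↦ extend_eq_coordField b hy)
  have h0 : ∀ u v w : TangentSpace (𝓡 n) x, coordOf x (u - v - w) =
      coordOf x u - coordOf x v - coordOf x w := by
    intro u v w
    simp only [coordOf, map_sub]
  have h1 : coordOf x (0 : TangentSpace (𝓡 n) x) = 0 := by
    simp only [coordOf, map_zero]
  simp only [curvature]
  rw [h0, key, key, hb, map_zero, h1, formCurv]
  simp only [_root_.add_apply, _root_.sub_apply, ContinuousLinearMap.comp_apply]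
  abel

namespace LocalFrame

variable {L : LocalFrame o x₀}

theorem formCurv_gauge_coordFrame (htor : cov.torsion = 0) (hmet : cov.IsMetricCompatible)
    (hp : p ∈ L.cdom) (a b : Eu n) :
    (L.coordFrame p).comp (formCurv (L.connForm cov) p a b) =
      (formCurv (christoffel x₀ cov) p a b).comp (L.coordFrame p) := by
  have hU := L.isOpen_cdom.mem_nhds hp
  refine formCurv_gauge ((contDiffOn_coordFrame.contDiffAt hU).of_le two_le_infty)
    (((contDiffOn_connForm htor hmet).contDiffAt hU).differentiableAt (by simp))
    (((contDiffOn_christoffel (L := L) htor hmet).contDiffAt hU).differentiableAt (by simp)) ?_ a b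
  filter_upwards [hU] with q hq u using coordFrame_connForm hq u

/-- The curvature form is skew. -/
theorem inner_formCurv (htor : cov.torsion = 0) (hmet : cov.IsMetricCompatible)
    (hp : p ∈ L.cdom) (a b v w : Eu n) :
    inner ℝ (formCurv (L.connForm cov) p a b v) w =
      - inner ℝ v (formCurv (L.connForm cov) p a b w) := by
  have hU := L.isOpen_cdom.mem_nhds hp
  have hd := ((contDiffOn_connForm (L := L) htor hmet).contDiffAt hU).differentiableAt (by simp)
  -- A derivative of a skew-valued function is skew; the quadratic part of the curvature is a
  -- commutator of skew endomorphisms, so it is skew too.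
  have key : ∀ a b v w : Eu n, inner ℝ (fderiv ℝ (L.connForm cov) p a b v) w =
      - inner ℝ v (fderiv ℝ (L.connForm cov) p a b w) := by
    intro a b v w
    have h1 : ∀ v, HasFDerivAt (fun q ↦ L.connForm cov q b v) _ p := fun v ↦
      (hd.hasFDerivAt.clm_apply (hasFDerivAt_const b _)).clm_apply (hasFDerivAt_const v _)
    have h2 := (h1 v).inner ℝ (hasFDerivAt_const w p)
    have h3 := ((hasFDerivAt_const v p).inner ℝ (h1 w)).neg
    have h4 := h2.unique (h3.congr_of_eventuallyEq (by
      filter_upwards [hU] with q hq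
      exact inner_connForm hq hmet b v w))
    have h5 := congrArg (fun T : Eu n →L[ℝ] ℝ ↦ T a) h4
    simpa using h5
  have hs := inner_connForm (cov := cov) hp hmet
  simp only [formCurv, _root_.add_apply, _root_.sub_apply, ContinuousLinearMap.comp_apply,
    inner_add_left, inner_sub_left, inner_add_right, inner_sub_right]
  have e1 : inner ℝ (L.connForm cov p a (L.connForm cov p b v)) w =
      inner ℝ v (L.connForm cov p b (L.connForm cov p a w)) := by rw [hs, hs, neg_neg]
  have e2 : inner ℝ (L.connForm cov p b (L.connForm cov p a v)) w =
      inner ℝ v (L.connForm cov p a (L.connForm cov p b w)) := by rw [hs, hs, neg_neg]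
  rw [key, key, e1, e2]
  ring

/-- `hx` places the point at the centre of the chart, since `curvature` extends vectors through the
preferred chart at their own base point. There it is the curvature of Γ, which the gauge
transformation converts into that of θ. -/
theorem curvature_point (htor : cov.torsion = 0) (hmet : cov.IsMetricCompatible)
    (hp : p ∈ L.cdom) (hx : (extChartAt (𝓡 n) x₀).symm p = x₀) (a : SO n) (v w u : Eu n) :
    curvature cov (L.point p a).1 ((L.point p a).2.iso v) ((L.point p a).2.iso w)
        ((L.point p a).2.iso u) =
      (L.frame ((extChartAt (𝓡 n) x₀).symm p)).iso (formCurv (L.connForm cov) p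
        (L.coordFrame p (toE a.1 v)) (L.coordFrame p (toE a.1 w)) (toE a.1 u)) := by
  have key : ∀ y : M, y = x₀ → ∀ a b c : TangentSpace (𝓡 n) y, curvature cov y a b c =
      coordField x₀ (formCurv (christoffel x₀ cov) (extChartAt (𝓡 n) x₀ y) (coordOf x₀ a)
        (coordOf x₀ b) (coordOf x₀ c)) y := by
    rintro y rfl a b c
    rw [← coordOf_curvature o htor hmet, coordField_coordOf (mem_chart_source _ y)]
  have hc : ∀ v, coordOf x₀ ((L.frame ((extChartAt (𝓡 n) x₀).symm p)).iso v) = L.coordFrame p v :=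
    fun v ↦ (coordFrame_apply _).symm
  have hg := congrArg (fun T : Eu n →L[ℝ] Eu n ↦ T (toE a.1 u))
    (formCurv_gauge_coordFrame (cov := cov) htor hmet hp (L.coordFrame p (toE a.1 v))
      (L.coordFrame p (toE a.1 w)))
  simp only [ContinuousLinearMap.comp_apply] at hg
  have h2 : curvature cov ((extChartAt (𝓡 n) x₀).symm p)
      ((L.frame ((extChartAt (𝓡 n) x₀).symm p)).iso (toE a.1 v))
      ((L.frame ((extChartAt (𝓡 n) x₀).symm p)).iso (toE a.1 w))
      ((L.frame ((extChartAt (𝓡 n) x₀).symm p)).iso (toE a.1 u)) =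
      (L.frame ((extChartAt (𝓡 n) x₀).symm p)).iso (formCurv (L.connForm cov) p
        (L.coordFrame p (toE a.1 v)) (L.coordFrame p (toE a.1 w)) (toE a.1 u)) := by
    rw [key _ hx, hc, hc, hc, (extChartAt (𝓡 n) x₀).right_inv hp.1, ← hg, coordField_coordFrame hp]
  exact h2

theorem frameCurvature_point (htor : cov.torsion = 0) (hmet : cov.IsMetricCompatible)
    (hp : p ∈ L.cdom) (hx : (extChartAt (𝓡 n) x₀).symm p = x₀) (a : SO n) (v w : Eu n)
    (i j : Fin n) :
    frameCurvature cov (L.point p a) ((L.point p a).2.iso v) ((L.point p a).2.iso w) i j =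
      inner ℝ (toE a.1 (EuclideanSpace.single i 1))
        (formCurv (L.connForm cov) p (L.coordFrame p (toE a.1 v)) (L.coordFrame p (toE a.1 w))
          (toE a.1 (EuclideanSpace.single j 1))) :=
  (congrArg (inner ℝ _) (curvature_point htor hmet hp hx a v w _)).trans
    ((L.frame ((extChartAt (𝓡 n) x₀).symm p)).iso.inner_map_map _ _)

end LocalFrame

/-- Supplies a trivialization centred at the base point of w, as `curvature_point` requires. The
centre is a separate variable so that w can be replaced by its coordinates. -/
theorem exists_point_self (w : FM o) : ∃ (x₀ : M) (L : LocalFrame o x₀), ∃ p ∈ L.cdom,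
    (extChartAt (𝓡 n) x₀).symm p = x₀ ∧ ∃ a, w = L.point p a := by
  obtain ⟨L, p, hp, a, h⟩ := exists_point w
  exact ⟨w.1, L, p, hp, (congrArg Sigma.fst h).symm, a, h⟩

theorem frameCurvature_mem_so (htor : cov.torsion = 0) (hmet : cov.IsMetricCompatible)
    (w : FM o) (v v' : Eu n) :
    frameCurvature cov w (w.2.iso v) (w.2.iso v') ∈ LieAlgebra.Orthogonal.so (Fin n) ℝ := by
  obtain ⟨x₀, L, p, hp, hx, a, rfl⟩ := exists_point_self w
  rw [LieAlgebra.Orthogonal.mem_so]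
  ext i j
  rw [Matrix.transpose_apply, Matrix.neg_apply, LocalFrame.frameCurvature_point htor hmet hp hx,
    LocalFrame.frameCurvature_point htor hmet hp hx, real_inner_comm,
    LocalFrame.inner_formCurv htor hmet hp]

/-- The curvature as a function on the frame bundle with values in `so(n)`. -/
def curvSo (htor : cov.torsion = 0) (hmet : cov.IsMetricCompatible) (w : FM o) (v v' : Eu n) :
    so n := ⟨_, frameCurvature_mem_so htor hmet w v v'⟩

/-- For the frame w = σa the curvature matrix is the curvature form of θ conjugated by a. In this
shape the bracket of two horizontal fields becomes a field of the form Y_η at the point in question.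
-/
theorem toE_curvSo {L : LocalFrame o x₀} (htor : cov.torsion = 0) (hmet : cov.IsMetricCompatible)
    (hp : p ∈ L.cdom) (hx : (extChartAt (𝓡 n) x₀).symm p = x₀) (a : SO n) (v w : Eu n) :
    (toE a.1).comp (toE (curvSo htor hmet (L.point p a) v w).1) =
      (formCurv (L.connForm cov) p (L.coordFrame p (toE a.1 v))
        (L.coordFrame p (toE a.1 w))).comp (toE a.1) := by
  refine ContinuousLinearMap.coe_injective ?_
  refine (EuclideanSpace.basisFun (Fin n) ℝ).toBasis.ext fun j ↦ ?_
  refine InnerProductSpace.ext_inner_left_basis ((EuclideanSpace.basisFun (Fin n) ℝ).map (rotation a)).toBasis fun i ↦ ?_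
  have h : inner ℝ (EuclideanSpace.single i 1)
      (toE (curvSo htor hmet (L.point p a) v w).1 (EuclideanSpace.single j 1)) =
      (curvSo htor hmet (L.point p a) v w).1 i j := by
    rw [EuclideanSpace.inner_single_left, toE_single]
    simp
  have h2 := LocalFrame.frameCurvature_point (cov := cov) htor hmet hp hx a v w i j
  simp only [OrthonormalBasis.coe_toBasis, EuclideanSpace.basisFun_apply,
    OrthonormalBasis.map_apply, ContinuousLinearMap.coe_coe, ContinuousLinearMap.comp_apply]
  rw [rotation_apply, ← toE_apply, inner_toE_SO, h, ← h2]
  rfl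

end Structure

/-! ### The basis e_i ∧ e_j of so(n) and its Casimir element. -/

section Basis

variable {n : ℕ}

/-- The element `e_i ∧ e_j` of `so(n)`. -/
def wedge (i j : Fin n) : so n :=
  ⟨Matrix.single j i 1 - Matrix.single i j 1, (LieAlgebra.Orthogonal.mem_so (Fin n) ℝ _).2 (by
    simp [Matrix.transpose_sub, Matrix.transpose_single])⟩

theorem toE_single_mat (i j : Fin n) (v : Eu n) :
    toE (Matrix.single i j (1 : ℝ)) v = EuclideanSpace.single i (v j) := by
  ext k
  simp [toE_apply, Matrix.toLpLin_apply, Matrix.single_mulVec, Function.update_apply]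

theorem toE_sub (A B : Matrix (Fin n) (Fin n) ℝ) : toE (A - B) = toE A - toE B := by
  simp [toE]

theorem toE_wedge (i j : Fin n) (v : Eu n) : toE (wedge i j).1 v =
    v i • EuclideanSpace.single j 1 - v j • EuclideanSpace.single i 1 := by
  rw [wedge, toE_sub, _root_.sub_apply, toE_single_mat, toE_single_mat]
  ext k
  simp

/-- For i ≠ j the square of e_i ∧ e_j is minus the projection onto the plane of e_i and e_j, and
each basis vector lies in n - 1 coordinate planes. The factor 1/2 corrects for summing over ordered
pairs. This is the origin of the constant n - 1. -/
theorem sum_wedge_wedge (v : Eu n) :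
    (1 / 2 : ℝ) • ∑ i, ∑ j, toE (wedge i j).1 (toE (wedge i j).1 v) = -((n : ℝ) - 1) • v := by
  -- A formula uniform in i and j: on the diagonal the first term compensates the other two, as e_i
  -- ∧ e_i = 0.
  have h : ∀ i j, toE (wedge i j).1 (toE (wedge i j).1 v) =
      (if i = j then (2 : ℝ) • v i • EuclideanSpace.single i (1 : ℝ) else 0)
        - v j • EuclideanSpace.single j (1 : ℝ) - v i • EuclideanSpace.single i (1 : ℝ) := by
    intro i j
    by_cases hij : i = j
    · subst hij
      simp [toE_wedge, two_smul]
    · simp only [toE_wedge, if_neg hij, PiLp.sub_apply, PiLp.smul_apply, smul_eq_mul]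
      simp [hij, Ne.symm hij]
  simp only [h, Finset.sum_sub_distrib, Finset.sum_ite_eq, Finset.mem_univ, if_true,
    Finset.sum_const, Finset.card_univ, Fintype.card_fin, ← Finset.smul_sum, sum_single,
    ← Nat.cast_smul_eq_nsmul ℝ]
  module

theorem so_apply_swap (ξ : so n) (i j : Fin n) : ξ.1 j i = - ξ.1 i j := by
  have h := congrFun (congrFun (so_transpose ξ) i) j
  simpa using h

theorem so_eq_sum_wedge (ξ : so n) : ξ = (1 / 2 : ℝ) • ∑ i, ∑ j, ξ.1 j i • wedge i j := by
  apply Subtype.ext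
  have h : (((1 / 2 : ℝ) • ∑ i, ∑ j, ξ.1 j i • wedge i j : so n) : Matrix (Fin n) (Fin n) ℝ) =
      (1 / 2 : ℝ) • ∑ i, ∑ j, ξ.1 j i • (wedge i j).1 := by
    simp
  rw [h]
  ext k l
  simp only [wedge, Matrix.smul_apply, Matrix.sum_apply, Matrix.sub_apply, Matrix.single_apply,
    smul_eq_mul, mul_sub, mul_ite, mul_one, mul_zero, Finset.sum_sub_distrib]
  have e1 : ∑ i, ∑ j, (if j = k ∧ i = l then ξ.1 j i else 0) = ξ.1 k l := by
    simp [ite_and]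
  have e2 : ∑ i, ∑ j, (if i = k ∧ j = l then ξ.1 j i else 0) = ξ.1 l k := by
    simp [ite_and]
  rw [e1, e2, so_apply_swap ξ k l]
  ring

theorem linear_so (ℓ : so n →ₗ[ℝ] ℝ) (ξ : so n) :
    ℓ ξ = (1 / 2 : ℝ) * ∑ i, ∑ j, ξ.1 j i * ℓ (wedge i j) := by
  conv_lhs => rw [so_eq_sum_wedge ξ]
  simp only [map_smul, map_sum, smul_eq_mul]

theorem wedge_swap (i j : Fin n) : wedge j i = - wedge i j := by
  apply Subtype.ext
  change Matrix.single i j 1 - Matrix.single j i 1 = -(Matrix.single j i 1 - Matrix.single i j 1)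
  abel

theorem ip_eq_sum (A B : Matrix (Fin n) (Fin n) ℝ) :
    ip A B = (1 / 2 : ℝ) * ∑ i, ∑ j, A j i * B j i := by
  simp [ip, Matrix.trace, Matrix.mul_apply]

end Basis

/-! ### Commutators of the vertical fields with the frame flow. -/

section Commutators

set_option linter.unusedSectionVars false

variable {n : ℕ} {M : Type*} [TopologicalSpace M] [ChartedSpace (EuclideanSpace ℝ (Fin n)) M]
  [IsManifold (𝓡 n) ∞ M] {x₀ : M} {p : Eu n}
  [RiemannianBundle (fun x : M ↦ TangentSpace (𝓡 n) x)]
  {o : ManifoldOrientation n M}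
  [IsContMDiffRiemannianBundle (𝓡 n) ∞ (EuclideanSpace ℝ (Fin n))
    (fun x : M ↦ TangentSpace (𝓡 n) x)] [NeZero n]
  {cov : CovariantDerivative (𝓡 n) (EuclideanSpace ℝ (Fin n))
    (fun x : M ↦ TangentSpace (𝓡 n) x)} {f : FM o → ℝ}

theorem SmoothFn.exists_linear_Y (hf : SmoothFn f) (w : FM o) :
    ∃ ℓ : so n →ₗ[ℝ] ℝ, ∀ ξ, FramePestov.Y ξ f w = ℓ ξ := by
  obtain ⟨L, p, hp, a, hw⟩ := exists_point w
  obtain ⟨F, hF⟩ := hf _ L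
  refine ⟨{ toFun := fun ξ ↦ FramePestov.Y ξ f w, map_add' := fun ξ η ↦ ?_, map_smul' := fun c ξ ↦ ?_ },
    fun _ ↦ rfl⟩
  · rw [hw, (hF.Y _).2 p hp, (hF.Y _).2 p hp, (hF.Y _).2 p hp]
    simp only [dAlong, vertField]
    rw [← map_add]
    congr 1
    have h : (ξ + η).1 = ξ.1 + η.1 := rfl
    rw [h, toE_add, ContinuousLinearMap.comp_add]
    simp
  · rw [hw, (hF.Y _).2 p hp, (hF.Y _).2 p hp]
    simp only [dAlong, vertField, RingHom.id_apply, smul_eq_mul]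
    rw [← smul_eq_mul, ← map_smul]
    congr 1
    have h : (c • ξ).1 = c • ξ.1 := rfl
    rw [h, toE_smul, ContinuousLinearMap.comp_smul]
    simp

/-- The gradient of a function along the fibres of the frame bundle. -/
def gradSo (f : FM o → ℝ) (w : FM o) : Matrix (Fin n) (Fin n) ℝ :=
  -- The indices are exchanged because e_i ∧ e_j has its entry 1 at (j, i). With this convention
  -- pairing with ξ gives Y_ξ f.
  Matrix.of fun i j ↦ Y (wedge j i) f w

theorem SmoothFn.gradSo_mem (hf : SmoothFn f) (w : FM o) :
    gradSo f w ∈ LieAlgebra.Orthogonal.so (Fin n) ℝ := by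
  obtain ⟨ℓ, hℓ⟩ := hf.exists_linear_Y w
  rw [LieAlgebra.Orthogonal.mem_so]
  ext i j
  simp only [gradSo, Matrix.transpose_apply, Matrix.of_apply, Matrix.neg_apply, hℓ]
  rw [wedge_swap, map_neg]

theorem SmoothFn.ip_gradSo (hf : SmoothFn f) (w : FM o) (ξ : so n) :
    ip (gradSo f w) ξ.1 = FramePestov.Y ξ f w := by
  obtain ⟨ℓ, hℓ⟩ := hf.exists_linear_Y w
  rw [hℓ, linear_so, ip_eq_sum]
  simp only [gradSo, Matrix.of_apply, hℓ, mul_comm]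

variable (cov) in
/-- The commutator of `Y_ξ` with the generator of the frame flow. -/
def H (ξ : so n) (f : FM o → ℝ) (w : FM o) : ℝ := Y ξ (X cov f) w - X cov (Y ξ f) w

/-- The commutator, formally of second order, is the horizontal derivative B_{ξe₁} by the first
structure equation. It is thus again a smooth first-order operator. -/
theorem LocalRep.H {L : LocalFrame o x₀} {F : Eu n × (Eu n →L[ℝ] Eu n) → ℝ}
    (hF : LocalRep L f F) (htor : cov.torsion = 0) (hmet : cov.IsMetricCompatible) (ξ : so n) :
    LocalRep L (H cov ξ f)
      (dAlong (horField L.coordFrame (L.connForm cov) (toE ξ.1 (e₁ n))) F) := by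
  refine ⟨ContDiffOn.dAlong (isOpen_domain L) hF.1 (contDiffOn_horField
    LocalFrame.contDiffOn_coordFrame (LocalFrame.contDiffOn_connForm htor hmet) _), fun p hp a ↦ ?_⟩
  have hU := L.isOpen_cdom.mem_nhds hp
  rw [FramePestov.H, ((hF.X htor hmet).Y ξ).2 p hp, ((hF.Y ξ).X htor hmet).2 p hp]
  exact dAlong_vertField_horField (q := (p, toE a.1))
    ((LocalFrame.contDiffOn_coordFrame.contDiffAt hU).differentiableAt (by simp))
    (((LocalFrame.contDiffOn_connForm htor hmet).contDiffAt hU).differentiableAt (by simp))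
    ((hF.contDiffAt (q := (p, toE a.1)) hp).of_le two_le_infty) _ _

theorem SmoothFn.H (hf : SmoothFn f) (htor : cov.torsion = 0) (hmet : cov.IsMetricCompatible)
    (ξ : so n) : SmoothFn (H cov ξ f) := fun x₀ L ↦ by
  obtain ⟨F, hF⟩ := hf x₀ L
  exact ⟨_, hF.H htor hmet ξ⟩

theorem horField_add (σ : Eu n → Eu n →L[ℝ] Eu n) (θ : Eu n → Eu n →L[ℝ] Eu n →L[ℝ] Eu n)
    (v w : Eu n) (q : Eu n × (Eu n →L[ℝ] Eu n)) :
    horField σ θ (v + w) q = horField σ θ v q + horField σ θ w q := by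
  simp only [horField, map_add, ContinuousLinearMap.add_comp, Prod.mk_add_mk]
  rw [neg_add]

theorem horField_smul (σ : Eu n → Eu n →L[ℝ] Eu n) (θ : Eu n → Eu n →L[ℝ] Eu n →L[ℝ] Eu n)
    (c : ℝ) (v : Eu n) (q : Eu n × (Eu n →L[ℝ] Eu n)) :
    horField σ θ (c • v) q = c • horField σ θ v q := by
  simp only [horField, map_smul, ContinuousLinearMap.smul_comp, Prod.smul_mk]
  rw [smul_neg]

/-- `∑ [Y_k, [Y_k, 𝐗]] = - (n - 1) 𝐗`. -/
theorem sum_Y_H (hf : SmoothFn f) (htor : cov.torsion = 0) (hmet : cov.IsMetricCompatible)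
    (w : FM o) :
    (1 / 2 : ℝ) * ∑ i, ∑ j, (Y (wedge i j) (H cov (wedge i j) f) w -
      H cov (wedge i j) (Y (wedge i j) f) w) = -((n : ℝ) - 1) * X cov f w := by
  obtain ⟨L, p, hp, a, hw⟩ := exists_point w
  obtain ⟨F, hF⟩ := hf _ L
  have hU := L.isOpen_cdom.mem_nhds hp
  let ℓ : Eu n →ₗ[ℝ] ℝ :=
    { toFun := fun v ↦ dAlong (horField L.coordFrame (L.connForm cov) v) F (p, toE a.1)
      map_add' := fun v w ↦ by simp only [dAlong, horField_add, map_add]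
      map_smul' := fun c v ↦ by simp only [dAlong, horField_smul, map_smul, RingHom.id_apply] }
  -- The first structure equation applied a second time: [Y_ξ, B_{ξe₁}] = B_{ξξe₁}, which is linear
  -- in its vector, so the sum reduces to `sum_wedge_wedge`.
  have key : ∀ ξ : so n, Y ξ (H cov ξ f) w - H cov ξ (Y ξ f) w =
      ℓ (toE ξ.1 (toE ξ.1 (e₁ n))) := by
    intro ξ
    rw [hw, ((hF.H htor hmet ξ).Y ξ).2 p hp, ((hF.Y ξ).H htor hmet ξ).2 p hp]
    exact dAlong_vertField_horField (q := (p, toE a.1))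
      ((LocalFrame.contDiffOn_coordFrame.contDiffAt hU).differentiableAt (by simp))
      (((LocalFrame.contDiffOn_connForm htor hmet).contDiffAt hU).differentiableAt (by simp))
      ((hF.contDiffAt (q := (p, toE a.1)) hp).of_le two_le_infty) _ _
  have hX : X cov f w = ℓ (e₁ n) := by
    rw [hw]
    exact (hF.X htor hmet).2 p hp a
  simp only [key]
  rw [hX, ← smul_eq_mul, ← smul_eq_mul, ← map_smul, ← sum_wedge_wedge]
  simp only [map_smul, map_sum]

theorem formCurv_swap {E : Type*} [NormedAddCommGroup E] [NormedSpace ℝ E]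
    (θ : E → E →L[ℝ] E →L[ℝ] E) (p a b : E) : formCurv θ p b a = - formCurv θ p a b := by
  simp only [formCurv]
  abel

theorem formCurv_add {E : Type*} [NormedAddCommGroup E] [NormedSpace ℝ E]
    (θ : E → E →L[ℝ] E →L[ℝ] E) (p a b c : E) :
    formCurv θ p a (b + c) = formCurv θ p a b + formCurv θ p a c := by
  simp only [formCurv, map_add, _root_.add_apply, ContinuousLinearMap.comp_add,
    ContinuousLinearMap.add_comp]
  abel

theorem formCurv_smul {E : Type*} [NormedAddCommGroup E] [NormedSpace ℝ E]
    (θ : E → E →L[ℝ] E →L[ℝ] E) (p a b : E) (t : ℝ) :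
    formCurv θ p a (t • b) = t • formCurv θ p a b := by
  ext v
  simp only [formCurv, map_smul, _root_.add_apply, _root_.sub_apply, _root_.smul_apply,
    ContinuousLinearMap.comp_apply, smul_add, smul_sub]

/-- The curvature is bilinear and antisymmetric. -/
theorem curvSo_swap (htor : cov.torsion = 0) (hmet : cov.IsMetricCompatible) (w : FM o)
    (v v' : Eu n) : curvSo htor hmet w v' v = - curvSo htor hmet w v v' := by
  obtain ⟨x₀, L, p, hp, hx, a, rfl⟩ := exists_point_self w
  apply Subtype.ext
  ext i j
  change frameCurvature cov _ _ _ i j = - frameCurvature cov _ _ _ i j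
  rw [LocalFrame.frameCurvature_point htor hmet hp hx,
    LocalFrame.frameCurvature_point htor hmet hp hx, formCurv_swap, _root_.neg_apply, inner_neg_right]

theorem curvSo_add (htor : cov.torsion = 0) (hmet : cov.IsMetricCompatible) (w : FM o)
    (v v' v'' : Eu n) : curvSo htor hmet w v (v' + v'') =
      curvSo htor hmet w v v' + curvSo htor hmet w v v'' := by
  obtain ⟨x₀, L, p, hp, hx, a, rfl⟩ := exists_point_self w
  apply Subtype.ext
  ext i j
  change frameCurvature cov _ _ _ i j = frameCurvature cov _ _ _ i j + frameCurvature cov _ _ _ i j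
  rw [LocalFrame.frameCurvature_point htor hmet hp hx,
    LocalFrame.frameCurvature_point htor hmet hp hx, LocalFrame.frameCurvature_point htor hmet hp hx,
    map_add, map_add, formCurv_add, _root_.add_apply, inner_add_right]

theorem curvSo_smul (htor : cov.torsion = 0) (hmet : cov.IsMetricCompatible) (w : FM o)
    (v v' : Eu n) (t : ℝ) : curvSo htor hmet w v (t • v') = t • curvSo htor hmet w v v' := by
  obtain ⟨x₀, L, p, hp, hx, a, rfl⟩ := exists_point_self w
  apply Subtype.ext
  ext i j
  change frameCurvature cov _ _ _ i j = t * frameCurvature cov _ _ _ i j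
  rw [LocalFrame.frameCurvature_point htor hmet hp hx,
    LocalFrame.frameCurvature_point htor hmet hp hx,
    map_smul, map_smul, formCurv_smul, _root_.smul_apply, inner_smul_right]

/-- `[𝐗, [Y_ξ, 𝐗]]` is a vertical vector field given by the curvature. -/
theorem X_H (hf : SmoothFn f) (htor : cov.torsion = 0) (hmet : cov.IsMetricCompatible)
    (w : FM o) (ξ : so n) :
    X cov (H cov ξ f) w - H cov ξ (X cov f) w =
      - Y (curvSo htor hmet w (e₁ n) (toE ξ.1 (e₁ n))) f w := by
  obtain ⟨x₀, L, p, hp, hx, a, rfl⟩ := exists_point_self w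
  obtain ⟨F, hF⟩ := hf _ L
  have hU := L.isOpen_cdom.mem_nhds hp
  rw [((hF.H htor hmet ξ).X htor hmet).2 p hp, ((hF.X htor hmet).H htor hmet ξ).2 p hp,
    (hF.Y _).2 p hp]
  rw [dAlong_horField_horField (q := (p, toE a.1))
      ((LocalFrame.contDiffOn_coordFrame.contDiffAt hU).differentiableAt (by simp))
      (((LocalFrame.contDiffOn_connForm htor hmet).contDiffAt hU).differentiableAt (by simp))
      ((hF.contDiffAt (q := (p, toE a.1)) hp).of_le two_le_infty)
      (LocalFrame.coordFrame_torsion hp htor)]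
  rw [dAlong, vertField, toE_curvSo htor hmet hp hx]

/-- The vertical field -Y_{R(e₁, ξe₁)} depends linearly on ξ, so summing it against the components
of the gradient evaluates it at the gradient itself. Exchanging the two arguments of the curvature
absorbs the sign. -/
theorem sum_X_H (hf : SmoothFn f) (htor : cov.torsion = 0) (hmet : cov.IsMetricCompatible)
    (w : FM o) :
    (1 / 2 : ℝ) * ∑ i, ∑ j, (X cov (H cov (wedge i j) f) w - H cov (wedge i j) (X cov f) w) *
      Y (wedge i j) f w = RFM cov w ⟨_, hf.gradSo_mem w⟩ ⟨_, hf.gradSo_mem w⟩ := by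
  obtain ⟨ℓ, hℓ⟩ := hf.exists_linear_Y w
  let m : so n →ₗ[ℝ] so n :=
    { toFun := fun ξ ↦ curvSo htor hmet w (e₁ n) (toE ξ.1 (e₁ n))
      map_add' := fun ξ η ↦ by
        rw [← curvSo_add, ← _root_.add_apply, ← toE_add]
        rfl
      map_smul' := fun c ξ ↦ by
        rw [RingHom.id_apply, ← curvSo_smul, ← _root_.smul_apply, ← toE_smul]
        rfl }
  have h1 : ∀ i j, (X cov (H cov (wedge i j) f) w - H cov (wedge i j) (X cov f) w) *
      Y (wedge i j) f w = -(gradSo f w j i * (ℓ.comp m) (wedge i j)) := by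
    intro i j
    rw [X_H hf htor hmet, hℓ (curvSo _ _ _ _ _)]
    change -ℓ (m (wedge i j)) * gradSo f w j i = _
    rw [LinearMap.comp_apply]
    ring
  simp only [h1, Finset.sum_neg_distrib]
  rw [mul_neg]
  have h2 := linear_so (ℓ.comp m) ⟨_, hf.gradSo_mem w⟩
  rw [← h2, LinearMap.comp_apply, ← hℓ, ← hf.ip_gradSo]
  change _ = ip _ (curvSo htor hmet w (toE (gradSo f w) (e₁ n)) (e₁ n)).1
  rw [curvSo_swap htor hmet w (e₁ n)]
  change - ip _ (curvSo htor hmet w (e₁ n) (toE (gradSo f w) (e₁ n))).1 =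
    ip _ (-(curvSo htor hmet w (e₁ n) (toE (gradSo f w) (e₁ n))).1)
  simp only [ip, Matrix.trace_neg, mul_neg]

end Commutators

/-! ### Topology of the frame bundle. -/

section FrameTopology

set_option linter.unusedSectionVars false

variable {n : ℕ} {M : Type*} [TopologicalSpace M] [ChartedSpace (EuclideanSpace ℝ (Fin n)) M]
  [IsManifold (𝓡 n) ∞ M] {x₀ : M} {p : Eu n}

theorem continuousOn_coordOf : ContinuousOn
    (fun v : TangentBundle (𝓡 n) M ↦ coordOf x₀ v.2)
    (TotalSpace.proj ⁻¹' (chartAt (Eu n) x₀).source) := by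
  have h : ContinuousOn (fun v : TangentBundle (𝓡 n) M ↦ (tanTriv (n := n) x₀ v).2)
      (TotalSpace.proj ⁻¹' (chartAt (Eu n) x₀).source) := by
    refine continuous_snd.comp_continuousOn ?_
    have := (tanTriv (n := n) x₀).continuousOn
    rwa [(tanTriv (n := n) x₀).source_eq] at this
  refine h.congr fun v hv ↦ ?_
  have := (tanTriv (n := n) x₀).coe_linearMapAt_of_mem (R := ℝ) (b := v.1) hv
  exact congrFun this v.2

theorem continuousOn_coordField : ContinuousOn
    (fun q : M × Eu n ↦ (⟨q.1, coordField x₀ q.2 q.1⟩ : TangentBundle (𝓡 n) M))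
    ((chartAt (Eu n) x₀).source ×ˢ Set.univ) := by
  have h := (tanTriv (n := n) x₀).continuousOn_invFun
  rw [(tanTriv (n := n) x₀).target_eq] at h
  refine h.congr fun q hq ↦ ?_
  have h1 : coordField x₀ q.2 q.1 = (tanTriv (n := n) x₀).symm q.1 q.2 :=
    (tanTriv (n := n) x₀).symmₗ_apply (R := ℝ) (b := q.1) hq.1 q.2
  rw [h1]
  exact (tanTriv (n := n) x₀).mk_symm (b := q.1) hq.1 q.2

variable [RiemannianBundle (fun x : M ↦ TangentSpace (𝓡 n) x)]
  {o : ManifoldOrientation n M}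

theorem continuous_frame_apply (i : Fin n) : Continuous
    (fun w : FM o ↦ (⟨w.1, w.2.iso (EuclideanSpace.single i 1)⟩ : TangentBundle (𝓡 n) M)) := by
  have h : Topology.IsInducing (fun (w : FM o) (i : Fin n) ↦
      (⟨w.1, w.2.iso (EuclideanSpace.single i 1)⟩ : TangentBundle (𝓡 n) M)) := ⟨rfl⟩
  exact continuous_pi_iff.1 h.continuous i

theorem continuousOn_coordOf_frame (i : Fin n) : ContinuousOn
    (fun w : FM o ↦ coordOf x₀ (w.2.iso (EuclideanSpace.single i 1)))
    {w | w.1 ∈ (chartAt (Eu n) x₀).source} := by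
  have h1 := continuousOn_coordOf (n := n) (x₀ := x₀)
  have h2 := (continuous_frame_apply (o := o) i).continuousOn
    (s := {w | w.1 ∈ (chartAt (Eu n) x₀).source})
  have h3 : Set.MapsTo (fun w : FM o ↦
      (⟨w.1, w.2.iso (EuclideanSpace.single i 1)⟩ : TangentBundle (𝓡 n) M))
      {w | w.1 ∈ (chartAt (Eu n) x₀).source}
      (TotalSpace.proj ⁻¹' (chartAt (Eu n) x₀).source) := fun w hw ↦ hw
  exact ContinuousOn.comp h1 h2 h3

theorem continuous_FM_iff {T : Type*} [TopologicalSpace T] {s : Set T} {g : T → FM o} :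
    ContinuousOn g s ↔ ∀ i : Fin n, ContinuousOn (fun t ↦ (⟨(g t).1,
      (g t).2.iso (EuclideanSpace.single i 1)⟩ : TangentBundle (𝓡 n) M)) s := by
  have h : Topology.IsInducing (fun (w : FM o) (i : Fin n) ↦
      (⟨w.1, w.2.iso (EuclideanSpace.single i 1)⟩ : TangentBundle (𝓡 n) M)) := ⟨rfl⟩
  rw [h.continuousOn_iff, continuousOn_pi]
  rfl

theorem continuous_base [NeZero n] : Continuous (fun w : FM o ↦ w.1) :=
  (FiberBundle.continuous_proj (Eu n) (fun x : M ↦ TangentSpace (𝓡 n) x)).comp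
    (continuous_frame_apply 0)

instance : MeasurableSpace (FM o) := borel _

instance : BorelSpace (FM o) := ⟨rfl⟩

namespace LocalFrame

variable (L : LocalFrame o x₀)

/-- The local trivialization of the frame bundle given by a local frame. -/
def framePoint (x : M) (a : SO n) : FM o := ⟨x, (L.frame x).rot a⟩

theorem continuousOn_framePoint : ContinuousOn
    (fun q : M × SO n ↦ L.framePoint q.1 q.2) (L.dom ×ˢ Set.univ) := by
  rw [continuous_FM_iff]
  intro i
  have h1 : ContinuousOn (fun q : M × SO n ↦ (q.1, L.coordFrame (extChartAt (𝓡 n) x₀ q.1)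
      (toE q.2.1 (EuclideanSpace.single i 1)))) (L.dom ×ˢ Set.univ) := by
    refine continuousOn_fst.prodMk (ContinuousOn.clm_apply ?_ ?_)
    · refine contDiffOn_coordFrame.continuousOn.comp ((continuousOn_extChartAt x₀).comp
        continuousOn_fst fun q hq ↦ ?_) fun q hq ↦ chart_mem_cdom hq.1
      rw [extChartAt_source]
      exact L.dom_subset hq.1
    · exact ((continuous_toE.comp (continuous_subtype_val.comp continuous_snd)).clm_apply
        continuous_const).continuousOn
  refine (continuousOn_coordField.comp h1 fun q hq ↦ ⟨L.dom_subset hq.1, Set.mem_univ _⟩).congr ?_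
  intro q hq
  have h2 := coordField_coordFrame (chart_mem_cdom hq.1) (toE q.2.1 (EuclideanSpace.single i 1))
  have h3 : ∀ y, y = q.1 → coordField x₀ (L.coordFrame (extChartAt (𝓡 n) x₀ q.1)
      (toE q.2.1 (EuclideanSpace.single i 1))) y =
        (L.frame y).iso (toE q.2.1 (EuclideanSpace.single i 1)) →
      (L.frame q.1).iso (toE q.2.1 (EuclideanSpace.single i 1)) =
        coordField x₀ (L.coordFrame (extChartAt (𝓡 n) x₀ q.1)
          (toE q.2.1 (EuclideanSpace.single i 1))) q.1 := by
    rintro y rfl h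
    exact h.symm
  exact congrArg (fun v : TangentSpace (𝓡 n) q.1 ↦ (⟨q.1, v⟩ : TangentBundle (𝓡 n) M))
    (h3 _ (symm_chart hq.1) h2)

theorem continuousOn_point : ContinuousOn (fun q : Eu n × SO n ↦ L.point q.1 q.2)
    (L.cdom ×ˢ Set.univ) := by
  refine L.continuousOn_framePoint.comp (f := fun q : Eu n × SO n ↦
    ((extChartAt (𝓡 n) x₀).symm q.1, q.2)) ?_ fun q hq ↦ ⟨hq.1.2, Set.mem_univ _⟩
  exact ((continuousOn_extChartAt_symm x₀).comp continuousOn_fst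
    fun q hq ↦ hq.1.1).prodMk continuousOn_snd

end LocalFrame

variable [IsContMDiffRiemannianBundle (𝓡 n) ∞ (EuclideanSpace ℝ (Fin n))
  (fun x : M ↦ TangentSpace (𝓡 n) x)] [NeZero n]

/-- The topology of FM is induced from powers of TM. The coordinates (p, σ(p)⁻¹ ∘ w) of a frame w
are continuous for it, and f is its local representative composed with them. -/
theorem SmoothFn.continuous {f : FM o → ℝ} (hf : SmoothFn f) : Continuous f := by
  rw [continuous_iff_continuousAt]
  intro w₀
  obtain ⟨L⟩ := exists_localFrame o w₀.1
  obtain ⟨F, hF⟩ := hf _ L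
  have hopen : IsOpen {w : FM o | w.1 ∈ L.dom} := L.isOpen_dom.preimage continuous_base
  have hw₀ : w₀ ∈ {w : FM o | w.1 ∈ L.dom} := L.mem_dom
  let A : FM o → (Eu n →L[ℝ] Eu n) := fun w ↦ ∑ i, (EuclideanSpace.proj i : Eu n →L[ℝ] ℝ).smulRight
    (coordOf w₀.1 (w.2.iso (EuclideanSpace.single i 1)))
  let B : FM o → Eu n × (Eu n →L[ℝ] Eu n) := fun w ↦ (extChartAt (𝓡 n) w₀.1 w.1,
    (L.coordCoframe (extChartAt (𝓡 n) w₀.1 w.1)).comp (A w))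
  have hA : ContinuousOn A {w : FM o | w.1 ∈ L.dom} := by
    rw [continuousOn_clm_apply]
    intro v
    have h1 : ∀ i, ContinuousOn (fun w : FM o ↦ coordOf w₀.1 (w.2.iso (EuclideanSpace.single i 1)))
        {w : FM o | w.1 ∈ L.dom} := fun i ↦
      (continuousOn_coordOf_frame i).mono fun w hw ↦ L.dom_subset hw
    have h2 : ∀ w, A w v = ∑ i, v i • coordOf w₀.1 (w.2.iso (EuclideanSpace.single i 1)) := by
      intro w
      simp only [A, _root_.sum_apply, ContinuousLinearMap.smulRight_apply]
      rfl
    simp only [h2]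
    exact continuousOn_finsetSum _ fun i _ ↦ (h1 i).const_smul (v i)
  have hφ : ContinuousOn (fun w : FM o ↦ extChartAt (𝓡 n) w₀.1 w.1) {w : FM o | w.1 ∈ L.dom} :=
    (continuousOn_extChartAt w₀.1).comp continuous_base.continuousOn fun w hw ↦ by
      rw [extChartAt_source]
      exact L.dom_subset hw
  have hB : ContinuousOn B {w : FM o | w.1 ∈ L.dom} :=
    hφ.prodMk ((LocalFrame.contDiffOn_coordCoframe.continuousOn.comp hφ
      fun w hw ↦ LocalFrame.chart_mem_cdom hw).clm_comp hA)
  have hfB : ∀ w ∈ {w : FM o | w.1 ∈ L.dom}, f w = F (B w) := by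
    intro w hw
    obtain ⟨p, hp, a, rfl⟩ := L.exists_point_eq hw
    rw [hF.2 p hp a]
    congr 1
    have h1 : extChartAt (𝓡 n) w₀.1 (L.point p a).1 = p :=
      (extChartAt (𝓡 n) w₀.1).right_inv hp.1
    have h2 : A (L.point p a) = (L.coordFrame p).comp (toE a.1) := by
      refine ContinuousLinearMap.coe_injective ?_
      refine (EuclideanSpace.basisFun (Fin n) ℝ).toBasis.ext fun j ↦ ?_
      simp only [OrthonormalBasis.coe_toBasis, EuclideanSpace.basisFun_apply,
        ContinuousLinearMap.coe_coe, ContinuousLinearMap.comp_apply]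
      rw [LocalFrame.coordFrame_apply]
      simp [A]
      rfl
    simp only [B]
    rw [h1, h2, ← ContinuousLinearMap.comp_assoc, LocalFrame.coordCoframe_coordFrame hp,
      ContinuousLinearMap.id_comp]
  have h : ContinuousOn f {w : FM o | w.1 ∈ L.dom} := by
    refine (hF.1.continuousOn.comp hB fun w hw ↦ ⟨LocalFrame.chart_mem_cdom hw, Set.mem_univ _⟩).congr
      hfB
  exact h.continuousAt (hopen.mem_nhds hw₀)

/-- FM is covered by finitely many images of products of a compact subset of M, lying in the domain
of a local frame, with the compact group SO(n). -/
instance [CompactSpace M] [T2Space M] : CompactSpace (FM o) := by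
  have : LocallyCompactSpace M := ChartedSpace.locallyCompactSpace (Eu n) M
  have hK : ∀ x : M, ∃ K : Set M, K ∈ 𝓝 x ∧ ∃ C : Set (FM o), IsCompact C ∧
      ∀ w : FM o, w.1 ∈ K → w ∈ C := by
    intro x
    obtain ⟨L⟩ := exists_localFrame o x
    obtain ⟨K, hK, hKL, hKc⟩ := local_compact_nhds (L.isOpen_dom.mem_nhds L.mem_dom)
    refine ⟨K, hK, _, (hKc.prod (isCompact_univ (X := SO n))).image_of_continuousOn
      (L.continuousOn_framePoint.mono (Set.prod_mono hKL (Set.Subset.refl _))), ?_⟩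
    rintro ⟨y, w⟩ hw
    obtain ⟨a, ha⟩ := (L.frame y).exists_rot w
    exact ⟨(y, a), ⟨hw, Set.mem_univ _⟩, congrArg (Sigma.mk y) ha⟩
  choose K hK C hC hKC using hK
  obtain ⟨t, ht⟩ := CompactSpace.elim_nhds_subcover K hK
  refine ⟨?_⟩
  have h : (Set.univ : Set (FM o)) = ⋃ x ∈ t, C x := by
    refine (Set.eq_univ_of_forall fun w ↦ ?_).symm
    have h1 : w.1 ∈ ⋃ x ∈ t, K x := by
      rw [ht]
      trivial
    simp only [Set.mem_iUnion] at h1 ⊢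
    obtain ⟨x, hx, hw⟩ := h1
    exact ⟨x, hx, hKC x w hw⟩
  rw [h]
  exact t.isCompact_biUnion fun x _ ↦ hC x

end FrameTopology

/-! ### The Riemannian measure in coordinates. -/

theorem setLIntegral_eq_of_subset {α : Type*} [MeasurableSpace α] {μ : Measure α} {A T : Set α}
    (hA : MeasurableSet A) (hT : MeasurableSet T) (hAT : A ⊆ T) {h : α → ENNReal}
    (h0 : ∀ p ∈ T, p ∉ A → h p = 0) : ∫⁻ p in T, h p ∂μ = ∫⁻ p in A, h p ∂μ := by
  rw [← lintegral_indicator hT, ← lintegral_indicator hA]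
  congr 1
  funext p
  by_cases hp : p ∈ A
  · rw [Set.indicator_of_mem hp, Set.indicator_of_mem (hAT hp)]
  · rw [Set.indicator_of_notMem hp]
    by_cases hp' : p ∈ T
    · rw [Set.indicator_of_mem hp', h0 p hp' hp]
    · rw [Set.indicator_of_notMem hp']

theorem det_toMat {n : ℕ} (T : Eu n →L[ℝ] Eu n) : (toMat T).det = T.det := by
  have h : (T : Eu n →ₗ[ℝ] Eu n) = Matrix.toEuclideanLin (toMat T) := by
    ext1 v
    exact (congrArg (fun S : Eu n →L[ℝ] Eu n ↦ S v) (toE_toMat T)).symm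
  rw [ContinuousLinearMap.det, h, Matrix.toEuclideanLin, Matrix.toLpLin_eq_toLin,
    LinearMap.det_toLin]

/-- The Gram determinant of the composition with an endomorphism. -/
theorem det_gram_comp {n : ℕ} {V : Type*} [NormedAddCommGroup V] [InnerProductSpace ℝ V]
    (K : Eu n →L[ℝ] V) (T : Eu n →L[ℝ] Eu n) :
    (Matrix.of fun i j : Fin n ↦ (inner ℝ (K (T (EuclideanSpace.single i 1)))
      (K (T (EuclideanSpace.single j 1))) : ℝ)).det =
    T.det ^ 2 * (Matrix.of fun i j : Fin n ↦ (inner ℝ (K (EuclideanSpace.single i 1))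
      (K (EuclideanSpace.single j 1)) : ℝ)).det := by
  have h : (Matrix.of fun i j : Fin n ↦ (inner ℝ (K (T (EuclideanSpace.single i 1)))
      (K (T (EuclideanSpace.single j 1))) : ℝ)) = (toMat T)ᵀ *
      (Matrix.of fun i j : Fin n ↦ (inner ℝ (K (EuclideanSpace.single i 1))
      (K (EuclideanSpace.single j 1)) : ℝ)) * toMat T := by
    ext i j
    have hT : ∀ i, T (EuclideanSpace.single i 1) =
        ∑ k, toMat T k i • (EuclideanSpace.single k 1 : Eu n) := fun i ↦
      (sum_single (T (EuclideanSpace.single i 1))).symm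
    simp only [Matrix.mul_apply, Matrix.of_apply, Matrix.transpose_apply]
    rw [hT i, hT j]
    simp only [map_sum, map_smul, inner_sum, sum_inner, inner_smul_left, inner_smul_right,
      conj_trivial, Finset.sum_mul, Finset.mul_sum]
    refine Finset.sum_congr rfl fun k _ ↦ Finset.sum_congr rfl fun l _ ↦ ?_
    ring
  rw [h, Matrix.det_mul, Matrix.det_mul, Matrix.det_transpose, det_toMat]
  ring

section Volume

set_option linter.unusedSectionVars false

variable {n : ℕ} {M : Type*} [TopologicalSpace M] [ChartedSpace (EuclideanSpace ℝ (Fin n)) M]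
  [IsManifold (𝓡 n) ∞ M] {x₀ : M} {p : Eu n}
  [RiemannianBundle (fun x : M ↦ TangentSpace (𝓡 n) x)]
  {o : ManifoldOrientation n M}

/-- The determinant of the metric in coordinates. -/
def gramDet (x₀ : M) (p : Eu n) : ℝ :=
  (Matrix.of fun i j : Fin n ↦ metricCoeff x₀ p (EuclideanSpace.single i 1)
    (EuclideanSpace.single j 1)).det

theorem mfderiv_symm_apply (hp : p ∈ (extChartAt (𝓡 n) x₀).target) (v : Eu n) :
    mfderiv 𝓘(ℝ, EuclideanSpace ℝ (Fin n)) (𝓡 n) (extChartAt (𝓡 n) x₀).symm p v =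
      coordField x₀ v ((extChartAt (𝓡 n) x₀).symm p) := by
  have hs := symm_mem_source hp
  have h := TangentBundle.symmL_trivializationAt (𝕜 := ℝ) (I := 𝓡 n) hs
  rw [(extChartAt (𝓡 n) x₀).right_inv hp, modelWithCornersSelf_coe, Set.range_id,
    mfderivWithin_univ] at h
  exact (congrArg (fun T : Eu n →L[ℝ] TangentSpace (𝓡 n) ((extChartAt (𝓡 n) x₀).symm p) ↦ T v)
    h).symm

/-- Orthonormality of the columns of σ means σᵀgσ = 1, hence det g · (det σ)² = 1. -/
theorem LocalFrame.gramDet_eq {L : LocalFrame o x₀} (hp : p ∈ L.cdom) :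
    √(gramDet x₀ p) = |(L.coordFrame p).det|⁻¹ := by
  have h := det_gram_comp ((tanTriv x₀).symmL ℝ ((extChartAt (𝓡 n) x₀).symm p)) (L.coordFrame p)
  have h1 : (Matrix.of fun i j : Fin n ↦ (inner ℝ
      ((tanTriv x₀).symmL ℝ ((extChartAt (𝓡 n) x₀).symm p)
        (L.coordFrame p (EuclideanSpace.single i 1)))
      ((tanTriv x₀).symmL ℝ ((extChartAt (𝓡 n) x₀).symm p)
        (L.coordFrame p (EuclideanSpace.single j 1))) : ℝ)) = 1 := by
    ext i j
    rw [Matrix.of_apply]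
    refine (metricCoeff_coordFrame hp _ _).trans ?_
    rw [Matrix.one_apply, EuclideanSpace.inner_single_left]
    simp
  rw [h1, Matrix.det_one] at h
  change 1 = _ * gramDet x₀ p at h
  have h2 : (L.coordFrame p).det ≠ 0 := by
    intro h0
    rw [h0] at h
    norm_num at h
  have h3 : gramDet x₀ p = (|(L.coordFrame p).det|⁻¹) ^ 2 := by
    rw [inv_pow, sq_abs]
    field_simp
    linarith
  rw [h3, Real.sqrt_sq (by positivity)]

variable [IsContMDiffRiemannianBundle (𝓡 n) ∞ (EuclideanSpace ℝ (Fin n))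
  (fun x : M ↦ TangentSpace (𝓡 n) x)]

theorem continuousOn_gramDet : ContinuousOn (gramDet (n := n) x₀) (extChartAt (𝓡 n) x₀).target := by
  unfold gramDet
  simp only [Matrix.det_apply]
  refine continuousOn_finsetSum _ fun τ _ ↦ ContinuousOn.const_smul ?_ _
  refine continuousOn_finsetProd _ fun i _ ↦ ?_
  exact (contDiffOn_metricCoeff _ _).continuousOn

/-- The transition map between charts in terms of tangent vectors. -/
theorem hasFDerivAt_transition {y₀ : M} (hp : p ∈ (extChartAt (𝓡 n) x₀).target)
    (hy : (extChartAt (𝓡 n) x₀).symm p ∈ (chartAt (Eu n) y₀).source) :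
    HasFDerivAt (fun q ↦ extChartAt (𝓡 n) y₀ ((extChartAt (𝓡 n) x₀).symm q))
      (((tanTriv y₀).continuousLinearMapAt ℝ ((extChartAt (𝓡 n) x₀).symm p)).comp
        ((tanTriv x₀).symmL ℝ ((extChartAt (𝓡 n) x₀).symm p))) p := by
  have h1 : ContDiffAt ℝ ∞ (fun q ↦ extChartAt (𝓡 n) y₀ ((extChartAt (𝓡 n) x₀).symm q)) p :=
    (contMDiffAt_iff_of_chart le_rfl hp).1 (contMDiffAt_chart hy)
  have h2 := (h1.differentiableAt (by simp)).hasFDerivAt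
  have hys : (extChartAt (𝓡 n) x₀).symm p ∈ (extChartAt (𝓡 n) y₀).source := by
    rwa [extChartAt_source]
  have h3 : ∀ m, m = (extChartAt (𝓡 n) x₀).symm p → ∀ u : TangentSpace (𝓡 n) m,
      mvfderiv (𝓡 n) (extChartAt (𝓡 n) y₀) m u = coordOf y₀ u := by
    intro m hm
    have h4 : (extChartAt (𝓡 n) y₀).symm (extChartAt (𝓡 n) y₀ m) = m := by
      rw [hm]
      exact (extChartAt (𝓡 n) y₀).left_inv hys
    have h5 : extChartAt (𝓡 n) y₀ m ∈ (extChartAt (𝓡 n) y₀).target := by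
      rw [hm]
      exact (extChartAt (𝓡 n) y₀).map_source hys
    have h6 : HasFDerivAt (fun q ↦ extChartAt (𝓡 n) y₀ ((extChartAt (𝓡 n) y₀).symm q))
        (ContinuousLinearMap.id ℝ (Eu n)) (extChartAt (𝓡 n) y₀ m) := by
      refine (hasFDerivAt_id _).congr_of_eventuallyEq ?_
      filter_upwards [(isOpen_extChartAt_target y₀).mem_nhds h5] with q hq
      exact (extChartAt (𝓡 n) y₀).right_inv hq
    have h7 := mvfderiv_eq_coordOf h5 h6
    rw [h4] at h7
    exact h7
  have h8 : fderiv ℝ (fun q ↦ extChartAt (𝓡 n) y₀ ((extChartAt (𝓡 n) x₀).symm q)) p =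
      ((tanTriv y₀).continuousLinearMapAt ℝ ((extChartAt (𝓡 n) x₀).symm p)).comp
        ((tanTriv x₀).symmL ℝ ((extChartAt (𝓡 n) x₀).symm p)) := by
    ext1 u
    rw [← mvfderiv_coordField hp h2 u, h3 _ rfl]
    rfl
  rwa [h8] at h2

theorem gramDet_transition {y₀ : M}
    (hy : (extChartAt (𝓡 n) x₀).symm p ∈ (chartAt (Eu n) y₀).source) :
    √(gramDet x₀ p) = |(((tanTriv y₀).continuousLinearMapAt ℝ ((extChartAt (𝓡 n) x₀).symm p)).comp
        ((tanTriv x₀).symmL ℝ ((extChartAt (𝓡 n) x₀).symm p)) : Eu n →L[ℝ] Eu n).det| *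
      √(gramDet y₀ (extChartAt (𝓡 n) y₀ ((extChartAt (𝓡 n) x₀).symm p))) := by
  have hys : (extChartAt (𝓡 n) x₀).symm p ∈ (extChartAt (𝓡 n) y₀).source := by
    rwa [extChartAt_source]
  have h := det_gram_comp ((tanTriv (n := n) y₀).symmL ℝ ((extChartAt (𝓡 n) x₀).symm p))
    (((tanTriv y₀).continuousLinearMapAt ℝ ((extChartAt (𝓡 n) x₀).symm p)).comp
        ((tanTriv x₀).symmL ℝ ((extChartAt (𝓡 n) x₀).symm p)))
  have h1 : ∀ v : Eu n, (tanTriv y₀).symmL ℝ ((extChartAt (𝓡 n) x₀).symm p)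
      ((((tanTriv y₀).continuousLinearMapAt ℝ ((extChartAt (𝓡 n) x₀).symm p)).comp
        ((tanTriv x₀).symmL ℝ ((extChartAt (𝓡 n) x₀).symm p))) v) =
      coordField x₀ v ((extChartAt (𝓡 n) x₀).symm p) := fun v ↦ coordField_coordOf hy _
  simp only [h1] at h
  have h2 : gramDet y₀ (extChartAt (𝓡 n) y₀ ((extChartAt (𝓡 n) x₀).symm p)) =
      (Matrix.of fun i j : Fin n ↦ (inner ℝ
        (coordField y₀ (EuclideanSpace.single i 1) ((extChartAt (𝓡 n) x₀).symm p))
        (coordField y₀ (EuclideanSpace.single j 1) ((extChartAt (𝓡 n) x₀).symm p)) : ℝ)).det := by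
    simp only [gramDet, metricCoeff]
    rw [(extChartAt (𝓡 n) y₀).left_inv hys]
  change gramDet x₀ p = _ at h
  rw [h, h2, Real.sqrt_mul (sq_nonneg _), Real.sqrt_sq_eq_abs]
  rfl

variable [MeasurableSpace M] [BorelSpace M]

theorem chartVolume_eq (x : M) : chartVolume (n := n) x =
    ((volume.restrict (extChartAt (𝓡 n) x).target).withDensity fun y ↦
      ENNReal.ofReal √(gramDet x y)).map (extChartAt (𝓡 n) x).symm := by
  rw [chartVolume]
  congr 1
  refine withDensity_congr_ae ?_
  filter_upwards [ae_restrict_mem (isOpen_extChartAt_target (I := 𝓡 n) x).measurableSet] with y hy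
  rw [gramDet]
  congr 3
  ext i j
  rw [Matrix.of_apply, Matrix.of_apply, metricCoeff, ← mfderiv_symm_apply hy,
    ← mfderiv_symm_apply hy]

theorem aemeasurable_symm (x : M) : AEMeasurable (extChartAt (𝓡 n) x).symm
    (volume.restrict (extChartAt (𝓡 n) x).target) :=
  (continuousOn_extChartAt_symm x).aemeasurable (isOpen_extChartAt_target x).measurableSet

theorem aemeasurable_gramDet (x : M) : AEMeasurable (fun y ↦ ENNReal.ofReal √(gramDet x y))
    (volume.restrict (extChartAt (𝓡 n) x).target) :=
  ((continuousOn_gramDet (x₀ := x)).aemeasurable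
    (isOpen_extChartAt_target x).measurableSet).sqrt.ennreal_ofReal

theorem lintegral_chartVolume (x : M) {f : M → ENNReal} (hf : Measurable f) :
    ∫⁻ y, f y ∂(chartVolume (n := n) x) = ∫⁻ p in (extChartAt (𝓡 n) x).target,
      ENNReal.ofReal √(gramDet x p) * f ((extChartAt (𝓡 n) x).symm p) := by
  rw [chartVolume_eq, lintegral_map' hf.aemeasurable
      ((aemeasurable_symm x).mono_ac (withDensity_absolutelyContinuous _ _))]
  exact lintegral_withDensity_eq_lintegral_mul₀ (aemeasurable_gramDet x)
      (hf.comp_aemeasurable (aemeasurable_symm x))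

/-- Two chart measures agree on the overlap: this is the change of variables formula, the Jacobian
of the transition map being exactly the factor relating the two densities. -/
theorem lintegral_chartVolume_congr (x y : M) {f : M → ENNReal} (hf : Measurable f)
    (h0 : ∀ m, m ∉ (chartAt (Eu n) x).source ∩ (chartAt (Eu n) y).source → f m = 0) :
    ∫⁻ m, f m ∂(chartVolume (n := n) x) = ∫⁻ m, f m ∂(chartVolume (n := n) y) := by
  have hopen : ∀ x y : M, IsOpen ((extChartAt (𝓡 n) x).target ∩
      (extChartAt (𝓡 n) x).symm ⁻¹' (chartAt (Eu n) y).source) := fun x y ↦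
    (continuousOn_extChartAt_symm x).isOpen_inter_preimage (isOpen_extChartAt_target x)
      (chartAt (Eu n) y).open_source
  have hres : ∀ x y : M, (∀ m, m ∉ (chartAt (Eu n) x).source ∩ (chartAt (Eu n) y).source → f m = 0) →
      ∫⁻ m, f m ∂(chartVolume (n := n) x) = ∫⁻ p in (extChartAt (𝓡 n) x).target ∩
        (extChartAt (𝓡 n) x).symm ⁻¹' (chartAt (Eu n) y).source,
        ENNReal.ofReal √(gramDet x p) * f ((extChartAt (𝓡 n) x).symm p) := by
    intro x y h0
    rw [lintegral_chartVolume x hf]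
    refine setLIntegral_eq_of_subset (hopen x y).measurableSet
      (isOpen_extChartAt_target x).measurableSet Set.inter_subset_left fun p hp hp' ↦ ?_
    rw [h0 _ fun h ↦ hp' ⟨hp, h.2⟩, mul_zero]
  have himg : (fun q ↦ extChartAt (𝓡 n) y ((extChartAt (𝓡 n) x).symm q)) ''
      ((extChartAt (𝓡 n) x).target ∩ (extChartAt (𝓡 n) x).symm ⁻¹' (chartAt (Eu n) y).source) =
      (extChartAt (𝓡 n) y).target ∩ (extChartAt (𝓡 n) y).symm ⁻¹' (chartAt (Eu n) x).source := by
    ext q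
    constructor
    · rintro ⟨p, ⟨hp, hpy⟩, rfl⟩
      have hpy' : (extChartAt (𝓡 n) x).symm p ∈ (extChartAt (𝓡 n) y).source := by
        rwa [extChartAt_source]
      refine ⟨(extChartAt (𝓡 n) y).map_source hpy', ?_⟩
      rw [Set.mem_preimage, (extChartAt (𝓡 n) y).left_inv hpy']
      exact symm_mem_source hp
    · rintro ⟨hq, hqx⟩
      have hqx' : (extChartAt (𝓡 n) y).symm q ∈ (extChartAt (𝓡 n) x).source := by
        rwa [extChartAt_source]
      refine ⟨extChartAt (𝓡 n) x ((extChartAt (𝓡 n) y).symm q),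
        ⟨(extChartAt (𝓡 n) x).map_source hqx', ?_⟩, ?_⟩
      · rw [Set.mem_preimage, (extChartAt (𝓡 n) x).left_inv hqx']
        exact symm_mem_source hq
      · beta_reduce
        rw [(extChartAt (𝓡 n) x).left_inv hqx', (extChartAt (𝓡 n) y).right_inv hq]
  have hinj : Set.InjOn (fun q ↦ extChartAt (𝓡 n) y ((extChartAt (𝓡 n) x).symm q))
      ((extChartAt (𝓡 n) x).target ∩
        (extChartAt (𝓡 n) x).symm ⁻¹' (chartAt (Eu n) y).source) := by
    rintro p ⟨hp, hpy⟩ q ⟨hq, hqy⟩ h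
    rw [Set.mem_preimage, ← extChartAt_source (𝓡 n)] at hpy hqy
    exact (extChartAt (𝓡 n) x).symm.injOn hp hq ((extChartAt (𝓡 n) y).injOn hpy hqy h)
  rw [hres x y h0, hres y x fun m hm ↦ h0 m fun h ↦ hm h.symm, ← himg,
    lintegral_image_eq_lintegral_abs_det_fderiv_mul volume (hopen x y).measurableSet
      (fun p hp ↦ (hasFDerivAt_transition hp.1 hp.2).hasFDerivWithinAt) hinj]
  refine setLIntegral_congr_fun (hopen x y).measurableSet fun p hp ↦ ?_
  have hpy : (extChartAt (𝓡 n) x).symm p ∈ (extChartAt (𝓡 n) y).source := by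
    rw [extChartAt_source]
    exact hp.2
  beta_reduce
  rw [(extChartAt (𝓡 n) y).left_inv hpy, gramDet_transition hp.2,
    ENNReal.ofReal_mul (abs_nonneg _), mul_assoc]

theorem chartVolume_apply (x : M) {S : Set M} (hS : MeasurableSet S) :
    chartVolume (n := n) x S = ∫⁻ m, S.indicator 1 m ∂(chartVolume (n := n) x) := by
  rw [lintegral_indicator_one hS]

theorem chartVolume_compl_source (x : M) :
    chartVolume (n := n) x ((chartAt (Eu n) x).source)ᶜ = 0 := by
  have hm : MeasurableSet ((chartAt (Eu n) x).source)ᶜ :=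
    (chartAt (Eu n) x).open_source.measurableSet.compl
  rw [chartVolume_apply x hm, lintegral_chartVolume x (measurable_one.indicator hm)]
  refine (setLIntegral_congr_fun (g := 0) (isOpen_extChartAt_target x).measurableSet
    fun p hp ↦ ?_).trans (by simp)
  have h : (extChartAt (𝓡 n) x).symm p ∉ ((chartAt (Eu n) x).source)ᶜ :=
    fun h ↦ h (symm_mem_source hp)
  rw [Set.indicator_of_notMem h, mul_zero]
  rfl

/-- The Riemannian measure restricts to the ones in charts. -/
theorem riemannianVolume_apply (x : M) {S : Set M} (hS : MeasurableSet S)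
    (hSx : S ⊆ (chartAt (Eu n) x).source) :
    riemannianVolume n M S = chartVolume (n := n) x S := by
  have hU : ∀ x : M, MeasurableSet (chartAt (Eu n) x).source := fun x ↦
    (chartAt (Eu n) x).open_source.measurableSet
  refine le_antisymm ?_ (Measure.le_iff'.1 (le_iSup (fun x : M ↦ chartVolume (n := n) x) x) S)
  -- A supremum of measures is not computed setwise, so it is bounded through the order instead.
  -- Inside the chart domain every chart measure is dominated by the one at x because they agree on
  -- overlaps; outside, the supremum itself serves as a bound.
  have h : riemannianVolume n M ≤ chartVolume (n := n) x +
      (riemannianVolume n M).restrict ((chartAt (Eu n) x).source)ᶜ := by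
    refine iSup_le fun y ↦ Measure.le_iff.2 fun T hT ↦ ?_
    rw [Measure.add_apply, ← measure_inter_add_sdiff T (hU x), Measure.restrict_apply hT]
    refine add_le_add ?_ ?_
    · rw [← measure_inter_add_sdiff (T ∩ (chartAt (Eu n) x).source) (hU y)]
      have h1 : chartVolume (n := n) y
          ((T ∩ (chartAt (Eu n) x).source) \ (chartAt (Eu n) y).source) = 0 :=
        measure_mono_null (fun m hm ↦ hm.2) (chartVolume_compl_source y)
      have hm := (hT.inter (hU x)).inter (hU y)
      rw [h1, add_zero, chartVolume_apply y hm,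
        lintegral_chartVolume_congr y x (measurable_one.indicator hm) fun m h ↦
          Set.indicator_of_notMem (fun h' ↦ h ⟨h'.2, h'.1.2⟩) _, ← chartVolume_apply x hm]
      exact measure_mono fun m hm ↦ hm.1.1
    · exact Measure.le_iff'.1 (le_iSup (fun x : M ↦ chartVolume (n := n) x) y) _
  refine (Measure.le_iff'.1 h S).trans ?_
  rw [Measure.add_apply, Measure.restrict_apply hS]
  have h2 : S ∩ ((chartAt (Eu n) x).source)ᶜ = ∅ := by
    ext m
    exact ⟨fun h ↦ h.2 (hSx h.1), fun h ↦ h.elim⟩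
  rw [h2, measure_empty, add_zero]

theorem riemannianVolume_restrict (x : M) :
    (riemannianVolume n M).restrict (chartAt (Eu n) x).source = chartVolume (n := n) x := by
  have hU : MeasurableSet (chartAt (Eu n) x).source := (chartAt (Eu n) x).open_source.measurableSet
  ext S hS
  rw [Measure.restrict_apply hS, riemannianVolume_apply x (hS.inter hU) Set.inter_subset_right]
  rw [← measure_inter_add_sdiff S hU]
  have h1 : chartVolume (n := n) x (S \ (chartAt (Eu n) x).source) = 0 :=
    measure_mono_null (fun m hm ↦ hm.2) (chartVolume_compl_source x)
  rw [h1, add_zero]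

theorem lintegral_riemannianVolume (L : LocalFrame o x₀) {f : M → ENNReal} (hf : Measurable f)
    (h0 : ∀ m, m ∉ L.dom → f m = 0) :
    ∫⁻ m, f m ∂(riemannianVolume n M) = ∫⁻ p in L.cdom,
      ENNReal.ofReal |(L.coordFrame p).det|⁻¹ * f ((extChartAt (𝓡 n) x₀).symm p) := by
  have h1 : ∫⁻ m, f m ∂(riemannianVolume n M) =
      ∫⁻ m in (chartAt (Eu n) x₀).source, f m ∂(riemannianVolume n M) := by
    rw [← lintegral_indicator (chartAt (Eu n) x₀).open_source.measurableSet]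
    congr 1
    funext m
    by_cases hm : m ∈ (chartAt (Eu n) x₀).source
    · rw [Set.indicator_of_mem hm]
    · rw [Set.indicator_of_notMem hm, h0 m fun h ↦ hm (L.dom_subset h)]
  rw [h1, riemannianVolume_restrict, lintegral_chartVolume x₀ hf,
    setLIntegral_eq_of_subset L.isOpen_cdom.measurableSet
      (isOpen_extChartAt_target x₀).measurableSet Set.inter_subset_left fun p hp hp' ↦ by
        rw [h0 _ fun h ↦ hp' ⟨hp, h⟩, mul_zero]]
  refine setLIntegral_congr_fun L.isOpen_cdom.measurableSet fun p hp ↦ ?_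
  rw [L.gramDet_eq hp]

/-- On a compact neighbourhood contained in a chart the density is bounded, and the image of the
neighbourhood has finite Lebesgue measure. -/
instance [T2Space M] : IsFiniteMeasureOnCompacts (riemannianVolume n M) := by
  have : LocallyCompactSpace M := ChartedSpace.locallyCompactSpace (Eu n) M
  have : IsLocallyFiniteMeasure (riemannianVolume n M) := by
    refine ⟨fun x ↦ ?_⟩
    obtain ⟨K, hK, hKx, hKc⟩ := local_compact_nhds
      ((chartAt (Eu n) x).open_source.mem_nhds (mem_chart_source _ x))
    refine ⟨K, hK, ?_⟩
    have hKm := hKc.measurableSet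
    have hKs : K ⊆ (extChartAt (𝓡 n) x).source := by rwa [extChartAt_source]
    have hC : IsCompact (extChartAt (𝓡 n) x '' K) :=
      hKc.image_of_continuousOn ((continuousOn_extChartAt x).mono hKs)
    have hCT : extChartAt (𝓡 n) x '' K ⊆ (extChartAt (𝓡 n) x).target := by
      rintro _ ⟨m, hm, rfl⟩
      exact (extChartAt (𝓡 n) x).map_source (hKs hm)
    obtain ⟨B, hB⟩ := hC.bddAbove_image ((continuousOn_gramDet (x₀ := x)).sqrt.mono hCT)
    rw [riemannianVolume_apply x hKm hKx, chartVolume_apply x hKm,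
      lintegral_chartVolume x (measurable_one.indicator hKm),
      setLIntegral_eq_of_subset hC.measurableSet (isOpen_extChartAt_target x).measurableSet hCT
        fun p hp hp' ↦ by
          rw [Set.indicator_of_notMem, mul_zero]
          exact fun h ↦ hp' ⟨_, h, (extChartAt (𝓡 n) x).right_inv hp⟩]
    refine (setLIntegral_mono' hC.measurableSet (g := fun _ ↦ ENNReal.ofReal B)
      fun p hp ↦ ?_).trans_lt ?_
    · refine (mul_le_mul' (ENNReal.ofReal_le_ofReal (hB ⟨p, hp, rfl⟩))
        (Set.indicator_le_self' (fun _ _ ↦ zero_le) _)).trans ?_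
      simp
    · rw [setLIntegral_const]
      exact ENNReal.mul_lt_top ENNReal.ofReal_lt_top hC.measure_lt_top
  infer_instance

end Volume

/-! ### Jacobi's formula and the divergence of a frame field. -/

section Determinant

variable {n : ℕ}

/-- The trace of an endomorphism of Euclidean space. -/
def trE (T : Eu n →L[ℝ] Eu n) : ℝ := ∑ k, T (EuclideanSpace.single k 1) k

theorem trE_sub (S T : Eu n →L[ℝ] Eu n) : trE (S - T) = trE S - trE T := by
  simp [trE, Finset.sum_sub_distrib]

theorem toMat_comp (S T : Eu n →L[ℝ] Eu n) : toMat (S.comp T) = toMat S * toMat T := by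
  apply toE_injective
  rw [toE_toMat, toE_mul, toE_toMat, toE_toMat]

theorem trE_comp_comm (S T : Eu n →L[ℝ] Eu n) : trE (S.comp T) = trE (T.comp S) := by
  have h : ∀ T : Eu n →L[ℝ] Eu n, trE T = (toMat T).trace := fun T ↦ rfl
  rw [h, h, toMat_comp, toMat_comp, Matrix.trace_mul_comm]

theorem trE_of_skew {T : Eu n →L[ℝ] Eu n} (hT : ∀ v w, inner ℝ (T v) w = - inner ℝ v (T w)) :
    trE T = 0 := by
  refine Finset.sum_eq_zero fun k _ ↦ ?_
  have h := hT (EuclideanSpace.single k 1) (EuclideanSpace.single k 1)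
  rw [EuclideanSpace.inner_single_right, EuclideanSpace.inner_single_left] at h
  simp only [conj_trivial, one_mul] at h
  linarith

theorem contDiff_det : ContDiff ℝ ∞ (fun T : Eu n →L[ℝ] Eu n ↦ T.det) := by
  simp only [← det_toMat, Matrix.det_apply]
  refine ContDiff.sum fun τ _ ↦ ContDiff.const_smul _ (contDiff_prod fun i _ ↦ ?_)
  exact (EuclideanSpace.proj (τ i) : Eu n →L[ℝ] ℝ).contDiff.comp
    (contDiff_id.clm_apply contDiff_const)

theorem hasDerivAt_det_one_add_smul (A : Matrix (Fin n) (Fin n) ℝ) :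
    HasDerivAt (fun t : ℝ ↦ (1 + t • A).det) A.trace 0 := by
  have h := (1 + (Polynomial.X : Polynomial ℝ) • A.map Polynomial.C).det.hasDerivAt (0 : ℝ)
  rw [Matrix.derivative_det_one_add_X_smul] at h
  refine h.congr_of_eventuallyEq (Filter.Eventually.of_forall fun t ↦ ?_)
  beta_reduce
  rw [← Polynomial.coe_evalRingHom, RingHom.map_det]
  congr 1
  ext i j
  simp only [RingHom.mapMatrix_apply, Matrix.map_apply, Matrix.add_apply, Matrix.smul_apply,
    smul_eq_mul, Matrix.one_apply, Polynomial.coe_evalRingHom, Polynomial.eval_add,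
    Polynomial.eval_mul, Polynomial.eval_X, Polynomial.eval_C]
  split_ifs <;> simp

/-- Jacobi's formula. -/
theorem fderiv_det {T S : Eu n →L[ℝ] Eu n} (h : T.comp S = ContinuousLinearMap.id ℝ (Eu n))
    (B : Eu n →L[ℝ] Eu n) :
    fderiv ℝ (fun T : Eu n →L[ℝ] Eu n ↦ T.det) T B = T.det * trE (S.comp B) := by
  have h1 := ((contDiff_det (n := n)).differentiable (by simp) T).hasFDerivAt
  have h2 : HasDerivAt (fun t : ℝ ↦ T + t • B) B 0 := by
    have h3 := (hasDerivAt_id (0 : ℝ)).smul_const B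
    rw [one_smul] at h3
    exact h3.const_add T
  have h0 : T + (0 : ℝ) • B = T := by
    ext1 v
    simp
  have h4 : HasDerivAt (fun t : ℝ ↦ (T + t • B).det)
      (fderiv ℝ (fun T : Eu n →L[ℝ] Eu n ↦ T.det) T B) 0 := by
    rw [← h0] at h1
    have h5 := h1.comp_hasDerivAt (0 : ℝ) h2
    rw [h0] at h5
    exact h5
  -- The factorization T + tB = T(1 + tSB) reduces the derivative to the identity matrix, where it
  -- is the trace.
  have h6 : ∀ t : ℝ, (T + t • B).det = T.det * (1 + t • toMat (S.comp B)).det := by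
    intro t
    have h7 : toMat (T + t • B) = toMat T * (1 + t • toMat (S.comp B)) := by
      apply toE_injective
      rw [toE_mul, toE_toMat, toE_toMat, toE_add, toE_one, toE_smul, toE_toMat]
      ext1 v
      have h8 := congrArg (fun A : Eu n →L[ℝ] Eu n ↦ A (B v)) h
      simp only [ContinuousLinearMap.comp_apply, ContinuousLinearMap.id_apply] at h8
      simp [h8]
    rw [← det_toMat, h7, Matrix.det_mul, det_toMat]
  simp only [h6] at h4
  exact h4.unique ((hasDerivAt_det_one_add_smul _).const_mul _)

/-- The divergence of a vector field of a frame with respect to the volume density of the frame, in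
terms of the connection form. -/
theorem divergence_frame {σ : Eu n → Eu n →L[ℝ] Eu n} {S : Eu n →L[ℝ] Eu n} {p : Eu n}
    {θ Γ : Eu n →L[ℝ] Eu n →L[ℝ] Eu n} (hσ : DifferentiableAt ℝ σ p)
    (h1 : (σ p).comp S = ContinuousLinearMap.id ℝ (Eu n))
    (h2 : S.comp (σ p) = ContinuousLinearMap.id ℝ (Eu n))
    (hθ : ∀ u, (σ p).comp (θ u) = fderiv ℝ σ p u + (Γ u).comp (σ p))
    (hskew : ∀ u v w, inner ℝ (θ u v) w = - inner ℝ v (θ u w))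
    (hΓ : ∀ u v, Γ u v = Γ v u) (v : Eu n) :
    ∑ k, fderiv ℝ (fun q ↦ |(σ q).det|⁻¹ * σ q v k) p (EuclideanSpace.single k 1) =
      |(σ p).det|⁻¹ * ∑ i, θ (σ p (EuclideanSpace.single i 1)) v i := by
  have hdet : (σ p).det ≠ 0 := by
    intro h0
    have h3 := congrArg (fun T : Eu n →L[ℝ] Eu n ↦ (toMat T).det) h1
    simp only [toMat_comp, Matrix.det_mul, det_toMat, h0, zero_mul] at h3
    have h4 : (ContinuousLinearMap.id ℝ (Eu n)).det = 1 := LinearMap.det_id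
    rw [h4] at h3
    exact zero_ne_one h3
  -- The real logarithm disregards the sign of its argument, so one formula covers both signs of the
  -- determinant and can be differentiated.
  have hJ : ∀ q, (σ q).det ≠ 0 → |(σ q).det|⁻¹ = Real.exp (-Real.log (σ q).det) := by
    intro q hq
    rw [Real.exp_neg, Real.exp_log_eq_abs hq]
  have hd : HasFDerivAt (fun q ↦ (σ q).det)
      ((fderiv ℝ (fun T : Eu n →L[ℝ] Eu n ↦ T.det) (σ p)).comp (fderiv ℝ σ p)) p :=
    ((contDiff_det (n := n)).differentiable (by simp) (σ p)).hasFDerivAt.comp p hσ.hasFDerivAt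
  have hJd : HasFDerivAt (fun q ↦ |(σ q).det|⁻¹) (|(σ p).det|⁻¹ • -(((σ p).det)⁻¹ •
      ((fderiv ℝ (fun T : Eu n →L[ℝ] Eu n ↦ T.det) (σ p)).comp (fderiv ℝ σ p)))) p := by
    have h3 : HasFDerivAt (fun q ↦ Real.exp (-Real.log (σ q).det))
        (Real.exp (-Real.log (σ p).det) • -(((σ p).det)⁻¹ •
          ((fderiv ℝ (fun T : Eu n →L[ℝ] Eu n ↦ T.det) (σ p)).comp (fderiv ℝ σ p)))) p :=
      (hd.log hdet).neg.exp
    rw [← hJ p hdet] at h3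
    refine h3.congr_of_eventuallyEq ?_
    filter_upwards [hd.continuousAt.eventually_ne hdet] with q hq using hJ q hq
  -- The logarithmic derivative of the density is -tr(σ⁻¹dσ). By the gauge relation this is tr Γ -
  -- tr θ, and tr θ = 0 by skewness.
  have hJv : ∀ u, (|(σ p).det|⁻¹ • -(((σ p).det)⁻¹ •
      ((fderiv ℝ (fun T : Eu n →L[ℝ] Eu n ↦ T.det) (σ p)).comp (fderiv ℝ σ p)))) u =
      |(σ p).det|⁻¹ * trE (Γ u) := by
    intro u
    have h3 : S.comp (fderiv ℝ σ p u) = θ u - S.comp ((Γ u).comp (σ p)) := by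
      have h4 : fderiv ℝ σ p u = (σ p).comp (θ u) - (Γ u).comp (σ p) := by
        rw [hθ, add_sub_cancel_right]
      rw [h4, ContinuousLinearMap.comp_sub, ← ContinuousLinearMap.comp_assoc, h2,
        ContinuousLinearMap.id_comp]
    have h5 : trE (S.comp (fderiv ℝ σ p u)) = - trE (Γ u) := by
      rw [h3, trE_sub, trE_of_skew (hskew u), trE_comp_comm S, ContinuousLinearMap.comp_assoc, h1,
        ContinuousLinearMap.comp_id, zero_sub]
    simp only [_root_.smul_apply, _root_.neg_apply, ContinuousLinearMap.comp_apply, smul_eq_mul]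
    rw [fderiv_det h1, h5]
    field_simp
  have hterm : ∀ k, fderiv ℝ (fun q ↦ |(σ q).det|⁻¹ * σ q v k) p (EuclideanSpace.single k 1) =
      |(σ p).det|⁻¹ * ((fderiv ℝ σ p (EuclideanSpace.single k 1)) v k) +
        |(σ p).det|⁻¹ * trE (Γ (EuclideanSpace.single k 1)) * (σ p v k) := by
    intro k
    have h3 : HasFDerivAt (fun q ↦ σ q v k) ((EuclideanSpace.proj k : Eu n →L[ℝ] ℝ).comp
        ((fderiv ℝ σ p).flip v)) p := by
      have h4 := (EuclideanSpace.proj k : Eu n →L[ℝ] ℝ).hasFDerivAt.comp p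
        (hσ.hasFDerivAt.clm_apply (hasFDerivAt_const v p))
      refine h4.congr_fderiv ?_
      ext u
      simp
    have h5 := (hJd.mul h3).fderiv
    have h6 := congrArg (fun T : Eu n →L[ℝ] ℝ ↦ T (EuclideanSpace.single k 1)) h5
    refine h6.trans ?_
    rw [_root_.add_apply, _root_.smul_apply, _root_.smul_apply, hJv]
    simp only [ContinuousLinearMap.comp_apply, ContinuousLinearMap.flip_apply, smul_eq_mul]
    rw [mul_comm (σ p v k)]
    rfl
  simp only [hterm]
  rw [Finset.sum_add_distrib]
  have hΓl : ∑ k, |(σ p).det|⁻¹ * trE (Γ (EuclideanSpace.single k 1)) * (σ p v k) =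
      |(σ p).det|⁻¹ * trE (Γ (σ p v)) := by
    have h3 : trE (Γ (σ p v)) = ∑ k, (σ p v k) * trE (Γ (EuclideanSpace.single k 1)) := by
      conv_lhs => rw [← sum_single (σ p v)]
      simp only [trE, map_sum, map_smul, _root_.sum_apply, _root_.smul_apply, WithLp.ofLp_sum,
        Finset.sum_apply, PiLp.smul_apply, smul_eq_mul, Finset.mul_sum]
      exact Finset.sum_comm
    rw [h3, Finset.mul_sum]
    exact Finset.sum_congr rfl fun k _ ↦ by ring
  -- By symmetry of Γ, dσ(u)v = σθ(u)v - Γ(σv)u. Taking the trace over u produces -tr Γ(σv), which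
  -- cancels the contribution of the density.
  have hσl : ∑ k, (fderiv ℝ σ p (EuclideanSpace.single k 1)) v k =
      ∑ i, θ (σ p (EuclideanSpace.single i 1)) v i - trE (Γ (σ p v)) := by
    have h3 : ∀ u, fderiv ℝ σ p u v = σ p (θ u v) - Γ (σ p v) u := by
      intro u
      have h4 := congrArg (fun T : Eu n →L[ℝ] Eu n ↦ T v) (hθ u)
      simp only [ContinuousLinearMap.comp_apply, _root_.add_apply] at h4
      rw [h4, hΓ u, add_sub_cancel_right]
    have h5 : trE ((σ p).comp (θ.flip v)) = trE ((θ.flip v).comp (σ p)) := trE_comp_comm _ _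
    have h6 : trE ((θ.flip v).comp (σ p)) = ∑ i, θ (σ p (EuclideanSpace.single i 1)) v i := rfl
    rw [← h6, ← h5]
    simp only [h3, PiLp.sub_apply, Finset.sum_sub_distrib]
    rfl
  rw [hΓl, ← Finset.mul_sum, hσl]
  ring

end Determinant

/-! ### Integrals of derivatives -/

/-- The integral of the derivative along a measure preserving flow vanishes. -/
theorem integral_deriv_flow_eq_zero {Ω : Type*} [TopologicalSpace Ω] [CompactSpace Ω]
    [MeasurableSpace Ω] [BorelSpace Ω] {μ : Measure Ω} [IsFiniteMeasure μ] {Φ : ℝ → Ω → Ω}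
    (hΦ : ∀ t, MeasurePreserving (Φ t) μ μ) (h0 : ∀ a, Φ 0 a = a) (hc : ∀ t, Continuous (Φ t))
    {ψ ψ' : Ω → ℝ} (hψ : Continuous ψ) (hψ' : Continuous ψ')
    (hd : ∀ a t, HasDerivAt (fun t ↦ ψ (Φ t a)) (ψ' (Φ t a)) t) : ∫ a, ψ' a ∂μ = 0 := by
  obtain ⟨C, hC⟩ := (isCompact_univ.image hψ').isBounded.exists_norm_le
  have hint : ∀ {g : Ω → ℝ}, Continuous g → Integrable g μ := by
    intro g hg
    obtain ⟨B, hB⟩ := (isCompact_univ.image hg).isBounded.exists_norm_le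
    exact Integrable.of_bound hg.measurable.aestronglyMeasurable B
      (Filter.Eventually.of_forall fun a ↦ hB _ ⟨a, trivial, rfl⟩)
  -- The derivative is taken under the integral sign with a constant bound, ψ' being continuous on a
  -- compact space. Invariance of the measure makes the integral constant in t.
  have h := hasDerivAt_integral_of_dominated_loc_of_deriv_le (μ := μ) (x₀ := (0 : ℝ))
    (s := Set.univ) (F := fun t a ↦ ψ (Φ t a)) (F' := fun t a ↦ ψ' (Φ t a)) (bound := fun _ ↦ C)
    Filter.univ_mem
    (Filter.Eventually.of_forall fun t ↦ (hψ.comp (hc t)).measurable.aestronglyMeasurable)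
    (hint (hψ.comp (hc 0))) (hψ'.comp (hc 0)).measurable.aestronglyMeasurable
    (Filter.Eventually.of_forall fun a t _ ↦ hC _ ⟨_, trivial, rfl⟩) (integrable_const C)
    (Filter.Eventually.of_forall fun a t _ ↦ hd a t)
  have h1 : (fun t ↦ ∫ a, ψ (Φ t a) ∂μ) = fun _ ↦ ∫ a, ψ a ∂μ := by
    funext t
    conv_rhs => rw [← (hΦ t).map_eq]
    rw [integral_map (hΦ t).measurable.aemeasurable hψ.measurable.aestronglyMeasurable]
  have h2 := h.2
  rw [h1] at h2
  have h3 := h2.unique (hasDerivAt_const (0 : ℝ) _)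
  simpa only [h0] using h3

/-- The integral of a partial derivative of a compactly supported function vanishes. -/
theorem integral_fderiv_apply_eq_zero {E : Type*} [NormedAddCommGroup E] [NormedSpace ℝ E]
    [FiniteDimensional ℝ E] [MeasurableSpace E] [BorelSpace E] {μ : Measure E} [μ.IsAddHaarMeasure]
    {g : E → ℝ} (hg : ContDiff ℝ 1 g) (hc : HasCompactSupport g) (v : E) :
    ∫ x, fderiv ℝ g x v ∂μ = 0 := by
  have h1 : Continuous fun x ↦ fderiv ℝ g x v :=
    (hg.continuous_fderiv (by norm_num)).clm_apply continuous_const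
  have h2 : HasCompactSupport fun x ↦ fderiv ℝ g x v :=
    (hc.fderiv (𝕜 := ℝ)).comp_left (g := fun T : E →L[ℝ] ℝ ↦ T v) rfl
  have h := integral_mul_fderiv_eq_neg_fderiv_mul_of_integrable (μ := μ) (𝕜 := ℝ)
    (f := fun _ ↦ (1 : ℝ)) (g := g) (v := v) (by simp)
    (by simpa using h1.integrable_of_hasCompactSupport h2)
    (by simpa using hg.continuous.integrable_of_hasCompactSupport hc)
    (fun x _ ↦ differentiableAt_const _) (fun x _ ↦ hg.differentiable (by norm_num) x)
  simpa using h

section FrameMeasure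

set_option linter.unusedSectionVars false

variable {n : ℕ} [NeZero n] {M : Type*} [TopologicalSpace M]
  [ChartedSpace (EuclideanSpace ℝ (Fin n)) M] [IsManifold (𝓡 n) ∞ M]
  [RiemannianBundle (fun x : M ↦ TangentSpace (𝓡 n) x)]
  [IsContMDiffRiemannianBundle (𝓡 n) ∞ (EuclideanSpace ℝ (Fin n))
    (fun x : M ↦ TangentSpace (𝓡 n) x)]
  {o : ManifoldOrientation n M} {x₀ x : M}

/-! ### The invariant measures on the fibres of the frame bundle -/

/-- The identification of `SO(n)` with the fibre of the frame bundle given by a frame. -/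
def fibrePoint (w : FrameAt o x) (a : SO n) : FM o := ⟨x, w.rot a⟩

theorem fibrePoint_rot (w : FrameAt o x) (a b : SO n) :
    fibrePoint (w.rot a) b = fibrePoint w (a * b) := by
  rw [fibrePoint, FrameAt.rot_rot]
  rfl

theorem fibrePoint_mul (w : FrameAt o x) (a b : SO n) :
    (fibrePoint w a).rot b = fibrePoint w (a * b) := fibrePoint_rot w a b

theorem continuous_fibrePoint (w : FrameAt o x) : Continuous (fibrePoint w) := by
  obtain ⟨L⟩ := exists_localFrame o x
  obtain ⟨b, rfl⟩ := (L.frame x).exists_rot w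
  have h := L.continuousOn_framePoint.comp_continuous (f := fun a : SO n ↦ (x, b * a))
    (by fun_prop) fun a ↦ ⟨L.mem_dom, Set.mem_univ _⟩
  exact h.congr fun a ↦ (fibrePoint_rot _ b a).symm

variable (o) in
/-- The invariant probability measure on the frames at a point. -/
def fibreMeasure (x : M) : Measure (FM o) :=
  (haarSO n).map (fibrePoint (Classical.choice (nonempty_frameAt o x)))

/-- Another reference frame differs by a left translation of SO(n), under which Haar measure is
invariant. The arbitrary choice of frames may thus be replaced by a smooth one locally. -/
theorem fibreMeasure_eq (w : FrameAt o x) :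
    fibreMeasure o x = (haarSO n).map (fibrePoint w) := by
  obtain ⟨b, rfl⟩ := (Classical.choice (nonempty_frameAt o x)).exists_rot w
  rw [funext (fibrePoint_rot (Classical.choice (nonempty_frameAt o x)) b)]
  have h := Measure.map_map (μ := haarSO n) (continuous_fibrePoint
    (Classical.choice (nonempty_frameAt o x))).measurable (measurable_const_mul b)
  rw [map_mul_left_eq_self] at h
  exact h

theorem fibreMeasure_univ (x : M) : fibreMeasure o x Set.univ = 1 := by
  rw [fibreMeasure, Measure.map_apply (continuous_fibrePoint _).measurable MeasurableSet.univ]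
  simp

theorem coordField_sum (hx : x ∈ (chartAt (Eu n) x₀).source) (c : Fin n → ℝ)
    (v : Fin n → TangentSpace (𝓡 n) x) :
    coordField x₀ (∑ j, c j • coordOf x₀ (v j)) x = ∑ j, c j • v j := by
  have h : ∑ j, c j • coordOf x₀ (v j) = coordOf x₀ (∑ j, c j • v j) := by
    simp only [coordOf, map_sum, map_smul]
  rw [h, coordField_coordOf hx]

theorem FrameAt.rot_iso_single (w : FrameAt o x) (b : SO n) (i : Fin n) :
    (w.rot b).iso (EuclideanSpace.single i 1) =
      ∑ j, b.1 j i • w.iso (EuclideanSpace.single j 1) := by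
  rw [FrameAt.rot_iso]
  conv_lhs => rw [← sum_single (toE b.1 (EuclideanSpace.single i 1))]
  simp only [toE_single, map_sum, map_smul]

theorem continuous_rot (b : SO n) : Continuous fun w : FM o ↦ w.rot b := by
  rw [← continuousOn_univ, continuous_FM_iff]
  intro i
  rw [continuousOn_univ, continuous_iff_continuousAt]
  intro w₀
  have hopen : IsOpen {w : FM o | w.1 ∈ (chartAt (Eu n) w₀.1).source} :=
    (chartAt (Eu n) w₀.1).open_source.preimage continuous_base
  have h1 : ContinuousOn (fun w : FM o ↦ (w.1, ∑ j, b.1 j i •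
      coordOf w₀.1 (w.2.iso (EuclideanSpace.single j 1))))
      {w : FM o | w.1 ∈ (chartAt (Eu n) w₀.1).source} :=
    continuous_base.continuousOn.prodMk (continuousOn_finsetSum _ fun j _ ↦
      (continuousOn_coordOf_frame j).const_smul (b.1 j i))
  have h2 := (continuousOn_coordField (n := n) (x₀ := w₀.1)).comp h1
    fun w hw ↦ ⟨hw, Set.mem_univ _⟩
  refine (h2.continuousAt (hopen.mem_nhds (mem_chart_source _ _))).congr ?_
  filter_upwards [hopen.mem_nhds (mem_chart_source _ _)] with w hw
  have h3 : coordField w₀.1 (∑ j, b.1 j i • coordOf w₀.1 (w.2.iso (EuclideanSpace.single j 1))) w.1 =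
      (w.rot b).2.iso (EuclideanSpace.single i 1) :=
    (coordField_sum hw _ _).trans (w.2.rot_iso_single b i).symm
  exact congrArg (fun v ↦ (⟨w.1, v⟩ : TangentBundle (𝓡 n) M)) h3

variable [T2Space M] [CompactSpace M] [MeasurableSpace M] [BorelSpace M]

/-- The chosen reference frames need not depend measurably on the point. Over the domain of a local
frame the fibre measure is instead the image of Haar measure under a map continuous in both
variables. Finitely many domains cover M. -/
theorem measurable_fibreMeasure : Measurable (fibreMeasure o) := by
  have hloc : ∀ x₀ : M, ∃ L : LocalFrame o x₀, Measurable fun x : L.dom ↦ fibreMeasure o x.1 := by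
    intro x₀
    obtain ⟨L⟩ := exists_localFrame o x₀
    refine ⟨L, ?_⟩
    have h1 : Continuous fun q : L.dom × SO n ↦ L.framePoint q.1.1 q.2 :=
      L.continuousOn_framePoint.comp_continuous (f := fun q : L.dom × SO n ↦ (q.1.1, q.2))
        (by fun_prop) fun q ↦ ⟨q.1.2, Set.mem_univ _⟩
    have h2 : (fun x : L.dom ↦ fibreMeasure o x.1) = fun x : L.dom ↦
        ((haarSO n).map (Prod.mk x)).map fun q : L.dom × SO n ↦ L.framePoint q.1.1 q.2 := by
      funext x
      rw [Measure.map_map h1.measurable measurable_prodMk_left, fibreMeasure_eq (L.frame x.1)]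
      rfl
    rw [h2]
    exact (Measure.measurable_map _ h1.measurable).comp Measurable.map_prodMk_left
  choose L hL using hloc
  obtain ⟨t, ht⟩ := isCompact_univ.elim_finite_subcover (fun x : M ↦ (L x).dom)
    (fun x ↦ (L x).isOpen_dom) fun x _ ↦ Set.mem_iUnion.2 ⟨x, (L x).mem_dom⟩
  intro S hS
  have h : fibreMeasure o ⁻¹' S = ⋃ x ∈ t, Subtype.val ''
      ((fun y : (L x).dom ↦ fibreMeasure o y.1) ⁻¹' S) := by
    ext y
    simp only [Set.mem_preimage, Set.mem_iUnion, Set.mem_image, Subtype.exists, exists_and_right,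
      exists_eq_right]
    constructor
    · intro hy
      obtain ⟨x, hx, hyx⟩ := Set.mem_iUnion₂.1 (ht (Set.mem_univ y))
      exact ⟨x, hx, hyx, hy⟩
    · rintro ⟨_, _, _, hy⟩
      exact hy
  rw [h]
  exact Finset.measurableSet_biUnion _ fun x _ ↦
    MeasurableSet.subtype_image (L x).isOpen_dom.measurableSet (hL x hS)

/-! ### The measure on the frame bundle -/

variable (o) in
/-- The product of the Riemannian measure and the invariant probability measures on the fibres. -/
def frameMeasure : Measure (FM o) := (riemannianVolume n M).bind (fibreMeasure o)

theorem frameMeasure_apply {S : Set (FM o)} (hS : MeasurableSet S) :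
    frameMeasure o S = ∫⁻ x, fibreMeasure o x S ∂(riemannianVolume n M) :=
  Measure.bind_apply hS measurable_fibreMeasure.aemeasurable

instance : IsFiniteMeasure (frameMeasure o) := ⟨by
  rw [frameMeasure_apply MeasurableSet.univ]
  simp only [fibreMeasure_univ, lintegral_const, one_mul]
  exact isCompact_univ.measure_lt_top⟩

/-- On each fibre this is right invariance of Haar measure. -/
theorem measurePreserving_rot (b : SO n) :
    MeasurePreserving (fun w : FM o ↦ w.rot b) (frameMeasure o) (frameMeasure o) := by
  refine ⟨(continuous_rot b).measurable, ?_⟩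
  ext S hS
  have hm := (continuous_rot (o := o) b).measurable
  rw [Measure.map_apply hm hS, frameMeasure_apply (hm hS), frameMeasure_apply hS]
  refine lintegral_congr fun x ↦ ?_
  have hc := (continuous_fibrePoint (Classical.choice (nonempty_frameAt o x))).measurable
  rw [fibreMeasure, Measure.map_apply hc (hm hS), Measure.map_apply hc hS]
  have h := measure_preimage_mul_right (haarSO n) b
    (fibrePoint (Classical.choice (nonempty_frameAt o x)) ⁻¹' S)
  refine Eq.trans ?_ h
  congr 1
  ext a
  simp only [Set.mem_preimage, fibrePoint_mul]

theorem continuous_toPM (G : Subgroup (SO n)) : Continuous (toPM G : FM o → PM o G) :=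
  continuous_quotient_mk'

/-- The measure on `PM` is a multiple of the image of the measure on the frame bundle. -/
theorem liouville_eq {G : Subgroup (SO n)} (hGc : IsClosed (G : Set (SO n)))
    (τ : Measure (SO n ⧸ G)) [IsFiniteMeasure τ]
    (hτ : ∀ a : SO n, τ.map (fun p ↦ a • p) = τ) :
    liouville o τ = τ Set.univ • (frameMeasure o).map (toPM G) := by
  have hmk : Measurable (QuotientGroup.mk : SO n → SO n ⧸ G) :=
    QuotientGroup.continuous_mk.measurable
  have hpm := (continuous_toPM (o := o) G).measurable
  have hfib : ∀ {x : M} (w : FrameAt o x), Measurable (fibreMap (G := G) w) := by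
    intro x w
    refine Continuous.measurable ?_
    exact Continuous.quotient_lift ((continuous_toPM G).comp (continuous_fibrePoint w)) _
  have h : (fun x : M ↦ τ.map (fibreMap (G := G) (Classical.choice (nonempty_frameAt o x)))) =
      fun x ↦ τ Set.univ • (fibreMeasure o x).map (toPM G) := by
    funext x
    conv_lhs => rw [eq_smul_map_haarSO hGc τ hτ]
    rw [Measure.map_smul, Measure.map_map (hfib _) hmk, fibreMeasure,
      Measure.map_map hpm (continuous_fibrePoint _).measurable]
    rfl
  rw [liouville, h]
  ext S hS
  have h1 : Measurable fun x ↦ (fibreMeasure o x).map (toPM G) :=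
    (Measure.measurable_map _ hpm).comp measurable_fibreMeasure
  have h2 : Measurable fun x ↦ τ Set.univ • (fibreMeasure o x).map (toPM G) := by
    refine Measure.measurable_of_measurable_coe _ fun T hT ↦ ?_
    simp only [Measure.smul_apply, smul_eq_mul]
    exact (((Measure.measurable_coe hT).comp h1)).const_mul _
  rw [Measure.bind_apply hS h2.aemeasurable, Measure.smul_apply, Measure.map_apply hpm hS,
    frameMeasure_apply (hpm hS), smul_eq_mul]
  simp only [Measure.smul_apply, smul_eq_mul]
  refine (lintegral_const_mul _ ((Measure.measurable_coe hS).comp h1)).trans ?_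
  congr 1
  exact lintegral_congr fun x ↦ Measure.map_apply hpm hS

/-! ### Integrals in local trivializations -/

namespace LocalFrame

variable (L : LocalFrame o x₀)

/-- The volume density of a local frame. -/
def density (p : Eu n) : ℝ := |(L.coordFrame p).det|⁻¹

theorem density_nonneg (p : Eu n) : 0 ≤ L.density p := inv_nonneg.2 (abs_nonneg _)

theorem det_coordFrame_ne_zero {p : Eu n} (hp : p ∈ L.cdom) : (L.coordFrame p).det ≠ 0 := by
  intro h
  have h1 := congrArg (fun T : Eu n →L[ℝ] Eu n ↦ (toMat T).det) (coordFrame_coordCoframe hp)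
  simp only [toMat_comp, Matrix.det_mul, det_toMat, h, zero_mul] at h1
  have h2 : (ContinuousLinearMap.id ℝ (Eu n)).det = 1 := LinearMap.det_id
  rw [h2] at h1
  exact zero_ne_one h1

theorem contDiffOn_density : ContDiffOn ℝ ∞ L.density L.cdom := by
  intro p hp
  have h1 : ContDiffAt ℝ ∞ (fun q ↦ (L.coordFrame q).det) p :=
    (contDiff_det (n := n)).contDiffAt.comp p
      (contDiffOn_coordFrame.contDiffAt (L.isOpen_cdom.mem_nhds hp))
  have h2 := L.det_coordFrame_ne_zero hp
  have h3 : ContDiffAt ℝ ∞ (fun q ↦ |(L.coordFrame q).det|) p :=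
    ContDiffAt.comp (g := fun x : ℝ ↦ |x|) p (contDiffAt_abs h2) h1
  exact (h3.inv (abs_ne_zero.2 h2)).contDiffWithinAt

/-- The measure on the domain of a local trivialization. -/
def trivMeasure : Measure (Eu n × SO n) := (volume.restrict L.cdom).prod (haarSO n)

theorem trivMeasure_eq : L.trivMeasure = (volume.prod (haarSO n)).restrict
    (L.cdom ×ˢ Set.univ) := by
  rw [trivMeasure, ← Measure.restrict_univ (μ := haarSO n), Measure.prod_restrict,
    Measure.restrict_univ]

theorem measurableSet_cdom_prod : MeasurableSet (L.cdom ×ˢ (Set.univ : Set (SO n))) :=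
  L.isOpen_cdom.measurableSet.prod MeasurableSet.univ

theorem aemeasurable_point : AEMeasurable (fun q : Eu n × SO n ↦ L.point q.1 q.2)
    L.trivMeasure := by
  rw [trivMeasure_eq]
  exact L.continuousOn_point.aemeasurable L.measurableSet_cdom_prod

theorem aemeasurable_density : AEMeasurable (fun q : Eu n × SO n ↦ ENNReal.ofReal (L.density q.1))
    L.trivMeasure := by
  rw [trivMeasure_eq]
  exact ((L.contDiffOn_density.continuousOn.comp continuousOn_fst fun q hq ↦ hq.1).aemeasurable
    L.measurableSet_cdom_prod).ennreal_ofReal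

/-- Riemannian measure has density |det σ|⁻¹ in the chart, and the fibre measure is Haar measure in
the local frame; Tonelli combines them. -/
theorem lintegral_frameMeasure {f : FM o → ENNReal} (hf : Measurable f)
    (h0 : ∀ w, w.1 ∉ L.dom → f w = 0) : ∫⁻ w, f w ∂(frameMeasure o) =
      ∫⁻ q, ENNReal.ofReal (L.density q.1) * f (L.point q.1 q.2) ∂L.trivMeasure := by
  rw [frameMeasure, Measure.lintegral_bind measurable_fibreMeasure.aemeasurable hf.aemeasurable,
    lintegral_riemannianVolume L (f := fun x ↦ ∫⁻ w, f w ∂(fibreMeasure o x))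
      ((Measure.measurable_lintegral hf).comp measurable_fibreMeasure)]
  · refine Eq.trans ?_ (lintegral_prod _ ((L.aemeasurable_density).mul
      (hf.comp_aemeasurable L.aemeasurable_point))).symm
    refine lintegral_congr fun p ↦ ?_
    simp only [Pi.mul_apply, Function.comp_apply]
    rw [lintegral_const_mul' _ _ ENNReal.ofReal_ne_top]
    congr 1
    rw [fibreMeasure_eq (L.frame ((extChartAt (𝓡 n) x₀).symm p)),
      lintegral_map hf (continuous_fibrePoint _).measurable]
    rfl
  · intro x hx
    rw [fibreMeasure, lintegral_map hf (continuous_fibrePoint _).measurable]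
    have h1 : ∀ a, f (fibrePoint (Classical.choice (nonempty_frameAt o x)) a) = 0 :=
      fun a ↦ h0 _ hx
    simp only [h1, lintegral_zero]

variable (o) in
/-- The part of the frame bundle over a set. -/
def partOver (U : Set M) : Set (FM o) := (fun w : FM o ↦ w.1) ⁻¹' U

theorem frameMeasure_restrict : (frameMeasure o).restrict (partOver o L.dom) =
    (L.trivMeasure.withDensity fun q ↦ ENNReal.ofReal (L.density q.1)).map
      fun q ↦ L.point q.1 q.2 := by
  have hD : MeasurableSet (partOver o L.dom) :=
    (L.isOpen_dom.preimage continuous_base).measurableSet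
  have hpt := L.aemeasurable_point.mono_ac
    (withDensity_absolutelyContinuous L.trivMeasure fun q ↦ ENNReal.ofReal (L.density q.1))
  ext S hS
  rw [Measure.restrict_apply hS, ← lintegral_indicator_one (hS.inter hD),
    L.lintegral_frameMeasure (measurable_one.indicator (hS.inter hD))
      fun w hw ↦ Set.indicator_of_notMem (fun h ↦ hw h.2) _,
    ← lintegral_indicator_one hS, lintegral_map' (measurable_one.indicator hS).aemeasurable hpt]
  refine Eq.trans ?_ (lintegral_withDensity_eq_lintegral_mul₀ L.aemeasurable_density
      ((measurable_one.indicator hS).comp_aemeasurable L.aemeasurable_point)).symm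
  rw [trivMeasure_eq]
  refine setLIntegral_congr_fun L.measurableSet_cdom_prod fun q hq ↦ ?_
  rw [Pi.mul_apply, Function.comp_apply]
  congr 1
  have hq' : L.point q.1 q.2 ∈ partOver o L.dom := hq.1.2
  by_cases h : L.point q.1 q.2 ∈ S
  · rw [Set.indicator_of_mem h, Set.indicator_of_mem (Set.mem_inter h hq')]
  · rw [Set.indicator_of_notMem h, Set.indicator_of_notMem fun h' ↦ h h'.1]

/-- The integral of a function supported over the domain of a local frame. -/
theorem integral_frameMeasure {g : FM o → ℝ} (hg : Continuous g)
    (h0 : ∀ w, w.1 ∉ L.dom → g w = 0) : ∫ w, g w ∂(frameMeasure o) =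
      ∫ q, L.density q.1 * g (L.point q.1 q.2) ∂L.trivMeasure := by
  have hpt := L.aemeasurable_point.mono_ac
    (withDensity_absolutelyContinuous L.trivMeasure fun q ↦ ENNReal.ofReal (L.density q.1))
  rw [← setIntegral_eq_integral_of_forall_compl_eq_zero (s := partOver o L.dom) h0,
    L.frameMeasure_restrict, integral_map hpt hg.measurable.aestronglyMeasurable,
    integral_withDensity_eq_integral_toReal_smul₀ L.aemeasurable_density
      (Filter.Eventually.of_forall fun q ↦ ENNReal.ofReal_lt_top)]
  refine integral_congr_ae (Filter.Eventually.of_forall fun q ↦ ?_)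
  beta_reduce
  rw [ENNReal.toReal_ofReal (L.density_nonneg _), smul_eq_mul]

end LocalFrame

end FrameMeasure

section Vanishing

set_option linter.unusedSectionVars false

variable {n : ℕ} [NeZero n] {M : Type*} [TopologicalSpace M]
  [ChartedSpace (EuclideanSpace ℝ (Fin n)) M] [IsManifold (𝓡 n) ∞ M]
  [RiemannianBundle (fun x : M ↦ TangentSpace (𝓡 n) x)]
  [IsContMDiffRiemannianBundle (𝓡 n) ∞ (EuclideanSpace ℝ (Fin n))
    (fun x : M ↦ TangentSpace (𝓡 n) x)]
  {o : ManifoldOrientation n M} {x₀ x : M} {p : Eu n}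
  {cov : CovariantDerivative (𝓡 n) (EuclideanSpace ℝ (Fin n)) (fun x : M ↦ TangentSpace (𝓡 n) x)}
  {f g : FM o → ℝ}

/-! ### Product rules -/

theorem Y_mul (hf : SmoothFn f) (hg : SmoothFn g) (ξ : so n) (w : FM o) :
    Y ξ (fun w ↦ f w * g w) w = Y ξ f w * g w + f w * Y ξ g w := by
  have h := ((hf.hasDerivAt_rot ξ w).mul (hg.hasDerivAt_rot ξ w)).deriv
  simp only [zero_smul, expSO_zero, FM.rot_one] at h
  exact h

theorem X_mul (hf : SmoothFn f) (hg : SmoothFn g) (hmet : cov.IsMetricCompatible)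
    (w : FM o) : X cov (fun w ↦ f w * g w) w = X cov f w * g w + f w * X cov g w := by
  obtain ⟨L, p, hp, a, hw⟩ := exists_point w
  obtain ⟨F, hF⟩ := hf _ L
  obtain ⟨F', hF'⟩ := hg _ L
  rw [hw]
  rw [(hF.mul hF').X_point hmet hp, hF.X_point hmet hp, hF'.X_point hmet hp, hF.2 p hp, hF'.2 p hp]
  have h := ((hF.hasFDerivAt (q := (p, toE a.1)) hp).mul
    (hF'.hasFDerivAt (q := (p, toE a.1)) hp)).fderiv
  have h2 := congrArg (fun T : Eu n × (Eu n →L[ℝ] Eu n) →L[ℝ] ℝ ↦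
    T (horField L.coordFrame (L.connForm cov) (e₁ n) (p, toE a.1))) h
  refine h2.trans ?_
  simp only [_root_.add_apply, _root_.smul_apply, smul_eq_mul, dAlong]
  ring

theorem X_add (hf : SmoothFn f) (hg : SmoothFn g) (hmet : cov.IsMetricCompatible)
    (w : FM o) : X cov (fun w ↦ f w + g w) w = X cov f w + X cov g w := by
  obtain ⟨L, p, hp, a, hw⟩ := exists_point w
  obtain ⟨F, hF⟩ := hf _ L
  obtain ⟨F', hF'⟩ := hg _ L
  rw [hw]
  rw [(hF.add hF').X_point hmet hp, hF.X_point hmet hp, hF'.X_point hmet hp]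
  have h := ((hF.hasFDerivAt (q := (p, toE a.1)) hp).add
    (hF'.hasFDerivAt (q := (p, toE a.1)) hp)).fderiv
  exact congrArg (fun T : Eu n × (Eu n →L[ℝ] Eu n) →L[ℝ] ℝ ↦
    T (horField L.coordFrame (L.connForm cov) (e₁ n) (p, toE a.1))) h

/-! ### Functions pulled back from the base -/

theorem LocalRep.base {χ : M → ℝ} (hχ : ContMDiff (𝓡 n) 𝓘(ℝ, ℝ) ∞ χ) (L : LocalFrame o x₀) :
    LocalRep L (fun w ↦ χ w.1) (fun q ↦ χ ((extChartAt (𝓡 n) x₀).symm q.1)) := by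
  refine ⟨fun q hq ↦ ?_, fun p _ a ↦ rfl⟩
  have h := (contMDiffAt_iff_of_chart (n := n) le_rfl hq.1.1).1 (hχ _)
  exact (ContDiffAt.comp q h contDiffAt_fst).contDiffWithinAt

theorem smoothFn_base {χ : M → ℝ} (hχ : ContMDiff (𝓡 n) 𝓘(ℝ, ℝ) ∞ χ) :
    SmoothFn (fun w : FM o ↦ χ w.1) := fun _ L ↦ ⟨_, LocalRep.base hχ L⟩

theorem X_base_eq_zero (hmet : cov.IsMetricCompatible) {χ : M → ℝ}
    (hχ : ContMDiff (𝓡 n) 𝓘(ℝ, ℝ) ∞ χ) {w : FM o} (hw : w.1 ∉ tsupport χ) :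
    X cov (fun w : FM o ↦ χ w.1) w = 0 := by
  obtain ⟨L, p, hp, a, hwp⟩ := exists_point w
  have hw' : (extChartAt (𝓡 n) w.1).symm p ∉ tsupport χ := by
    have h := congrArg Sigma.fst hwp
    exact fun h' ↦ hw (h ▸ h')
  rw [hwp, (LocalRep.base hχ L).X_point hmet hp]
  have h1 : ContinuousAt (extChartAt (𝓡 n) w.1).symm p := (contMDiffAt_symm hp.1).continuousAt
  have h2 : (fun q : Eu n × (Eu n →L[ℝ] Eu n) ↦ χ ((extChartAt (𝓡 n) w.1).symm q.1))
      =ᶠ[𝓝 (p, toE a.1)] fun _ ↦ 0 := by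
    have h3 : ContinuousAt (fun q : Eu n × (Eu n →L[ℝ] Eu n) ↦ (extChartAt (𝓡 n) w.1).symm q.1)
      (p, toE a.1) := ContinuousAt.comp (f := Prod.fst) h1 continuousAt_fst
    filter_upwards [h3.preimage_mem_nhds ((isClosed_tsupport χ).isOpen_compl.mem_nhds hw')] with q hq
    exact image_eq_zero_of_notMem_tsupport hq
  rw [dAlong, h2.fderiv_eq]
  simp

variable [T2Space M] [CompactSpace M] [MeasurableSpace M] [BorelSpace M]

/-! ### Integrals of derivatives over the frame bundle -/

theorem integrable_of_continuous {f : FM o → ℝ} (hf : Continuous f) :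
    Integrable f (frameMeasure o) := by
  obtain ⟨B, hB⟩ := (isCompact_univ.image hf).isBounded.exists_norm_le
  exact Integrable.of_bound hf.measurable.aestronglyMeasurable B
    (Filter.Eventually.of_forall fun a ↦ hB _ ⟨a, trivial, rfl⟩)

/-- Y_ξ generates right rotations by exp(tξ), which preserve the measure. -/
theorem integral_Y (hf : SmoothFn f) (ξ : so n) : ∫ w, Y ξ f w ∂(frameMeasure o) = 0 :=
  integral_deriv_flow_eq_zero (Φ := fun t w ↦ w.rot (expSO (t • ξ)))
    (fun _ ↦ measurePreserving_rot _) (fun w ↦ by rw [zero_smul, expSO_zero, FM.rot_one])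
    (fun _ ↦ continuous_rot _) hf.continuous (hf.Y ξ).continuous fun w t ↦ hf.hasDerivAt_rot' ξ w t

theorem continuous_toE_SO : Continuous fun a : SO n ↦ toE a.1 :=
  continuous_toE.comp continuous_subtype_val

/-- The integral over `SO(n)` of a derivative along right invariant vector fields. -/
theorem integral_right_invariant {Φ : (Eu n →L[ℝ] Eu n) → ℝ} (hΦ : ContDiff ℝ ∞ Φ) (v : Eu n)
    {θ : Eu n →L[ℝ] Eu n →L[ℝ] Eu n} (hθ : ∀ u v w, inner ℝ (θ u v) w = - inner ℝ v (θ u w)) :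
    ∫ a : SO n, (fderiv ℝ Φ (toE a.1) ((θ (toE a.1 v)).comp (toE a.1)) +
      (∑ i, θ (EuclideanSpace.single i 1) (toE a.1 v) i) * Φ (toE a.1)) ∂(haarSO n) = 0 := by
  have hc := continuous_toE_SO (n := n)
  have hcv : Continuous fun a : SO n ↦ toE a.1 v := hc.clm_apply continuous_const
  have hΦc : Continuous fun a : SO n ↦ Φ (toE a.1) := hΦ.continuous.comp hc
  have hΦd : Continuous fun a : SO n ↦ fderiv ℝ Φ (toE a.1) :=
    (hΦ.continuous_fderiv (by simp)).comp hc
  -- The field a ↦ θ(av)a is ∑ (av)_i θ(e_i)a, and each θ(e_i)a generates left translations, which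
  -- preserve Haar measure. Differentiating the product (av)_i Φ(a) along the i-th one gives the
  -- i-th summand, the derivative of its coefficient being the divergence term.
  let ψ : Fin n → SO n → ℝ := fun i a ↦ toE a.1 v i * Φ (toE a.1)
  let ψ' : Fin n → SO n → ℝ := fun i a ↦
    (θ (EuclideanSpace.single i 1) (toE a.1 v) i) * Φ (toE a.1) +
      toE a.1 v i * fderiv ℝ Φ (toE a.1) ((θ (EuclideanSpace.single i 1)).comp (toE a.1))
  have hproj : ∀ i (h : SO n → Eu n), Continuous h → Continuous fun a ↦ h a i := fun i h hh ↦
    (EuclideanSpace.proj i : Eu n →L[ℝ] ℝ).continuous.comp hh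
  have hψ : ∀ i, Continuous (ψ i) := fun i ↦ (hproj i _ hcv).mul hΦc
  have hψ' : ∀ i, Continuous (ψ' i) := fun i ↦
    ((hproj i _ (continuous_const.clm_apply hcv)).mul hΦc).add
      ((hproj i _ hcv).mul (hΦd.clm_apply (continuous_const.clm_comp hc)))
  have hint : ∀ i, ∫ a, ψ' i a ∂(haarSO n) = 0 := by
    intro i
    let η : so n := soOf (θ (EuclideanSpace.single i 1)) (hθ _)
    have hη : toE η.1 = θ (EuclideanSpace.single i 1) := toE_soOf _
    have hd0 : ∀ a, HasDerivAt (fun t : ℝ ↦ ψ i (expSO (t • η) * a)) (ψ' i a) 0 := by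
      intro a
      have h1 : HasDerivAt (fun t : ℝ ↦ toE (expSO (t • η) * a).1)
          ((θ (EuclideanSpace.single i 1)).comp (toE a.1)) 0 := by
        have h2 := (((ContinuousLinearMap.compL ℝ (Eu n) (Eu n) (Eu n)).flip
          (toE a.1)).hasFDerivAt).comp_hasDerivAt (0 : ℝ) (hasDerivAt_toE_expSO η)
        rw [hη] at h2
        refine h2.congr_of_eventuallyEq (Filter.Eventually.of_forall fun t ↦ ?_)
        have h3 : (expSO (t • η) * a).1 = (expSO (t • η)).1 * a.1 := rfl
        beta_reduce
        rw [h3, toE_mul]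
        rfl
      have h0 : expSO ((0 : ℝ) • η) * a = a := by rw [zero_smul, expSO_zero, one_mul]
      have h4 : HasDerivAt (fun t : ℝ ↦ toE (expSO (t • η) * a).1 v i)
          (θ (EuclideanSpace.single i 1) (toE a.1 v) i) 0 :=
        ((EuclideanSpace.proj i : Eu n →L[ℝ] ℝ).comp
          (ContinuousLinearMap.apply ℝ (Eu n) v)).hasFDerivAt.comp_hasDerivAt (0 : ℝ) h1
      have h5 : HasFDerivAt Φ (fderiv ℝ Φ (toE a.1)) (toE (expSO ((0 : ℝ) • η) * a).1) := by
        rw [h0]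
        exact (hΦ.differentiable (by simp) _).hasFDerivAt
      have h6 := h4.mul (h5.comp_hasDerivAt (0 : ℝ) h1)
      simp only [h0, Function.comp_apply] at h6
      exact h6
    refine integral_deriv_flow_eq_zero (Φ := fun t a ↦ expSO (t • η) * a)
      (fun t ↦ measurePreserving_mul_left _ _) (fun a ↦ by rw [zero_smul, expSO_zero, one_mul])
      (fun t ↦ continuous_const_mul _) (hψ i) (hψ' i) fun a t ↦ ?_
    have h1 := hd0 (expSO (t • η) * a)
    rw [← sub_self t] at h1
    refine (h1.comp_sub_const t t).congr_of_eventuallyEq (Filter.Eventually.of_forall fun s ↦ ?_)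
    beta_reduce
    rw [← mul_assoc, ← expSO_add_smul, sub_add_cancel]
  have hsum : ∀ a : SO n, fderiv ℝ Φ (toE a.1) ((θ (toE a.1 v)).comp (toE a.1)) +
      (∑ i, θ (EuclideanSpace.single i 1) (toE a.1 v) i) * Φ (toE a.1) = ∑ i, ψ' i a := by
    intro a
    have h1 : (θ (toE a.1 v)).comp (toE a.1) =
        ∑ i, toE a.1 v i • (θ (EuclideanSpace.single i 1)).comp (toE a.1) := by
      ext1 u
      conv_lhs => rw [← sum_single (toE a.1 v)]
      simp only [map_sum, map_smul, _root_.sum_apply, ContinuousLinearMap.comp_apply,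
        _root_.smul_apply]
    rw [h1, map_sum, Finset.sum_mul, ← Finset.sum_add_distrib]
    refine Finset.sum_congr rfl fun i _ ↦ ?_
    rw [map_smul, smul_eq_mul, add_comm]
  simp only [hsum]
  rw [integral_finsetSum]
  · simp only [hint, Finset.sum_const_zero]
  · intro i _
    exact (hψ' i).integrable_of_hasCompactSupport (HasCompactSupport.of_compactSpace _)

namespace LocalFrame

variable {L : LocalFrame o x₀}

theorem integrable_trivMeasure {h : Eu n × SO n → ℝ} (hh : ContinuousOn h (L.cdom ×ˢ Set.univ))
    {K : Set (Eu n)} (hK : IsCompact K) (hKL : K ⊆ L.cdom) (h0 : ∀ q, q.1 ∉ K → h q = 0) :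
    Integrable h L.trivMeasure := by
  rw [trivMeasure_eq]
  have h1 : IntegrableOn h (K ×ˢ (Set.univ : Set (SO n))) (volume.prod (haarSO n)) :=
    (hh.mono (Set.prod_mono hKL subset_rfl)).integrableOn_compact (hK.prod isCompact_univ)
  exact h1.of_forall_sdiff_eq_zero L.measurableSet_cdom_prod
    fun q hq ↦ h0 q fun hqK ↦ hq.2 ⟨hqK, Set.mem_univ _⟩

/-- The integral over the domain of a local frame of a derivative along the vector fields of the
frame. -/
theorem integral_divergence {K : Set (Eu n)} (hK : IsCompact K) (hKL : K ⊆ L.cdom)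
    (htor : cov.torsion = 0) (hmet : cov.IsMetricCompatible) {Ψ : Eu n → ℝ}
    (hΨ : ContDiff ℝ ∞ Ψ) (h0 : ∀ p ∉ K, Ψ p = 0) (v : Eu n) :
    ∫ p in L.cdom, (L.density p * fderiv ℝ Ψ p (L.coordFrame p v) + L.density p *
      ((∑ i, L.connForm cov p (L.coordFrame p (EuclideanSpace.single i 1)) v i) * Ψ p)) = 0 := by
  -- The components of Ψ · density · σv. They vanish off K, hence are globally C¹ with compact
  -- support although the density and the frame are controlled only on the domain.
  let g : Fin n → Eu n → ℝ := fun k p ↦ Ψ p * (L.density p * L.coordFrame p v k)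
  have hfr : ∀ p ∈ L.cdom, ∀ k, ContDiffAt ℝ ∞ (fun p ↦ L.density p * L.coordFrame p v k) p := by
    intro p hp k
    have h1 := L.isOpen_cdom.mem_nhds hp
    exact (L.contDiffOn_density.contDiffAt h1).mul
      ((EuclideanSpace.proj k : Eu n →L[ℝ] ℝ).contDiff.contDiffAt.comp p
        ((contDiffOn_coordFrame.contDiffAt h1).clm_apply contDiffAt_const))
  have hg0 : ∀ k, ∀ p ∉ K, g k p = 0 := fun k p hp ↦ by simp only [g, h0 p hp, zero_mul]
  have hg : ∀ k, ContDiff ℝ 1 (g k) := by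
    intro k
    refine contDiff_iff_contDiffAt.2 fun p ↦ ?_
    by_cases hp : p ∈ K
    · exact (hΨ.contDiffAt.mul (hfr p (hKL hp) k)).of_le ENat.LEInfty.out
    · refine (contDiffAt_const (c := (0 : ℝ))).congr_of_eventuallyEq ?_
      filter_upwards [hK.isClosed.isOpen_compl.mem_nhds hp] with q hq using hg0 k q hq
  have hgc : ∀ k, HasCompactSupport (g k) := fun k ↦ HasCompactSupport.intro hK (hg0 k)
  have hd0 : ∀ k, ∀ p ∉ K, fderiv ℝ (g k) p (EuclideanSpace.single k 1) = 0 := by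
    intro k p hp
    have h1 : g k =ᶠ[𝓝 p] fun _ ↦ 0 := by
      filter_upwards [hK.isClosed.isOpen_compl.mem_nhds hp] with q hq using hg0 k q hq
    rw [h1.fderiv_eq]
    simp
  have hpt : ∀ p ∈ L.cdom, L.density p * fderiv ℝ Ψ p (L.coordFrame p v) + L.density p *
      ((∑ i, L.connForm cov p (L.coordFrame p (EuclideanSpace.single i 1)) v i) * Ψ p) =
      ∑ k, fderiv ℝ (g k) p (EuclideanSpace.single k 1) := by
    intro p hp
    have h1 : ∀ k, fderiv ℝ (g k) p (EuclideanSpace.single k 1) =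
        Ψ p * fderiv ℝ (fun p ↦ L.density p * L.coordFrame p v k) p (EuclideanSpace.single k 1) +
          L.density p * L.coordFrame p v k * fderiv ℝ Ψ p (EuclideanSpace.single k 1) := by
      intro k
      have h2 := ((hΨ.differentiable (by simp) p).hasFDerivAt.mul
        ((hfr p hp k).differentiableAt (by simp)).hasFDerivAt).fderiv
      have h3 := congrArg (fun T : Eu n →L[ℝ] ℝ ↦ T (EuclideanSpace.single k 1)) h2
      exact h3
    -- The divergence of density · σv is the density times a trace of the connection form. This is
    -- the second summand of the integrand.
    have h2 := divergence_frame ((contDiffOn_coordFrame.contDiffAt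
      (L.isOpen_cdom.mem_nhds hp)).differentiableAt (by simp)) (coordFrame_coordCoframe hp)
      (coordCoframe_coordFrame hp) (coordFrame_connForm (cov := cov) hp) (inner_connForm hp hmet)
      (fun u v ↦ christoffel_symm hp.1 htor u v) v
    have h3 : fderiv ℝ Ψ p (L.coordFrame p v) =
        ∑ k, L.coordFrame p v k * fderiv ℝ Ψ p (EuclideanSpace.single k 1) := by
      conv_lhs => rw [← sum_single (L.coordFrame p v)]
      simp only [map_sum, map_smul, smul_eq_mul]
    simp only [h1]
    rw [Finset.sum_add_distrib, ← Finset.mul_sum]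
    refine Eq.trans ?_ (congrArg (fun r ↦ Ψ p * r + _) h2.symm)
    rw [h3, Finset.mul_sum, density]
    simp only [mul_assoc]
    ring
  rw [setIntegral_congr_fun L.isOpen_cdom.measurableSet hpt,
    setIntegral_eq_integral_of_forall_compl_eq_zero fun p hp ↦
      Finset.sum_eq_zero fun k _ ↦ hd0 k p fun hpK ↦ hp (hKL hpK), integral_finsetSum]
  · exact Finset.sum_eq_zero fun k _ ↦ integral_fderiv_apply_eq_zero (hg k) (hgc k) _
  · intro k _
    refine Continuous.integrable_of_hasCompactSupport
      (((hg k).continuous_fderiv (by norm_num)).clm_apply continuous_const) ?_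
    exact HasCompactSupport.intro hK (hd0 k)

end LocalFrame

/-- The integral of `𝐗 f` vanishes if `f` is supported over the domain of a local frame. -/
theorem integral_X_of_support {L : LocalFrame o x₀} {F : Eu n × (Eu n →L[ℝ] Eu n) → ℝ}
    (hfF : LocalRep L f F) (hF : ContDiff ℝ ∞ F) {K : Set (Eu n)} (hK : IsCompact K)
    (hKL : K ⊆ L.cdom) (h0 : ∀ q, q.1 ∉ K → F q = 0) (hf : SmoothFn f) (htor : cov.torsion = 0)
    (hmet : cov.IsMetricCompatible) (hX : ∀ w : FM o, w.1 ∉ L.dom → X cov f w = 0) :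
    ∫ w, X cov f w ∂(frameMeasure o) = 0 := by
  have hc := continuous_toE_SO (n := n)
  have hθ := LocalFrame.contDiffOn_connForm (L := L) htor hmet
  have hd0 : ∀ q, q.1 ∉ K → fderiv ℝ F q = 0 := by
    intro q hq
    have h1 : F =ᶠ[𝓝 q] fun _ ↦ 0 := by
      filter_upwards [(hK.isClosed.isOpen_compl.preimage continuous_fst).mem_nhds hq] with q hq
      exact h0 q hq
    rw [h1.fderiv_eq]
    simp
  let ι : Eu n × SO n → Eu n × (Eu n →L[ℝ] Eu n) := fun q ↦ (q.1, toE q.2.1)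
  have hι : Continuous ι := continuous_fst.prodMk (hc.comp continuous_snd)
  -- The horizontal field splits into its base component, giving A, and minus a fibre component,
  -- giving B. S is their common divergence term: A + S and B + S both integrate to zero, hence so
  -- does A - B.
  let A : Eu n × SO n → ℝ := fun q ↦
    L.density q.1 * fderiv ℝ F (ι q) (L.coordFrame q.1 (toE q.2.1 (e₁ n)), 0)
  let B : Eu n × SO n → ℝ := fun q ↦ L.density q.1 * fderiv ℝ F (ι q)
    (0, (L.connForm cov q.1 (L.coordFrame q.1 (toE q.2.1 (e₁ n)))).comp (toE q.2.1))
  let S : Eu n × SO n → ℝ := fun q ↦ L.density q.1 *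
    ((∑ i, L.connForm cov q.1 (L.coordFrame q.1 (EuclideanSpace.single i 1))
      (toE q.2.1 (e₁ n)) i) * F (ι q))
  have hJc : ContinuousOn (fun q : Eu n × SO n ↦ L.density q.1) (L.cdom ×ˢ Set.univ) :=
    L.contDiffOn_density.continuousOn.comp continuousOn_fst fun q hq ↦ hq.1
  have hσc : ContinuousOn (fun q : Eu n × SO n ↦ L.coordFrame q.1) (L.cdom ×ˢ Set.univ) :=
    LocalFrame.contDiffOn_coordFrame.continuousOn.comp continuousOn_fst fun q hq ↦ hq.1
  have hθc : ContinuousOn (fun q : Eu n × SO n ↦ L.connForm cov q.1) (L.cdom ×ˢ Set.univ) :=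
    hθ.continuousOn.comp continuousOn_fst fun q hq ↦ hq.1
  have hTc : ContinuousOn (fun q : Eu n × SO n ↦ toE q.2.1) (L.cdom ×ˢ Set.univ) :=
    (hc.comp continuous_snd).continuousOn
  have huc : ContinuousOn (fun q : Eu n × SO n ↦ toE q.2.1 (e₁ n)) (L.cdom ×ˢ Set.univ) :=
    hTc.clm_apply continuousOn_const
  have hDc : ContinuousOn (fun q ↦ fderiv ℝ F (ι q)) (L.cdom ×ˢ Set.univ) :=
    ((hF.continuous_fderiv (by simp)).comp hι).continuousOn
  have hA : Integrable A L.trivMeasure := by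
    refine LocalFrame.integrable_trivMeasure
      (hJc.mul (hDc.clm_apply ((hσc.clm_apply huc).prodMk continuousOn_const))) hK hKL fun q hq ↦ ?_
    simp only [A, hd0 (ι q) hq]
    simp
  have hB : Integrable B L.trivMeasure := by
    refine LocalFrame.integrable_trivMeasure
      (hJc.mul (hDc.clm_apply (continuousOn_const.prodMk
        ((hθc.clm_apply (hσc.clm_apply huc)).clm_comp hTc)))) hK hKL fun q hq ↦ ?_
    simp only [B, hd0 (ι q) hq]
    simp
  have hS : Integrable S L.trivMeasure := by
    refine LocalFrame.integrable_trivMeasure (hJc.mul ((continuousOn_finsetSum _ fun i _ ↦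
      (EuclideanSpace.proj i : Eu n →L[ℝ] ℝ).continuous.comp_continuousOn
        ((hθc.clm_apply (hσc.clm_apply continuousOn_const)).clm_apply huc)).mul
      (hF.continuous.comp hι).continuousOn)) hK hKL fun q hq ↦ ?_
    simp only [S, h0 (ι q) hq, mul_zero]
  have hAi : Integrable (fun q ↦ A q + S q) L.trivMeasure := hA.add hS
  have hBi : Integrable (fun q ↦ B q + S q) L.trivMeasure := hB.add hS
  -- The group element is frozen and the base variable integrated first.
  have hAS : ∫ q, (A q + S q) ∂L.trivMeasure = 0 := by
    rw [LocalFrame.trivMeasure, integral_prod_symm _ hAi]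
    refine integral_eq_zero_of_ae (Filter.Eventually.of_forall fun a ↦ ?_)
    have h1 : ContDiff ℝ ∞ fun p : Eu n ↦ F (p, toE a.1) :=
      hF.comp (contDiff_id.prodMk contDiff_const)
    have h2 := LocalFrame.integral_divergence hK hKL htor hmet h1 (fun p hp ↦ h0 _ hp)
      (toE a.1 (e₁ n))
    refine Eq.trans (integral_congr_ae (Filter.Eventually.of_forall fun p ↦ ?_)) h2
    have h3 : HasFDerivAt (fun p : Eu n ↦ F (p, toE a.1)) ((fderiv ℝ F (p, toE a.1)).comp
        ((ContinuousLinearMap.id ℝ (Eu n)).prod 0)) p :=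
      ((hF.differentiable (by simp)) _).hasFDerivAt.comp p
        ((hasFDerivAt_id p).prodMk (hasFDerivAt_const _ p))
    simp only [A, S, ι]
    rw [h3.fderiv]
    rfl
  -- The base point is frozen and the group integrated first. There the form θ(σ·) plays the part of
  -- the constant form in `integral_right_invariant`.
  have hBS : ∫ q, (B q + S q) ∂L.trivMeasure = 0 := by
    rw [LocalFrame.trivMeasure, integral_prod _ hBi]
    refine setIntegral_eq_zero_of_forall_eq_zero fun p hp ↦ ?_
    have h1 : ContDiff ℝ ∞ fun T : Eu n →L[ℝ] Eu n ↦ F (p, T) :=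
      hF.comp (contDiff_const.prodMk contDiff_id)
    have h2 := integral_right_invariant h1 (e₁ n)
      (θ := (L.connForm cov p).comp (L.coordFrame p))
      fun u v w ↦ LocalFrame.inner_connForm hp hmet _ v w
    have h3 : ∀ a : SO n, B (p, a) + S (p, a) = L.density p *
        (fderiv ℝ (fun T : Eu n →L[ℝ] Eu n ↦ F (p, T)) (toE a.1)
          ((((L.connForm cov p).comp (L.coordFrame p)) (toE a.1 (e₁ n))).comp (toE a.1)) +
        (∑ i, ((L.connForm cov p).comp (L.coordFrame p)) (EuclideanSpace.single i 1)
          (toE a.1 (e₁ n)) i) * F (p, toE a.1)) := by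
      intro a
      have h4 : HasFDerivAt (fun T : Eu n →L[ℝ] Eu n ↦ F (p, T)) ((fderiv ℝ F (p, toE a.1)).comp
          ((0 : (Eu n →L[ℝ] Eu n) →L[ℝ] Eu n).prod (ContinuousLinearMap.id ℝ _))) (toE a.1) :=
        ((hF.differentiable (by simp)) _).hasFDerivAt.comp (toE a.1)
          ((hasFDerivAt_const p _).prodMk (hasFDerivAt_id _))
      rw [h4.fderiv, mul_add]
      rfl
    simp only [h3]
    rw [integral_const_mul, h2, mul_zero]
  rw [L.integral_frameMeasure (hf.X htor hmet).continuous hX]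
  have h1 : ∫ q, L.density q.1 * X cov f (L.point q.1 q.2) ∂L.trivMeasure =
      ∫ q, ((A q + S q) - (B q + S q)) ∂L.trivMeasure := by
    rw [LocalFrame.trivMeasure_eq]
    refine setIntegral_congr_fun L.measurableSet_cdom_prod fun q hq ↦ ?_
    rw [hfF.X_point hmet hq.1]
    have h2 : horField L.coordFrame (L.connForm cov) (e₁ n) (q.1, toE q.2.1) =
        (L.coordFrame q.1 (toE q.2.1 (e₁ n)), 0) -
        (0, (L.connForm cov q.1 (L.coordFrame q.1 (toE q.2.1 (e₁ n)))).comp (toE q.2.1)) := by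
      simp [horField]
    rw [dAlong, h2, map_sub]
    simp only [A, B, ι]
    ring
  rw [h1, integral_sub hAi hBi, hAS, hBS, sub_zero]

/-- The frame flow preserves the measure on the frame bundle. -/
theorem integral_X (hf : SmoothFn f) (htor : cov.torsion = 0)
    (hmet : cov.IsMetricCompatible) : ∫ w, X cov f w ∂(frameMeasure o) = 0 := by
  choose L _ using fun x : M ↦ (exists_true_iff_nonempty.2 (exists_localFrame o x))
  obtain ⟨t, ht⟩ := isCompact_univ.elim_finite_subcover (fun x : M ↦ (L x).dom)
    (fun x ↦ (L x).isOpen_dom) fun x _ ↦ Set.mem_iUnion.2 ⟨x, (L x).mem_dom⟩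
  obtain ⟨ρ, hρ⟩ := SmoothPartitionOfUnity.exists_isSubordinate (𝓡 n) isClosed_univ
    (fun i : t ↦ (L i.1).dom) (fun i ↦ (L i.1).isOpen_dom) fun x hx ↦ by
      obtain ⟨y, hy, hxy⟩ := Set.mem_iUnion₂.1 (ht hx)
      exact Set.mem_iUnion.2 ⟨⟨y, hy⟩, hxy⟩
  have hρs : ∀ i, ContMDiff (𝓡 n) 𝓘(ℝ, ℝ) ∞ (ρ i) := fun i ↦ (ρ i).contMDiff
  have h1 : ∀ w : FM o, ∑ i, ρ i w.1 = 1 := fun w ↦ by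
    rw [← finsum_eq_sum_of_fintype]
    exact ρ.sum_eq_one (Set.mem_univ w.1)
  have hs : ∀ i, SmoothFn fun w : FM o ↦ ρ i w.1 * f w := fun i ↦ (smoothFn_base (hρs i)).mul hf
  have hXρ : ∀ i (w : FM o), X cov (fun w ↦ ρ i w.1 * f w) w =
      X cov (fun w : FM o ↦ ρ i w.1) w * f w + ρ i w.1 * X cov f w :=
    fun i w ↦ X_mul (smoothFn_base (hρs i)) hf hmet w
  have hsum : ∀ (s : Finset t) (w : FM o), SmoothFn (fun w : FM o ↦ ∑ i ∈ s, ρ i w.1 * f w) ∧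
      X cov (fun w : FM o ↦ ∑ i ∈ s, ρ i w.1 * f w) w =
        ∑ i ∈ s, X cov (fun w ↦ ρ i w.1 * f w) w := by
    classical
    intro s w
    induction s using Finset.induction_on with
    | empty =>
      have h0 : SmoothFn fun _ : FM o ↦ (0 : ℝ) :=
        smoothFn_base (χ := fun _ ↦ (0 : ℝ)) contMDiff_const
      refine ⟨by simpa using h0, ?_⟩
      have h2 := X_mul h0 h0 hmet w
      simpa using h2
    | insert i s hi ih =>
      simp only [Finset.sum_insert hi]
      exact ⟨(hs i).add ih.1, by rw [X_add (hs i) ih.1 hmet, ih.2]⟩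
  have hXf : ∀ w, X cov f w = ∑ i, X cov (fun w ↦ ρ i w.1 * f w) w := by
    intro w
    rw [← (hsum Finset.univ w).2]
    congr 1
    funext w
    rw [← Finset.sum_mul, h1, one_mul]
  simp only [hXf]
  rw [integral_finsetSum _ fun i _ ↦ integrable_of_continuous ((hs i).X htor hmet).continuous]
  refine Finset.sum_eq_zero fun i _ ↦ ?_
  obtain ⟨F, hF⟩ := hf _ (L i.1)
  have hsupp : ∀ y, y ∉ tsupport (ρ i) → ρ i y = 0 := fun y hy ↦ image_eq_zero_of_notMem_tsupport hy
  have hsubL : tsupport (ρ i) ⊆ (L i.1).dom := hρ i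
  let K : Set (Eu n) := extChartAt (𝓡 n) i.1 '' tsupport (ρ i)
  have hK : IsCompact K := (isClosed_tsupport _).isCompact.image_of_continuousOn
    ((continuousOn_extChartAt i.1).mono fun y hy ↦ by
      rw [extChartAt_source]
      exact (L i.1).dom_subset (hsubL hy))
  have hKL : K ⊆ (L i.1).cdom := by
    rintro _ ⟨y, hy, rfl⟩
    exact LocalFrame.chart_mem_cdom (hsubL hy)
  classical
  -- The representative of f is smooth only over the local domain. Cut off by ρ and continued by
  -- zero it is smooth everywhere and supported over the compact set K.
  let F' : Eu n × (Eu n →L[ℝ] Eu n) → ℝ := fun q ↦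
    if q.1 ∈ K then ρ i ((extChartAt (𝓡 n) i.1).symm q.1) * F q else 0
  have hF' : ∀ q, q.1 ∈ (L i.1).cdom → F' q = ρ i ((extChartAt (𝓡 n) i.1).symm q.1) * F q := by
    intro q hq
    by_cases hqK : q.1 ∈ K
    · exact if_pos hqK
    · have h2 : (extChartAt (𝓡 n) i.1).symm q.1 ∉ tsupport (ρ i) := fun h2 ↦
        hqK ⟨_, h2, (extChartAt (𝓡 n) i.1).right_inv hq.1⟩
      rw [hsupp _ h2, zero_mul]
      exact if_neg hqK
  have hrep := (LocalRep.base (o := o) (hρs i) (L i.1)).mul hF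
  have h0 : ∀ q, q.1 ∉ K → F' q = 0 := fun q hq ↦ if_neg hq
  have hrep' : LocalRep (L i.1) (fun w ↦ ρ i w.1 * f w) F' :=
    ⟨hrep.1.congr fun q hq ↦ hF' q hq.1, fun p hp a ↦ (hrep.2 p hp a).trans (hF' (p, _) hp).symm⟩
  refine integral_X_of_support hrep' ?_ hK hKL h0 (hs i) htor hmet fun w hw ↦ ?_
  · refine contDiff_iff_contDiffAt.2 fun q ↦ ?_
    by_cases hq : q.1 ∈ K
    · exact hrep'.contDiffAt (hKL hq)
    · refine (contDiffAt_const (c := (0 : ℝ))).congr_of_eventuallyEq ?_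
      filter_upwards [(hK.isClosed.isOpen_compl.preimage continuous_fst).mem_nhds hq] with q hq
      exact h0 q hq
  · have h2 : w.1 ∉ tsupport (ρ i) := fun h ↦ hw (hsubL h)
    rw [hXρ, X_base_eq_zero hmet (hρs i) h2, hsupp _ h2, zero_mul, zero_mul, add_zero]

end Vanishing

/-! ### The Pestov identity on the frame bundle. -/

section FramePestovIdentity

set_option linter.unusedSectionVars false

variable {n : ℕ} [NeZero n] {M : Type*} [TopologicalSpace M]
  [ChartedSpace (EuclideanSpace ℝ (Fin n)) M] [IsManifold (𝓡 n) ∞ M]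
  [RiemannianBundle (fun x : M ↦ TangentSpace (𝓡 n) x)]
  [IsContMDiffRiemannianBundle (𝓡 n) ∞ (EuclideanSpace ℝ (Fin n))
    (fun x : M ↦ TangentSpace (𝓡 n) x)]
  {o : ManifoldOrientation n M} {x₀ x : M} {p : Eu n}
  {cov : CovariantDerivative (𝓡 n) (EuclideanSpace ℝ (Fin n)) (fun x : M ↦ TangentSpace (𝓡 n) x)}
  {f : FM o → ℝ}

theorem SmoothFn.const (c : ℝ) : SmoothFn fun _ : FM o ↦ c :=
  smoothFn_base (χ := fun _ ↦ c) contMDiff_const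

theorem SmoothFn.sum {ι : Type*} (s : Finset ι) {F : ι → FM o → ℝ} (h : ∀ i, SmoothFn (F i)) :
    SmoothFn fun w ↦ ∑ i ∈ s, F i w := by
  classical
  induction s using Finset.induction_on with
  | empty => simpa using SmoothFn.const (o := o) 0
  | insert i s hi ih =>
    simp only [Finset.sum_insert hi]
    exact (h i).add ih

theorem X_const (c : ℝ) (w : FM o) (hmet : cov.IsMetricCompatible) :
    X cov (fun _ : FM o ↦ c) w = 0 := by
  obtain ⟨L, p, hp, a, hw⟩ := exists_point w
  have h : LocalRep L (fun _ : FM o ↦ c) fun _ ↦ c := ⟨contDiffOn_const, fun _ _ _ ↦ rfl⟩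
  rw [hw, h.X_point hmet hp, dAlong, fderiv_fun_const]
  rfl

theorem X_sum {ι : Type*} (s : Finset ι) (c : ι → ℝ) {F : ι → FM o → ℝ} (h : ∀ i, SmoothFn (F i))
    (hmet : cov.IsMetricCompatible) (w : FM o) :
    X cov (fun w ↦ ∑ i ∈ s, c i * F i w) w = ∑ i ∈ s, c i * X cov (F i) w := by
  classical
  induction s using Finset.induction_on with
  | empty => simpa using X_const 0 w hmet
  | insert i s hi ih =>
    simp only [Finset.sum_insert hi]
    rw [X_add ((SmoothFn.const (c i)).mul (h i))
      (SmoothFn.sum s fun i ↦ (SmoothFn.const (c i)).mul (h i)) hmet,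
      X_mul (SmoothFn.const (c i)) (h i) hmet, X_const _ _ hmet, ih, zero_mul, zero_add]

variable [T2Space M] [CompactSpace M] [MeasurableSpace M] [BorelSpace M]

/-- The Pestov identity for one vertical vector field. -/
theorem integral_commutator (hf : SmoothFn f) (htor : cov.torsion = 0)
    (hmet : cov.IsMetricCompatible) (ξ : so n) :
    ∫ w, (Y ξ (X cov f) w ^ 2 - X cov (Y ξ f) w ^ 2
      + (Y ξ (H cov ξ f) w - H cov ξ (Y ξ f) w) * X cov f w
      + (X cov (H cov ξ f) w - H cov ξ (X cov f) w) * Y ξ f w) ∂(frameMeasure o) = 0 := by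
  have hX := hf.X htor hmet
  have hY := hf.Y ξ
  have hH := hf.H htor hmet ξ
  have hXY := hY.X htor hmet
  have hYX := hX.Y ξ
  have hXX := hX.X htor hmet
  have hYY := hY.Y ξ
  -- The integrand is Y(Hf·𝐗f) + 𝐗(Hf·Yf) + 𝐗(YYf·𝐗f) + 𝐗(Y𝐗f·Yf) - Y(𝐗Yf·𝐗f) - Y(𝐗𝐗f·Yf). Expansion
  -- by the product rule yields Hf·(Y𝐗f + 𝐗Yf), a difference of squares, and the two commutator
  -- terms; the products YYf·𝐗𝐗f and Y𝐗f·𝐗Yf cancel.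
  have i1 := integral_Y (hH.mul hX) ξ
  have i2 := integral_X (hH.mul hY) htor hmet
  have i3 := integral_Y (hXY.mul hX) ξ
  have i4 := integral_X (hYY.mul hX) htor hmet
  have i5 := integral_Y (hXX.mul hY) ξ
  have i6 := integral_X (hYX.mul hY) htor hmet
  have c1 := integrable_of_continuous ((hH.mul hX).Y ξ).continuous
  have c2 := integrable_of_continuous ((hH.mul hY).X htor hmet).continuous
  have c3 := integrable_of_continuous ((hXY.mul hX).Y ξ).continuous
  have c4 := integrable_of_continuous ((hYY.mul hX).X htor hmet).continuous
  have c5 := integrable_of_continuous ((hXX.mul hY).Y ξ).continuous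
  have c6 := integrable_of_continuous ((hYX.mul hY).X htor hmet).continuous
  have key := (integral_sub (((c1.add c2).add c4).add c6) (c3.add c5)).symm
  rw [integral_add' ((c1.add c2).add c4) c6, integral_add' (c1.add c2) c4, integral_add' c1 c2,
    integral_add' c3 c5, i1, i2, i3, i4, i5, i6] at key
  simp only [add_zero, sub_zero] at key
  rw [key]
  refine integral_congr_ae (Filter.Eventually.of_forall fun w ↦ ?_)
  simp only [Pi.add_apply]
  rw [Y_mul hH hX, X_mul hH hY hmet, Y_mul hXY hX, X_mul hYY hX hmet, Y_mul hXX hY,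
    X_mul hYX hY hmet]
  simp only [H]
  ring

theorem smoothFn_sum_sq {F : so n → FM o → ℝ} (h : ∀ ξ, SmoothFn (F ξ)) :
    SmoothFn fun w ↦ (1 / 2 : ℝ) * ∑ i, ∑ j, F (wedge i j) w ^ 2 := by
  refine (SmoothFn.const _).mul (SmoothFn.sum _ fun i ↦ SmoothFn.sum _ fun j ↦ ?_)
  simp only [sq]
  exact (h _).mul (h _)

/-- The derivative of the vertical gradient along the frame flow. -/
def gradX (cov : CovariantDerivative (𝓡 n) (EuclideanSpace ℝ (Fin n))
    (fun x : M ↦ TangentSpace (𝓡 n) x)) (f : FM o → ℝ) (w : FM o) : Matrix (Fin n) (Fin n) ℝ :=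
  Matrix.of fun i j ↦ X cov (fun w ↦ gradSo f w i j) w

theorem ip_gradSo_self (f : FM o → ℝ) (w : FM o) :
    ip (gradSo f w) (gradSo f w) = (1 / 2 : ℝ) * ∑ i, ∑ j, Y (wedge i j) f w ^ 2 := by
  rw [ip_self]
  rfl

theorem ip_gradX_self (f : FM o → ℝ) (w : FM o) :
    ip (gradX cov f w) (gradX cov f w) =
      (1 / 2 : ℝ) * ∑ i, ∑ j, X cov (Y (wedge i j) f) w ^ 2 := by
  rw [ip_self]
  rfl

theorem continuous_ip_gradSo (hf : SmoothFn f) :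
    Continuous fun w ↦ ip (gradSo f w) (gradSo f w) := by
  simp only [ip_gradSo_self]
  exact (smoothFn_sum_sq fun ξ ↦ hf.Y ξ).continuous

theorem continuous_ip_gradX (hf : SmoothFn f) (htor : cov.torsion = 0)
    (hmet : cov.IsMetricCompatible) :
    Continuous fun w ↦ ip (gradX cov f w) (gradX cov f w) := by
  simp only [ip_gradX_self]
  exact (smoothFn_sum_sq fun ξ ↦ (hf.Y ξ).X htor hmet).continuous

theorem continuous_RFM (hf : SmoothFn f) (htor : cov.torsion = 0)
    (hmet : cov.IsMetricCompatible) :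
    Continuous fun w ↦ RFM cov w ⟨_, hf.gradSo_mem w⟩ ⟨_, hf.gradSo_mem w⟩ := by
  simp only [← sum_X_H hf htor hmet]
  exact ((SmoothFn.const _).mul (SmoothFn.sum _ fun i ↦ SmoothFn.sum _ fun j ↦
    (((hf.H htor hmet _).X htor hmet).sub ((hf.X htor hmet).H htor hmet _)).mul
      (hf.Y _))).continuous

/-- The Pestov identity on the frame bundle. -/
theorem pestov_frame (hf : SmoothFn f) (htor : cov.torsion = 0) (hmet : cov.IsMetricCompatible) :
    (∫ w, ip (gradSo (X cov f) w) (gradSo (X cov f) w) ∂(frameMeasure o)) -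
      ∫ w, ip (gradX cov f w) (gradX cov f w) ∂(frameMeasure o) =
    ((n : ℝ) - 1) * (∫ w, X cov f w ^ 2 ∂(frameMeasure o)) -
      ∫ w, RFM cov w ⟨_, hf.gradSo_mem w⟩ ⟨_, hf.gradSo_mem w⟩ ∂(frameMeasure o) := by
  have hX := hf.X htor hmet
  have c1 := integrable_of_continuous (continuous_ip_gradSo hX)
  have c2 := integrable_of_continuous (continuous_ip_gradX hf htor hmet)
  have c3 : Integrable (fun w ↦ X cov f w ^ 2) (frameMeasure o) :=
    integrable_of_continuous (hX.continuous.pow 2)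
  have c4 := integrable_of_continuous (continuous_RFM hf htor hmet)
  have hD : ∀ ξ : so n, Integrable (fun w ↦ Y ξ (X cov f) w ^ 2 - X cov (Y ξ f) w ^ 2
      + (Y ξ (H cov ξ f) w - H cov ξ (Y ξ f) w) * X cov f w
      + (X cov (H cov ξ f) w - H cov ξ (X cov f) w) * Y ξ f w) (frameMeasure o) := by
    intro ξ
    refine integrable_of_continuous ?_
    have hH := hf.H htor hmet ξ
    have hY := hf.Y ξ
    exact ((((hX.Y ξ).continuous.pow 2).sub ((hY.X htor hmet).continuous.pow 2)).add
      (((hH.Y ξ).sub (hY.H htor hmet ξ)).mul hX).continuous).add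
      (((hH.X htor hmet).sub (hX.H htor hmet ξ)).mul hY).continuous
  have h1 : ∫ w, (ip (gradSo (X cov f) w) (gradSo (X cov f) w) -
      ip (gradX cov f w) (gradX cov f w) - ((n : ℝ) - 1) * X cov f w ^ 2 +
      RFM cov w ⟨_, hf.gradSo_mem w⟩ ⟨_, hf.gradSo_mem w⟩) ∂(frameMeasure o) = 0 := by
    have h2 : ∀ w, ip (gradSo (X cov f) w) (gradSo (X cov f) w) -
        ip (gradX cov f w) (gradX cov f w) - ((n : ℝ) - 1) * X cov f w ^ 2 +
        RFM cov w ⟨_, hf.gradSo_mem w⟩ ⟨_, hf.gradSo_mem w⟩ = (1 / 2 : ℝ) * ∑ i, ∑ j,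
          (Y (wedge i j) (X cov f) w ^ 2 - X cov (Y (wedge i j) f) w ^ 2
          + (Y (wedge i j) (H cov (wedge i j) f) w - H cov (wedge i j) (Y (wedge i j) f) w) *
            X cov f w
          + (X cov (H cov (wedge i j) f) w - H cov (wedge i j) (X cov f) w) *
            Y (wedge i j) f w) := by
      intro w
      -- Summed over the basis, the term with [Y, H] becomes -(n-1)(𝐗f)² and the term with [𝐗, H]
      -- becomes the curvature form.
      have h3 := congrArg (fun r ↦ r * X cov f w) (sum_Y_H hf htor hmet w)
      simp only [Finset.sum_add_distrib, Finset.sum_sub_distrib, ← Finset.sum_mul, mul_add,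
        mul_sub]
      have h4 := sum_X_H hf htor hmet w
      rw [ip_gradSo_self, ip_gradX_self, ← h4]
      simp only [Finset.sum_sub_distrib] at h3
      linear_combination -h3
    simp only [h2]
    rw [integral_const_mul, integral_finsetSum _ fun i _ ↦ integrable_finsetSum _ fun j _ ↦ hD _]
    refine mul_eq_zero_of_right _ (Finset.sum_eq_zero fun i _ ↦ ?_)
    rw [integral_finsetSum _ fun j _ ↦ hD _]
    exact Finset.sum_eq_zero fun j _ ↦ integral_commutator hf htor hmet _
  have c12 : Integrable (fun w ↦ ip (gradSo (X cov f) w) (gradSo (X cov f) w) -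
      ip (gradX cov f w) (gradX cov f w)) (frameMeasure o) := c1.sub c2
  have c123 : Integrable (fun w ↦ ip (gradSo (X cov f) w) (gradSo (X cov f) w) -
      ip (gradX cov f w) (gradX cov f w) - ((n : ℝ) - 1) * X cov f w ^ 2) (frameMeasure o) :=
    c12.sub (c3.const_mul _)
  rw [integral_add c123 c4, integral_sub c12 (c3.const_mul _), integral_sub c1 c2,
    integral_const_mul] at h1
  linarith

end FramePestovIdentity

section Descent

set_option linter.unusedSectionVars false

variable {n : ℕ} {M : Type*} [TopologicalSpace M]
  [ChartedSpace (EuclideanSpace ℝ (Fin n)) M] [IsManifold (𝓡 n) ∞ M]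
  [RiemannianBundle (fun x : M ↦ TangentSpace (𝓡 n) x)]
  {o : ManifoldOrientation n M} {x₀ x : M} {p : Eu n} {G : Subgroup (SO n)} {z : PM o G}

/-! ### Vertical vectors -/

theorem ip_add_left (A B C : Matrix (Fin n) (Fin n) ℝ) : ip (A + B) C = ip A C + ip B C := by
  simp only [ip, Matrix.transpose_add, Matrix.add_mul, Matrix.trace_add]
  ring

theorem ip_sub_left (A B C : Matrix (Fin n) (Fin n) ℝ) : ip (A - B) C = ip A C - ip B C := by
  simp only [ip, Matrix.transpose_sub, Matrix.sub_mul, Matrix.trace_sub]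
  ring

theorem ip_comm (A B : Matrix (Fin n) (Fin n) ℝ) : ip A B = ip B A := by
  simp only [ip_eq_sum, mul_comm]

theorem eq_of_ip_eq (ξ η : so n) (h : ∀ ζ : so n, ip ξ.1 ζ.1 = ip η.1 ζ.1) : ξ = η := by
  apply Subtype.ext
  have h1 : ip (ξ.1 - η.1) (ξ.1 - η.1) = 0 := by
    have h2 := h (ξ - η)
    have h3 : (ξ - η).1 = ξ.1 - η.1 := rfl
    rw [h3] at h2
    rw [ip_sub_left, h2, sub_self]
  exact sub_eq_zero.1 (eq_zero_of_ip_self h1)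

theorem riesz_eq {ℓ : Vert z → ℝ} {T : Vert z} (h : ∀ T', ℓ T' = inner ℝ T T') : riesz ℓ = T := by
  conv_rhs => rw [← (stdOrthonormalBasis ℝ (Vert z)).sum_repr' T]
  simp only [riesz, h, real_inner_comm]

theorem inner_riesz (ℓ : Vert z →ₗ[ℝ] ℝ) (T : Vert z) : inner ℝ (riesz ℓ) T = ℓ T := by
  conv_rhs => rw [← (stdOrthonormalBasis ℝ (Vert z)).sum_repr' T]
  simp only [riesz, sum_inner, real_inner_smul_left, map_sum, map_smul, smul_eq_mul, mul_comm]

/-- The section of the vertical bundle given by an equivariant function on the frame bundle. -/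
def vertOf {B : FM o → so n} (h : ∀ w, ∀ η ∈ lieAlg G, ip (B w).1 η.1 = 0)
    (h' : ∀ w, ∀ a ∈ G, (B (w.rot a)).1 = a.1ᵀ * (B w).1 * a.1) (z : PM o G) : Vert z :=
  ⟨fun w ↦ B w.1, fun w ↦ h w.1, fun w w' a ha hw ↦ by
    change (B w'.1).1 = _
    rw [← hw]
    exact h' w.1 a ha⟩

theorem at_vertOf {B : FM o → so n} (h : ∀ w, ∀ η ∈ lieAlg G, ip (B w).1 η.1 = 0)
    (h' : ∀ w, ∀ a ∈ G, (B (w.rot a)).1 = a.1ᵀ * (B w).1 * a.1) (w : FibreOver z) :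
    Vert.at w (vertOf h h' z) = B w.1 := rfl

theorem norm_sq_vert (w : FibreOver z) (T : Vert z) :
    ‖T‖ ^ 2 = ip (Vert.at w T).1 (Vert.at w T).1 := by
  rw [← real_inner_self_eq_norm_sq, Vert.inner_eq w]

/-! ### Conjugation -/

/-- The adjoint action of `SO(n)`. -/
def conjSo (a : SO n) (ξ : so n) : so n :=
  ⟨a.1 * ξ.1 * a.1ᵀ, (LieAlgebra.Orthogonal.mem_so (Fin n) ℝ _).2 (by
    simp only [Matrix.transpose_mul, Matrix.transpose_transpose, so_transpose, Matrix.mul_assoc,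
      Matrix.neg_mul, Matrix.mul_neg])⟩

theorem expSO_conjSo (a : SO n) (ξ : so n) (t : ℝ) :
    expSO (t • conjSo a ξ) = a * expSO (t • ξ) * a⁻¹ := by
  apply Subtype.ext
  have h1 : (a * expSO (t • ξ) * a⁻¹).1 = a.1 * (expSO (t • ξ)).1 * a.1ᵀ := by
    rw [← SO_coe_inv]
    rfl
  rw [h1]
  have h2 := Matrix.exp_units_conj (⟨a.1, a.1ᵀ, SO_mul_transpose a, SO_transpose_mul a⟩ :
    (Matrix (Fin n) (Fin n) ℝ)ˣ) (t • ξ.1)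
  have h3 : (t • conjSo a ξ).1 = a.1 * (t • ξ.1) * a.1ᵀ := by
    rw [Matrix.mul_smul, Matrix.smul_mul]
    rfl
  change NormedSpace.exp (t • conjSo a ξ).1 = _
  rw [h3]
  exact h2

theorem ip_conj_left (a : SO n) (A B : Matrix (Fin n) (Fin n) ℝ) :
    ip (a.1ᵀ * A * a.1) B = ip A (a.1 * B * a.1ᵀ) := by
  rw [← ip_conj a A]
  congr 1
  simp only [Matrix.mul_assoc, SO_transpose_mul, Matrix.mul_one]
  rw [← Matrix.mul_assoc, SO_transpose_mul, Matrix.one_mul]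

theorem transpose_conj_mem (a : SO n) (ξ : so n) :
    a.1ᵀ * ξ.1 * a.1 ∈ LieAlgebra.Orthogonal.so (Fin n) ℝ := by
  rw [LieAlgebra.Orthogonal.mem_so]
  simp only [Matrix.transpose_mul, Matrix.transpose_transpose, so_transpose, Matrix.mul_assoc,
      Matrix.neg_mul, Matrix.mul_neg]

/-! ### Invariant functions -/

/-- a exp(tξ) = exp(t aξa⁻¹) a. -/
theorem Y_rot (f : FM o → ℝ) (w : FM o) (a : SO n) (ξ : so n) :
    Y ξ f (w.rot a) = Y (conjSo a ξ) (fun w ↦ f (w.rot a)) w := by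
  rw [Y, Y]
  congr 1
  funext t
  rw [expSO_conjSo, ← FM.rot_mul, ← FM.rot_mul, inv_mul_cancel_right]

theorem toPM_rot (w : FM o) {a : SO n} (ha : a ∈ G) : toPM G (w.rot a) = toPM G w :=
  (Quotient.sound ⟨a, ha, rfl⟩ : toPM G w = toPM G (w.rot a)).symm

variable [NeZero n] [IsContMDiffRiemannianBundle (𝓡 n) ∞ (EuclideanSpace ℝ (Fin n))
    (fun x : M ↦ TangentSpace (𝓡 n) x)]
  {cov : CovariantDerivative (𝓡 n) (EuclideanSpace ℝ (Fin n)) (fun x : M ↦ TangentSpace (𝓡 n) x)}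
  {f : FM o → ℝ} {u : PM o G → ℝ}

theorem toE_of_mem_subSO {a : SO n} (ha : a ∈ subSO n) : toE a.1 (e₁ n) = e₁ n := ha

/-- The frame flow commutes with the right action of `SO(n-1)`. -/
theorem X_rot (hf : SmoothFn f) (hmet : cov.IsMetricCompatible) (w : FM o) {a : SO n}
    (ha : a ∈ subSO n) : X cov f (w.rot a) = X cov (fun w ↦ f (w.rot a)) w := by
  obtain ⟨L, p, hp, b, hw⟩ := exists_point w
  obtain ⟨F, hF⟩ := hf _ L
  let A : (Eu n →L[ℝ] Eu n) →L[ℝ] (Eu n →L[ℝ] Eu n) :=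
    (ContinuousLinearMap.compL ℝ (Eu n) (Eu n) (Eu n)).flip (toE a.1)
  have hmul : ∀ b : SO n, toE (b * a).1 = A (toE b.1) := fun b ↦ toE_mul b.1 a.1
  have hd : ∀ q : Eu n × (Eu n →L[ℝ] Eu n), q.1 ∈ L.cdom →
      HasFDerivAt (fun q : Eu n × (Eu n →L[ℝ] Eu n) ↦ F (q.1, A q.2))
        ((fderiv ℝ F (q.1, A q.2)).comp ((ContinuousLinearMap.fst ℝ _ _).prod
          (A.comp (ContinuousLinearMap.snd ℝ _ _)))) q := fun q hq ↦
    (hF.hasFDerivAt (q := (q.1, A q.2)) hq).comp q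
      (hasFDerivAt_fst.prodMk (A.hasFDerivAt.comp q hasFDerivAt_snd))
  have hF' : LocalRep L (fun w ↦ f (w.rot a)) fun q ↦ F (q.1, A q.2) := by
    refine ⟨?_, fun p hp b ↦ ?_⟩
    · exact hF.1.comp (contDiff_fst.prodMk (A.contDiff.comp contDiff_snd)).contDiffOn
        fun q hq ↦ ⟨hq.1, Set.mem_univ _⟩
    · change f ((L.point p b).rot a) = F (p, A (toE b.1))
      rw [LocalFrame.point_rot, hF.2 p hp, hmul]
  rw [hw, LocalFrame.point_rot, hF.X_point hmet hp, hF'.X_point hmet hp, dAlong, dAlong,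
    (hd (p, toE b.1) hp).fderiv, hmul]
  change _ = fderiv ℝ F (p, A (toE b.1)) _
  congr 1
  -- Right translation by a carries B_v to B_{a⁻¹v}; it preserves 𝐗 because a fixes e₁.
  have h1 : A (toE b.1) (e₁ n) = toE b.1 (e₁ n) := congrArg (toE b.1) (toE_of_mem_subSO ha)
  simp only [horField, h1]
  rfl

/-- By invariance of f, testing the gradient at the rotated frame against ζ is the same as testing
the gradient at w against aζa⁻¹. -/
theorem gradSo_rot (hf : SmoothFn f) (hinv : ∀ w, ∀ a ∈ G, f (w.rot a) = f w) (w : FM o)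
    {a : SO n} (ha : a ∈ G) : gradSo f (w.rot a) = a.1ᵀ * gradSo f w * a.1 := by
  have h := eq_of_ip_eq ⟨_, hf.gradSo_mem (w.rot a)⟩
    ⟨_, transpose_conj_mem a ⟨_, hf.gradSo_mem w⟩⟩ fun ζ ↦ ?_
  · exact congrArg Subtype.val h
  · have h1 := hf.ip_gradSo w (conjSo a ζ)
    rw [ip_conj_left, hf.ip_gradSo, Y_rot, funext fun w ↦ hinv w a ha]
    exact h1.symm

/-- f is constant along the curves t ↦ w exp(tη). The full gradient on FM therefore already lies in
the complement of the Lie algebra, and the identity on FM descends without projecting anything. -/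
theorem ip_gradSo_lieAlg (hf : SmoothFn f) (hinv : ∀ w, ∀ a ∈ G, f (w.rot a) = f w) (w : FM o)
    {η : so n} (hη : η ∈ lieAlg G) : ip (gradSo f w) η.1 = 0 := by
  rw [hf.ip_gradSo, Y]
  simp only [hinv w _ (hη _)]
  exact deriv_const _ _

theorem SmoothFn.gradSo_apply (hf : SmoothFn f) (i j : Fin n) :
    SmoothFn fun w ↦ gradSo f w i j := hf.Y (wedge j i)

theorem ip_gradX (hf : SmoothFn f) (hmet : cov.IsMetricCompatible) (w : FM o)
    (B : Matrix (Fin n) (Fin n) ℝ) :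
    ip (gradX cov f w) B = X cov (fun w ↦ ip (gradSo f w) B) w := by
  have h := X_sum (cov := cov) (Finset.univ : Finset (Fin n × Fin n))
    (fun q ↦ (1 / 2 : ℝ) * B q.2 q.1) (F := fun q w ↦ gradSo f w q.2 q.1)
    (fun q ↦ hf.gradSo_apply _ _) hmet w
  have h1 : ∀ A : Matrix (Fin n) (Fin n) ℝ, ip A B =
      ∑ q : Fin n × Fin n, (1 / 2 : ℝ) * B q.2 q.1 * A q.2 q.1 := by
    intro A
    rw [ip_eq_sum, Fintype.sum_prod_type, Finset.mul_sum]
    refine Finset.sum_congr rfl fun i _ ↦ ?_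
    rw [Finset.mul_sum]
    exact Finset.sum_congr rfl fun j _ ↦ by ring
  simp only [h1]
  exact h.symm

theorem SmoothFn.gradX_mem (hf : SmoothFn f) (hmet : cov.IsMetricCompatible) (w : FM o) :
    gradX cov f w ∈ LieAlgebra.Orthogonal.so (Fin n) ℝ := by
  rw [LieAlgebra.Orthogonal.mem_so]
  ext i j
  have h := X_sum (cov := cov) {()} (fun _ ↦ (-1 : ℝ)) (F := fun _ w ↦ gradSo f w i j)
    (fun q ↦ hf.gradSo_apply _ _) hmet w
  simp only [Finset.sum_singleton, neg_mul, one_mul] at h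
  rw [Matrix.transpose_apply, Matrix.neg_apply]
  change FramePestov.X cov (fun w ↦ gradSo f w j i) w = - FramePestov.X cov (fun w ↦ gradSo f w i j) w
  rw [← h]
  congr 1
  funext w
  exact so_apply_swap ⟨_, hf.gradSo_mem w⟩ i j

/-- Equivariance of the gradient combined with the fact that 𝐗 commutes with G. The latter needs G
to fix e₁. -/
theorem gradX_rot (hf : SmoothFn f) (hmet : cov.IsMetricCompatible) (hG : G ≤ subSO n)
    (hinv : ∀ w, ∀ a ∈ G, f (w.rot a) = f w) (w : FM o)
    {a : SO n} (ha : a ∈ G) : gradX cov f (w.rot a) = a.1ᵀ * gradX cov f w * a.1 := by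
  have h := eq_of_ip_eq ⟨_, hf.gradX_mem hmet (w.rot a)⟩
    ⟨_, transpose_conj_mem a ⟨_, hf.gradX_mem hmet w⟩⟩ fun ζ ↦ ?_
  · exact congrArg Subtype.val h
  · have h1 : SmoothFn fun w ↦ ip (gradSo f w) ζ.1 := by
      simp only [hf.ip_gradSo]
      exact hf.Y ζ
    rw [ip_conj_left, ip_gradX hf hmet, ip_gradX hf hmet, X_rot h1 hmet w (hG ha)]
    congr 1
    funext w
    rw [gradSo_rot hf hinv w ha, ip_conj_left]

theorem ip_gradX_lieAlg (hf : SmoothFn f) (hmet : cov.IsMetricCompatible)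
    (hinv : ∀ w, ∀ a ∈ G, f (w.rot a) = f w) (w : FM o)
    {η : so n} (hη : η ∈ lieAlg G) : ip (gradX cov f w) η.1 = 0 := by
  rw [ip_gradX hf hmet]
  simp only [ip_gradSo_lieAlg hf hinv _ hη]
  exact X_const 0 w hmet

/-! ### The operators on the associated bundle -/

/-- The gradient of the lifted function is equivariant and orthogonal to the Lie algebra, so it
defines a vertical vector. It represents the same linear form as the vertical gradient, at every
frame of the fibre. -/
theorem vertGrad_eq (hu : SmoothFn fun w ↦ u (toPM G w)) (w : FibreOver z) :
    (Vert.at w (vertGrad u z)).1 = gradSo (fun w ↦ u (toPM G w)) w.1 := by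
  have hinv : ∀ w : FM o, ∀ a ∈ G, u (toPM G (w.rot a)) = u (toPM G w) :=
    fun w a ha ↦ by rw [toPM_rot w ha]
  have h : vertGrad u z = vertOf (B := fun w ↦ ⟨_, hu.gradSo_mem w⟩)
      (fun w η hη ↦ ip_gradSo_lieAlg hu hinv w hη) (fun w a ha ↦ gradSo_rot hu hinv w ha) z := by
    refine riesz_eq fun T ↦ ?_
    rw [Vert.inner_eq (lift z), at_vertOf]
    exact (hu.ip_gradSo _ _).symm
  rw [h, at_vertOf]

/-- `XPM` is evaluated at a chosen frame over the point; commutation of 𝐗 with G makes the choice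
irrelevant. -/
theorem XPM_toPM (hu : SmoothFn fun w ↦ u (toPM G w)) (hmet : cov.IsMetricCompatible)
    (hG : G ≤ subSO n) (w : FM o) : XPM cov u (toPM G w) = X cov (fun w ↦ u (toPM G w)) w := by
  obtain ⟨a, ha, h⟩ := exists_rot_eq (lift (toPM G w)) ⟨w, rfl⟩
  conv_rhs => rw [← (show (lift (toPM G w)).1.rot a = w from h), X_rot hu hmet _ (hG ha)]
  rw [XPM]
  congr 1
  funext w
  rw [toPM_rot w ha]

theorem covX_vertGrad_eq (hu : SmoothFn fun w ↦ u (toPM G w)) (hmet : cov.IsMetricCompatible)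
    (hG : G ≤ subSO n) (w : FibreOver z) :
    (Vert.at w (covX cov (vertGrad u) z)).1 = gradX cov (fun w ↦ u (toPM G w)) w.1 := by
  have hinv : ∀ w : FM o, ∀ a ∈ G, u (toPM G (w.rot a)) = u (toPM G w) :=
    fun w a ha ↦ by rw [toPM_rot w ha]
  have h : covX cov (vertGrad u) z = vertOf (B := fun w ↦ ⟨_, hu.gradX_mem hmet w⟩)
      (fun w η hη ↦ ip_gradX_lieAlg hu hmet hinv w hη)
      (fun w a ha ↦ gradX_rot hu hmet hG hinv w ha) z := by
    refine riesz_eq fun T ↦ ?_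
    rw [Vert.inner_eq (lift z), at_vertOf]
    simp only [vertGrad_eq hu]
    rfl
  rw [h, at_vertOf]

/-! ### The curvature -/

theorem curvature_iso (htor : cov.torsion = 0) (hmet : cov.IsMetricCompatible) (w : FM o)
    (a b c : Eu n) : curvature cov w.1 (w.2.iso a) (w.2.iso b) (w.2.iso c) =
      w.2.iso (toE (curvSo htor hmet w a b).1 c) := by
  obtain ⟨x₀, L, p, hp, hx, g, rfl⟩ := exists_point_self w
  have h := congrArg (fun T : Eu n →L[ℝ] Eu n ↦ T c) (toE_curvSo htor hmet hp hx g a b)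
  simp only [ContinuousLinearMap.comp_apply] at h
  refine (LocalFrame.curvature_point htor hmet hp hx g a b c).trans ?_
  rw [← h]
  rfl

theorem curvSo_rot (htor : cov.torsion = 0) (hmet : cov.IsMetricCompatible) (w : FM o) (g : SO n)
    (a b : Eu n) : (curvSo htor hmet (w.rot g) a b).1 =
      g.1ᵀ * (curvSo htor hmet w (toE g.1 a) (toE g.1 b)).1 * g.1 := by
  have h : toE g.1 ∘L toE (curvSo htor hmet (w.rot g) a b).1 =
      toE (curvSo htor hmet w (toE g.1 a) (toE g.1 b)).1 ∘L toE g.1 := by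
    ext1 c
    have h1 := curvature_iso htor hmet (w.rot g) a b c
    have h2 := curvature_iso htor hmet w (toE g.1 a) (toE g.1 b) (toE g.1 c)
    exact w.2.iso.injective (h1.symm.trans h2)
  rw [← toE_mul, ← toE_mul] at h
  rw [Matrix.mul_assoc, ← toE_injective h, ← Matrix.mul_assoc, SO_transpose_mul, Matrix.one_mul]

theorem RFM_eq (htor : cov.torsion = 0) (hmet : cov.IsMetricCompatible) (w : FM o) (ξ η : so n) :
    RFM cov w ξ η = ip ξ.1 (curvSo htor hmet w (toE η.1 (e₁ n)) (e₁ n)).1 := rfl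

/-- The curvature matrix, ξ and η are all conjugated by g, and g fixes e₁, so the invariance of the
inner product applies. -/
theorem RFM_rot (htor : cov.torsion = 0) (hmet : cov.IsMetricCompatible) (w : FM o) {g : SO n}
    (hg : g ∈ subSO n) (ξ η ξ' η' : so n) (hξ : ξ'.1 = g.1ᵀ * ξ.1 * g.1)
    (hη : η'.1 = g.1ᵀ * η.1 * g.1) : RFM cov (w.rot g) ξ' η' = RFM cov w ξ η := by
  have h1 : toE g.1 (toE η'.1 (e₁ n)) = toE η.1 (e₁ n) := by
    rw [← ContinuousLinearMap.comp_apply, ← toE_mul, hη, ← Matrix.mul_assoc, ← Matrix.mul_assoc,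
      SO_mul_transpose, Matrix.one_mul, toE_mul, ContinuousLinearMap.comp_apply,
      toE_of_mem_subSO hg]
  rw [RFM_eq htor hmet, RFM_eq htor hmet, curvSo_rot, hξ, ip_conj, h1, toE_of_mem_subSO hg]

theorem RFM_fibre (htor : cov.torsion = 0) (hmet : cov.IsMetricCompatible) (hG : G ≤ subSO n)
    (w w' : FibreOver z) (T T' : Vert z) :
    RFM cov w.1 (Vert.at w T) (Vert.at w T') = RFM cov w'.1 (Vert.at w' T) (Vert.at w' T') := by
  obtain ⟨a, ha, h⟩ := exists_rot_eq w w'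
  have e1 : (Vert.at w' T).1 = a.1ᵀ * (Vert.at w T).1 * a.1 := T.2.2 w w' a ha h
  have e2 : (Vert.at w' T').1 = a.1ᵀ * (Vert.at w T').1 * a.1 := T'.2.2 w w' a ha h
  rw [← h]
  exact (RFM_rot htor hmet w.1 (hG ha) _ _ _ _ e1 e2).symm

/-- The vector formed by `riesz` represents its form only when that form is linear. Linearity in the
second argument comes from bilinearity of the curvature. -/
theorem inner_RPM (htor : cov.torsion = 0) (hmet : cov.IsMetricCompatible) (hG : G ≤ subSO n)
    (w : FibreOver z) (T T' : Vert z) :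
    inner ℝ (RPM cov z T) T' = RFM cov w.1 (Vert.at w T) (Vert.at w T') := by
  rw [RFM_fibre htor hmet hG w (lift z)]
  let ℓ : Vert z →ₗ[ℝ] ℝ :=
    { toFun := fun T' ↦ RFM cov (lift z).1 (Vert.at (lift z) T) (Vert.at (lift z) T')
      map_add' := fun S S' ↦ by
        have h : ∀ ξ η : so n, toE (ξ + η).1 (e₁ n) = toE ξ.1 (e₁ n) + toE η.1 (e₁ n) := by
          intro ξ η
          rw [← _root_.add_apply, ← toE_add]
          rfl
        simp only [RFM_eq htor hmet, map_add, h]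
        rw [curvSo_swap, curvSo_add, neg_add, ← curvSo_swap, ← curvSo_swap, ip_comm,
          ip_comm _ (curvSo _ _ _ _ _).1, ip_comm _ (curvSo _ _ _ _ _).1, ← ip_add_left]
        rfl
      map_smul' := fun c S ↦ by
        have h : ∀ ξ : so n, toE (c • ξ).1 (e₁ n) = c • toE ξ.1 (e₁ n) := by
          intro ξ
          rw [← _root_.smul_apply, ← toE_smul]
          rfl
        simp only [RFM_eq htor hmet, map_smul, h, RingHom.id_apply, smul_eq_mul]
        rw [curvSo_swap, curvSo_smul, ← smul_neg, ← curvSo_swap]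
        change ip _ (c • (curvSo _ _ _ _ _).1) = _
        simp only [ip, Matrix.mul_smul, Matrix.trace_smul, smul_eq_mul]
        ring }
  exact inner_riesz ℓ T'

/-! ### The Pestov identity on the associated bundle -/

variable [T2Space M] [CompactSpace M] [MeasurableSpace M] [BorelSpace M]

theorem integral_liouville (hGc : IsClosed (G : Set (SO n))) (τ : Measure (SO n ⧸ G))
    [IsFiniteMeasure τ] (hτ : ∀ a : SO n, τ.map (fun p ↦ a • p) = τ) {Φ : PM o G → ℝ}
    {φ : FM o → ℝ} (hφ : Continuous φ) (h : ∀ w, Φ (toPM G w) = φ w) :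
    Integrable Φ (liouville o τ) ∧
      ∫ z, Φ z ∂(liouville o τ) = (τ Set.univ).toReal * ∫ w, φ w ∂(frameMeasure o) := by
  have hΦ : Continuous Φ := by
    refine continuous_coinduced_dom.2 ?_
    exact hφ.congr fun w ↦ (h w).symm
  have hpm := (continuous_toPM (o := o) G).measurable
  rw [liouville_eq hGc τ hτ]
  constructor
  · refine Integrable.smul_measure ?_ (measure_ne_top τ _)
    rw [integrable_map_measure hΦ.measurable.aestronglyMeasurable hpm.aemeasurable]
    exact (integrable_of_continuous hφ).congr (Filter.Eventually.of_forall fun w ↦ (h w).symm)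
  · rw [integral_smul_measure, integral_map hpm.aemeasurable hΦ.measurable.aestronglyMeasurable,
      smul_eq_mul]
    simp only [h]

/-- Each of the four integrands, pulled back to FM, is the corresponding continuous function of
`pestov_frame`. All four integrals acquire the same factor, the total mass of τ. -/
theorem pestov_associated (htor : cov.torsion = 0) (hmet : cov.IsMetricCompatible)
    (hG : G ≤ subSO n) (hGc : IsClosed (G : Set (SO n))) (τ : Measure (SO n ⧸ G))
    [IsFiniteMeasure τ] (hτ : ∀ a : SO n, τ.map (fun p ↦ a • p) = τ)
    (hu : SmoothFn fun w ↦ u (toPM G w)) :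
    Integrable (fun z ↦ ‖vertGrad (XPM cov u) z‖ ^ 2) (liouville o τ) ∧
      Integrable (fun z ↦ ‖covX cov (vertGrad u) z‖ ^ 2) (liouville o τ) ∧
      Integrable (fun z ↦ XPM cov u z ^ 2) (liouville o τ) ∧
      Integrable (fun z ↦ (inner ℝ (RPM cov z (vertGrad u z)) (vertGrad u z) : ℝ))
        (liouville o τ) ∧
      (∫ z, ‖vertGrad (XPM cov u) z‖ ^ 2 ∂(liouville o τ))
          - ∫ z, ‖covX cov (vertGrad u) z‖ ^ 2 ∂(liouville o τ)
        = ((n : ℝ) - 1) * (∫ z, XPM cov u z ^ 2 ∂(liouville o τ))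
          - ∫ z, (inner ℝ (RPM cov z (vertGrad u z)) (vertGrad u z) : ℝ) ∂(liouville o τ) := by
  have hX := hu.X htor hmet
  have hXPM : (fun w ↦ XPM cov u (toPM G w)) = X cov fun w ↦ u (toPM G w) :=
    funext fun w ↦ XPM_toPM hu hmet hG w
  have hX' : SmoothFn fun w ↦ XPM cov u (toPM G w) := by rwa [hXPM]
  obtain ⟨a1, b1⟩ := integral_liouville hGc τ hτ (Φ := fun z ↦ ‖vertGrad (XPM cov u) z‖ ^ 2)
    (continuous_ip_gradSo hX) fun w ↦ by
      rw [norm_sq_vert ⟨w, rfl⟩, vertGrad_eq hX', hXPM]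
  obtain ⟨a2, b2⟩ := integral_liouville hGc τ hτ (Φ := fun z ↦ ‖covX cov (vertGrad u) z‖ ^ 2)
    (continuous_ip_gradX hu htor hmet) fun w ↦ by
      rw [norm_sq_vert ⟨w, rfl⟩, covX_vertGrad_eq hu hmet hG]
  obtain ⟨a3, b3⟩ := integral_liouville hGc τ hτ (Φ := fun z ↦ XPM cov u z ^ 2)
    (hX.continuous.pow 2) fun w ↦ by
      rw [XPM_toPM hu hmet hG]
      rfl
  obtain ⟨a4, b4⟩ := integral_liouville hGc τ hτ
    (Φ := fun z ↦ (inner ℝ (RPM cov z (vertGrad u z)) (vertGrad u z) : ℝ))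
    (continuous_RFM hu htor hmet) fun w ↦ by
      rw [inner_RPM htor hmet hG ⟨w, rfl⟩]
      congr 1 <;> exact Subtype.ext (vertGrad_eq hu _)
  refine ⟨a1, a2, a3, a4, ?_⟩
  rw [b1, b2, b3, b4]
  have h := pestov_frame hu htor hmet
  simp only [Pi.pow_apply]
  linear_combination (τ Set.univ).toReal * h

end Descent

section Sphere

set_option linter.unusedSectionVars false

variable {n : ℕ}

/-! ### The Lie algebra of `SO(n-1)` -/

theorem toE_so_add (ξ η : so n) : toE (ξ + η).1 = toE ξ.1 + toE η.1 := toE_add ξ.1 η.1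

theorem toE_so_smul (c : ℝ) (ξ : so n) : toE (c • ξ).1 = c • toE ξ.1 := toE_smul c ξ.1

theorem mem_lieAlg_subSO [NeZero n] {η : so n} :
    η ∈ lieAlg (subSO n) ↔ toE η.1 (e₁ n) = 0 := by
  constructor
  · intro h
    have h1 : HasDerivAt (fun t : ℝ ↦ toE (expSO (t • η)).1 (e₁ n)) (toE η.1 (e₁ n)) 0 :=
      (ContinuousLinearMap.apply ℝ (Eu n) (e₁ n)).hasFDerivAt.comp_hasDerivAt (0 : ℝ)
        (hasDerivAt_toE_expSO η)
    have h2 : (fun t : ℝ ↦ toE (expSO (t • η)).1 (e₁ n)) = fun _ ↦ e₁ n := funext fun t ↦ h t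
    rw [h2] at h1
    exact h1.unique (hasDerivAt_const _ _)
  · intro h t
    -- The curve exp(tη)e₁ has derivative exp(tη)ηe₁ = 0, so it stays at e₁.
    have h1 : ∀ t : ℝ, HasDerivAt (fun t : ℝ ↦ NormedSpace.exp (t • toE η.1) (e₁ n)) 0 t := by
      intro t
      have h2 := (ContinuousLinearMap.apply ℝ (Eu n) (e₁ n)).hasFDerivAt.comp_hasDerivAt t
        (hasDerivAt_exp_smul_const (𝕂 := ℝ) (toE η.1) t)
      have h3 : (NormedSpace.exp (t • toE η.1) * toE η.1) (e₁ n) = 0 := by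
        change NormedSpace.exp (t • toE η.1) (toE η.1 (e₁ n)) = 0
        rw [h, map_zero]
      simp only [ContinuousLinearMap.apply_apply, h3] at h2
      exact h2
    have h2 := is_const_of_deriv_eq_zero (fun t ↦ (h1 t).differentiableAt)
      (fun t ↦ (h1 t).deriv) t 0
    have h3 : toE (expSO (t • η)).1 = NormedSpace.exp (t • toE η.1) := by
      rw [toE_expSO, toE_so_smul]
    change toE (expSO (t • η)).1 (e₁ n) = e₁ n
    have h4 : (0 : ℝ) • toE η.1 = 0 := by ext1 v; simp
    rw [h3, h2, h4, NormedSpace.exp_zero]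
    rfl

theorem ip_wedge (ξ : so n) (i j : Fin n) : ip ξ.1 (wedge i j).1 = ξ.1 j i := by
  have h1 : ∀ k l, ip ξ.1 (Matrix.single k l 1) = (1 / 2 : ℝ) * ξ.1 k l := by
    intro k l
    rw [ip_eq_sum]
    congr 1
    simp [Matrix.single_apply, ite_and]
  have h2 : ip ξ.1 (wedge i j).1 = ip ξ.1 (Matrix.single j i 1) - ip ξ.1 (Matrix.single i j 1) := by
    rw [ip_comm, wedge, ip_sub_left, ip_comm, ip_comm (Matrix.single i j 1)]
  rw [h2, h1, h1, so_apply_swap ξ j i]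
  ring

variable [NeZero n]

/-- The element `e₁ ∧ v` of `so(n)`. -/
def wedgeE (v : Eu n) : so n := ∑ j, v j • wedge 0 j

/-- v ↦ e₁ ∧ v is the adjoint of the evaluation ξ ↦ ξe₁. -/
theorem ip_wedgeE (ξ : so n) (v : Eu n) : ip ξ.1 (wedgeE v).1 = inner ℝ (toE ξ.1 (e₁ n)) v := by
  let ℓ : so n →ₗ[ℝ] ℝ :=
    { toFun := fun η ↦ ip ξ.1 η.1
      map_add' := fun η ζ ↦ by
        rw [ip_comm, ip_comm _ η.1, ip_comm _ ζ.1, ← ip_add_left]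
        rfl
      map_smul' := fun c η ↦ by
        change ip _ (c • η.1) = _
        simp only [ip, Matrix.mul_smul, Matrix.trace_smul, smul_eq_mul, RingHom.id_apply]
        ring }
  have h : ip ξ.1 (wedgeE v).1 = ℓ (wedgeE v) := rfl
  rw [h, wedgeE, map_sum]
  simp only [map_smul, smul_eq_mul]
  rw [EuclideanSpace.inner_eq_star_dotProduct]
  simp only [star_trivial, dotProduct]
  refine Finset.sum_congr rfl fun j _ ↦ ?_
  rw [e₁, toE_single]
  exact congrArg _ (ip_wedge ξ 0 j)

theorem toE_wedgeE {v : Eu n} (hv : inner ℝ (e₁ n) v = 0) : toE (wedgeE v).1 (e₁ n) = v := by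
  have hv0 : v 0 = 0 := by
    rw [e₁, EuclideanSpace.inner_single_left] at hv
    simpa using hv
  let ℓ : so n →ₗ[ℝ] Eu n :=
    { toFun := fun η ↦ toE η.1 (e₁ n)
      map_add' := fun η ζ ↦ by rw [toE_so_add, _root_.add_apply]
      map_smul' := fun c η ↦ by rw [toE_so_smul, _root_.smul_apply, RingHom.id_apply] }
  have h : toE (wedgeE v).1 (e₁ n) = ℓ (wedgeE v) := rfl
  rw [h, wedgeE, map_sum]
  have h1 : ∀ j, ℓ (v j • wedge 0 j) = v j • EuclideanSpace.single j (1 : ℝ) := by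
    intro j
    rw [map_smul]
    change v j • toE (wedge 0 j).1 (e₁ n) = _
    by_cases hj : j = 0
    · rw [hj, hv0, zero_smul, zero_smul]
    · have h2 : e₁ n j = 0 := by simp [e₁, hj]
      have h3 : e₁ n 0 = 1 := by simp [e₁]
      rw [toE_wedge, h2, h3, one_smul, zero_smul, sub_zero]
  simp only [h1]
  exact sum_single v

theorem inner_e₁_toE (ξ : so n) : inner ℝ (e₁ n) (toE ξ.1 (e₁ n)) = 0 := by
  have h := inner_toE_so ξ (e₁ n) (e₁ n)
  rw [real_inner_comm] at h
  linarith

/-- On the orthogonal complement of the Lie algebra of `SO(n-1)` the inner product is given by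
`ξ ↦ ξ e₁`. -/
theorem ip_eq_inner {ξ : so n} (hξ : ∀ η ∈ lieAlg (subSO n), ip ξ.1 η.1 = 0) (η : so n) :
    ip ξ.1 η.1 = inner ℝ (toE ξ.1 (e₁ n)) (toE η.1 (e₁ n)) := by
  -- Subtracting e₁ ∧ ηe₁ from η leaves an element annihilating e₁, that is, one in the Lie algebra
  -- of SO(n-1), to which ξ is orthogonal.
  have h1 : η - wedgeE (toE η.1 (e₁ n)) ∈ lieAlg (subSO n) := by
    rw [mem_lieAlg_subSO]
    have h2 : toE (η - wedgeE (toE η.1 (e₁ n))).1 =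
      toE η.1 - toE (wedgeE (toE η.1 (e₁ n))).1 := toE_sub _ _
    rw [h2, _root_.sub_apply, toE_wedgeE (inner_e₁_toE η), sub_self]
  have h3 := hξ _ h1
  have h4 : ip ξ.1 (η - wedgeE (toE η.1 (e₁ n))).1 = ip ξ.1 η.1 -
      ip ξ.1 (wedgeE (toE η.1 (e₁ n))).1 := by
    have h5 : (η - wedgeE (toE η.1 (e₁ n))).1 = η.1 - (wedgeE (toE η.1 (e₁ n))).1 := rfl
    rw [ip_comm, h5, ip_sub_left, ip_comm, ip_comm (wedgeE _).1]
  rw [← ip_wedgeE]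
  linarith

theorem ip_wedgeE_lieAlg (v : Eu n) {η : so n} (hη : η ∈ lieAlg (subSO n)) :
    ip (wedgeE v).1 η.1 = 0 := by
  rw [ip_comm, ip_wedgeE, mem_lieAlg_subSO.1 hη, inner_zero_left]

/-! ### Transitivity on the sphere -/

theorem matrix_orthogonal_of_isometry (T : Eu n →L[ℝ] Eu n)
    (hT : ∀ v w, inner ℝ (T v) (T w) = inner ℝ v w) : (toMat T)ᵀ * toMat T = 1 := by
  ext i j
  have h := hT (EuclideanSpace.single i 1) (EuclideanSpace.single j 1)
  rw [EuclideanSpace.inner_eq_star_dotProduct, EuclideanSpace.inner_eq_star_dotProduct,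
    dotProduct_comm] at h
  rw [Matrix.mul_apply]
  simp only [star_trivial, dotProduct] at h
  refine Eq.trans ?_ (h.trans ?_)
  · rfl
  · rw [Matrix.one_apply]
    simp [eq_comm]

theorem exists_SO_of_isometry {T : Eu n →L[ℝ] Eu n}
    (hT : ∀ v w, inner ℝ (T v) (T w) = inner ℝ v w) (hdet : 0 < T.det) :
    ∃ a : SO n, toE a.1 = T := by
  have h := matrix_orthogonal_of_isometry T hT
  have h1 : (toMat T).det = 1 := by
    have h2 := congrArg Matrix.det h
    rw [Matrix.det_mul, Matrix.det_transpose, Matrix.det_one] at h2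
    rw [← det_toMat] at hdet
    nlinarith
  exact ⟨⟨toMat T, Matrix.mem_specialOrthogonalGroup_iff.2
    ⟨Matrix.mem_orthogonalGroup_iff' _ _ |>.2 h, h1⟩⟩, toE_toMat T⟩

/-- A reflection takes e₁ to β. Should its determinant be negative, it is preceded by the reflection
negating the second basis vector, which fixes e₁; this is where n ≥ 2 enters. -/
theorem exists_SO_apply_e₁ (hn : 2 ≤ n) {β : Eu n} (hβ : ‖β‖ = 1) :
    ∃ a : SO n, toE a.1 (e₁ n) = β := by
  have he : ‖e₁ n‖ = ‖β‖ := by rw [hβ, e₁]; simp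
  let R := Submodule.reflection (ℝ ∙ (e₁ n - β))ᗮ
  have hR : R (e₁ n) = β := Submodule.reflection_sub he
  let T : Eu n →L[ℝ] Eu n := (R : Eu n ≃L[ℝ] Eu n)
  have hT : ∀ v w, inner ℝ (T v) (T w) = inner ℝ v w := fun v w ↦ R.inner_map_map v w
  have hT2 : T.det * T.det = 1 := by
    have h := congrArg Matrix.det (matrix_orthogonal_of_isometry T hT)
    rwa [Matrix.det_mul, Matrix.det_transpose, Matrix.det_one, det_toMat] at h
  rcases lt_or_ge 0 T.det with h | h
  · obtain ⟨a, ha⟩ := exists_SO_of_isometry hT h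
    exact ⟨a, by rw [ha]; exact hR⟩
  · let k : Fin n := ⟨1, hn⟩
    have hk : k ≠ 0 := by
      intro h
      have := congrArg Fin.val h
      simp [k] at this
    let K : Submodule ℝ (Eu n) := ℝ ∙ (EuclideanSpace.single k (1 : ℝ) : Eu n)
    let S := Kᗮ.reflection
    have hS : S (e₁ n) = e₁ n := by
      refine Submodule.reflection_mem_subspace_eq_self ?_
      rw [Submodule.mem_orthogonal_singleton_iff_inner_right, EuclideanSpace.inner_single_left, e₁]
      simp [hk]
    let S' : Eu n →L[ℝ] Eu n := (S : Eu n ≃L[ℝ] Eu n)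
    have hSd : S'.det = -1 := by
      have h1 := Submodule.det_reflection Kᗮ
      rw [Submodule.orthogonal_orthogonal, finrank_span_singleton (by simp), pow_one] at h1
      exact h1
    have hTS : ∀ v w, inner ℝ ((T ∘L S') v) ((T ∘L S') w) = inner ℝ v w := fun v w ↦
      (hT _ _).trans (S.inner_map_map v w)
    have hd : (T ∘L S').det = T.det * S'.det := LinearMap.det_comp _ _
    obtain ⟨a, ha⟩ := exists_SO_of_isometry hTS (by rw [hd, hSd]; nlinarith)
    refine ⟨a, ?_⟩
    rw [ha]
    exact (congrArg R hS).trans hR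

end Sphere

section UnitTangent

set_option linter.unusedSectionVars false

variable {n : ℕ} {M : Type*} [TopologicalSpace M]
  [ChartedSpace (EuclideanSpace ℝ (Fin n)) M] [IsManifold (𝓡 n) ∞ M]
  [RiemannianBundle (fun x : M ↦ TangentSpace (𝓡 n) x)]
  {o : ManifoldOrientation n M} {G : Subgroup (SO n)} {z : PM o G}

/-! ### The identification of `PM` with the unit tangent bundle -/

/-- SO(n) acts freely on frames, so a value at one frame extends to the fibre by equivariance
without ambiguity. The extension stays orthogonal to the Lie algebra, which is stable under
conjugation by G. -/
theorem exists_vert (w : FibreOver z) {ξ : so n} (hξ : ∀ η ∈ lieAlg G, ip ξ.1 η.1 = 0) :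
    ∃ T : Vert z, Vert.at w T = ξ := by
  have hinj : ∀ a b : SO n, w.1.rot a = w.1.rot b → a = b := by
    intro a b h
    have h1 : w.1.2.rot a = w.1.2.rot b := eq_of_heq (Sigma.mk.inj h).2
    have h2 : toE a.1 = toE b.1 := by
      ext1 v
      exact w.1.2.iso.injective (congrArg (fun e : FrameAt o w.1.1 ↦ e.iso v) h1)
    exact Subtype.ext (toE_injective h2)
  have hconj : ∀ a ∈ G, ∀ η ∈ lieAlg G, conjSo a η ∈ lieAlg G := by
    intro a ha η hη t
    rw [expSO_conjSo]
    exact G.mul_mem (G.mul_mem ha (hη t)) (G.inv_mem ha)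
  choose g hg hgw using fun w' ↦ exists_rot_eq w w'
  let B : FibreOver z → so n := fun w' ↦ ⟨_, transpose_conj_mem (g w') ξ⟩
  have hB1 : ∀ w', ∀ η ∈ lieAlg G, ip (B w').1 η.1 = 0 := by
    intro w' η hη
    change ip ((g w').1ᵀ * ξ.1 * (g w').1) η.1 = 0
    rw [ip_conj_left]
    exact hξ _ (hconj _ (hg w') η hη)
  have hB2 : ∀ w' w'' : FibreOver z, ∀ a ∈ G, w'.1.rot a = w''.1 →
      (B w'').1 = a.1ᵀ * (B w').1 * a.1 := by
    intro w' w'' a ha h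
    have h1 : g w'' = g w' * a := by
      apply hinj
      rw [hgw, FM.rot_mul, hgw, h]
    change (g w'').1ᵀ * ξ.1 * (g w'').1 = a.1ᵀ * ((g w').1ᵀ * ξ.1 * (g w').1) * a.1
    have h2 : (g w'').1 = (g w').1 * a.1 := congrArg Subtype.val h1
    rw [h2, Matrix.transpose_mul]
    simp only [Matrix.mul_assoc]
  refine ⟨⟨B, hB1, hB2⟩, ?_⟩
  have h1 : g w = 1 := by
    apply hinj
    rw [hgw, FM.rot_one]
  apply Subtype.ext
  change (g w).1ᵀ * ξ.1 * (g w).1 = ξ.1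
  have h2 : (g w).1 = 1 := congrArg Subtype.val h1
  rw [h2, Matrix.transpose_one, Matrix.one_mul, Matrix.mul_one]

variable [NeZero n]

theorem FM.toSM_rot (w : FM o) {a : SO n} (ha : a ∈ subSO n) : (w.rot a).toSM = w.toSM := by
  have h : (w.2.rot a).iso (e₁ n) = w.2.iso (e₁ n) :=
    (FrameAt.rot_iso _ _ _).trans (congrArg w.2.iso (toE_of_mem_subSO ha))
  change (⟨w.1, ⟨(w.2.rot a).iso (e₁ n), _⟩⟩ : SM (n := n) M) = ⟨w.1, ⟨w.2.iso (e₁ n), _⟩⟩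
  congr 1
  exact Subtype.ext h

theorem toSM_toPM (hG : G ≤ subSO n) (w : FM o) : (toPM G w).toSM = w.toSM := by
  obtain ⟨a, ha, h⟩ := exists_rot_eq (lift (toPM G w)) ⟨w, rfl⟩
  have h' : (lift (toPM G w)).1.rot a = w := h
  conv_rhs => rw [← h']
  exact (FM.toSM_rot _ (hG ha)).symm

/-- Two frames at a point with the same first vector differ by a rotation fixing e₁; transitivity of
SO(n) on the unit sphere gives surjectivity. -/
theorem bijective_toSM (hn : 2 ≤ n) :
    Function.Bijective (PM.toSM : PM o (subSO n) → SM (n := n) M) := by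
  constructor
  · intro z z' h
    obtain ⟨w, rfl⟩ := Quotient.exists_rep z
    obtain ⟨w', rfl⟩ := Quotient.exists_rep z'
    have h1 : w.toSM = w'.toSM :=
      (toSM_toPM le_rfl w).symm.trans (h.trans (toSM_toPM le_rfl w'))
    obtain ⟨x, w⟩ := w
    obtain ⟨x', w'⟩ := w'
    obtain rfl : x = x' := congrArg Sigma.fst h1
    have h2 : w.iso (e₁ n) = w'.iso (e₁ n) :=
      congrArg Subtype.val (eq_of_heq (Sigma.mk.inj h1).2)
    obtain ⟨a, rfl⟩ := w.exists_rot w'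
    refine Quotient.sound ⟨a, ?_, rfl⟩
    exact w.iso.injective h2.symm
  · rintro ⟨x, v, hv⟩
    obtain ⟨w⟩ := nonempty_frameAt o x
    obtain ⟨a, ha⟩ := exists_SO_apply_e₁ hn (β := w.iso.symm v) (by
      rw [LinearIsometryEquiv.norm_map, hv])
    refine ⟨toPM _ ⟨x, w.rot a⟩, (toSM_toPM le_rfl _).trans ?_⟩
    have h : (w.rot a).iso (e₁ n) = v := by
      rw [FrameAt.rot_iso, ha, LinearIsometryEquiv.apply_symm_apply]
    change (⟨x, ⟨(w.rot a).iso (e₁ n), _⟩⟩ : SM (n := n) M) = ⟨x, ⟨v, hv⟩⟩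
    congr 1
    exact Subtype.ext h

/-- The identification of a vertical space of `PM` with a subspace of a tangent space of `M`. -/
def vertMap (w : FM o) : Vert (toPM G w) →ₗ[ℝ] TangentSpace (𝓡 n) w.1 where
  toFun T := w.2.iso (toE (Vert.at ⟨w, rfl⟩ T).1 (e₁ n))
  map_add' T T' := by rw [map_add, toE_so_add, _root_.add_apply, map_add]
  map_smul' c T := by rw [map_smul, toE_so_smul, _root_.smul_apply, map_smul, RingHom.id_apply]

theorem vertMap_apply (w : FM o) (T : Vert (toPM G w)) :
    vertMap w T = w.2.iso (toE (Vert.at ⟨w, rfl⟩ T).1 (e₁ n)) := rfl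

theorem range_vertMap (w : FM o) :
    Set.range (vertMap (G := subSO n) w) = {η | inner ℝ (w.2.iso (e₁ n)) η = 0} := by
  ext η
  constructor
  · rintro ⟨T, rfl⟩
    rw [Set.mem_ofPred_eq, vertMap_apply, LinearIsometryEquiv.inner_map_map, inner_e₁_toE]
  · intro h
    have h1 : inner ℝ (e₁ n) (w.2.iso.symm η) = 0 := by
      rw [← w.2.iso.inner_map_map, LinearIsometryEquiv.apply_symm_apply]
      exact h
    obtain ⟨T, hT⟩ := exists_vert (z := toPM (subSO n) w) ⟨w, rfl⟩
      (ξ := wedgeE (w.2.iso.symm η)) fun ζ hζ ↦ ip_wedgeE_lieAlg _ hζ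
    refine ⟨T, ?_⟩
    rw [vertMap_apply, hT, toE_wedgeE h1, LinearIsometryEquiv.apply_symm_apply]

theorem inner_vertMap (w : FM o) (T T' : Vert (toPM (subSO n) w)) :
    inner ℝ T T' = inner ℝ (vertMap w T) (vertMap w T') := by
  rw [Vert.inner_eq ⟨w, rfl⟩, vertMap_apply, vertMap_apply, LinearIsometryEquiv.inner_map_map]
  exact ip_eq_inner (T.2.1 ⟨w, rfl⟩) _

variable [IsContMDiffRiemannianBundle (𝓡 n) ∞ (EuclideanSpace ℝ (Fin n))
    (fun x : M ↦ TangentSpace (𝓡 n) x)]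
  {cov : CovariantDerivative (𝓡 n) (EuclideanSpace ℝ (Fin n)) (fun x : M ↦ TangentSpace (𝓡 n) x)}

theorem curvature_bianchi (o : ManifoldOrientation n M) (htor : cov.torsion = 0)
    (hmet : cov.IsMetricCompatible) (x : M) (a b c : TangentSpace (𝓡 n) x) :
    curvature cov x a b c + curvature cov x b c a + curvature cov x c a b = 0 := by
  have hs : x ∈ (chartAt (Eu n) x).source := mem_chart_source _ x
  have h : coordOf x (curvature cov x a b c + curvature cov x b c a + curvature cov x c a b) =
      coordOf x (curvature cov x a b c) + coordOf x (curvature cov x b c a) +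
        coordOf x (curvature cov x c a b) := by
    simp only [coordOf, map_add]
  rw [← coordField_coordOf hs (_ + _), h, coordOf_curvature o htor hmet,
    coordOf_curvature o htor hmet, coordOf_curvature o htor hmet, formCurv_bianchi]
  · simp only [coordField, map_zero]
  · exact (contDiffAt_christoffel o htor hmet x).differentiableAt (by simp)
  · filter_upwards [(isOpen_extChartAt_target x).mem_nhds (mem_extChartAt_target x)] with q hq
    exact fun u v ↦ christoffel_symm hq htor u v

theorem curvSo_bianchi (htor : cov.torsion = 0) (hmet : cov.IsMetricCompatible) (w : FM o)
    (a b c : Eu n) : toE (curvSo htor hmet w a b).1 c + toE (curvSo htor hmet w b c).1 a +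
      toE (curvSo htor hmet w c a).1 b = 0 := by
  apply w.2.iso.injective
  have h := curvature_bianchi o htor hmet w.1 (w.2.iso a) (w.2.iso b) (w.2.iso c)
  rw [curvature_iso htor hmet, curvature_iso htor hmet, curvature_iso htor hmet] at h
  rw [map_add, map_add, map_zero]
  exact h

/-- The four cyclic identities obtained by rotating (a, b, c, d) are brought to common terms by the
two skew symmetries; a linear combination of them is the claim. -/
theorem pair_symm_of_bianchi {V : Type*} {R : V → V → V → V → ℝ}
    (h1 : ∀ a b c d, R a b c d = - R b a c d) (h2 : ∀ a b c d, R a b c d = - R a b d c)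
    (h3 : ∀ a b c d, R a b c d + R b c a d + R c a b d = 0) (a b c d : V) :
    R a b c d = R c d a b := by
  have b1 := h3 a b c d
  have b2 := h3 b c d a
  have b3 := h3 c d a b
  have b4 := h3 d a b c
  rw [h1 c a b d] at b1
  rw [h2 b c d a, h2 c d b a, h1 d b c a, h2 b d c a] at b2
  rw [h1 d a c b, h2 a d c b, h2 a c d b] at b3
  rw [h1 d a b c, h2 a b d c] at b4
  linarith

theorem toE_curvSo_swap (htor : cov.torsion = 0) (hmet : cov.IsMetricCompatible) (w : FM o)
    (a b c : Eu n) : toE (curvSo htor hmet w a b).1 c = - toE (curvSo htor hmet w b a).1 c := by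
  have h : toE (curvSo htor hmet w a b).1 = toE (-curvSo htor hmet w b a).1 := by
    rw [curvSo_swap]
  rw [h, ← neg_one_smul ℝ (curvSo htor hmet w b a), toE_so_smul]
  simp

/-- The pair symmetry of the curvature tensor. -/
theorem inner_curvSo_symm (htor : cov.torsion = 0) (hmet : cov.IsMetricCompatible) (w : FM o)
    (a b c d : Eu n) : inner ℝ (toE (curvSo htor hmet w a b).1 c) d =
      inner ℝ (toE (curvSo htor hmet w c d).1 a) b := by
  refine pair_symm_of_bianchi
    (R := fun a b c d ↦ inner ℝ (toE (curvSo htor hmet w a b).1 c) d)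
    (fun a b c d ↦ ?_) (fun a b c d ↦ ?_) (fun a b c d ↦ ?_) a b c d
  · rw [toE_curvSo_swap, inner_neg_left]
  · rw [inner_toE_so, real_inner_comm]
  · rw [← inner_add_left, ← inner_add_left, curvSo_bianchi, inner_zero_left]

/-- On the complement of the Lie algebra the inner product only sees images of e₁, so R_FM becomes
⟨ξe₁, R(ξ'e₁, e₁)e₁⟩. Pair symmetry and the skew symmetries move ξe₁ into the first slot. -/
theorem inner_RPM_vertMap (htor : cov.torsion = 0) (hmet : cov.IsMetricCompatible) (w : FM o)
    (T T' : Vert (toPM (subSO n) w)) : inner ℝ (RPM cov (toPM (subSO n) w) T) T' =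
      inner ℝ (curvature cov w.1 (vertMap w T) (w.2.iso (e₁ n)) (w.2.iso (e₁ n)))
        (vertMap w T') := by
  have h1 : inner ℝ (RPM cov (toPM (subSO n) w) T) T' =
      inner ℝ (toE (Vert.at ⟨w, rfl⟩ T).1 (e₁ n)) (toE (curvSo htor hmet w
        (toE (Vert.at ⟨w, rfl⟩ T').1 (e₁ n)) (e₁ n)).1 (e₁ n)) := by
    refine (inner_RPM htor hmet le_rfl ⟨w, rfl⟩ T T').trans ?_
    rw [RFM_eq htor hmet]
    exact ip_eq_inner (ξ := Vert.at ⟨w, rfl⟩ T) (T.2.1 ⟨w, rfl⟩) (curvSo htor hmet w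
        (toE (Vert.at ⟨w, rfl⟩ T').1 (e₁ n)) (e₁ n))
  rw [h1, vertMap_apply, vertMap_apply, curvature_iso htor hmet,
    LinearIsometryEquiv.inner_map_map, real_inner_comm, inner_curvSo_symm, inner_toE_so,
    real_inner_comm, toE_curvSo_swap, inner_neg_left, neg_neg]

end UnitTangent

section Geodesic

set_option linter.unusedSectionVars false

variable {n : ℕ}

/-! ### Rotations along a curve on the sphere -/

/-- The reflection in the hyperplane orthogonal to `u`. -/
def hyperplaneReflection (u : Eu n) : Eu n →L[ℝ] Eu n :=
  ContinuousLinearMap.id ℝ (Eu n) - (2 / inner ℝ u u : ℝ) • (innerSL ℝ u).smulRight u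

theorem hyperplaneReflection_apply (u v : Eu n) :
    hyperplaneReflection u v = v - (2 / inner ℝ u u * inner ℝ u v : ℝ) • u := by
  simp [hyperplaneReflection, mul_smul]

theorem inner_hyperplaneReflection {u : Eu n} (hu : u ≠ 0) (v w : Eu n) :
    inner ℝ (hyperplaneReflection u v) (hyperplaneReflection u w) = inner ℝ v w := by
  have h : (inner ℝ u u : ℝ) ≠ 0 := inner_self_ne_zero.2 hu
  simp only [hyperplaneReflection_apply, inner_sub_left, inner_sub_right, real_inner_smul_left,
    real_inner_smul_right, real_inner_comm u v]
  field_simp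
  ring

theorem hyperplaneReflection_self {u : Eu n} (hu : u ≠ 0) : hyperplaneReflection u u = -u := by
  have h : (inner ℝ u u : ℝ) ≠ 0 := inner_self_ne_zero.2 hu
  rw [hyperplaneReflection_apply, div_mul_cancel₀ _ h, two_smul]
  abel

/-- For vectors of equal length u + v is normal to the hyperplane whose reflection exchanges u and
-v. This provides rotations depending smoothly on v. -/
theorem hyperplaneReflection_add {u v : Eu n} (h : ‖u‖ = ‖v‖) (huv : u + v ≠ 0) :
    hyperplaneReflection (u + v) u = -v := by
  have h0 : (inner ℝ (u + v) (u + v) : ℝ) ≠ 0 := inner_self_ne_zero.2 huv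
  have h1 : (2 / inner ℝ (u + v) (u + v) * inner ℝ (u + v) u : ℝ) = 1 := by
    rw [div_mul_eq_mul_div, div_eq_one_iff_eq h0]
    simp only [inner_add_left, inner_add_right, real_inner_self_eq_norm_sq, h, real_inner_comm u v]
    ring
  rw [hyperplaneReflection_apply, h1, one_smul]
  abel

theorem hyperplaneReflection_double {u : Eu n} (hu : u ≠ 0) (v : Eu n) :
    hyperplaneReflection (u + u) (hyperplaneReflection u v) = v := by
  have h : (inner ℝ u u : ℝ) ≠ 0 := inner_self_ne_zero.2 hu
  rw [hyperplaneReflection_apply u v, map_sub, map_smul,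
    hyperplaneReflection_add rfl (by rw [← two_smul ℝ]; simpa using hu),
    hyperplaneReflection_apply, sub_sub, sub_eq_self, ← two_smul ℝ u, smul_smul, smul_neg,
    ← sub_eq_add_neg, ← sub_smul]
  have h2 : (2 / inner ℝ ((2 : ℝ) • u) ((2 : ℝ) • u) * inner ℝ ((2 : ℝ) • u) v * 2 -
      2 / inner ℝ u u * inner ℝ u v : ℝ) = 0 := by
    simp only [real_inner_smul_left, real_inner_smul_right]
    field_simp
    ring
  rw [h2, zero_smul]

theorem contDiffAt_hyperplaneReflection {u : Eu n} (hu : u ≠ 0) :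
    ContDiffAt ℝ ∞ (hyperplaneReflection (n := n)) u := by
  have h : (inner ℝ u u : ℝ) ≠ 0 := inner_self_ne_zero.2 hu
  refine contDiffAt_const.sub (ContDiffAt.smul (contDiffAt_const.div
    (contDiffAt_id.inner ℝ contDiffAt_id) h) ?_)
  exact (innerSL ℝ (E := Eu n)).contDiff.contDiffAt.smulRight contDiffAt_id

variable [NeZero n]

/-- The product of the reflections along β(p) and then β(p) + β(q) carries β(p) to β(q), depends
smoothly on q near p, and is the identity at q = p. Applied after a it gives the required field; its
determinant remains positive near p by continuity. -/
theorem exists_rotation_field {β : Eu n → Eu n} {p : Eu n} (hβ : ContDiffAt ℝ ∞ β p)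
    (hβ1 : ∀ᶠ q in 𝓝 p, ‖β q‖ = 1) (a : SO n) (ha : toE a.1 (e₁ n) = β p) :
    ∃ A : Eu n → (Eu n →L[ℝ] Eu n), ContDiffAt ℝ ∞ A p ∧ A p = toE a.1 ∧
      ∀ᶠ q in 𝓝 p, A q (e₁ n) = β q ∧ ∃ b : SO n, toE b.1 = A q := by
  have hp1 : ‖β p‖ = 1 := hβ1.self_of_nhds
  have hp0 : β p ≠ 0 := by
    intro h
    rw [h, norm_zero] at hp1
    exact zero_ne_one hp1
  have hpp : β p + β p ≠ 0 := by
    rw [← two_smul ℝ]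
    simpa using hp0
  let A : Eu n → (Eu n →L[ℝ] Eu n) := fun q ↦
    (hyperplaneReflection (β p + β q)).comp ((hyperplaneReflection (β p)).comp (toE a.1))
  have hr : ContDiffAt ℝ ∞ (fun q ↦ hyperplaneReflection (β p + β q)) p :=
    ContDiffAt.comp (g := hyperplaneReflection (n := n)) (f := fun q ↦ β p + β q) p
      (contDiffAt_hyperplaneReflection hpp) (contDiffAt_const.add hβ)
  have hA : ContDiffAt ℝ ∞ A p := hr.clm_comp contDiffAt_const
  have hAp : A p = toE a.1 := by
    ext1 v
    exact hyperplaneReflection_double hp0 _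
  refine ⟨A, hA, hAp, ?_⟩
  have hne : ∀ᶠ q in 𝓝 p, β p + β q ≠ 0 :=
    (contDiffAt_const.add hβ).continuousAt.eventually_ne hpp
  have hdet : ∀ᶠ q in 𝓝 p, 0 < (A q).det := by
    have h1 : 0 < (A p).det := by
      rw [hAp, ← det_toMat, toMat_toE]
      have h2 : a.1.det = 1 := a.2.2
      rw [h2]
      exact one_pos
    exact (ContinuousLinearMap.continuous_det.continuousAt.comp hA.continuousAt).eventually
      (lt_mem_nhds h1)
  filter_upwards [hβ1, hne, hdet] with q h1 h2 h3
  refine ⟨?_, exists_SO_of_isometry (fun v w ↦ ?_) h3⟩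
  · change hyperplaneReflection (β p + β q) (hyperplaneReflection (β p) (toE a.1 (e₁ n))) = β q
    rw [ha, hyperplaneReflection_self hp0, map_neg,
      hyperplaneReflection_add (hp1.trans h1.symm) h2, neg_neg]
  · exact (inner_hyperplaneReflection h2 _ _).trans
      ((inner_hyperplaneReflection hp0 _ _).trans (inner_toE_SO a v w))

/-! ### The geodesic vector field -/

variable {M : Type*} [TopologicalSpace M]
  [ChartedSpace (EuclideanSpace ℝ (Fin n)) M] [IsManifold (𝓡 n) ∞ M]
  [RiemannianBundle (fun x : M ↦ TangentSpace (𝓡 n) x)]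
  {o : ManifoldOrientation n M} {G : Subgroup (SO n)} {z : PM o G} {x₀ : M} {p : Eu n}

theorem LocalFrame.toSM_point {L : LocalFrame o x₀} {p : Eu n} {a : SO n}
    {V : ∀ x : M, {v : TangentSpace (𝓡 n) x // ‖v‖ = 1}}
    (h : (L.frame ((extChartAt (𝓡 n) x₀).symm p)).iso (toE a.1 (e₁ n)) =
      (V ((extChartAt (𝓡 n) x₀).symm p)).1) :
    (L.point p a).toSM = ⟨(extChartAt (𝓡 n) x₀).symm p, V ((extChartAt (𝓡 n) x₀).symm p)⟩ := by
  have h1 : ∀ v : {v : TangentSpace (𝓡 n) ((extChartAt (𝓡 n) x₀).symm p) // ‖v‖ = 1},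
      v.1 = (V ((extChartAt (𝓡 n) x₀).symm p)).1 →
      (⟨(extChartAt (𝓡 n) x₀).symm p, v⟩ : SM (n := n) M) =
        ⟨(extChartAt (𝓡 n) x₀).symm p, V ((extChartAt (𝓡 n) x₀).symm p)⟩ := by
    intro v hv
    rw [Subtype.ext hv]
  exact h1 _ h

variable [IsContMDiffRiemannianBundle (𝓡 n) ∞ (EuclideanSpace ℝ (Fin n))
    (fun x : M ↦ TangentSpace (𝓡 n) x)]
  {cov : CovariantDerivative (𝓡 n) (EuclideanSpace ℝ (Fin n)) (fun x : M ↦ TangentSpace (𝓡 n) x)}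

/-- The derivative along a vertical vector of the form `Y_η` with `η` in the Lie algebra of
`SO(n-1)` of a function which descends to the unit tangent bundle. -/
theorem fderiv_vertical_eq_zero {L : LocalFrame o x₀} {f : SM (n := n) M → ℝ}
    {F : Eu n × (Eu n →L[ℝ] Eu n) → ℝ} (hF : LocalRep L (fun w : FM o ↦ f w.toSM) F)
    (hp : p ∈ L.cdom) (a : SO n) {T : Eu n →L[ℝ] Eu n}
    (hT : ∀ v w, inner ℝ (T v) (toE a.1 w) = - inner ℝ (toE a.1 v) (T w))
    (hT1 : T (e₁ n) = 0) : fderiv ℝ F (p, toE a.1) (0, T) = 0 := by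
  have haa : ∀ v, toE a.1 (toE a.1ᵀ v) = v := by
    intro v
    rw [← ContinuousLinearMap.comp_apply, ← toE_mul, SO_mul_transpose, toE_one]
    rfl
  have hsk : ∀ v w, inner ℝ (((toE a.1ᵀ).comp T) v) w = - inner ℝ v (((toE a.1ᵀ).comp T) w) := by
    intro v w
    rw [← inner_toE_SO a, ← inner_toE_SO a v]
    simp only [ContinuousLinearMap.comp_apply, haa]
    exact hT v w
  have h1 : T = (toE a.1).comp (toE (soOf _ hsk).1) := by
    ext1 v
    rw [toE_soOf]
    exact (haa _).symm
  have h2 := hF.hasDerivAt_rot hp a (soOf _ hsk)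
  have h3 : soOf _ hsk ∈ lieAlg (subSO n) := by
    rw [mem_lieAlg_subSO, toE_soOf, ContinuousLinearMap.comp_apply, hT1, map_zero]
  simp only [FM.toSM_rot _ (h3 _)] at h2
  have h4 := h2.unique (hasDerivAt_const _ _)
  rw [h1]
  exact h4

/-- V is lifted near the point to the frame field σA with Ae₁ equal to V in the frame. Only its
first vector is parallel at the point, so its derivative differs from the horizontal lift by a
vertical direction. That direction annihilates e₁, and functions pulled back from SM are constant
along it. -/
theorem X_toSM {f : SM (n := n) M → ℝ} (hf : SmoothFn fun w : FM o ↦ f w.toSM)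
    (hmet : cov.IsMetricCompatible) {V : ∀ x : M, {v : TangentSpace (𝓡 n) x // ‖v‖ = 1}}
    {U : Set M} {x : M} (hU : IsOpen U) (hx : x ∈ U)
    (hV : ContMDiffOn (𝓡 n) ((𝓡 n).prod 𝓘(ℝ, EuclideanSpace ℝ (Fin n))) ∞
      (fun y ↦ (⟨y, (V y).1⟩ : TangentBundle (𝓡 n) M)) U)
    (hpar : cov (fun y ↦ (V y).1) x = 0) (w : FM o) (hw : w.toSM = ⟨x, V x⟩) :
    X cov (fun w ↦ f w.toSM) w = mvfderiv (𝓡 n) (fun y ↦ f ⟨y, V y⟩) x (V x).1 := by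
  obtain ⟨x₀, L, p, hp, -, a, rfl⟩ := exists_point_self w
  obtain rfl : (extChartAt (𝓡 n) x₀).symm p = x := congrArg Sigma.fst hw
  have hw' : (L.frame ((extChartAt (𝓡 n) x₀).symm p)).iso (toE a.1 (e₁ n)) =
      (V ((extChartAt (𝓡 n) x₀).symm p)).1 :=
    congrArg Subtype.val (eq_of_heq (Sigma.mk.inj hw).2)
  obtain ⟨F, hF⟩ := hf _ L
  let β : Eu n → Eu n := fun q ↦
    L.coordCoframe q (coordOf x₀ (V ((extChartAt (𝓡 n) x₀).symm q)).1)
  have hσβ : ∀ q ∈ L.cdom, L.coordFrame q (β q) =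
      coordOf x₀ (V ((extChartAt (𝓡 n) x₀).symm q)).1 := fun q hq ↦
    congrArg (fun T : Eu n →L[ℝ] Eu n ↦ T _) (LocalFrame.coordFrame_coordCoframe hq)
  have hβV : ∀ q ∈ L.cdom, (L.frame ((extChartAt (𝓡 n) x₀).symm q)).iso (β q) =
      (V ((extChartAt (𝓡 n) x₀).symm q)).1 := by
    intro q hq
    rw [← LocalFrame.coordField_coordFrame hq, hσβ q hq, coordField_coordOf (symm_mem_source hq.1)]
  have hVc : ContDiffAt ℝ ∞ (fun q ↦ coordOf x₀ (V ((extChartAt (𝓡 n) x₀).symm q)).1) p :=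
    (contMDiffAt_iff_coordOf le_rfl hp.1).1 (hV.contMDiffAt (hU.mem_nhds hx))
  have hcd := L.isOpen_cdom.mem_nhds hp
  have hβ : ContDiffAt ℝ ∞ β p :=
    (LocalFrame.contDiffOn_coordCoframe.contDiffAt hcd).clm_apply hVc
  have hβ1 : ∀ᶠ q in 𝓝 p, ‖β q‖ = 1 := by
    filter_upwards [hcd] with q hq
    rw [← (V ((extChartAt (𝓡 n) x₀).symm q)).2, ← hβV q hq, LinearIsometryEquiv.norm_map]
  have ha : toE a.1 (e₁ n) = β p :=
    (L.frame ((extChartAt (𝓡 n) x₀).symm p)).iso.injective (hw'.trans (hβV p hp).symm)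
  obtain ⟨A, hA, hAp, hAq⟩ := exists_rotation_field hβ hβ1 a ha
  have hAd := (hA.differentiableAt (by simp)).hasFDerivAt
  have hβd := hβ.differentiableAt (by simp)
  have hσd := ((LocalFrame.contDiffOn_coordFrame (L := L)).contDiffAt hcd).differentiableAt
    (by simp)
  have hloc : (fun q ↦ f ⟨(extChartAt (𝓡 n) x₀).symm q, V ((extChartAt (𝓡 n) x₀).symm q)⟩) =ᶠ[𝓝 p]
      fun q ↦ F (q, A q) := by
    filter_upwards [hcd, hAq] with q hq ⟨h1, b, hb⟩
    rw [← hb, ← hF.2 q hq b]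
    refine congrArg f (LocalFrame.toSM_point ?_).symm
    rw [hb, h1, hβV q hq]
  have hFd : HasFDerivAt (fun q ↦ F (q, A q)) ((fderiv ℝ F (p, A p)).comp
      ((ContinuousLinearMap.id ℝ (Eu n)).prod (fderiv ℝ A p))) p :=
    (hF.hasFDerivAt (q := (p, A p)) hp).comp p ((hasFDerivAt_id p).prodMk hAd)
  let u : Eu n := L.coordFrame p (toE a.1 (e₁ n))
  have hu : coordField x₀ u ((extChartAt (𝓡 n) x₀).symm p) =
      (V ((extChartAt (𝓡 n) x₀).symm p)).1 :=
    (LocalFrame.coordField_coordFrame hp _).trans hw'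
  have hR := mvfderiv_coordField hp.1
    (g := fun y ↦ f ⟨y, V y⟩) (hFd.congr_of_eventuallyEq hloc) u
  rw [hu] at hR
  refine (hF.X_point hmet hp a).trans (Eq.trans ?_ hR.symm)
  -- the difference of the two derivatives is vertical
  let T : Eu n →L[ℝ] Eu n := fderiv ℝ A p u + (L.connForm cov p u).comp (toE a.1)
  have hT : ∀ v w, inner ℝ (T v) (toE a.1 w) = - inner ℝ (toE a.1 v) (T w) := by
    intro v w
    have h1 : ∀ v, HasFDerivAt (fun q ↦ A q v) _ p := fun v ↦
      hAd.clm_apply (hasFDerivAt_const v p)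
    have h2 := (h1 v).inner ℝ (h1 w)
    have h3 : (fun q ↦ inner ℝ (A q v) (A q w)) =ᶠ[𝓝 p] fun _ ↦ inner ℝ v w := by
      filter_upwards [hAq] with q ⟨_, b, hb⟩
      rw [← hb, inner_toE_SO]
    have h4 := h2.unique ((hasFDerivAt_const _ p).congr_of_eventuallyEq h3)
    have h5 := congrArg (fun S : Eu n →L[ℝ] ℝ ↦ S u) h4
    simp [hAp] at h5
    have h6 := LocalFrame.inner_connForm (cov := cov) hp hmet u (toE a.1 v) (toE a.1 w)
    simp only [T, _root_.add_apply, ContinuousLinearMap.comp_apply, inner_add_left,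
      inner_add_right]
    linarith
  -- Te₁ = dβ(u) + θ(u)β is the covariant derivative of V expressed in the frame, which vanishes
  -- because V is parallel at the point.
  have hT1 : T (e₁ n) = 0 := by
    have h1 : fderiv ℝ A p u (e₁ n) = fderiv ℝ β p u := by
      have h2 : HasFDerivAt (fun q ↦ A q (e₁ n)) _ p := hAd.clm_apply (hasFDerivAt_const (e₁ n) p)
      have h3 := h2.unique (hβd.hasFDerivAt.congr_of_eventuallyEq
        (hAq.mono fun q hq ↦ hq.1))
      simpa using congrArg (fun S : Eu n →L[ℝ] Eu n ↦ S u) h3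
    have h2 := coordOf_cov cov hp.1 (Z := fun y ↦ (V y).1) (hVc.of_le ENat.LEInfty.out) u
    have h3 : (fun q ↦ coordOf x₀ (V ((extChartAt (𝓡 n) x₀).symm q)).1) =ᶠ[𝓝 p]
        fun q ↦ L.coordFrame q (β q) := by
      filter_upwards [hcd] with q hq using (hσβ q hq).symm
    rw [hpar, h3.fderiv_eq, h3.eq_of_nhds, fderiv_clm_apply hσd hβd] at h2
    have h4 := congrArg (fun S : Eu n →L[ℝ] Eu n ↦ S (β p))
      (LocalFrame.coordFrame_connForm (L := L) (cov := cov) hp u)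
    simp only [ContinuousLinearMap.comp_apply, _root_.add_apply] at h4
    have h5 : coordOf x₀ ((0 : TangentSpace (𝓡 n) ((extChartAt (𝓡 n) x₀).symm p) →L[ℝ]
        TangentSpace (𝓡 n) ((extChartAt (𝓡 n) x₀).symm p))
          (coordField x₀ u ((extChartAt (𝓡 n) x₀).symm p))) = 0 := by
      simp only [coordOf, _root_.zero_apply, map_zero]
    rw [h5] at h2
    apply LocalFrame.coordFrame_injective hp
    simp only [T, _root_.add_apply, ContinuousLinearMap.comp_apply]
    rw [h1, ha, map_add, map_zero, h4, h2]
    simp only [_root_.add_apply, ContinuousLinearMap.comp_apply, ContinuousLinearMap.flip_apply]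
    abel
  have hz := fderiv_vertical_eq_zero hF hp a hT hT1
  have hsplit : ((u, fderiv ℝ A p u) : Eu n × (Eu n →L[ℝ] Eu n)) =
      horField L.coordFrame (L.connForm cov) (e₁ n) (p, toE a.1) + (0, T) := by
    refine Prod.ext ?_ ?_
    · exact (add_zero u).symm
    · change _ = -(L.connForm cov p u).comp (toE a.1) + T
      simp only [T]
      abel
  change fderiv ℝ F (p, toE a.1) _ = fderiv ℝ F (p, A p) (u, fderiv ℝ A p u)
  rw [hAp, hsplit, map_add, hz, add_zero]

theorem XPM_toSM (hG : G ≤ subSO n) {f : SM (n := n) M → ℝ}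
    (hf : SmoothFn fun w : FM o ↦ f (toPM G w).toSM)
    (hmet : cov.IsMetricCompatible) {V : ∀ x : M, {v : TangentSpace (𝓡 n) x // ‖v‖ = 1}}
    {U : Set M} {x : M} (hU : IsOpen U) (hx : x ∈ U)
    (hV : ContMDiffOn (𝓡 n) ((𝓡 n).prod 𝓘(ℝ, EuclideanSpace ℝ (Fin n))) ∞
      (fun y ↦ (⟨y, (V y).1⟩ : TangentBundle (𝓡 n) M)) U)
    (hpar : cov (fun y ↦ (V y).1) x = 0) (hz : z.toSM = ⟨x, V x⟩) :
    XPM cov (fun z : PM o G ↦ f z.toSM) z =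
      mvfderiv (𝓡 n) (fun y ↦ f ⟨y, V y⟩) x (V x).1 := by
  have h : (fun w : FM o ↦ f (toPM G w).toSM) = fun w ↦ f w.toSM :=
    funext fun w ↦ by rw [toSM_toPM hG]
  rw [h] at hf
  rw [XPM, h]
  exact X_toSM hf hmet hU hx hV hpar _ hz

end Geodesic

end FramePestov

end

/-! ### The associated Pestov identity and its form on the unit tangent bundle. -/

theorem corollary3p3 {n : ℕ} [NeZero n] (hn : 2 ≤ n)
    {M : Type*} [TopologicalSpace M] [ChartedSpace (EuclideanSpace ℝ (Fin n)) M]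
    [IsManifold (𝓡 n) ∞ M] [T2Space M] [CompactSpace M] [ConnectedSpace M]
    [MeasurableSpace M] [BorelSpace M]
    [RiemannianBundle (fun x : M ↦ TangentSpace (𝓡 n) x)]
    [IsContMDiffRiemannianBundle (𝓡 n) ∞ (EuclideanSpace ℝ (Fin n))
      (fun x : M ↦ TangentSpace (𝓡 n) x)]
    (o : ManifoldOrientation n M)
    (cov : CovariantDerivative (𝓡 n) (EuclideanSpace ℝ (Fin n))
      (fun x : M ↦ TangentSpace (𝓡 n) x)) (hcov : IsLeviCivita cov)
    (G : Subgroup (SO n)) (hG : G ≤ subSO n) (hGc : IsClosed (G : Set (SO n)))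
    (σ : Measure (SO n ⧸ G)) [IsFiniteMeasure σ]
    (hσ : ∀ a : SO n, σ.map (fun p ↦ a • p) = σ) :
    (∀ u : PM o G → ℝ, SmoothPM u →
      Integrable (fun z ↦ ‖vertGrad (XPM cov u) z‖ ^ 2) (liouville o σ) ∧
      Integrable (fun z ↦ ‖covX cov (vertGrad u) z‖ ^ 2) (liouville o σ) ∧
      Integrable (fun z ↦ XPM cov u z ^ 2) (liouville o σ) ∧
      Integrable (fun z ↦ (inner ℝ (RPM cov z (vertGrad u z)) (vertGrad u z) : ℝ))
        (liouville o σ) ∧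
      (∫ z, ‖vertGrad (XPM cov u) z‖ ^ 2 ∂(liouville o σ))
          - ∫ z, ‖covX cov (vertGrad u) z‖ ^ 2 ∂(liouville o σ)
        = ((n : ℝ) - 1) * (∫ z, XPM cov u z ^ 2 ∂(liouville o σ))
          - ∫ z, (inner ℝ (RPM cov z (vertGrad u z)) (vertGrad u z) : ℝ) ∂(liouville o σ)) ∧
    (G = subSO n →
      Function.Bijective (PM.toSM : PM o G → SM M) ∧
      (∀ w : FM o, (toPM G w).toSM = w.toSM) ∧
      (∀ w : FM o, ∃ K : Vert (toPM G w) →ₗ[ℝ] TangentSpace (𝓡 n) w.1,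
        (∀ T, K T = w.2.iso (Matrix.toEuclideanLin (Vert.at ⟨w, rfl⟩ T).1 (e₁ n))) ∧
        Set.range K = {η | inner ℝ (w.2.iso (e₁ n)) η = 0} ∧
        (∀ T T', (inner ℝ T T' : ℝ) = inner ℝ (K T) (K T')) ∧
        (∀ T T', (inner ℝ (RPM cov (toPM G w) T) T' : ℝ) =
          inner ℝ (curvature cov w.1 (K T) (w.2.iso (e₁ n)) (w.2.iso (e₁ n))) (K T'))) ∧
      (∀ f : SM (n := n) M → ℝ, SmoothPM (fun z : PM o G ↦ f z.toSM) →
        ∀ (V : ∀ x : M, {v : TangentSpace (𝓡 n) x // ‖v‖ = 1}) (U : Set M) (x : M),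
          IsOpen U → x ∈ U →
          ContMDiffOn (𝓡 n) ((𝓡 n).prod 𝓘(ℝ, EuclideanSpace ℝ (Fin n))) ∞
            (fun y ↦ (⟨y, (V y).1⟩ : TangentBundle (𝓡 n) M)) U →
          cov (fun y ↦ (V y).1) x = 0 →
          ∀ z : PM o G, z.toSM = ⟨x, V x⟩ →
            XPM cov (fun z ↦ f z.toSM) z
              = mvfderiv (𝓡 n) (fun y ↦ f ⟨y, V y⟩) x (V x).1)) := by
  obtain ⟨htor, hmet⟩ := hcov
  refine ⟨fun u hu ↦ pestov_associated htor hmet hG hGc σ hσ hu.smoothFn, ?_⟩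
  rintro rfl
  refine ⟨bijective_toSM hn, toSM_toPM le_rfl, fun w ↦ ?_, ?_⟩
  · exact ⟨vertMap w, vertMap_apply w, range_vertMap w, inner_vertMap w,
      inner_RPM_vertMap htor hmet w⟩
  · intro f hf V U x hU hx hV hpar z hz
    exact XPM_toSM le_rfl hf.smoothFn hmet hU hx hV hpar hz
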